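/- Let $X$ be a compact connected complex manifold of dimension $n$, and let $S$ be an $\mathbb{R}$-line bundle on $X$ with a smooth Hermitian metric $\psi$ (written additively through local weights, $|s|^2=|s_i|^2e^{-\psi_i}$) that is semipositive: $\theta=i\partial\bar\partial\psi\ge 0$. Let $\mathcal H$ be the set of smooth Hermitian metrics $\phi$ on the $\mathbb{R}$-line bundle $-(K_X+S)$ with $\omega_\phi:=i\partial\bar\partial\phi>0$, and fix $\phi_0\in\mathcal H$. For $\phi\in\mathcal H$ the sum $\phi+\psi$ is a metric on $-K_X$, so that $e^{-\phi-\psi}$ is a volume form on $X$. Define the twisted Ding functional $\mathcal D=-\mathcal E+\mathcal F_\psi$ on $\mathcal H$ by $$\mathcal E(\phi)=\frac{1}{(n+1)V}\sum_{j=0}^n\int_X(\phi-\phi_0)\,\omega_\phi^{j}\wedge\omega_{\phi_0}^{n-j},\qquad \mathcal F_\psi(\phi)=-\log\int_X e^{-\phi-\psi},\qquad V=\int_X\omega_{\phi_0}^n .$$ Let $(\phi_t)_{0\le t\le 1}$ be a smooth geodesic in $\mathcal H$, that is, a path in $\mathcal H$ whose local weights are smooth on $[0,1]\times X$ and which satisfies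 $$\phi_t''=|\partial\phi_t'|^2_{g_{\phi_t}}=g_{\phi_t}^{\alpha\bar\beta}\,\partial_\alpha\phi_t'\,\partial_{\bar\beta}\phi_t',$$ where primes denote derivatives in $t$ and $g_{\phi}=(\partial_\alpha\partial_{\bar\beta}\phi)$. Then the function $t\mapsto\mathcal D(\phi_t)$ is convex on $[0,1]$. -/

import Mathlib

open scoped Manifold ContDiff ENNReal ComplexOrder
open MeasureTheory Set

noncomputable section

namespace TwistedDing

/-! ## Holomorphic coordinates, line bundles and real line bundles -/

/-- A cover of the complex manifold `X` of dimension `n` by holomorphic coordinate charts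
`(chart i)`, taken from the maximal holomorphic atlas. -/
structure CoordCover (n : ℕ) (X : Type*) [TopologicalSpace X] [ChartedSpace (Fin n → ℂ) X]
    (ι : Type*) where
  /-- the coordinate charts -/
  chart : ι → OpenPartialHomeomorph X (Fin n → ℂ)
  chart_mem : ∀ i, chart i ∈ IsManifold.maximalAtlas 𝓘(ℂ, Fin n → ℂ) ω X
  /-- for each point, a chart around it -/
  indexAt : X → ι
  mem_indexAt : ∀ x, x ∈ (chart (indexAt x)).source

variable {n : ℕ} {X : Type*} [TopologicalSpace X] [ChartedSpace (Fin n → ℂ) X] {ι : Type*}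

/-- A holomorphic line bundle, trivialized over the coordinate domains of the cover and given by
its transition functions: the components `s i` of a section satisfy `s i = g i j * s j`. -/
structure LineBundle (A : CoordCover n X ι) where
  /-- the transition functions -/
  g : ι → ι → X → ℂ
  holomorphic : ∀ i j, DifferentiableOn ℂ (fun z => g i j ((A.chart i).symm z))
    ((A.chart i).symm.trans (A.chart j)).source
  ne_zero : ∀ i j, ∀ x ∈ (A.chart i).source ∩ (A.chart j).source, g i j x ≠ 0
  cocycle : ∀ i j k, ∀ x ∈ (A.chart i).source ∩ (A.chart j).source ∩ (A.chart k).source,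
    g i j x * g j k x = g i k x

/-- The coordinate change from chart `i` to chart `j`. -/
def CoordCover.trans (A : CoordCover n X ι) (i j : ι) (z : Fin n → ℂ) : Fin n → ℂ :=
  A.chart j ((A.chart i).symm z)

/-- The holomorphic Jacobian determinant `det (∂ z_j / ∂ z_i)` of the coordinate change. -/
def CoordCover.jac (A : CoordCover n X ι) (i j : ι) (x : X) : ℂ :=
  (fderiv ℂ (A.trans i j) (A.chart i x)).det

theorem CoordCover.contDiffOn_trans [IsManifold 𝓘(ℂ, Fin n → ℂ) ω X] (A : CoordCover n X ι)
    (i j : ι) :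
    ContDiffOn ℂ ω (A.trans i j) ((A.chart i).symm.trans (A.chart j)).source := by
  have h := IsManifold.compatible_of_mem_maximalAtlas (A.chart_mem i) (A.chart_mem j)
  rw [contDiffGroupoid, mem_groupoid_of_pregroupoid, contDiffPregroupoid] at h
  have h1 := h.1
  simp only [modelWithCornersSelf_coe, modelWithCornersSelf_coe_symm, range_id, inter_univ,
    preimage_id, Function.comp_id, Function.id_comp] at h1
  exact h1

theorem CoordCover.mem_source {A : CoordCover n X ι} {i j : ι} {x : X}
    (hi : x ∈ (A.chart i).source) (hj : x ∈ (A.chart j).source) :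
    A.chart i x ∈ ((A.chart i).symm.trans (A.chart j)).source := by
  simp [hi, hj]

theorem CoordCover.jac_mul [IsManifold 𝓘(ℂ, Fin n → ℂ) ω X] (A : CoordCover n X ι)
    (i j k : ι) (x : X) (hi : x ∈ (A.chart i).source) (hj : x ∈ (A.chart j).source)
    (hk : x ∈ (A.chart k).source) : A.jac i j x * A.jac j k x = A.jac i k x := by
  have hd : ∀ a b, x ∈ (A.chart a).source → x ∈ (A.chart b).source →
      DifferentiableAt ℂ (A.trans a b) (A.chart a x) := fun a b ha hb =>
    ((A.contDiffOn_trans a b).differentiableOn (by simp)).differentiableAt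
      (((A.chart a).symm.trans (A.chart b)).open_source.mem_nhds (mem_source ha hb))
  have hij : A.trans i j (A.chart i x) = A.chart j x := by simp [CoordCover.trans, hi]
  have hev : A.trans i k =ᶠ[nhds (A.chart i x)] (A.trans j k ∘ A.trans i j) := by
    filter_upwards [((A.chart i).symm.trans (A.chart j)).open_source.mem_nhds
      (mem_source hi hj)] with z hz
    have hz' : (A.chart i).symm z ∈ (A.chart j).source := by
      rw [OpenPartialHomeomorph.trans_source] at hz
      exact hz.2
    simp [CoordCover.trans, hz']
  have hc := fderiv_comp (A.chart i x) (hij ▸ hd j k hj hk) (hd i j hi hj)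
  simp only [CoordCover.jac]
  rw [hev.fderiv_eq, hc, hij, mul_comm]
  simp [ContinuousLinearMap.det]

theorem CoordCover.jac_self (A : CoordCover n X ι) (i : ι) (x : X)
    (hi : x ∈ (A.chart i).source) : A.jac i i x = 1 := by
  have hev : A.trans i i =ᶠ[nhds (A.chart i x)] id := by
    filter_upwards [(A.chart i).open_target.mem_nhds ((A.chart i).map_source hi)] with z hz
    simp [CoordCover.trans, hz]
  simp only [CoordCover.jac]
  rw [hev.fderiv_eq]
  simp [ContinuousLinearMap.det]

theorem CoordCover.differentiableOn_jac [IsManifold 𝓘(ℂ, Fin n → ℂ) ω X] (A : CoordCover n X ι)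
    (i j : ι) : DifferentiableOn ℂ (fun z => A.jac i j ((A.chart i).symm z))
      ((A.chart i).symm.trans (A.chart j)).source := by
  have h1 : DifferentiableOn ℂ (fderiv ℂ (A.trans i j))
      ((A.chart i).symm.trans (A.chart j)).source :=
    ((A.contDiffOn_trans i j).fderiv_of_isOpen (m := 1)
      ((A.chart i).symm.trans (A.chart j)).open_source (by simp)).differentiableOn (by simp)
  have h2 : DifferentiableOn ℂ (fun z => (fderiv ℂ (A.trans i j) z).det)
      ((A.chart i).symm.trans (A.chart j)).source := by
    have he : ∀ f : (Fin n → ℂ) →L[ℂ] (Fin n → ℂ), f.det =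
        ∑ σ : Equiv.Perm (Fin n), ((Equiv.Perm.sign σ : ℤ) : ℂ) *
          ∏ a, f (Pi.single a 1) (σ a) := by
      intro f
      rw [ContinuousLinearMap.det, ← LinearMap.det_toMatrix', Matrix.det_apply']
      simp [LinearMap.toMatrix'_apply, Pi.single]
    simp only [he]
    have h3 : ∀ a b, DifferentiableOn ℂ (fun z => fderiv ℂ (A.trans i j) z (Pi.single a 1) b)
        ((A.chart i).symm.trans (A.chart j)).source := fun a b =>
      differentiableOn_pi.1 (h1.clm_apply (differentiableOn_const _)) b
    exact DifferentiableOn.fun_sum fun σ _ => (differentiableOn_const _).mul fun x hx =>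
      (HasFDerivWithinAt.finsetProd
        (fun a _ => (h3 a (σ a) x hx).hasFDerivWithinAt)).differentiableWithinAt
  refine h2.congr fun z hz => ?_
  have hz' : z ∈ (A.chart i).target := by
    rw [OpenPartialHomeomorph.trans_source] at hz
    simpa using hz.1
  simp [CoordCover.jac, hz']

/-- The canonical bundle `K_X`: `dz_j = det (∂ z_j / ∂ z_i) dz_i`, so the components of a
holomorphic `n`-form satisfy `s i = det (∂ z_j / ∂ z_i) * s j`. -/
def canonicalBundle [IsManifold 𝓘(ℂ, Fin n → ℂ) ω X] (A : CoordCover n X ι) : LineBundle A where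
  g := A.jac
  holomorphic := A.differentiableOn_jac
  ne_zero := by
    intro i j x hx h
    have h1 := A.jac_mul i j i x hx.1 hx.2 hx.1
    rw [A.jac_self i x hx.1, h, zero_mul] at h1
    exact zero_ne_one h1
  cocycle := fun i j k x hx => A.jac_mul i j k x hx.1.1 hx.1.2 hx.2

/-- A real line bundle: a formal real linear combination of holomorphic line bundles
(written additively). -/
abbrev RealLineBundle (A : CoordCover n X ι) := LineBundle A →₀ ℝ

/-- `log |g i j|^2` for the (formal) transition functions of a real line bundle. -/
def RealLineBundle.logTrans {A : CoordCover n X ι} (L : RealLineBundle A) (i j : ι) (x : X) : ℝ :=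
  L.sum fun B a => a * Real.log (‖B.g i j x‖ ^ 2)

/-- The canonical bundle as a real line bundle. -/
def canonical [IsManifold 𝓘(ℂ, Fin n → ℂ) ω X] (A : CoordCover n X ι) : RealLineBundle A :=
  Finsupp.single (canonicalBundle A) 1

/-! ## Metrics and their curvature -/

/-- The Wirtinger derivative `∂ f / ∂ z^a`. -/
def dz (a : Fin n) (f : (Fin n → ℂ) → ℂ) (z : Fin n → ℂ) : ℂ :=
  (1 / 2) * (fderiv ℝ f z (Pi.single a 1) - Complex.I * fderiv ℝ f z (Pi.single a Complex.I))

/-- The Wirtinger derivative `∂ f / ∂ z̄^a`. -/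
def dzbar (a : Fin n) (f : (Fin n → ℂ) → ℂ) (z : Fin n → ℂ) : ℂ :=
  (1 / 2) * (fderiv ℝ f z (Pi.single a 1) + Complex.I * fderiv ℝ f z (Pi.single a Complex.I))

/-- The complex Hessian `(∂² f / ∂ z^a ∂ z̄^b)` of a real function. -/
def complexHessian (f : (Fin n → ℂ) → ℝ) (z : Fin n → ℂ) : Matrix (Fin n) (Fin n) ℂ :=
  Matrix.of fun a b => dz a (dzbar b fun w => (f w : ℂ)) z

/-- A smooth Hermitian metric `|s|^2 = |s i|^2 * exp (-φ i)` on a real line bundle, given by its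
local weights `φ i` on the coordinate domains (the values elsewhere are irrelevant). -/
structure SmoothMetric {A : CoordCover n X ι} (L : RealLineBundle A) where
  /-- the local weights -/
  weight : ι → X → ℝ
  smooth : ∀ i, ContDiffOn ℝ ∞ (fun z => weight i ((A.chart i).symm z)) (A.chart i).target
  transition : ∀ i j, ∀ x ∈ (A.chart i).source ∩ (A.chart j).source,
    weight i x - weight j x = L.logTrans i j x

/-- The coefficient matrix `(φ_{a b̄})`, in the coordinates of chart `i`, of the curvature form
`i ∂∂̄ φ = i ∑ φ_{a b̄} dz^a ∧ dz̄^b`, at the point with coordinates `z`. -/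
def SmoothMetric.curv {A : CoordCover n X ι} {L : RealLineBundle A} (φ : SmoothMetric L) (i : ι)
    (z : Fin n → ℂ) : Matrix (Fin n) (Fin n) ℂ :=
  complexHessian (fun w => φ.weight i ((A.chart i).symm w)) z

/-- `i ∂∂̄ ψ ≥ 0`. -/
def SmoothMetric.IsSemipositive {A : CoordCover n X ι} {L : RealLineBundle A}
    (ψ : SmoothMetric L) : Prop :=
  ∀ i, ∀ z ∈ (A.chart i).target, (ψ.curv i z).PosSemidef

/-- A positively curved smooth metric, i.e. one for which `ω_φ = i ∂∂̄ φ` is a Kähler form. -/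
structure PosMetric {A : CoordCover n X ι} (L : RealLineBundle A) extends SmoothMetric L where
  pos : ∀ i, ∀ z ∈ (A.chart i).target, (toSmoothMetric.curv i z).PosDef

/-! ## Integration -/

/-- The measure on `X` of the positive volume form that is
`ρ i * (i dz^1 ∧ dz̄^1) ∧ ... ∧ (i dz^n ∧ dz̄^n)` in the coordinates of chart `i`, where
`i dz ∧ dz̄ = 2 dx ∧ dy`: the least measure that is at least the local measure on each coordinate
domain, which for a compatible family `ρ` coincides with the local measure there. -/
def volumeFormMeasure [MeasurableSpace X] (A : CoordCover n X ι) (ρ : ι → (Fin n → ℂ) → ℝ) :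
    Measure X :=
  ⨆ i, Measure.map (A.chart i).symm
    ((volume.restrict (A.chart i).target).withDensity fun z => ENNReal.ofReal (2 ^ n * ρ i z))

/-- For `α k = i ∑ (M k)_{a b̄} dz^a ∧ dz̄^b`, the coefficient of the top form
`α 1 ∧ ... ∧ α n` with respect to `(i dz^1 ∧ dz̄^1) ∧ ... ∧ (i dz^n ∧ dz̄^n)`. -/
def wedgeCoeff (M : Fin n → Matrix (Fin n) (Fin n) ℂ) : ℂ :=
  ∑ σ : Equiv.Perm (Fin n), ∑ π : Equiv.Perm (Fin n),
    ((Equiv.Perm.sign σ : ℤ) : ℂ) * ((Equiv.Perm.sign π : ℤ) : ℂ) * ∏ k, M k (σ k) (π k)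

variable {A : CoordCover n X ι} {L : RealLineBundle A}

/-- The measure `ω_φ^j ∧ ω_{φ₀}^{n-j}`. -/
def mixedMA [MeasurableSpace X] (φ φ₀ : PosMetric L) (j : ℕ) : Measure X :=
  volumeFormMeasure A fun i z =>
    (wedgeCoeff fun k : Fin n =>
      if (k : ℕ) < j then φ.toSmoothMetric.curv i z else φ₀.toSmoothMetric.curv i z).re

/-- The global function `φ - φ₀` on `X`, for two metrics on the same bundle. -/
def metricDiff (φ φ₀ : PosMetric L) (x : X) : ℝ :=
  φ.weight (A.indexAt x) x - φ₀.weight (A.indexAt x) x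

/-- The volume `∫_X ω_φ^n`. -/
def kahlerVolume [MeasurableSpace X] (φ : PosMetric L) : ℝ :=
  (mixedMA φ φ n).real univ

/-- The functional `𝓔`, with reference metric `φ₀`; the forms `ω_φ^j ∧ ω_{φ₀}^{n-j}` are
normalized to have total mass one. -/
def energy [MeasurableSpace X] (φ₀ φ : PosMetric L) : ℝ :=
  1 / ((n + 1 : ℝ) * kahlerVolume φ₀) *
    ∑ j ∈ Finset.range (n + 1), ∫ x, metricDiff φ φ₀ x ∂(mixedMA φ φ₀ j)

/-- For metrics `φ` on `-(K_X + S)` and `ψ` on `S`, the measure of the volume form `e^{-φ-ψ}` on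
`X`, i.e. the one with coefficient `exp (-φ i - ψ i)` in the coordinates of chart `i`. -/
def expMeasure [MeasurableSpace X] [IsManifold 𝓘(ℂ, Fin n → ℂ) ω X] {S : RealLineBundle A}
    (ψ : SmoothMetric S) (φ : PosMetric (-(canonical A + S))) : Measure X :=
  volumeFormMeasure A fun i z =>
    Real.exp (-φ.weight i ((A.chart i).symm z) - ψ.weight i ((A.chart i).symm z))

/-- The functional `𝓕_ψ (φ) = - log ∫_X e^{-φ-ψ}`. -/
def logFunctional [MeasurableSpace X] [IsManifold 𝓘(ℂ, Fin n → ℂ) ω X] {S : RealLineBundle A}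
    (ψ : SmoothMetric S) (φ : PosMetric (-(canonical A + S))) : ℝ :=
  -Real.log ((expMeasure ψ φ).real univ)

/-- The twisted Ding functional `𝓓 = -𝓔 + 𝓕_ψ`. -/
def dingFunctional [MeasurableSpace X] [IsManifold 𝓘(ℂ, Fin n → ℂ) ω X] {S : RealLineBundle A}
    (ψ : SmoothMetric S) (φ₀ φ : PosMetric (-(canonical A + S))) : ℝ :=
  -energy φ₀ φ + logFunctional ψ φ

/-! ## Geodesics -/

/-- `|∂ u|^2_g = ∑ g^{a b̄} u_a u_{b̄}` for the Hermitian matrix `g = (g_{a b̄})` and a real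
function `u` at `z`; here `g^{a b̄}` is the `(b, a)` entry of the inverse matrix. -/
def gradNormSq (g : Matrix (Fin n) (Fin n) ℂ) (u : (Fin n → ℂ) → ℝ) (z : Fin n → ℂ) : ℝ :=
  (∑ a, ∑ b, g⁻¹ b a * dz a (fun w => (u w : ℂ)) z * dzbar b (fun w => (u w : ℂ)) z).re

/-- A smooth geodesic `φ t`, `0 ≤ t ≤ 1`, in the space of positively curved metrics: the weights
are smooth in space and time up to the end points, and `φ'' = |∂ φ'|^2_{g_φ}`. The values of `φ`
for `t` outside `[0,1]` are irrelevant. -/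
structure IsSmoothGeodesic (φ : ℝ → PosMetric L) : Prop where
  smooth : ∀ i, ContDiffOn ℝ ∞
    (fun p : ℝ × (Fin n → ℂ) => (φ p.1).weight i ((A.chart i).symm p.2))
    (Icc (0 : ℝ) 1 ×ˢ (A.chart i).target)
  equation : ∀ t ∈ Ioo (0 : ℝ) 1, ∀ i, ∀ z ∈ (A.chart i).target,
    deriv (deriv fun s => (φ s).weight i ((A.chart i).symm z)) t =
      gradNormSq ((φ t).toSmoothMetric.curv i z)
        (fun w => deriv (fun s => (φ s).weight i ((A.chart i).symm w)) t) z

end TwistedDing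

end

open scoped Manifold ContDiff ENNReal ComplexOrder
open MeasureTheory Set

noncomputable section

set_option linter.unusedSectionVars false

/-! Write `μ` for the volume form `e^{-φ-ψ}` and `M` for its mass. Along any smooth path the
derivative of `𝓔` is a fixed multiple of `∫ φ' ω_φ^n`. Integration by parts turns the derivative of
that integral into `∫ (φ'' - |∂φ'|²) ω_φ^n`, which is zero on a geodesic, so `𝓔` is affine.
Differentiating `-log M` twice gives `M² 𝓕'' = M ∫ (φ'' - φ'²) dμ + (∫ φ' dμ)²`. Since `φ'' = |∂φ'|²
= |∂̄φ'|²`, convexity amounts to a Poincaré inequality with constant one: the variance of `φ'` under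
`μ / M` is at most the mean of `|∂̄φ'|²`. The constant comes from the curvature: `-i∂∂̄ log μ = ω_φ
+ θ ≥ ω_φ`.

Let `L u = -div_μ (grad u)` be the weighted ∂̄-Laplacian (`lapL`). Commuting ∂̄ with the weighted
divergence produces the Hessian of the weight and a term that is nonnegative because `ω_φ` is
closed; this is the Bochner inequality `∫ |∂̄w|² ≤ ∫ |Lw|²` (`dbarSq_le`, `integral_dbarSq_le`). The
Poincaré inequality (`integral_norm_sq_le_integral_dbarSq`) follows without spectral theory. For `f`
of mean zero and a constant `c`, `‖f - c - Lw‖² ≥ ‖f‖² + ‖Lw‖² - 2 Re ⟨f, Lw⟩ ≥ ‖f‖² + ‖Lw‖² - ∫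
|∂̄f|² - ∫ |∂̄w|² ≥ ‖f‖² - ∫ |∂̄f|²`, so it is enough that `f - c` lies in the L²-closure of the
range of `L` for some `c`.

That density statement is the analytic core, and is reached without elliptic regularity. For a
suitable `δ > 0` the operator `δ + L` on smooth functions has range dense among smooth functions in
L²: its coefficients are frozen in small charts, the constant coefficient operator is inverted by
the Fourier transform, the local solutions are glued (`exists_local_parametrix`,
`exists_resolvent_half`), and the error is iterated away (`exists_resolvent_approx`). The component
`h` of `f` orthogonal to the range of `L` is then an L²-limit of smooth `v` with `∫ |∂̄v|²` tending
to zero (`exists_almost_holomorphic_limit`). For the Riemannian density `det g` the operator is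
real, so `∫ |∂v|²` tends to zero as well (`exists_integral_dbarSq_conj_le`); hence `h` is locally
constant, and constant by connectedness (`ae_eq_const_of_almost_holomorphic`).

The derivative of `𝓔` is found by interpolation: the coefficients of `det ((1-s) ω₀ + s ω_φ)` in `s`
are Bernstein polynomials times the mixed forms in `𝓔`, and each of these polynomials has integral
`1 / (n + 1)` over `[0,1]`. Symmetry of `L` makes the time derivative of the interpolated integral
an exact derivative in `s` (`sum_bernstein_mul_deriv_eq`, `sum_deriv_integral_mixedMA`). -/

namespace TwistedDing

/-! ### Wirtinger calculus on `ℂⁿ`. -/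

section

variable {n : ℕ}

-- The splitting `d = ∂ + ∂̄`, found by expanding `v` in the real basis `e_a, i e_a`. The chain
-- rules for holomorphic maps and the bound on the full gradient both start from it.
open ComplexConjugate in
theorem fderiv_eq_sum_dz (f : (Fin n → ℂ) → ℂ) (z v : Fin n → ℂ) :
    fderiv ℝ f z v = ∑ a, (v a * dz a f z + conj (v a) * dzbar a f z) := by
  have hv : v = ∑ a, ((v a).re • (Pi.single a 1 : Fin n → ℂ) +
      (v a).im • (Pi.single a Complex.I : Fin n → ℂ)) := by
    ext c
    simp [Finset.sum_apply, Pi.single_apply, Finset.sum_add_distrib, Complex.re_add_im]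
  conv_lhs => rw [hv]
  rw [map_sum]
  refine Finset.sum_congr rfl fun a _ => ?_
  rw [map_add, map_smul, map_smul, dz, dzbar]
  have h1 : conj (v a) = (v a).re - (v a).im * Complex.I := by
    apply Complex.ext <;> simp
  conv_rhs => rw [h1]
  conv_rhs => enter [1, 1]; rw [← Complex.re_add_im (v a)]
  simp only [Complex.real_smul]
  linear_combination (((v a).im : ℂ) * fderiv ℝ f z (Pi.single a Complex.I)) * Complex.I_mul_I

theorem dz_congr {f g : (Fin n → ℂ) → ℂ} {z : Fin n → ℂ} (h : f =ᶠ[nhds z] g) (a : Fin n) :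
    dz a f z = dz a g z := by
  simp only [dz, h.fderiv_eq]

theorem dzbar_congr {f g : (Fin n → ℂ) → ℂ} {z : Fin n → ℂ} (h : f =ᶠ[nhds z] g) (a : Fin n) :
    dzbar a f z = dzbar a g z := by
  simp only [dzbar, h.fderiv_eq]

theorem dz_const (a : Fin n) (c : ℂ) (z : Fin n → ℂ) : dz a (fun _ => c) z = 0 := by
  simp [dz]

theorem dzbar_const (a : Fin n) (c : ℂ) (z : Fin n → ℂ) : dzbar a (fun _ => c) z = 0 := by
  simp [dzbar]

section
variable {f g : (Fin n → ℂ) → ℂ} {z : Fin n → ℂ} (a : Fin n)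

theorem dz_add (hf : DifferentiableAt ℝ f z) (hg : DifferentiableAt ℝ g z) :
    dz a (fun w => f w + g w) z = dz a f z + dz a g z := by
  simp only [dz, fderiv_fun_add hf hg, add_apply]; ring

theorem dzbar_add (hf : DifferentiableAt ℝ f z) (hg : DifferentiableAt ℝ g z) :
    dzbar a (fun w => f w + g w) z = dzbar a f z + dzbar a g z := by
  simp only [dzbar, fderiv_fun_add hf hg, add_apply]; ring

theorem dzbar_neg : dzbar a (fun w => -f w) z = -dzbar a f z := by
  simp only [dzbar, fderiv_fun_neg, neg_apply]; ring

theorem dz_sub (hf : DifferentiableAt ℝ f z) (hg : DifferentiableAt ℝ g z) :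
    dz a (fun w => f w - g w) z = dz a f z - dz a g z := by
  simp only [dz, fderiv_fun_sub hf hg, sub_apply]; ring

theorem dzbar_sub (hf : DifferentiableAt ℝ f z) (hg : DifferentiableAt ℝ g z) :
    dzbar a (fun w => f w - g w) z = dzbar a f z - dzbar a g z := by
  simp only [dzbar, fderiv_fun_sub hf hg, sub_apply]; ring

theorem dz_mul (hf : DifferentiableAt ℝ f z) (hg : DifferentiableAt ℝ g z) :
    dz a (fun w => f w * g w) z = dz a f z * g z + f z * dz a g z := by
  simp only [dz, fderiv_fun_mul hf hg, add_apply, smul_apply, smul_eq_mul]; ring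

theorem dzbar_mul (hf : DifferentiableAt ℝ f z) (hg : DifferentiableAt ℝ g z) :
    dzbar a (fun w => f w * g w) z = dzbar a f z * g z + f z * dzbar a g z := by
  simp only [dzbar, fderiv_fun_mul hf hg, add_apply, smul_apply, smul_eq_mul]; ring

theorem dz_const_mul (c : ℂ) (hf : DifferentiableAt ℝ f z) :
    dz a (fun w => c * f w) z = c * dz a f z := by
  rw [dz_mul a (by fun_prop) hf, dz_const]; ring

theorem dzbar_const_mul (c : ℂ) (hf : DifferentiableAt ℝ f z) :
    dzbar a (fun w => c * f w) z = c * dzbar a f z := by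
  rw [dzbar_mul a (by fun_prop) hf, dzbar_const]; ring

theorem dz_sum {κ : Type*} (s : Finset κ) {F : κ → (Fin n → ℂ) → ℂ}
    (hF : ∀ k ∈ s, DifferentiableAt ℝ (F k) z) :
    dz a (fun w => ∑ k ∈ s, F k w) z = ∑ k ∈ s, dz a (F k) z := by
  simp only [dz, fderiv_fun_sum hF, sum_apply, Finset.mul_sum, Finset.sum_sub_distrib, mul_sub]

theorem dzbar_sum {κ : Type*} (s : Finset κ) {F : κ → (Fin n → ℂ) → ℂ}
    (hF : ∀ k ∈ s, DifferentiableAt ℝ (F k) z) :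
    dzbar a (fun w => ∑ k ∈ s, F k w) z = ∑ k ∈ s, dzbar a (F k) z := by
  simp only [dzbar, fderiv_fun_sum hF, sum_apply, Finset.mul_sum, Finset.sum_add_distrib, mul_add]

open ComplexConjugate in
theorem dz_conj (f : (Fin n → ℂ) → ℂ) (z : Fin n → ℂ) :
    dz a (fun w => conj (f w)) z = conj (dzbar a f z) := by
  have h := (Complex.conjCLE : ℂ ≃L[ℝ] ℂ).comp_fderiv (f := f) (x := z)
  have h' : fderiv ℝ (fun w => conj (f w)) z =
      (Complex.conjCLE : ℂ →L[ℝ] ℂ).comp (fderiv ℝ f z) := h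
  simp only [dz, dzbar, h']
  simp [sub_eq_add_neg]
  exact Or.inl (map_ofNat (starRingEnd ℂ) 2).symm

open ComplexConjugate in
theorem dzbar_conj (f : (Fin n → ℂ) → ℂ) (z : Fin n → ℂ) :
    dzbar a (fun w => conj (f w)) z = conj (dz a f z) := by
  have h := dz_conj a (fun w => conj (f w)) z
  simp only [Complex.conj_conj] at h
  rw [h, Complex.conj_conj]

theorem contDiffAt_dz (hf : ContDiffAt ℝ ∞ f z) : ContDiffAt ℝ ∞ (dz a f) z := by
  have h : ContDiffAt ℝ ∞ (fderiv ℝ f) z := hf.fderiv_right (by simp)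
  unfold dz
  fun_prop

theorem contDiffAt_dzbar (hf : ContDiffAt ℝ ∞ f z) : ContDiffAt ℝ ∞ (dzbar a f) z := by
  have h : ContDiffAt ℝ ∞ (fderiv ℝ f) z := hf.fderiv_right (by simp)
  unfold dzbar
  fun_prop

theorem fderiv_fderiv_apply (hf : ContDiffAt ℝ ∞ f z) (v w : Fin n → ℂ) :
    fderiv ℝ (fun y => fderiv ℝ f y v) z w = fderiv ℝ (fderiv ℝ f) z w v := by
  have h : ContDiffAt ℝ ∞ (fderiv ℝ f) z := hf.fderiv_right (by simp)
  rw [fderiv_clm_apply (h.differentiableAt (by simp)) (by fun_prop)]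
  simp

theorem fderiv_fderiv_comm (hf : ContDiffAt ℝ ∞ f z) (v w : Fin n → ℂ) :
    fderiv ℝ (fderiv ℝ f) z v w = fderiv ℝ (fderiv ℝ f) z w v :=
  (hf.isSymmSndFDerivAt (by simp; exact WithTop.coe_le_coe.2 le_top)).eq v w

theorem fderiv_dz (hf : ContDiffAt ℝ ∞ f z) (v : Fin n → ℂ) :
    fderiv ℝ (dz a f) z v = (1 / 2) * (fderiv ℝ (fderiv ℝ f) z v (Pi.single a 1) -
      Complex.I * fderiv ℝ (fderiv ℝ f) z v (Pi.single a Complex.I)) := by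
  have h : DifferentiableAt ℝ (fderiv ℝ f) z :=
    (hf.fderiv_right (m := ∞) (by simp)).differentiableAt (by simp)
  unfold dz
  rw [fderiv_const_mul (by fun_prop), fderiv_fun_sub (by fun_prop) (by fun_prop),
    fderiv_const_mul (by fun_prop)]
  simp [fderiv_fderiv_apply hf]

theorem fderiv_dzbar (hf : ContDiffAt ℝ ∞ f z) (v : Fin n → ℂ) :
    fderiv ℝ (dzbar a f) z v = (1 / 2) * (fderiv ℝ (fderiv ℝ f) z v (Pi.single a 1) +
      Complex.I * fderiv ℝ (fderiv ℝ f) z v (Pi.single a Complex.I)) := by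
  have h : DifferentiableAt ℝ (fderiv ℝ f) z :=
    (hf.fderiv_right (m := ∞) (by simp)).differentiableAt (by simp)
  unfold dzbar
  rw [fderiv_const_mul (by fun_prop), fderiv_fun_add (by fun_prop) (by fun_prop),
    fderiv_const_mul (by fun_prop)]
  simp [fderiv_fderiv_apply hf]
  ring

theorem dz_dzbar_comm (hf : ContDiffAt ℝ ∞ f z) (b : Fin n) :
    dz a (dzbar b f) z = dzbar b (dz a f) z := by
  conv_lhs => rw [dz]
  conv_rhs => rw [dzbar]
  rw [fderiv_dz a hf, fderiv_dz a hf, fderiv_dzbar b hf, fderiv_dzbar b hf]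
  simp only [fderiv_fderiv_comm hf (Pi.single b _) (Pi.single a _)]
  ring

theorem dz_dz_comm (hf : ContDiffAt ℝ ∞ f z) (b : Fin n) :
    dz a (dz b f) z = dz b (dz a f) z := by
  conv_lhs => rw [dz]
  conv_rhs => rw [dz]
  rw [fderiv_dz a hf, fderiv_dz a hf, fderiv_dz b hf, fderiv_dz b hf]
  simp only [fderiv_fderiv_comm hf (Pi.single b _) (Pi.single a _)]
  ring

theorem dzbar_dzbar_comm (hf : ContDiffAt ℝ ∞ f z) (b : Fin n) :
    dzbar a (dzbar b f) z = dzbar b (dzbar a f) z := by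
  conv_lhs => rw [dzbar]
  conv_rhs => rw [dzbar]
  rw [fderiv_dzbar a hf, fderiv_dzbar a hf, fderiv_dzbar b hf, fderiv_dzbar b hf]
  simp only [fderiv_fderiv_comm hf (Pi.single b _) (Pi.single a _)]
  ring

end

section Holomorphic
variable {T : (Fin n → ℂ) → (Fin n → ℂ)} {T' : (Fin n → ℂ) →L[ℂ] (Fin n → ℂ)}
  {f : (Fin n → ℂ) → ℂ} {z : Fin n → ℂ}

theorem map_single_I (T' : (Fin n → ℂ) →L[ℂ] (Fin n → ℂ)) (a : Fin n) :
    T' (Pi.single a Complex.I) = Complex.I • T' (Pi.single a 1) := by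
  rw [← map_smul]
  congr 1
  ext c
  by_cases h : c = a
  · subst h; simp
  · simp [h]

theorem fderiv_comp_holomorphic (hT : HasFDerivAt T T' z) (hf : DifferentiableAt ℝ f (T z))
    (v : Fin n → ℂ) : fderiv ℝ (fun w => f (T w)) z v = fderiv ℝ f (T z) (T' v) := by
  have h := hf.hasFDerivAt.comp z (hT.restrictScalars ℝ)
  have h2 : fderiv ℝ (fun w => f (T w)) z = _ := h.fderiv
  rw [h2]
  rfl

/-- Complex linearity gives `T'(i e_a) = i T'(e_a)`, so in the combination defining `dz` the
conjugate-linear halves cancel and the linear halves double. -/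
theorem dz_comp_holomorphic (hT : HasFDerivAt T T' z) (hf : DifferentiableAt ℝ f (T z))
    (a : Fin n) :
    dz a (fun w => f (T w)) z = ∑ c, T' (Pi.single a 1) c * dz c f (T z) := by
  rw [dz, fderiv_comp_holomorphic hT hf, fderiv_comp_holomorphic hT hf, map_single_I,
    fderiv_eq_sum_dz, fderiv_eq_sum_dz, Finset.mul_sum, ← Finset.sum_sub_distrib, Finset.mul_sum]
  refine Finset.sum_congr rfl fun c _ => ?_
  simp only [Pi.smul_apply, smul_eq_mul, map_mul, Complex.conj_I]
  linear_combination (-(1 / 2) * T' (Pi.single a 1) c * dz c f (T z) + (1 / 2) *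
    (starRingEnd ℂ) (T' (Pi.single a 1) c) * dzbar c f (T z)) * Complex.I_mul_I

open ComplexConjugate in
theorem dzbar_comp_holomorphic (hT : HasFDerivAt T T' z) (hf : DifferentiableAt ℝ f (T z))
    (a : Fin n) :
    dzbar a (fun w => f (T w)) z = ∑ c, conj (T' (Pi.single a 1) c) * dzbar c f (T z) := by
  rw [dzbar, fderiv_comp_holomorphic hT hf, fderiv_comp_holomorphic hT hf, map_single_I,
    fderiv_eq_sum_dz, fderiv_eq_sum_dz, Finset.mul_sum, ← Finset.sum_add_distrib, Finset.mul_sum]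
  refine Finset.sum_congr rfl fun c _ => ?_
  simp only [Pi.smul_apply, smul_eq_mul, map_mul, Complex.conj_I]
  linear_combination ((1 / 2) * T' (Pi.single a 1) c * dz c f (T z) - (1 / 2) *
    (starRingEnd ℂ) (T' (Pi.single a 1) c) * dzbar c f (T z)) * Complex.I_mul_I

theorem dzbar_holomorphic (hf : DifferentiableAt ℂ f z) (a : Fin n) : dzbar a f z = 0 := by
  have h : fderiv ℝ f z = (fderiv ℂ f z).restrictScalars ℝ := hf.fderiv_restrictScalars ℝ
  have h2 : fderiv ℂ f z (Pi.single a Complex.I) = Complex.I * fderiv ℂ f z (Pi.single a 1) := by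
    rw [← smul_eq_mul, ← map_smul]
    congr 1
    ext c
    by_cases h : c = a
    · subst h; simp
    · simp [h]
  rw [dzbar, h]
  simp only [ContinuousLinearMap.coe_restrictScalars', h2]
  linear_combination (1 / 2) * fderiv ℂ f z (Pi.single a 1) * Complex.I_mul_I

end Holomorphic

theorem integral_dz_eq_zero {f : (Fin n → ℂ) → ℂ} (hf : ContDiff ℝ 1 f)
    (hc : HasCompactSupport f) (a : Fin n) : ∫ z, dz a f z = 0 := by
  have key : ∀ v, ∫ z, fderiv ℝ f z v = 0 := by
    intro v
    -- Integration by parts against the constant function one.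
    have h := integral_mul_fderiv_eq_neg_fderiv_mul_of_integrable (μ := volume)
      (𝕜 := ℂ)
      (f := fun _ : Fin n → ℂ => (1 : ℂ)) (g := f) (v := v)
      (by simp) (by
        simp only [one_mul]
        exact ((hf.continuous_fderiv (by simp)).clm_apply continuous_const).integrable_of_hasCompactSupport
          (hc.fderiv_apply ℝ v)) (by
        simp only [one_mul]; exact hf.continuous.integrable_of_hasCompactSupport hc)
      (fun x _ => by fun_prop) (fun x _ => hf.differentiable (by simp) x)
    simpa using h
  have hi : ∀ v, Integrable fun z => fderiv ℝ f z v := fun v =>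
    ((hf.continuous_fderiv (by simp)).clm_apply continuous_const).integrable_of_hasCompactSupport
      (hc.fderiv_apply ℝ v)
  simp only [dz]
  rw [integral_const_mul, integral_sub (hi _) ((hi _).const_mul _), integral_const_mul, key, key]
  simp

end

/-! ### Smooth functions on `X`, cutoffs and partitions of unity. -/

section

variable {n : ℕ}
variable {X : Type*} [TopologicalSpace X] [ChartedSpace (Fin n → ℂ) X] {ι : Type*}
  {A : CoordCover n X ι}

/-- The local expression of a function in the chart `i`. -/
def CoordCover.loc (A : CoordCover n X ι) {F : Type*} (i : ι) (f : X → F) (z : Fin n → ℂ) : F :=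
  f ((A.chart i).symm z)

/-- Smoothness of a function on `X`, tested in the charts of the cover. -/
def CoordCover.IsSmooth (A : CoordCover n X ι) {F : Type*} [NormedAddCommGroup F]
    [NormedSpace ℝ F] (f : X → F) : Prop :=
  ∀ i, ∀ z ∈ (A.chart i).target, ContDiffAt ℝ ∞ (A.loc i f) z

/-- The overlap of the charts `i` and `j` in the coordinates of chart `i`. -/
def CoordCover.overlap (A : CoordCover n X ι) (i j : ι) : Set (Fin n → ℂ) :=
  ((A.chart i).symm.trans (A.chart j)).source

theorem CoordCover.mem_overlap {i j : ι} {z : Fin n → ℂ} :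
    z ∈ A.overlap i j ↔ z ∈ (A.chart i).target ∧ (A.chart i).symm z ∈ (A.chart j).source := by
  simp [CoordCover.overlap]

theorem CoordCover.isOpen_overlap (i j : ι) : IsOpen (A.overlap i j) :=
  ((A.chart i).symm.trans (A.chart j)).open_source

theorem CoordCover.trans_mem {i j : ι} {z : Fin n → ℂ} (hz : z ∈ A.overlap i j) :
    A.trans i j z ∈ (A.chart j).target :=
  (A.chart j).map_source (CoordCover.mem_overlap.1 hz).2

theorem CoordCover.symm_trans {i j : ι} {z : Fin n → ℂ} (hz : z ∈ A.overlap i j) :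
    (A.chart j).symm (A.trans i j z) = (A.chart i).symm z :=
  (A.chart j).left_inv (CoordCover.mem_overlap.1 hz).2

theorem CoordCover.loc_trans {F : Type*} (f : X → F) {i j : ι} {z : Fin n → ℂ}
    (hz : z ∈ A.overlap i j) : A.loc j f (A.trans i j z) = A.loc i f z := by
  rw [CoordCover.loc, CoordCover.symm_trans hz, CoordCover.loc]

theorem CoordCover.loc_eventuallyEq {F : Type*} (f : X → F) {i j : ι} {z : Fin n → ℂ}
    (hz : z ∈ A.overlap i j) : A.loc i f =ᶠ[nhds z] fun w => A.loc j f (A.trans i j w) := by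
  filter_upwards [(CoordCover.isOpen_overlap i j).mem_nhds hz] with w hw
  rw [CoordCover.loc_trans f hw]

theorem CoordCover.contDiffAt_trans [IsManifold 𝓘(ℂ, Fin n → ℂ) ω X] {i j : ι}
    {z : Fin n → ℂ} (hz : z ∈ A.overlap i j) : ContDiffAt ℂ ω (A.trans i j) z :=
  (A.contDiffOn_trans i j).contDiffAt ((CoordCover.isOpen_overlap i j).mem_nhds hz)

theorem CoordCover.hasFDerivAt_trans [IsManifold 𝓘(ℂ, Fin n → ℂ) ω X] {i j : ι}
    {z : Fin n → ℂ} (hz : z ∈ A.overlap i j) :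
    HasFDerivAt (A.trans i j) (fderiv ℂ (A.trans i j) z) z :=
  ((CoordCover.contDiffAt_trans hz).differentiableAt (by simp)).hasFDerivAt

theorem CoordCover.contDiffAt_trans_real [IsManifold 𝓘(ℂ, Fin n → ℂ) ω X] {i j : ι}
    {z : Fin n → ℂ} (hz : z ∈ A.overlap i j) : ContDiffAt ℝ ∞ (A.trans i j) z :=
  ((CoordCover.contDiffAt_trans hz).restrict_scalars ℝ).of_le (by simp)

theorem CoordCover.chart_mem_overlap {i j : ι} {x : X} (hi : x ∈ (A.chart i).source)
    (hj : x ∈ (A.chart j).source) : A.chart i x ∈ A.overlap i j :=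
  CoordCover.mem_source hi hj

theorem CoordCover.trans_chart {i j : ι} {x : X} (hi : x ∈ (A.chart i).source) :
    A.trans i j (A.chart i x) = A.chart j x := by
  simp [CoordCover.trans, hi]

section Smooth
variable {F : Type*} [NormedAddCommGroup F] [NormedSpace ℝ F]

theorem isSmooth_of_exists [IsManifold 𝓘(ℂ, Fin n → ℂ) ω X] {f : X → F}
    (h : ∀ x, ∃ i, x ∈ (A.chart i).source ∧ ContDiffAt ℝ ∞ (A.loc i f) (A.chart i x)) :
    A.IsSmooth f := by
  intro j z hz
  obtain ⟨i, hi, hs⟩ := h ((A.chart j).symm z)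
  have hzo : z ∈ A.overlap j i := CoordCover.mem_overlap.2 ⟨hz, hi⟩
  refine ContDiffAt.congr_of_eventuallyEq ?_ (CoordCover.loc_eventuallyEq f hzo)
  exact ContDiffAt.comp z (g := A.loc i f) hs (CoordCover.contDiffAt_trans_real hzo)

theorem CoordCover.IsSmooth.continuous {f : X → F} (hf : A.IsSmooth f) : Continuous f := by
  rw [continuous_iff_continuousAt]
  intro x
  have hx := A.mem_indexAt x
  have h1 : ContinuousAt (fun y => A.loc (A.indexAt x) f (A.chart (A.indexAt x) y)) x :=
    ContinuousAt.comp (g := A.loc (A.indexAt x) f)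
      (hf _ _ ((A.chart _).map_source hx)).continuousAt ((A.chart _).continuousAt hx)
  refine h1.congr ?_
  filter_upwards [(A.chart (A.indexAt x)).open_source.mem_nhds hx] with y hy
  simp [CoordCover.loc, hy]

theorem isSmooth_const (c : F) : A.IsSmooth fun _ => c := fun _ _ _ => contDiffAt_const

theorem CoordCover.IsSmooth.add {f g : X → F} (hf : A.IsSmooth f) (hg : A.IsSmooth g) :
    A.IsSmooth fun x => f x + g x := fun i z hz => (hf i z hz).add (hg i z hz)

theorem CoordCover.IsSmooth.mul {f g : X → ℂ} (hf : A.IsSmooth f)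
    (hg : A.IsSmooth g) : A.IsSmooth fun x => f x * g x :=
  fun i z hz => (hf i z hz).mul (hg i z hz)

theorem CoordCover.IsSmooth.sum {κ : Type*} {s : Finset κ} {f : κ → X → F}
    (hf : ∀ k ∈ s, A.IsSmooth (f k)) : A.IsSmooth fun x => ∑ k ∈ s, f k x :=
  fun i z hz => ContDiffAt.sum fun k hk => hf k hk i z hz

theorem CoordCover.IsSmooth.ofReal {f : X → ℝ} (hf : A.IsSmooth f) :
    A.IsSmooth fun x => (f x : ℂ) :=
  fun i z hz => Complex.ofRealCLM.contDiff.contDiffAt.comp z (hf i z hz)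

theorem CoordCover.IsSmooth.conj {f : X → ℂ} (hf : A.IsSmooth f) :
    A.IsSmooth fun x => (starRingEnd ℂ) (f x) :=
  fun i z hz => Complex.conjCLE.contDiff.contDiffAt.comp z (hf i z hz)

/-- The extension by zero to `X` of a function of the coordinates of chart `i`. -/
def CoordCover.ext (A : CoordCover n X ι) (i : ι) (P : (Fin n → ℂ) → F) : X → F :=
  (A.chart i).source.indicator fun x => P (A.chart i x)

theorem loc_ext {i : ι} (P : (Fin n → ℂ) → F) {z : Fin n → ℂ} (hz : z ∈ (A.chart i).target) :
    A.loc i (A.ext i P) z = P z := by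
  simp [CoordCover.loc, CoordCover.ext, hz]

theorem ext_eq_zero {i : ι} {P : (Fin n → ℂ) → F} {C : Set (Fin n → ℂ)}
    (hP : ∀ z ∉ C, P z = 0) {x : X} (hx : x ∉ (A.chart i).symm '' C) : A.ext i P x = 0 := by
  by_cases hs : x ∈ (A.chart i).source
  · rw [CoordCover.ext, indicator_of_mem hs]
    exact hP _ fun h => hx ⟨_, h, (A.chart i).left_inv hs⟩
  · rw [CoordCover.ext, indicator_of_notMem hs]

theorem isCompact_symm_image {i : ι} {C : Set (Fin n → ℂ)} (hC : IsCompact C)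
    (hCt : C ⊆ (A.chart i).target) : IsCompact ((A.chart i).symm '' C) :=
  hC.image_of_continuousOn ((A.chart i).continuousOn_symm.mono hCt)

theorem symm_image_subset {i : ι} {C : Set (Fin n → ℂ)} (hCt : C ⊆ (A.chart i).target) :
    (A.chart i).symm '' C ⊆ (A.chart i).source := by
  rintro _ ⟨z, hz, rfl⟩
  exact (A.chart i).map_target (hCt hz)

/-- Outside the coordinate domain the extension vanishes near every point: the image of the compact
set `C` is compact, hence closed since `X` is Hausdorff. -/
theorem isSmooth_ext [T2Space X] [IsManifold 𝓘(ℂ, Fin n → ℂ) ω X] {i : ι} {P : (Fin n → ℂ) → F}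
    {C : Set (Fin n → ℂ)} (hC : IsCompact C) (hCt : C ⊆ (A.chart i).target)
    (hP : ∀ z ∉ C, P z = 0) (hs : ∀ z ∈ (A.chart i).target, ContDiffAt ℝ ∞ P z) :
    A.IsSmooth (A.ext i P) := by
  refine isSmooth_of_exists fun x => ?_
  by_cases hx : x ∈ (A.chart i).source
  · refine ⟨i, hx, (hs _ ((A.chart i).map_source hx)).congr_of_eventuallyEq ?_⟩
    filter_upwards [(A.chart i).open_target.mem_nhds ((A.chart i).map_source hx)] with z hz
    exact loc_ext P hz
  · refine ⟨A.indexAt x, A.mem_indexAt x, ?_⟩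
    have hcl : IsClosed ((A.chart i).symm '' C) := (isCompact_symm_image hC hCt).isClosed
    have hxn : x ∉ (A.chart i).symm '' C := fun h => hx (symm_image_subset hCt h)
    have ht := (A.chart (A.indexAt x)).map_source (A.mem_indexAt x)
    have hcont := (A.chart (A.indexAt x)).continuousAt_symm ht
    have hev : ∀ᶠ z in nhds (A.chart (A.indexAt x) x),
        (A.chart (A.indexAt x)).symm z ∈ ((A.chart i).symm '' C)ᶜ := by
      apply hcont.eventually_mem
      rw [(A.chart _).left_inv (A.mem_indexAt x)]
      exact hcl.isOpen_compl.mem_nhds hxn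
    refine (contDiffAt_const (c := (0 : F))).congr_of_eventuallyEq ?_
    filter_upwards [hev] with z hz
    exact ext_eq_zero hP hz

end Smooth

/-- A finite family of smooth functions, each supported in a compact subset of a coordinate
domain. -/
structure IsCutoff (A : CoordCover n X ι) (i : ι) (η : X → ℝ) (C : Set X) : Prop where
  smooth : A.IsSmooth η
  compact : IsCompact C
  subset : C ⊆ (A.chart i).source
  zero : ∀ x ∉ C, η x = 0

theorem exists_bump [T2Space X] [IsManifold 𝓘(ℂ, Fin n → ℂ) ω X] (A : CoordCover n X ι) (x : X)
    {N : Set X} (hN : N ∈ nhds x) : ∃ (b : X → ℝ) (C : Set X),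
    IsCutoff A (A.indexAt x) b C ∧ C ⊆ N ∧ ∃ U ∈ nhds x, ∀ y ∈ U, b y = 1 := by
  set i := A.indexAt x
  have hx := A.mem_indexAt x
  have ht := (A.chart i).map_source hx
  have hN' : (A.chart i).target ∩ (A.chart i).symm ⁻¹' N ∈ nhds (A.chart i x) := by
    refine Filter.inter_mem ((A.chart i).open_target.mem_nhds ht) ?_
    apply ((A.chart i).continuousAt_symm ht).preimage_mem_nhds
    rwa [(A.chart i).left_inv hx]
  obtain ⟨r, hr, hsub⟩ := Metric.nhds_basis_closedBall.mem_iff.1 hN'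
  let β : ContDiffBump (A.chart i x) := ⟨r / 2, r, by positivity, by linarith⟩
  have hz : ∀ z ∉ Metric.closedBall (A.chart i x) r, β z = 0 := fun z hz => by
    apply β.zero_of_le_dist
    rw [Metric.mem_closedBall, not_le] at hz
    exact hz.le
  have hC : IsCompact (Metric.closedBall (A.chart i x) r) := isCompact_closedBall _ _
  refine ⟨A.ext i β, (A.chart i).symm '' Metric.closedBall (A.chart i x) r,
    ⟨isSmooth_ext hC (fun z h => (hsub h).1) hz fun z _ => β.contDiff.contDiffAt,
      isCompact_symm_image hC fun z h => (hsub h).1, symm_image_subset fun z h => (hsub h).1,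
      fun x hx => ext_eq_zero hz hx⟩, ?_, ?_⟩
  · rintro _ ⟨z, hz, rfl⟩
    exact (hsub hz).2
  · refine ⟨(A.chart i).source ∩ (A.chart i) ⁻¹' Metric.closedBall (A.chart i x) (r / 2), ?_, ?_⟩
    · refine Filter.inter_mem ((A.chart i).open_source.mem_nhds hx) ?_
      exact ((A.chart i).continuousAt hx).preimage_mem_nhds
        (Metric.closedBall_mem_nhds _ (by positivity))
    · rintro y ⟨hy, hy'⟩
      rw [CoordCover.ext, indicator_of_mem hy]
      exact β.one_of_mem_closedBall hy'

/-- Squares are used because the parametrix cuts off its source and its solution by the same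
function, and because errors of the form `∑ η k * e k` can then be summed by Cauchy-Schwarz without
counting overlaps. The neighbourhoods `N` are prescribed so that the coefficients of the operator
hardly vary on each support. -/
theorem exists_sq_partition [T2Space X] [CompactSpace X] [IsManifold 𝓘(ℂ, Fin n → ℂ) ω X]
    (A : CoordCover n X ι) {N : X → Set X} (hN : ∀ x, N x ∈ nhds x) :
    ∃ (K : Finset X) (η : X → X → ℝ) (C : X → Set X),
      (∀ k, IsCutoff A (A.indexAt k) (η k) (C k)) ∧ (∀ k, C k ⊆ N k) ∧
      ∀ x, ∑ k ∈ K, η k x ^ 2 = 1 := by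
  choose b C hb hCN U hU hbU using fun x => exists_bump A x (hN x)
  obtain ⟨K, -, hK⟩ := isCompact_univ.elim_nhds_subcover U fun x _ => hU x
  set q : X → ℝ := fun x => ∑ k ∈ K, b k x ^ 2
  have hq : ∀ x, 0 < q x := fun x => by
    obtain ⟨k, hk, hkx⟩ := mem_iUnion₂.1 (hK (mem_univ x))
    refine Finset.sum_pos' (fun _ _ => sq_nonneg _) ⟨k, hk, ?_⟩
    rw [hbU k x hkx]
    norm_num
  refine ⟨K, fun k x => (Real.sqrt (q x))⁻¹ * b k x, C, fun k => ⟨?_, (hb k).compact,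
    (hb k).subset, fun x hx => by simp [(hb k).zero x hx]⟩, hCN, fun x => ?_⟩
  · intro i z hz
    have h1 : ContDiffAt ℝ ∞ (A.loc i q) z :=
      ContDiffAt.sum fun k _ => ((hb k).smooth i z hz).pow 2
    have h2 := (h1.sqrt (hq _).ne').inv (Real.sqrt_ne_zero'.2 (hq _))
    exact h2.mul ((hb k).smooth i z hz)
  · simp only [mul_pow, inv_pow, Real.sq_sqrt (hq x).le]
    rw [← Finset.mul_sum]
    exact inv_mul_cancel₀ (hq x).ne'

end

/-! ### The measure defined by a volume form. -/

section

variable {n : ℕ}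
variable {X : Type*} [TopologicalSpace X] [ChartedSpace (Fin n → ℂ) X] {ι : Type*}
  {A : CoordCover n X ι}

/-- A positive continuous density: the coefficients, in the charts, of a volume form. -/
structure IsDensity (A : CoordCover n X ι) (ρ : ι → (Fin n → ℂ) → ℝ) : Prop where
  continuousOn : ∀ i, ContinuousOn (ρ i) (A.chart i).target
  pos : ∀ i, ∀ z ∈ (A.chart i).target, 0 < ρ i z
  trans : ∀ i j, ∀ z ∈ A.overlap i j,
    ρ i z = ‖(fderiv ℂ (A.trans i j) z).det‖ ^ 2 * ρ j (A.trans i j z)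

/-- The measure on `X` that a density defines on the domain of the chart `i`. -/
def localMeasure [MeasurableSpace X] (A : CoordCover n X ι) (ρ : ι → (Fin n → ℂ) → ℝ) (i : ι) :
    Measure X :=
  Measure.map (A.chart i).symm
    ((volume.restrict (A.chart i).target).withDensity fun z => ENNReal.ofReal (2 ^ n * ρ i z))

theorem image_trans {i j : ι} (S : Set X) :
    A.trans i j '' (A.overlap i j ∩ (A.chart i).symm ⁻¹' S) =
      A.overlap j i ∩ (A.chart j).symm ⁻¹' S := by
  ext w
  constructor
  · rintro ⟨z, ⟨hz, hzS⟩, rfl⟩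
    refine ⟨CoordCover.mem_overlap.2 ⟨CoordCover.trans_mem hz, ?_⟩, ?_⟩
    · rw [CoordCover.symm_trans hz]
      exact (A.chart i).map_target (CoordCover.mem_overlap.1 hz).1
    · rwa [mem_preimage, CoordCover.symm_trans hz]
  · rintro ⟨hw, hwS⟩
    have hz := CoordCover.trans_mem hw
    refine ⟨A.trans j i w, ⟨CoordCover.mem_overlap.2 ⟨hz, ?_⟩, ?_⟩, ?_⟩
    · rw [CoordCover.symm_trans hw]
      exact (A.chart j).map_target (CoordCover.mem_overlap.1 hw).1
    · rwa [mem_preimage, CoordCover.symm_trans hw]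
    · rw [CoordCover.trans, CoordCover.symm_trans hw,
        (A.chart j).right_inv (CoordCover.mem_overlap.1 hw).1]

theorem injOn_trans (i j : ι) : InjOn (A.trans i j) (A.overlap i j) := by
  intro z hz w hw h
  have h1 := CoordCover.symm_trans hz
  rw [h, CoordCover.symm_trans hw] at h1
  exact ((A.chart i).symm.injOn (CoordCover.mem_overlap.1 hz).1
    (CoordCover.mem_overlap.1 hw).1 h1.symm)

/-- The real Jacobian of a holomorphic map, which is exactly the factor in the transformation rule
of a density. -/
theorem abs_det_restrictScalars (L : (Fin n → ℂ) →L[ℂ] (Fin n → ℂ)) :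
    |(L.restrictScalars ℝ).det| = ‖L.det‖ ^ 2 := by
  have h : (L.restrictScalars ℝ).det = Complex.normSq L.det := by
    simp [ContinuousLinearMap.det, LinearMap.det_restrictScalars, Algebra.norm_complex_apply]
  rw [h, abs_of_nonneg (Complex.normSq_nonneg _), Complex.normSq_eq_norm_sq]

section Measure
variable [MeasurableSpace X] [BorelSpace X] {ρ : ι → (Fin n → ℂ) → ℝ}

theorem measurableSet_target_inter {i : ι} {S : Set X} (hS : MeasurableSet S) :
    MeasurableSet ((A.chart i).target ∩ (A.chart i).symm ⁻¹' S) := by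
  have h : Measurable ((A.chart i).target.domRestrict (A.chart i).symm) :=
    (continuousOn_iff_continuous_domRestrict.1 (A.chart i).continuousOn_symm).measurable
  have h2 := (A.chart i).open_target.measurableSet.subtype_image (h hS)
  convert! h2 using 1
  ext z
  simp [and_comm]

theorem aemeasurable_symm (i : ι) :
    AEMeasurable (A.chart i).symm
      ((volume.restrict (A.chart i).target).withDensity fun z => ENNReal.ofReal (2 ^ n * ρ i z)) :=
  ((A.chart i).continuousOn_symm.aemeasurable (A.chart i).open_target.measurableSet).mono_ac
    (withDensity_absolutelyContinuous _ _)

theorem localMeasure_apply (i : ι) {S : Set X} (hS : MeasurableSet S) :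
    localMeasure A ρ i S =
      ∫⁻ z in (A.chart i).target ∩ (A.chart i).symm ⁻¹' S, ENNReal.ofReal (2 ^ n * ρ i z) := by
  have ht := (A.chart i).open_target.measurableSet
  rw [localMeasure, Measure.map_apply_of_aemeasurable (aemeasurable_symm i) hS]
  have h0 : ((volume.restrict (A.chart i).target).withDensity
      fun z => ENNReal.ofReal (2 ^ n * ρ i z)) (A.chart i).targetᶜ = 0 :=
    withDensity_absolutelyContinuous _ _ (by simp [Measure.restrict_apply ht.compl])
  rw [← measure_inter_conull (t := (A.chart i).target)
      h0, inter_comm,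
    withDensity_apply _ (measurableSet_target_inter hS),
    Measure.restrict_restrict (measurableSet_target_inter hS)]
  congr 2
  ext z
  simp +contextual

theorem localMeasure_compl (i : ι) {S : Set X} (hS : MeasurableSet S)
    (h : Disjoint S (A.chart i).source) : localMeasure A ρ i S = 0 := by
  rw [localMeasure_apply i hS]
  have : (A.chart i).target ∩ (A.chart i).symm ⁻¹' S = ∅ := by
    ext z
    simp only [mem_inter_iff, mem_preimage, mem_empty_iff_false, iff_false, not_and]
    exact fun hz hS => h.le_bot ⟨hS, (A.chart i).map_target hz⟩
  rw [this]
  simp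

variable [IsManifold 𝓘(ℂ, Fin n → ℂ) ω X]

theorem localMeasure_eq (hρ : IsDensity A ρ) (i j : ι) {S : Set X} (hS : MeasurableSet S)
    (hi : S ⊆ (A.chart i).source) (hj : S ⊆ (A.chart j).source) :
    localMeasure A ρ i S = localMeasure A ρ j S := by
  have key : ∀ a b, S ⊆ (A.chart a).source → S ⊆ (A.chart b).source →
      (A.chart a).target ∩ (A.chart a).symm ⁻¹' S =
        A.overlap a b ∩ (A.chart a).symm ⁻¹' S := by
    intro a b ha hb
    ext z
    simp only [mem_inter_iff, mem_preimage, CoordCover.mem_overlap]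
    exact ⟨fun h => ⟨⟨h.1, hb h.2⟩, h.2⟩, fun h => ⟨h.1.1, h.2⟩⟩
  rw [localMeasure_apply i hS, localMeasure_apply j hS]
  have hm : MeasurableSet (A.overlap i j ∩ (A.chart i).symm ⁻¹' S) := by
    rw [← key i j hi hj]
    exact measurableSet_target_inter hS
  rw [key j i hj hi, key i j hi hj, ← image_trans (i := i) (j := j),
    lintegral_image_eq_lintegral_abs_det_fderiv_mul volume hm
      (f' := fun z => (fderiv ℂ (A.trans i j) z).restrictScalars ℝ)
      (fun z hz => ((CoordCover.hasFDerivAt_trans hz.1).restrictScalars ℝ).hasFDerivWithinAt)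
      ((injOn_trans i j).mono inter_subset_left)]
  refine setLIntegral_congr_fun hm fun z hz => ?_
  rw [abs_det_restrictScalars, ← ENNReal.ofReal_mul (by positivity), hρ.trans i j z hz.1]
  congr 1
  ring

theorem volumeFormMeasure_apply (hρ : IsDensity A ρ) (i : ι) {S : Set X} (hS : MeasurableSet S)
    (hi : S ⊆ (A.chart i).source) : volumeFormMeasure A ρ S = localMeasure A ρ i S := by
  have hsi := (A.chart i).open_source.measurableSet
  refine le_antisymm ?_ (Measure.le_iff'.1 (le_iSup (localMeasure A ρ) i) S)
  -- It suffices to bound every local measure, since the measure is their supremum. Inside the chart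
  -- `i` all local measures agree by the change of variables formula, and the second summand
  -- accounts for the rest; it vanishes on subsets of the chart.
  have h : volumeFormMeasure A ρ ≤ localMeasure A ρ i +
      (volumeFormMeasure A ρ).restrict (A.chart i).sourceᶜ := by
    refine iSup_le fun j => Measure.le_iff.2 fun B hB => ?_
    have hsj := (A.chart j).open_source.measurableSet
    change localMeasure A ρ j B ≤ _
    rw [← measure_inter_add_sdiff B hsi, Measure.add_apply]
    refine add_le_add ?_ ?_
    · rw [← measure_inter_add_sdiff (B ∩ (A.chart i).source) hsj,
        localMeasure_compl j ((hB.inter hsi).diff hsj) disjoint_sdiff_left, add_zero,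
        localMeasure_eq hρ j i ((hB.inter hsi).inter hsj) inter_subset_right
          (inter_subset_left.trans inter_subset_right)]
      exact measure_mono (inter_subset_left.trans inter_subset_left)
    · rw [Measure.restrict_apply hB]
      exact Measure.le_iff'.1 (le_iSup (localMeasure A ρ) j) _
  refine (Measure.le_iff'.1 h S).trans ?_
  rw [Measure.add_apply, Measure.restrict_apply hS]
  have : S ∩ (A.chart i).sourceᶜ = ∅ := by
    rw [← Set.sdiff_eq, Set.sdiff_eq_empty.2 hi]
  simp [this]

theorem volumeFormMeasure_restrict (hρ : IsDensity A ρ) (i : ι) :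
    (volumeFormMeasure A ρ).restrict (A.chart i).source = localMeasure A ρ i := by
  have hsi := (A.chart i).open_source.measurableSet
  ext S hS
  rw [Measure.restrict_apply hS, volumeFormMeasure_apply hρ i (hS.inter hsi) inter_subset_right,
    ← measure_inter_add_sdiff S hsi, localMeasure_compl i (hS.diff hsi) disjoint_sdiff_left,
    add_zero]

theorem integral_eq_chart (hρ : IsDensity A ρ) {i : ι} {G : Type*} [NormedAddCommGroup G]
    [NormedSpace ℝ G] {F : X → G} (hF : AEStronglyMeasurable F (volumeFormMeasure A ρ))
    (h0 : ∀ x ∉ (A.chart i).source, F x = 0) :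
    ∫ x, F x ∂(volumeFormMeasure A ρ) =
      ∫ z in (A.chart i).target, (2 ^ n * ρ i z) • A.loc i F z := by
  have ht := (A.chart i).open_target.measurableSet
  rw [← setIntegral_eq_integral_of_forall_compl_eq_zero (s := (A.chart i).source)
    fun x hx => h0 x hx, volumeFormMeasure_restrict hρ]
  have hF' : AEStronglyMeasurable F (localMeasure A ρ i) := by
    rw [← volumeFormMeasure_restrict hρ]
    exact hF.mono_measure Measure.restrict_le_self
  rw [localMeasure, integral_map (aemeasurable_symm i) hF',
    integral_withDensity_eq_integral_toReal_smul₀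
      ((((hρ.continuousOn i).const_mul (2 ^ n)).aemeasurable ht).ennreal_ofReal) (by simp only [ENNReal.ofReal_lt_top, Filter.eventually_true])]
  refine setIntegral_congr_fun ht fun z hz => ?_
  rw [ENNReal.toReal_ofReal (by have := hρ.pos i z hz; positivity), CoordCover.loc]

theorem aestronglyMeasurable_loc (hρ : IsDensity A ρ) {i : ι} {G : Type*} [NormedAddCommGroup G]
    {F : X → G} (hF : AEStronglyMeasurable F (volumeFormMeasure A ρ)) :
    AEStronglyMeasurable (A.loc i F) (volume.restrict (A.chart i).target) := by
  have ht := (A.chart i).open_target.measurableSet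
  have hF' : AEStronglyMeasurable F (localMeasure A ρ i) := by
    rw [← volumeFormMeasure_restrict hρ]
    exact hF.mono_measure Measure.restrict_le_self
  have h := hF'.comp_aemeasurable (aemeasurable_symm i)
  refine AEStronglyMeasurable.mono_ac ?_ h
  refine withDensity_absolutelyContinuous'
    ((((hρ.continuousOn i).const_mul (2 ^ n)).aemeasurable ht).ennreal_ofReal) ?_
  filter_upwards [ae_restrict_mem ht] with z hz
  have := hρ.pos i z hz
  simpa using by positivity

theorem volumeFormMeasure_compact_lt_top (hρ : IsDensity A ρ) {i : ι} {C : Set X}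
    (hC : IsCompact C) (hm : MeasurableSet C) (hi : C ⊆ (A.chart i).source) :
    volumeFormMeasure A ρ C < ⊤ := by
  rw [volumeFormMeasure_apply hρ i hm hi, localMeasure_apply i hm]
  have hK : IsCompact (A.chart i '' C) :=
    hC.image_of_continuousOn ((A.chart i).continuousOn.mono hi)
  have hKt : A.chart i '' C ⊆ (A.chart i).target := by
    rintro _ ⟨x, hx, rfl⟩
    exact (A.chart i).map_source (hi hx)
  have he : (A.chart i).target ∩ (A.chart i).symm ⁻¹' C ⊆ A.chart i '' C := fun z hz =>
    ⟨_, hz.2, (A.chart i).right_inv hz.1⟩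
  refine (lintegral_mono_set he).trans_lt ?_
  have hint : IntegrableOn (fun z => 2 ^ n * ρ i z) (A.chart i '' C) :=
    (((hρ.continuousOn i).mono hKt).const_mul _).integrableOn_compact hK
  exact hint.lintegral_lt_top

theorem isFiniteMeasure_volumeForm [T2Space X] [CompactSpace X] (hρ : IsDensity A ρ) :
    IsFiniteMeasure (volumeFormMeasure A ρ) := by
  obtain ⟨K, η, C, hη, -, hsum⟩ := exists_sq_partition A (N := fun _ => univ) (by simp)
  refine ⟨(measure_mono (t := ⋃ k ∈ K, C k) fun x _ => ?_).trans_lt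
    ((measure_biUnion_finset_le K C).trans_lt (ENNReal.sum_lt_top.2 fun k _ =>
      volumeFormMeasure_compact_lt_top hρ (hη k).compact (hη k).compact.measurableSet
        (hη k).subset))⟩
  by_contra hx
  simp only [mem_iUnion, not_exists] at hx
  have := hsum x
  rw [Finset.sum_eq_zero fun k hk => by rw [(hη k).zero x (hx k hk)]; simp] at this
  exact zero_ne_one this

theorem isOpenPosMeasure_volumeForm (hρ : IsDensity A ρ) :
    (volumeFormMeasure A ρ).IsOpenPosMeasure := by
  refine ⟨fun U hU ⟨x, hx⟩ h0 => ?_⟩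
  set i := A.indexAt x
  have hxi := A.mem_indexAt x
  have hV := hU.inter (A.chart i).open_source
  have h1 : volumeFormMeasure A ρ (U ∩ (A.chart i).source) = 0 :=
    measure_mono_null inter_subset_left h0
  rw [volumeFormMeasure_apply hρ i hV.measurableSet inter_subset_right,
    localMeasure_apply i hV.measurableSet] at h1
  have hO : IsOpen ((A.chart i).target ∩ (A.chart i).symm ⁻¹' (U ∩ (A.chart i).source)) :=
    (A.chart i).symm.isOpen_inter_preimage hV
  rw [setLIntegral_eq_zero_iff' hO.measurableSet
    ((((hρ.continuousOn i).mono inter_subset_left).const_mul (2 ^ n)).aemeasurable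
      hO.measurableSet).ennreal_ofReal] at h1
  have h2 : volume ((A.chart i).target ∩ (A.chart i).symm ⁻¹' (U ∩ (A.chart i).source)) = 0 := by
    rw [← compl_compl (_ ∩ _)]
    rw [ae_iff] at h1
    refine measure_mono_null (fun z hz => ?_) h1
    rw [compl_compl] at hz
    simp only [mem_ofPred_eq, not_forall]
    refine ⟨hz, ?_⟩
    have := hρ.pos i z hz.1
    simp only [ENNReal.ofReal_eq_zero, not_le]
    positivity
  refine (hO.measure_pos volume ⟨A.chart i x, (A.chart i).map_source hxi, ?_⟩).ne' h2
  simp only [mem_preimage]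
  rw [(A.chart i).left_inv hxi]
  exact ⟨hx, hxi⟩

theorem volumeFormMeasure_mono {ρ' : ι → (Fin n → ℂ) → ℝ} {c : ℝ} (hc : 0 ≤ c)
    (h : ∀ i, ∀ z ∈ (A.chart i).target, ρ' i z ≤ c * ρ i z) (hρ : IsDensity A ρ) :
    volumeFormMeasure A ρ' ≤ ENNReal.ofReal c • volumeFormMeasure A ρ := by
  refine iSup_le fun i => Measure.le_iff.2 fun S hS => ?_
  change localMeasure A ρ' i S ≤ _
  rw [Measure.smul_apply, smul_eq_mul]
  refine le_trans ?_ (mul_le_mul_right (Measure.le_iff'.1 (le_iSup (localMeasure A ρ) i) S) _)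
  rw [localMeasure_apply i hS, localMeasure_apply i hS, ← lintegral_const_mul'' _
    ((((hρ.continuousOn i).mono inter_subset_left).const_mul (2 ^ n)).aemeasurable
      (measurableSet_target_inter hS)).ennreal_ofReal]
  refine setLIntegral_mono' (measurableSet_target_inter hS) fun z hz => ?_
  rw [← ENNReal.ofReal_mul hc]
  refine ENNReal.ofReal_le_ofReal ?_
  have := h i z hz.1
  nlinarith [pow_pos (two_pos : (0:ℝ) < 2) n]

end Measure

end

/-! ### Vector fields of type (1,0), divergence and integration by parts. -/

section

variable {n : ℕ}
variable {X : Type*} [TopologicalSpace X] [ChartedSpace (Fin n → ℂ) X] {ι : Type*}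
  {A : CoordCover n X ι}

theorem integrableOn_of_zero_off_compact {G : Type*} [NormedAddCommGroup G]
    {U C : Set (Fin n → ℂ)} {f : (Fin n → ℂ) → G} (hU : IsOpen U)
    (hf : ContinuousOn f U) (hC : IsCompact C) (hCU : C ⊆ U) (h0 : ∀ z ∈ U, z ∉ C → f z = 0) :
    IntegrableOn f U := by
  have h1 : IntegrableOn f C := (hf.mono hCU).integrableOn_compact hC
  refine h1.of_forall_sdiff_eq_zero hU.measurableSet fun z hz => h0 z hz.1 hz.2

theorem setIntegral_dz_eq_zero {U C : Set (Fin n → ℂ)} {f : (Fin n → ℂ) → ℂ} (hU : IsOpen U)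
    (hf : ∀ z ∈ U, ContDiffAt ℝ ∞ f z) (hC : IsCompact C) (hCU : C ⊆ U)
    (h0 : ∀ z ∈ U, z ∉ C → f z = 0) (a : Fin n) : ∫ z in U, dz a f z = 0 := by
  have hs : ∀ z ∉ C, U.indicator f z = 0 := fun z hz => by
    by_cases hzU : z ∈ U
    · rw [indicator_of_mem hzU, h0 z hzU hz]
    · rw [indicator_of_notMem hzU]
  have hev : ∀ z ∈ U, U.indicator f =ᶠ[nhds z] f := fun z hz => by
    filter_upwards [hU.mem_nhds hz] with w hw
    rw [indicator_of_mem hw]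
  have hev0 : ∀ z ∉ C, U.indicator f =ᶠ[nhds z] fun _ => 0 := fun z hz => by
    filter_upwards [hC.isClosed.isOpen_compl.mem_nhds hz] with w hw
    exact hs w hw
  have hsm : ContDiff ℝ 1 (U.indicator f) := by
    rw [contDiff_iff_contDiffAt]
    intro z
    by_cases hz : z ∈ C
    · exact ((hf z (hCU hz)).congr_of_eventuallyEq (hev z (hCU hz))).of_le (by simp)
    · exact contDiffAt_const.congr_of_eventuallyEq (hev0 z hz)
  have hcs : HasCompactSupport (U.indicator f) := HasCompactSupport.intro hC hs
  rw [← integral_dz_eq_zero hsm hcs a, ← setIntegral_eq_integral_of_forall_compl_eq_zero (s := U)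
    (f := fun z => dz a (U.indicator f) z)]
  · exact setIntegral_congr_fun hU.measurableSet fun z hz => (dz_congr (hev z hz) a).symm
  · intro z hz
    rw [dz_congr (hev0 z fun h => hz (hCU h)), dz_const]

/-- A positive smooth density. -/
structure IsSmoothDensity (A : CoordCover n X ι) (ρ : ι → (Fin n → ℂ) → ℝ) : Prop extends
    IsDensity A ρ where
  smooth : ∀ i, ∀ z ∈ (A.chart i).target, ContDiffAt ℝ ∞ (ρ i) z

/-- The components, in the charts, of a smooth vector field of type `(1,0)`. -/
structure IsVectorField (A : CoordCover n X ι) (ζ : ι → (Fin n → ℂ) → (Fin n → ℂ)) : Prop where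
  smooth : ∀ i, ∀ z ∈ (A.chart i).target, ContDiffAt ℝ ∞ (ζ i) z
  trans : ∀ i j, ∀ z ∈ A.overlap i j,
    ζ j (A.trans i j z) = fderiv ℂ (A.trans i j) z (ζ i z)

/-- The derivative `ζ p` of a function along a vector field of type `(1,0)`. -/
def dirD (A : CoordCover n X ι) (ζ : ι → (Fin n → ℂ) → (Fin n → ℂ)) (p : X → ℂ) (x : X) : ℂ :=
  ∑ a, ζ (A.indexAt x) (A.chart (A.indexAt x) x) a *
    dz a (A.loc (A.indexAt x) p) (A.chart (A.indexAt x) x)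

/-- The divergence of a vector field with respect to a density, in the chart `i`. -/
def divLoc (ρ : ι → (Fin n → ℂ) → ℝ) (ζ : ι → (Fin n → ℂ) → (Fin n → ℂ)) (i : ι)
    (z : Fin n → ℂ) : ℂ :=
  (∑ a, dz a (fun w => (ρ i w : ℂ) * ζ i w a) z) / ρ i z

/-- The divergence of a vector field with respect to a density, as a function on `X`. -/
def divX (A : CoordCover n X ι) (ρ : ι → (Fin n → ℂ) → ℝ)
    (ζ : ι → (Fin n → ℂ) → (Fin n → ℂ)) (x : X) : ℂ :=
  divLoc ρ ζ (A.indexAt x) (A.chart (A.indexAt x) x)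

theorem sum_mul_map_single (L : (Fin n → ℂ) →L[ℂ] (Fin n → ℂ)) (v : Fin n → ℂ) (c : Fin n) :
    ∑ a, v a * L (Pi.single a 1) c = L v c := by
  conv_rhs => rw [← Finset.univ_sum_single v, map_sum, Finset.sum_apply]
  refine Finset.sum_congr rfl fun a _ => ?_
  have : (Pi.single a (v a) : Fin n → ℂ) = v a • Pi.single a 1 := by
    rw [← Pi.single_smul, smul_eq_mul, mul_one]
  rw [this, map_smul, Pi.smul_apply, smul_eq_mul]

section
variable [IsManifold 𝓘(ℂ, Fin n → ℂ) ω X] {ζ : ι → (Fin n → ℂ) → (Fin n → ℂ)} {p : X → ℂ}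

theorem sum_dz_trans (hζ : IsVectorField A ζ) (hp : A.IsSmooth p) {i j : ι} {z : Fin n → ℂ}
    (hz : z ∈ A.overlap i j) : ∑ a, ζ i z a * dz a (A.loc i p) z =
      ∑ a, ζ j (A.trans i j z) a * dz a (A.loc j p) (A.trans i j z) := by
  have h1 : ∀ a, dz a (A.loc i p) z = _ := fun a =>
    (dz_congr (CoordCover.loc_eventuallyEq p hz) a).trans
      (dz_comp_holomorphic (CoordCover.hasFDerivAt_trans hz)
        ((hp j _ (CoordCover.trans_mem hz)).differentiableAt (by simp)) a)
  simp only [h1, Finset.mul_sum, hζ.trans i j z hz]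
  rw [Finset.sum_comm]
  refine Finset.sum_congr rfl fun c _ => ?_
  rw [← sum_mul_map_single, Finset.sum_mul]
  exact Finset.sum_congr rfl fun a _ => by ring

theorem dirD_eq (hζ : IsVectorField A ζ) (hp : A.IsSmooth p) {i : ι} {x : X}
    (hx : x ∈ (A.chart i).source) : dirD A ζ p x =
      ∑ a, ζ i (A.chart i x) a * dz a (A.loc i p) (A.chart i x) := by
  rw [sum_dz_trans hζ hp (CoordCover.chart_mem_overlap hx (A.mem_indexAt x)),
    CoordCover.trans_chart hx, dirD]

theorem loc_dirD (hζ : IsVectorField A ζ) (hp : A.IsSmooth p) {i : ι} {z : Fin n → ℂ}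
    (hz : z ∈ (A.chart i).target) : A.loc i (dirD A ζ p) z =
      ∑ a, ζ i z a * dz a (A.loc i p) z := by
  rw [CoordCover.loc, dirD_eq hζ hp ((A.chart i).map_target hz), (A.chart i).right_inv hz]

theorem isSmooth_dirD (hζ : IsVectorField A ζ) (hp : A.IsSmooth p) :
    A.IsSmooth (dirD A ζ p) := by
  intro i z hz
  have : ContDiffAt ℝ ∞ (fun z => ∑ a, ζ i z a * dz a (A.loc i p) z) z :=
    ContDiffAt.sum fun a _ => ((contDiffAt_pi.1 (hζ.smooth i z hz)) a).mul
      (contDiffAt_dz a (hp i z hz))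
  refine this.congr_of_eventuallyEq ?_
  filter_upwards [(A.chart i).open_target.mem_nhds hz] with w hw
  exact loc_dirD hζ hp hw

theorem contDiffAt_divLoc {ρ : ι → (Fin n → ℂ) → ℝ} (hρ : IsSmoothDensity A ρ)
    (hζ : IsVectorField A ζ) {i : ι} {z : Fin n → ℂ} (hz : z ∈ (A.chart i).target) :
    ContDiffAt ℝ ∞ (fun w => divLoc ρ ζ i w) z := by
  have h1 : ContDiffAt ℝ ∞ (fun w => (ρ i w : ℂ)) z :=
    Complex.ofRealCLM.contDiff.contDiffAt.comp z (hρ.smooth i z hz)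
  simp only [divLoc, div_eq_mul_inv]
  exact (ContDiffAt.sum fun a _ => contDiffAt_dz a
    (h1.mul (contDiffAt_pi.1 (hζ.smooth i z hz) a))).mul
      (h1.inv (by exact_mod_cast (hρ.pos i z hz).ne'))

variable [MeasurableSpace X] [BorelSpace X] {ρ : ι → (Fin n → ℂ) → ℝ}

theorem dirD_eq_zero {x : X} (h : p =ᶠ[nhds x] fun _ => 0) : dirD A ζ p x = 0 := by
  rw [dirD]
  refine Finset.sum_eq_zero fun a _ => ?_
  have hx := A.mem_indexAt x
  have : A.loc (A.indexAt x) p =ᶠ[nhds (A.chart (A.indexAt x) x)] fun _ => 0 := by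
    have hc := (A.chart (A.indexAt x)).continuousAt_symm ((A.chart _).map_source hx)
    rw [ContinuousAt, (A.chart _).left_inv hx] at hc
    exact hc.eventually h
  rw [dz_congr this, dz_const, mul_zero]

/-- The chart is any one that contains the support. Comparing the right-hand sides for two charts is
what later shows that the divergence does not depend on the chart. -/
theorem integral_dirD_cutoff [T2Space X] (hρ : IsSmoothDensity A ρ) (hζ : IsVectorField A ζ)
    (hp : A.IsSmooth p) {i : ι} {C : Set X} (hC : IsCompact C) (hCs : C ⊆ (A.chart i).source)
    (h0 : ∀ x ∉ C, p x = 0) :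
    ∫ x, dirD A ζ p x ∂(volumeFormMeasure A ρ) =
      -∫ z in (A.chart i).target, (2 ^ n * ρ i z) • (A.loc i p z * divLoc ρ ζ i z) := by
  have ht := (A.chart i).open_target
  set K := A.chart i '' C
  have hK : IsCompact K := hC.image_of_continuousOn ((A.chart i).continuousOn.mono hCs)
  have hKt : K ⊆ (A.chart i).target := by
    rintro _ ⟨x, hx, rfl⟩
    exact (A.chart i).map_source (hCs hx)
  have hloc0 : ∀ z ∈ (A.chart i).target, z ∉ K → A.loc i p z = 0 := fun z hz hzK =>
    h0 _ fun h => hzK ⟨_, h, (A.chart i).right_inv hz⟩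
  have hdz0 : ∀ a, ∀ z ∈ (A.chart i).target, z ∉ K → dz a (A.loc i p) z = 0 := by
    intro a z hz hzK
    have : A.loc i p =ᶠ[nhds z] fun _ => 0 := by
      filter_upwards [ht.mem_nhds hz, hK.isClosed.isOpen_compl.mem_nhds hzK] with w hw hwK
      exact hloc0 w hw hwK
    rw [dz_congr this, dz_const]
  have hρs : ∀ z ∈ (A.chart i).target, ContDiffAt ℝ ∞ (fun w => (ρ i w : ℂ)) z := fun z hz =>
    Complex.ofRealCLM.contDiff.contDiffAt.comp z (hρ.smooth i z hz)
  have hR : ∀ a, ∀ z ∈ (A.chart i).target,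
      ContDiffAt ℝ ∞ (fun w => (ρ i w : ℂ) * ζ i w a) z := fun a z hz =>
    (hρs z hz).mul (contDiffAt_pi.1 (hζ.smooth i z hz) a)
  rw [integral_eq_chart hρ.toIsDensity (i := i)
    (isSmooth_dirD hζ hp).continuous.aestronglyMeasurable ?_]
  · have e1 : ∫ z in (A.chart i).target, (2 ^ n * ρ i z) • A.loc i (dirD A ζ p) z =
        ∫ z in (A.chart i).target, ∑ a, 2 ^ n * (dz a (A.loc i p) z * ((ρ i z : ℂ) * ζ i z a)) := by
      refine setIntegral_congr_fun ht.measurableSet fun z hz => ?_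
      simp only [loc_dirD hζ hp hz, Complex.real_smul, Finset.mul_sum]
      refine Finset.sum_congr rfl fun a _ => ?_
      push_cast
      ring
    have e2 : ∫ z in (A.chart i).target, (2 ^ n * ρ i z) • (A.loc i p z * divLoc ρ ζ i z) =
        ∫ z in (A.chart i).target, ∑ a,
          2 ^ n * (A.loc i p z * dz a (fun w => (ρ i w : ℂ) * ζ i w a) z) := by
      refine setIntegral_congr_fun ht.measurableSet fun z hz => ?_
      have hne : (ρ i z : ℂ) ≠ 0 := by exact_mod_cast (hρ.pos i z hz).ne'
      simp only [divLoc, Complex.real_smul]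
      rw [← Finset.mul_sum, ← Finset.mul_sum]
      push_cast
      field_simp
    have i1 : ∀ a, IntegrableOn (fun z => dz a (A.loc i p) z * ((ρ i z : ℂ) * ζ i z a))
        (A.chart i).target := fun a =>
      integrableOn_of_zero_off_compact ht (fun z hz => ((contDiffAt_dz a (hp i z hz)).mul
        (hR a z hz)).continuousAt.continuousWithinAt) hK hKt
        (fun z hz hzK => by rw [hdz0 a z hz hzK, zero_mul])
    have i2 : ∀ a, IntegrableOn (fun z => A.loc i p z * dz a (fun w => (ρ i w : ℂ) * ζ i w a) z)
        (A.chart i).target := fun a =>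
      integrableOn_of_zero_off_compact ht (fun z hz => ((hp i z hz).mul
        (contDiffAt_dz a (hR a z hz))).continuousAt.continuousWithinAt) hK hKt
        (fun z hz hzK => by rw [hloc0 z hz hzK, zero_mul])
    rw [e1, e2, integral_finsetSum _ fun a _ => (i1 a).const_mul _,
      integral_finsetSum _ fun a _ => (i2 a).const_mul _, ← Finset.sum_neg_distrib]
    refine Finset.sum_congr rfl fun a _ => ?_
    rw [integral_const_mul, integral_const_mul, ← mul_neg]
    congr 1
    rw [eq_neg_iff_add_eq_zero, ← integral_add (i1 a) (i2 a)]
    -- The two integrands add up to `∂_a (p ρ ζ^a)`, which has compact support in the chart.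
    rw [← setIntegral_dz_eq_zero ht (f := fun w => A.loc i p w * ((ρ i w : ℂ) * ζ i w a))
      (fun z hz => (hp i z hz).mul (hR a z hz)) hK hKt
      (fun z hz hzK => by rw [hloc0 z hz hzK, zero_mul]) a]
    refine setIntegral_congr_fun ht.measurableSet fun z hz => ?_
    exact (dz_mul a ((hp i z hz).differentiableAt (by simp))
      ((hR a z hz).differentiableAt (by simp))).symm
  · intro x hx
    apply dirD_eq_zero
    filter_upwards [hC.isClosed.isOpen_compl.mem_nhds fun h => hx (hCs h)] with y hy
    exact h0 y hy

/-- Proved by duality instead of differentiating Jacobians: for a test function supported in the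
overlap, the integral of its derivative along `ζ` can be integrated by parts in either chart, so the
two local divergences have the same integral against every test function. -/
theorem divLoc_trans [T2Space X] (hρ : IsSmoothDensity A ρ) (hζ : IsVectorField A ζ) {i j : ι}
    {z : Fin n → ℂ} (hz : z ∈ A.overlap i j) :
    divLoc ρ ζ i z = divLoc ρ ζ j (A.trans i j z) := by
  have hO := CoordCover.isOpen_overlap (A := A) i j
  have hc : ContinuousOn (fun z => (ρ i z : ℂ) *
      (divLoc ρ ζ i z - divLoc ρ ζ j (A.trans i j z))) (A.overlap i j) := by
    intro z hz
    have h1 := (contDiffAt_divLoc hρ hζ (CoordCover.mem_overlap.1 hz).1).continuousAt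
    have h2 := (contDiffAt_divLoc hρ hζ (CoordCover.trans_mem hz)).continuousAt
    have h3 := (CoordCover.contDiffAt_trans_real hz).continuousAt
    have h4 := (hρ.smooth i z (CoordCover.mem_overlap.1 hz).1).continuousAt
    have h5 : ContinuousAt (fun z => divLoc ρ ζ j (A.trans i j z)) z :=
      ContinuousAt.comp (f := A.trans i j) (g := fun w => divLoc ρ ζ j w) h2 h3
    exact ((Complex.continuous_ofReal.continuousAt.comp h4).mul (h1.sub h5)).continuousWithinAt
  have key : ∀ᵐ z ∂volume, z ∈ A.overlap i j → (ρ i z : ℂ) *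
      (divLoc ρ ζ i z - divLoc ρ ζ j (A.trans i j z)) = 0 := by
    refine hO.ae_eq_zero_of_integral_contDiff_smul_eq_zero
      (hc.locallyIntegrableOn hO.measurableSet) fun g hg hgc hgs => ?_
    have hgt : tsupport g ⊆ (A.chart i).target := fun z hz => (CoordCover.mem_overlap.1 (hgs hz)).1
    have hgz : ∀ z ∉ tsupport g, g z = 0 := fun z hz => image_eq_zero_of_notMem_tsupport hz
    set p : X → ℂ := fun x => ((A.ext i g x : ℝ) : ℂ)
    set C := (A.chart i).symm '' tsupport g
    have hC : IsCompact C := isCompact_symm_image hgc hgt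
    have hCi : C ⊆ (A.chart i).source := symm_image_subset hgt
    have hCj : C ⊆ (A.chart j).source := by
      rintro _ ⟨z, hz, rfl⟩
      exact (CoordCover.mem_overlap.1 (hgs hz)).2
    have hp : A.IsSmooth p :=
      (isSmooth_ext hgc hgt hgz fun z _ => hg.contDiffAt).ofReal
    have hp0 : ∀ x ∉ C, p x = 0 := fun x hx => by simp [p, ext_eq_zero hgz hx]
    have hint : ∀ k, C ⊆ (A.chart k).source → Integrable
        (fun x => p x * divLoc ρ ζ k (A.chart k x)) (volumeFormMeasure A ρ) ∧
        ∫ x, dirD A ζ p x ∂(volumeFormMeasure A ρ) =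
          -∫ x, p x * divLoc ρ ζ k (A.chart k x) ∂(volumeFormMeasure A ρ) := by
      intro k hk
      have hcon : ContinuousOn (fun x => p x * divLoc ρ ζ k (A.chart k x)) C := by
        intro x hx
        have h1 : ContinuousAt (fun x => divLoc ρ ζ k (A.chart k x)) x :=
          ContinuousAt.comp (g := fun w => divLoc ρ ζ k w)
            (contDiffAt_divLoc hρ hζ ((A.chart k).map_source (hk hx))).continuousAt
            ((A.chart k).continuousAt (hk hx))
        exact (hp.continuous.continuousAt.mul h1).continuousWithinAt
      have hI : Integrable (fun x => p x * divLoc ρ ζ k (A.chart k x))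
          (volumeFormMeasure A ρ) := by
        have h1 : IntegrableOn (fun x => p x * divLoc ρ ζ k (A.chart k x)) C
            (volumeFormMeasure A ρ) := by
          have : IsFiniteMeasure ((volumeFormMeasure A ρ).restrict C) := ⟨by
            rw [Measure.restrict_apply_univ]
            exact volumeFormMeasure_compact_lt_top hρ.toIsDensity hC hC.measurableSet hk⟩
          obtain ⟨B, hB⟩ := hC.exists_bound_of_continuousOn hcon
          refine Integrable.of_bound (hcon.aestronglyMeasurable_of_isCompact hC hC.measurableSet)
            B ?_
          filter_upwards [ae_restrict_mem hC.measurableSet] with x hx using hB x hx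
        refine (integrableOn_iff_integrable_of_support_subset fun x hx => ?_).1 h1
        by_contra hxC
        exact hx (by simp [hp0 x hxC])
      refine ⟨hI, ?_⟩
      rw [integral_dirD_cutoff hρ hζ hp hC hk hp0, integral_eq_chart hρ.toIsDensity (i := k)
        hI.aestronglyMeasurable fun x hx => by rw [hp0 x fun h => hx (hk h), zero_mul]]
      congr 1
      refine setIntegral_congr_fun (A.chart k).open_target.measurableSet fun z hz => ?_
      simp only [CoordCover.loc, (A.chart k).right_inv hz]
    obtain ⟨hI1, h1⟩ := hint i hCi
    obtain ⟨hI2, h2⟩ := hint j hCj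
    have h3 : ∫ x, p x * divLoc ρ ζ i (A.chart i x) - p x * divLoc ρ ζ j (A.chart j x)
        ∂(volumeFormMeasure A ρ) = 0 := by
      rw [integral_sub hI1 hI2, sub_eq_zero]
      exact neg_injective (h1.symm.trans h2)
    rw [integral_eq_chart hρ.toIsDensity (i := i) (F := fun x =>
        p x * divLoc ρ ζ i (A.chart i x) - p x * divLoc ρ ζ j (A.chart j x))
      (hI1.sub hI2).aestronglyMeasurable fun x hx => by rw [hp0 x fun h => hx (hCi h)]; simp] at h3
    have h4 : (2 ^ n : ℂ) * ∫ z, g z • ((ρ i z : ℂ) *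
        (divLoc ρ ζ i z - divLoc ρ ζ j (A.trans i j z))) = 0 := by
      rw [← h3, ← integral_const_mul, ← setIntegral_eq_integral_of_forall_compl_eq_zero
        (s := (A.chart i).target) fun z hz => by simp [hgz z fun h => hz (hgt h)]]
      refine setIntegral_congr_fun (A.chart i).open_target.measurableSet fun z hz => ?_
      have h5 : p ((A.chart i).symm z) = g z := by
        simpa [p, CoordCover.loc] using loc_ext (A := A) g hz
      simp only [CoordCover.loc, (A.chart i).right_inv hz, h5, Complex.real_smul,
        CoordCover.trans]
      push_cast
      ring
    exact (mul_eq_zero.1 h4).resolve_left (by positivity)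
  -- Both divergences are continuous, so almost everywhere equality on the open overlap is equality
  -- everywhere there.
  have h6 := (Measure.eqOn_open_of_ae_eq ((ae_restrict_iff' hO.measurableSet).2 key) hO hc
    continuousOn_const) hz
  simp only [mul_eq_zero, Complex.ofReal_eq_zero, sub_eq_zero] at h6
  exact h6.resolve_left (hρ.pos i z (CoordCover.mem_overlap.1 hz).1).ne'

theorem divX_eq [T2Space X] (hρ : IsSmoothDensity A ρ) (hζ : IsVectorField A ζ) {i : ι} {x : X}
    (hx : x ∈ (A.chart i).source) : divX A ρ ζ x = divLoc ρ ζ i (A.chart i x) := by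
  rw [divLoc_trans hρ hζ (CoordCover.chart_mem_overlap hx (A.mem_indexAt x)),
    CoordCover.trans_chart hx, divX]

theorem loc_divX [T2Space X] (hρ : IsSmoothDensity A ρ) (hζ : IsVectorField A ζ) {i : ι}
    {z : Fin n → ℂ} (hz : z ∈ (A.chart i).target) : A.loc i (divX A ρ ζ) z = divLoc ρ ζ i z := by
  rw [CoordCover.loc, divX_eq hρ hζ ((A.chart i).map_target hz), (A.chart i).right_inv hz]

theorem isSmooth_divX [T2Space X] (hρ : IsSmoothDensity A ρ) (hζ : IsVectorField A ζ) :
    A.IsSmooth (divX A ρ ζ) := by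
  intro i z hz
  refine (contDiffAt_divLoc hρ hζ hz).congr_of_eventuallyEq ?_
  filter_upwards [(A.chart i).open_target.mem_nhds hz] with w hw
  exact loc_divX hρ hζ hw

variable [T2Space X] [CompactSpace X]

theorem integrable_of_continuous (hρ : IsDensity A ρ) {f : X → ℂ} (hf : Continuous f) :
    Integrable f (volumeFormMeasure A ρ) := by
  have := isFiniteMeasure_volumeForm hρ
  obtain ⟨B, hB⟩ := isCompact_univ.exists_bound_of_continuousOn hf.continuousOn
  exact Integrable.of_bound hf.aestronglyMeasurable B
    (Filter.Eventually.of_forall fun x => hB x (mem_univ x))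

theorem dirD_sum {κ : Type*} {s : Finset κ} {f : κ → X → ℂ}
    (hf : ∀ k, A.IsSmooth (f k)) (x : X) :
    dirD A ζ (fun x => ∑ k ∈ s, f k x) x = ∑ k ∈ s, dirD A ζ (f k) x := by
  simp only [dirD]
  rw [Finset.sum_comm]
  refine Finset.sum_congr rfl fun a _ => ?_
  rw [← Finset.mul_sum, ← dz_sum]
  · rfl
  · exact fun k _ => (hf k _ _ ((A.chart _).map_source (A.mem_indexAt x))).differentiableAt
      (by simp)

/-- The function `p` is cut into pieces `η k ^ 2 * p`, each supported in one chart, where the local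
formula applies. -/
theorem integral_mul_divX (hρ : IsSmoothDensity A ρ) (hζ : IsVectorField A ζ)
    (hp : A.IsSmooth p) : ∫ x, p x * divX A ρ ζ x ∂(volumeFormMeasure A ρ) =
      -∫ x, dirD A ζ p x ∂(volumeFormMeasure A ρ) := by
  obtain ⟨K, η, C, hη, -, hsum⟩ := exists_sq_partition A (N := fun _ => univ) (by simp)
  set q : X → X → ℂ := fun k x => ((η k x ^ 2 : ℝ) : ℂ) * p x
  have hq : ∀ k, A.IsSmooth (q k) := fun k =>
    CoordCover.IsSmooth.mul (CoordCover.IsSmooth.ofReal fun i z hz =>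
      ((hη k).smooth i z hz).pow 2) hp
  have hq0 : ∀ k, ∀ x ∉ C k, q k x = 0 := fun k x hx => by simp [q, (hη k).zero x hx]
  have hpq : p = fun x => ∑ k ∈ K, q k x := by
    ext x
    simp only [q]
    rw [← Finset.sum_mul, ← Complex.ofReal_sum, hsum, Complex.ofReal_one, one_mul]
  conv_lhs => rw [hpq]
  conv_rhs => rw [hpq]
  simp only [Finset.sum_mul, dirD_sum hq]
  have hdc := (isSmooth_divX hρ hζ).continuous
  have hi : ∀ k, Integrable (fun x => q k x * divX A ρ ζ x) (volumeFormMeasure A ρ) := fun k =>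
    integrable_of_continuous hρ.toIsDensity ((hq k).continuous.mul hdc)
  rw [integral_finsetSum _ fun k _ => hi k, integral_finsetSum _ fun k _ =>
      integrable_of_continuous hρ.toIsDensity (isSmooth_dirD hζ (hq k)).continuous,
    ← Finset.sum_neg_distrib]
  refine Finset.sum_congr rfl fun k _ => ?_
  rw [integral_dirD_cutoff hρ hζ (hq k) (hη k).compact (hη k).subset (hq0 k), neg_neg,
    integral_eq_chart hρ.toIsDensity (i := A.indexAt k)
      (hi k).aestronglyMeasurable
      fun x hx => by rw [hq0 k x fun h => hx ((hη k).subset h), zero_mul]]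
  refine setIntegral_congr_fun (A.chart _).open_target.measurableSet fun z hz => ?_
  rw [← loc_divX hρ hζ hz]
  rfl

theorem integral_divX (hρ : IsSmoothDensity A ρ) (hζ : IsVectorField A ζ) :
    ∫ x, divX A ρ ζ x ∂(volumeFormMeasure A ρ) = 0 := by
  have h := integral_mul_divX hρ hζ (p := fun _ => 1) (isSmooth_const 1)
  simp only [one_mul] at h
  rw [h]
  have : ∀ x, dirD A ζ (fun _ => 1) x = 0 := fun x => by
    rw [dirD]
    exact Finset.sum_eq_zero fun a _ => by
      rw [show A.loc (A.indexAt x) (fun _ : X => (1 : ℂ)) = fun _ => 1 from rfl, dz_const, mul_zero]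
  simp [this]

end

end

/-! ### Kähler metrics, gradients and the weighted ∂̄-Laplacian. -/

section

variable {n : ℕ}
variable {X : Type*} [TopologicalSpace X] [ChartedSpace (Fin n → ℂ) X] {ι : Type*}
  {A : CoordCover n X ι}

open ComplexConjugate Matrix

/-! ### Matrix lemmas -/

/-- With `Y = Gᵀ M` symmetric and `P = (Gᵀ)⁻¹`, the sum is the trace of `P (Y Pᵀ Yᴴ)`, a product of
two positive semidefinite matrices. Symmetry of `Y` is used to replace the entrywise conjugate of
`Y` by `Yᴴ`. In the Bochner formula `M` is the matrix of ∂̄-derivatives of a gradient. -/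
theorem re_sum_conj_mul_nonneg {G M : Matrix (Fin n) (Fin n) ℂ} (hG : G.PosDef)
    (hS : (Gᵀ * M)ᵀ = Gᵀ * M) : 0 ≤ (∑ a, ∑ b, conj (M b a) * M a b).re := by
  set Y := Gᵀ * M
  set P := (Gᵀ)⁻¹
  have hP : P.PosDef := hG.transpose.inv
  have hM : M = P * Y := by
    rw [← Matrix.mul_assoc, Matrix.nonsing_inv_mul _ ((Matrix.isUnit_iff_isUnit_det _).1
      hG.transpose.isUnit), Matrix.one_mul]
  have hMc : M.map conj = Pᵀ * Yᴴ := by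
    have h1 : M.map conj = (Mᴴ)ᵀ := by ext; simp
    rw [h1, hM, Matrix.conjTranspose_mul, hP.isHermitian.eq, Matrix.transpose_mul]
    congr 1
    ext a b
    have := congrFun (congrFun hS a) b
    rw [Matrix.transpose_apply] at this
    simp [this]
  have htr : ∑ a, ∑ b, conj (M b a) * M a b = Matrix.trace (M * M.map conj) := by
    simp only [Matrix.trace, Matrix.diag_apply, Matrix.mul_apply, Matrix.map_apply]
    exact Finset.sum_congr rfl fun a _ => Finset.sum_congr rfl fun b _ => mul_comm _ _
  obtain ⟨m, v, hv⟩ := Matrix.posSemidef_iff_eq_sum_vecMulVec.1 hP.posSemidef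
  have hN := hP.posSemidef.transpose.mul_mul_conjTranspose_same Y
  rw [htr, hMc]
  nth_rw 1 [hM]
  nth_rw 1 [hv]
  have : (∑ i, Matrix.vecMulVec (v i) (star (v i))) * Y * (Pᵀ * Yᴴ) =
      (∑ i, Matrix.vecMulVec (v i) (star (v i))) * (Y * Pᵀ * Yᴴ) := by
    simp only [Matrix.mul_assoc]
  rw [this, Finset.sum_mul, Matrix.trace_sum, Complex.re_sum]
  refine Finset.sum_nonneg fun i _ => ?_
  rw [Matrix.vecMulVec_mul, Matrix.trace_vecMulVec, dotProduct_comm, ← Matrix.dotProduct_mulVec]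
  exact (Complex.le_def.1 (hN.dotProduct_mulVec_nonneg (v i))).1

theorem contDiffAt_det {E : Type*} [NormedAddCommGroup E] [NormedSpace ℝ E] {m : ℕ}
    {M : E → Matrix (Fin m) (Fin m) ℂ} {z : E}
    (hM : ∀ a b, ContDiffAt ℝ ∞ (fun w => M w a b) z) :
    ContDiffAt ℝ ∞ (fun w => (M w).det) z := by
  simp only [Matrix.det_apply]
  exact ContDiffAt.sum fun σ _ => (contDiffAt_prod fun a _ => hM _ _).const_smul _

theorem contDiffAt_inv_entry {E : Type*} [NormedAddCommGroup E] [NormedSpace ℝ E] {m : ℕ}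
    {M : E → Matrix (Fin m) (Fin m) ℂ} {z : E}
    (hM : ∀ a b, ContDiffAt ℝ ∞ (fun w => M w a b) z) (hz : (M z).det ≠ 0) (a b : Fin m) :
    ContDiffAt ℝ ∞ (fun w => (M w)⁻¹ a b) z := by
  simp only [Matrix.inv_def, Matrix.smul_apply, Ring.inverse_eq_inv', smul_eq_mul,
    Matrix.adjugate_apply]
  refine ((contDiffAt_det hM).inv hz).mul (contDiffAt_det fun c d => ?_)
  by_cases h : c = b
  · subst h; simpa using contDiffAt_const
  · simpa [Matrix.updateRow_ne h] using hM c d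

theorem PosDef.det_ne_zero {G : Matrix (Fin n) (Fin n) ℂ} (hG : G.PosDef) : G.det ≠ 0 :=
  hG.det_pos.ne'

/-! ### Kähler metrics in coordinates -/

/-- The Jacobian matrix of the coordinate change. -/
def jacM (A : CoordCover n X ι) (i j : ι) (z : Fin n → ℂ) : Matrix (Fin n) (Fin n) ℂ :=
  Matrix.of fun c a => fderiv ℂ (A.trans i j) z (Pi.single a 1) c

theorem jacM_mulVec (i j : ι) (z v : Fin n → ℂ) :
    jacM A i j z *ᵥ v = fderiv ℂ (A.trans i j) z v := by
  ext c
  rw [← sum_mul_map_single]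
  simp only [Matrix.mulVec, dotProduct, jacM, Matrix.of_apply]
  exact Finset.sum_congr rfl fun a _ => mul_comm _ _

theorem jacM_det (i j : ι) (z : Fin n → ℂ) :
    (jacM A i j z).det = (fderiv ℂ (A.trans i j) z).det := by
  rw [ContinuousLinearMap.det, ← LinearMap.det_toMatrix']
  congr 1

theorem jacM_det_ne_zero [IsManifold 𝓘(ℂ, Fin n → ℂ) ω X] {i j : ι} {z : Fin n → ℂ}
    (hz : z ∈ A.overlap i j) : (jacM A i j z).det ≠ 0 := by
  rw [jacM_det]
  obtain ⟨h1, h2⟩ := CoordCover.mem_overlap.1 hz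
  have := (canonicalBundle A).ne_zero i j _ ⟨(A.chart i).map_target h1, h2⟩
  simpa only [canonicalBundle, CoordCover.jac, (A.chart i).right_inv h1] using this

/-- The coefficient matrices, in the charts, of a Kähler metric. -/
structure IsKahler (A : CoordCover n X ι) (g : ι → (Fin n → ℂ) → Matrix (Fin n) (Fin n) ℂ) :
    Prop where
  smooth : ∀ i, ∀ z ∈ (A.chart i).target, ∀ a b, ContDiffAt ℝ ∞ (fun w => g i w a b) z
  posDef : ∀ i, ∀ z ∈ (A.chart i).target, (g i z).PosDef
  trans : ∀ i j, ∀ z ∈ A.overlap i j,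
    g i z = (jacM A i j z)ᵀ * g j (A.trans i j z) * (jacM A i j z).map conj
  closed : ∀ i, ∀ z ∈ (A.chart i).target, ∀ a b c,
    dz c (fun w => g i w a b) z = dz a (fun w => g i w c b) z

/-- The components `∑ b, g^{a b̄} ∂_{b̄} u` of the gradient of type `(1,0)`. -/
def gradV (A : CoordCover n X ι) (g : ι → (Fin n → ℂ) → Matrix (Fin n) (Fin n) ℂ) (u : X → ℂ)
    (i : ι) (z : Fin n → ℂ) : Fin n → ℂ :=
  ((g i z)⁻¹)ᵀ *ᵥ fun b => dzbar b (A.loc i u) z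

theorem dzbar_loc_trans [IsManifold 𝓘(ℂ, Fin n → ℂ) ω X] {u : X → ℂ} (hu : A.IsSmooth u)
    {i j : ι} {z : Fin n → ℂ} (hz : z ∈ A.overlap i j) :
    (fun b => dzbar b (A.loc i u) z) =
      (jacM A i j z)ᴴ *ᵥ fun b => dzbar b (A.loc j u) (A.trans i j z) := by
  ext b
  rw [dzbar_congr (CoordCover.loc_eventuallyEq u hz), dzbar_comp_holomorphic
    (CoordCover.hasFDerivAt_trans hz)
    ((hu j _ (CoordCover.trans_mem hz)).differentiableAt (by simp))]
  rfl

variable {g : ι → (Fin n → ℂ) → Matrix (Fin n) (Fin n) ℂ} {u : X → ℂ}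

/-- The conjugate Jacobian produced by `∂̄u` cancels against the one in the inverse metric, and only
the holomorphic Jacobian is left. -/
theorem isVectorField_gradV [IsManifold 𝓘(ℂ, Fin n → ℂ) ω X] (hg : IsKahler A g)
    (hu : A.IsSmooth u) : IsVectorField A (gradV A g u) where
  smooth i z hz := by
    rw [contDiffAt_pi]
    intro a
    simp only [gradV, Matrix.mulVec, dotProduct, Matrix.transpose_apply]
    exact ContDiffAt.sum fun b _ => (contDiffAt_inv_entry (hg.smooth i z hz)
      (PosDef.det_ne_zero (hg.posDef i z hz)) _ _).mul (contDiffAt_dzbar b (hu i z hz))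
  trans i j z hz := by
    have hJ : IsUnit (jacM A i j z).det := (jacM_det_ne_zero hz).isUnit
    have hJH : IsUnit ((jacM A i j z)ᴴ).det := by
      rw [Matrix.det_conjTranspose]; exact hJ.star
    rw [← jacM_mulVec, gradV, gradV, dzbar_loc_trans hu hz, hg.trans i j z hz,
      Matrix.mul_inv_rev, Matrix.mul_inv_rev, Matrix.transpose_mul, Matrix.transpose_mul,
      Matrix.transpose_nonsing_inv, Matrix.transpose_nonsing_inv, Matrix.transpose_nonsing_inv,
      Matrix.transpose_transpose]
    have hc : ((jacM A i j z).map conj)ᵀ = (jacM A i j z)ᴴ := by ext; simp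
    rw [hc, Matrix.mulVec_mulVec, Matrix.mulVec_mulVec, Matrix.mul_assoc, Matrix.mul_assoc,
      Matrix.nonsing_inv_mul _ hJH, Matrix.mul_one, ← Matrix.mul_assoc,
      Matrix.mul_nonsing_inv _ hJ, Matrix.one_mul]

theorem sum_metric_mul_gradV (hg : IsKahler A g) {i : ι} {z : Fin n → ℂ}
    (hz : z ∈ (A.chart i).target) (b : Fin n) :
    ∑ a, g i z a b * gradV A g u i z a = dzbar b (A.loc i u) z := by
  have h : (g i z)ᵀ *ᵥ gradV A g u i z = fun b => dzbar b (A.loc i u) z := by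
    rw [gradV, Matrix.mulVec_mulVec, ← Matrix.transpose_mul, Matrix.nonsing_inv_mul _
      (PosDef.det_ne_zero (hg.posDef i z hz)).isUnit, Matrix.transpose_one, Matrix.one_mulVec]
  exact congrFun h b

theorem sum_gradV_mul_conj {i : ι} {z : Fin n → ℂ} (v : X → ℂ) :
    ∑ a, gradV A g u i z a * dz a (A.loc i fun x => conj (v x)) z =
      star (fun b => dzbar b (A.loc i v) z) ⬝ᵥ (((g i z)⁻¹)ᵀ *ᵥ fun b => dzbar b (A.loc i u) z) := by
  simp only [dotProduct, Pi.star_apply]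
  refine Finset.sum_congr rfl fun a _ => ?_
  rw [mul_comm]
  congr 1
  exact dz_conj a _ z

/-- The pointwise square norm `|∂̄ u|²`. -/
def dbarSq (A : CoordCover n X ι) (g : ι → (Fin n → ℂ) → Matrix (Fin n) (Fin n) ℂ) (u : X → ℂ)
    (x : X) : ℝ := (dirD A (gradV A g u) (fun x => conj (u x)) x).re

section
variable [IsManifold 𝓘(ℂ, Fin n → ℂ) ω X]

theorem loc_dirD_gradV_conj (hg : IsKahler A g) (hu : A.IsSmooth u) {v : X → ℂ}
    (hv : A.IsSmooth v) {i : ι} {z : Fin n → ℂ} (hz : z ∈ (A.chart i).target) :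
    A.loc i (dirD A (gradV A g u) fun x => conj (v x)) z =
      star (fun b => dzbar b (A.loc i v) z) ⬝ᵥ (((g i z)⁻¹)ᵀ *ᵥ fun b => dzbar b (A.loc i u) z) := by
  rw [loc_dirD (isVectorField_gradV hg hu) hv.conj hz, sum_gradV_mul_conj]

theorem dirD_gradV_conj_nonneg (hg : IsKahler A g) (hu : A.IsSmooth u) (x : X) :
    0 ≤ dirD A (gradV A g u) (fun x => conj (u x)) x := by
  have hx := A.mem_indexAt x
  have h := loc_dirD_gradV_conj hg hu hu ((A.chart _).map_source hx)
  rw [CoordCover.loc, (A.chart _).left_inv hx] at h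
  rw [h]
  exact (hg.posDef _ _ ((A.chart _).map_source hx)).inv.transpose.posSemidef.dotProduct_mulVec_nonneg _

theorem ofReal_dbarSq (hg : IsKahler A g) (hu : A.IsSmooth u) (x : X) :
    (dbarSq A g u x : ℂ) = dirD A (gradV A g u) (fun x => conj (u x)) x := by
  have := (Complex.le_def.1 (dirD_gradV_conj_nonneg hg hu x)).2
  apply Complex.ext
  · simp [dbarSq]
  · simpa using this

theorem dbarSq_nonneg (hg : IsKahler A g) (hu : A.IsSmooth u) (x : X) : 0 ≤ dbarSq A g u x :=
  (Complex.le_def.1 (dirD_gradV_conj_nonneg hg hu x)).1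

theorem dirD_gradV_conj_symm (hg : IsKahler A g) (hu : A.IsSmooth u) {v : X → ℂ}
    (hv : A.IsSmooth v) (x : X) : conj (dirD A (gradV A g u) (fun x => conj (v x)) x) =
      dirD A (gradV A g v) (fun x => conj (u x)) x := by
  have hx := A.mem_indexAt x
  have ht := (A.chart _).map_source hx
  have h := loc_dirD_gradV_conj hg hu hv ht
  have h' := loc_dirD_gradV_conj hg hv hu ht
  rw [CoordCover.loc, (A.chart _).left_inv hx] at h h'
  rw [h, h']
  have hH := (hg.posDef _ _ ht).inv.transpose.isHermitian
  change star _ = _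
  rw [Matrix.star_dotProduct, star_star, Matrix.star_mulVec, hH.eq, dotProduct_mulVec]

/-- The Kähler operator `L u = -div (grad u)` with respect to a density. -/
def lapL (A : CoordCover n X ι) (ρ : ι → (Fin n → ℂ) → ℝ)
    (g : ι → (Fin n → ℂ) → Matrix (Fin n) (Fin n) ℂ) (u : X → ℂ) (x : X) : ℂ :=
  -divX A ρ (gradV A g u) x

variable [MeasurableSpace X] [BorelSpace X] [T2Space X] [CompactSpace X]
  {ρ : ι → (Fin n → ℂ) → ℝ}

theorem isSmooth_lapL (hρ : IsSmoothDensity A ρ) (hg : IsKahler A g) (hu : A.IsSmooth u) :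
    A.IsSmooth (lapL A ρ g u) := fun i z hz =>
  (isSmooth_divX hρ (isVectorField_gradV hg hu) i z hz).neg

theorem integral_mul_lapL (hρ : IsSmoothDensity A ρ) (hg : IsKahler A g) (hu : A.IsSmooth u)
    {p : X → ℂ} (hp : A.IsSmooth p) :
    ∫ x, p x * lapL A ρ g u x ∂(volumeFormMeasure A ρ) =
      ∫ x, dirD A (gradV A g u) p x ∂(volumeFormMeasure A ρ) := by
  simp only [lapL, mul_neg]
  rw [integral_neg, integral_mul_divX hρ (isVectorField_gradV hg hu) hp, neg_neg]

/-- Both sides are the integral of the Hermitian pairing of the gradients of `u` and `v`. -/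
theorem lapL_symm (hρ : IsSmoothDensity A ρ) (hg : IsKahler A g) (hu : A.IsSmooth u)
    {v : X → ℂ} (hv : A.IsSmooth v) :
    ∫ x, conj (v x) * lapL A ρ g u x ∂(volumeFormMeasure A ρ) =
      ∫ x, u x * conj (lapL A ρ g v x) ∂(volumeFormMeasure A ρ) := by
  rw [integral_mul_lapL hρ hg hu hv.conj]
  have h := integral_mul_lapL hρ hg hv hu.conj
  have h2 := congrArg conj h
  rw [← integral_conj, ← integral_conj] at h2
  simp only [map_mul, Complex.conj_conj, dirD_gradV_conj_symm hg hv hu] at h2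
  exact h2.symm

end

end

/-! ### The Bochner inequality. -/

section

variable {n : ℕ}
variable {X : Type*} [TopologicalSpace X] [ChartedSpace (Fin n → ℂ) X] {ι : Type*}
  {A : CoordCover n X ι}

open ComplexConjugate Matrix

/-- The divergence of `V` with respect to the weight `exp (-Φ)`. -/
def wdiv (Φ : (Fin n → ℂ) → ℂ) (V : (Fin n → ℂ) → (Fin n → ℂ)) (z : Fin n → ℂ) : ℂ :=
  ∑ a, (dz a (fun w => V w a) z - dz a Φ z * V z a)

/-- The derivative `∂̄_{V̄} V` of a vector field of type `(1,0)` in the direction of its conjugate. -/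
def barD (V : (Fin n → ℂ) → (Fin n → ℂ)) (z : Fin n → ℂ) (a : Fin n) : ℂ :=
  ∑ b, conj (V z b) * dzbar b (fun w => V w a) z

/-- The terms `conj V^b ∂_a ∂̄_b V^a` and the terms with a first derivative of `Φ` cancel; what
survives of the commutator of ∂̄ with the weighted divergence is a quadratic expression in `∂̄V` and
the Hessian of `Φ` in the direction `V`. -/
theorem wdiv_commutator {V : (Fin n → ℂ) → (Fin n → ℂ)} {Φ : (Fin n → ℂ) → ℂ} {z : Fin n → ℂ}
    (hV : ContDiffAt ℝ ∞ V z) (hΦ : ContDiffAt ℝ ∞ Φ z) :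
    -(∑ b, conj (V z b) * dzbar b (wdiv Φ V) z) + wdiv Φ (barD V) z =
      (∑ a, ∑ b, conj (dzbar a (fun w => V w b) z) * dzbar b (fun w => V w a) z) +
      ∑ a, ∑ b, dz a (dzbar b Φ) z * V z a * conj (V z b) := by
  have hVa : ∀ a, ContDiffAt ℝ ∞ (fun w => V w a) z := contDiffAt_pi.1 hV
  have hVc : ∀ a, ContDiffAt ℝ ∞ (fun w => conj (V w a)) z := fun a =>
    Complex.conjCLE.contDiff.contDiffAt.comp z (hVa a)
  have D : ∀ {f : (Fin n → ℂ) → ℂ}, ContDiffAt ℝ ∞ f z → DifferentiableAt ℝ f z := fun h =>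
    h.differentiableAt (by simp)
  have e1 : ∀ b, dzbar b (wdiv Φ V) z = ∑ a, (dz a (dzbar b fun w => V w a) z -
      (dz a (dzbar b Φ) z * V z a + dz a Φ z * dzbar b (fun w => V w a) z)) := by
    intro b
    unfold wdiv
    rw [dzbar_sum b _ fun a _ => D ((contDiffAt_dz a (hVa a)).sub
      ((contDiffAt_dz a hΦ).mul (hVa a)))]
    refine Finset.sum_congr rfl fun a _ => ?_
    rw [dzbar_sub b (D (contDiffAt_dz a (hVa a))) (D ((contDiffAt_dz a hΦ).mul (hVa a))),
      dzbar_mul b (D (contDiffAt_dz a hΦ)) (D (hVa a)), dz_dzbar_comm a (hVa a),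
      dz_dzbar_comm a hΦ]
  have e2 : ∀ a, dz a (fun w => barD V w a) z =
      ∑ b, (conj (dzbar a (fun w => V w b) z) * dzbar b (fun w => V w a) z +
        conj (V z b) * dz a (dzbar b fun w => V w a) z) := by
    intro a
    unfold barD
    rw [dz_sum a _ fun b _ => D ((hVc b).mul (contDiffAt_dzbar b (hVa a)))]
    refine Finset.sum_congr rfl fun b _ => ?_
    rw [dz_mul a (D (hVc b)) (D (contDiffAt_dzbar b (hVa a))), dz_conj]
  conv_lhs => enter [2]; unfold wdiv
  simp only [e1, e2]
  simp only [barD, Finset.mul_sum]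
  rw [Finset.sum_comm, ← Finset.sum_neg_distrib, ← Finset.sum_add_distrib,
    ← Finset.sum_add_distrib]
  refine Finset.sum_congr rfl fun a _ => ?_
  rw [← Finset.sum_neg_distrib, ← Finset.sum_sub_distrib, ← Finset.sum_add_distrib,
    ← Finset.sum_add_distrib]
  refine Finset.sum_congr rfl fun b _ => ?_
  ring

/-- The ∂̄-derivative of the components of a (1,0)-field is tensorial because the Jacobian matrix of
a coordinate change is holomorphic, so that no derivative of it appears. Knowing that this is a
field makes its divergence a global function with vanishing integral. -/
theorem isVectorField_barD [IsManifold 𝓘(ℂ, Fin n → ℂ) ω X]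
    {V : ι → (Fin n → ℂ) → (Fin n → ℂ)} (hV : IsVectorField A V) :
    IsVectorField A fun i => barD (V i) where
  smooth i z hz := by
    rw [contDiffAt_pi]
    have hVa : ∀ a, ContDiffAt ℝ ∞ (fun w => V i w a) z := contDiffAt_pi.1 (hV.smooth i z hz)
    intro a
    exact ContDiffAt.sum fun b _ => (Complex.conjCLE.contDiff.contDiffAt.comp z (hVa b)).mul
      (contDiffAt_dzbar b (hVa a))
  trans i j z hz := by
    have hT := CoordCover.hasFDerivAt_trans hz
    have hzt := (CoordCover.mem_overlap.1 hz).1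
    have hVa : ∀ a, ContDiffAt ℝ ∞ (fun w => V i w a) z := contDiffAt_pi.1 (hV.smooth i z hzt)
    have hVj : ∀ a, ContDiffAt ℝ ∞ (fun w => V j w a) (A.trans i j z) :=
      contDiffAt_pi.1 (hV.smooth j _ (CoordCover.trans_mem hz))
    have hJ : ∀ a c, DifferentiableAt ℂ
        (fun w => fderiv ℂ (A.trans i j) w (Pi.single a 1) c) z := by
      intro a c
      have h1 : ContDiffAt ℂ 1 (fderiv ℂ (A.trans i j)) z :=
        (CoordCover.contDiffAt_trans hz).fderiv_right (by simp)
      have h2 : DifferentiableAt ℂ (fun w => fderiv ℂ (A.trans i j) w (Pi.single a 1)) z :=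
        (h1.differentiableAt (by simp)).clm_apply (by fun_prop)
      exact (differentiableAt_pi.1 h2) c
    have key : ∀ b c, ∑ d, conj (fderiv ℂ (A.trans i j) z (Pi.single b 1) d) *
        dzbar d (fun w => V j w c) (A.trans i j z) =
        ∑ a, dzbar b (fun w => V i w a) z * fderiv ℂ (A.trans i j) z (Pi.single a 1) c := by
      intro b c
      rw [← dzbar_comp_holomorphic hT ((hVj c).differentiableAt (by simp))]
      have hev : (fun w => V j (A.trans i j w) c) =ᶠ[nhds z]
          fun w => ∑ a, V i w a * fderiv ℂ (A.trans i j) w (Pi.single a 1) c := by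
        filter_upwards [(CoordCover.isOpen_overlap i j).mem_nhds hz] with w hw
        rw [sum_mul_map_single, hV.trans i j w hw]
      rw [dzbar_congr hev, dzbar_sum b _ fun a _ => ((hVa a).differentiableAt (by simp)).fun_mul
        ((hJ a c).restrictScalars ℝ)]
      refine Finset.sum_congr rfl fun a _ => ?_
      rw [dzbar_mul b ((hVa a).differentiableAt (by simp)) ((hJ a c).restrictScalars ℝ),
        dzbar_holomorphic (hJ a c), mul_zero, add_zero]
    ext c
    rw [← sum_mul_map_single]
    simp only [barD, hV.trans i j z hz]
    have e1 : ∀ d, conj (fderiv ℂ (A.trans i j) z (V i z) d) =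
        ∑ b, conj (V i z b) * conj (fderiv ℂ (A.trans i j) z (Pi.single b 1) d) := by
      intro d
      rw [← sum_mul_map_single, map_sum]
      simp only [map_mul]
    simp only [e1, Finset.sum_mul]
    rw [Finset.sum_comm]
    conv_rhs => rw [Finset.sum_comm]
    refine Finset.sum_congr rfl fun b _ => ?_
    have := congrArg (fun t => conj (V i z b) * t) (key b c)
    simp only [Finset.mul_sum] at this
    simpa only [mul_assoc] using this

theorem fderiv_ofReal {r : (Fin n → ℂ) → ℝ} {z : Fin n → ℂ} (hr : DifferentiableAt ℝ r z)
    (v : Fin n → ℂ) : fderiv ℝ (fun w => (r w : ℂ)) z v = (fderiv ℝ r z v : ℂ) := by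
  have h := Complex.ofRealCLM.hasFDerivAt.comp z hr.hasFDerivAt
  have h2 : fderiv ℝ (fun w => (r w : ℂ)) z = _ := h.fderiv
  rw [h2]
  rfl

theorem dz_neg_log {r : (Fin n → ℂ) → ℝ} {z : Fin n → ℂ} (hr : DifferentiableAt ℝ r z)
    (hz : 0 < r z) (a : Fin n) :
    dz a (fun w => (r w : ℂ)) z = -(r z : ℂ) * dz a (fun w => ((-Real.log (r w) : ℝ) : ℂ)) z := by
  have h1 : HasFDerivAt (fun w => -Real.log (r w)) (-((r z)⁻¹ • fderiv ℝ r z)) z :=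
    (hr.hasFDerivAt.log hz.ne').neg
  have hne : (r z : ℂ) ≠ 0 := by exact_mod_cast hz.ne'
  rw [dz, dz, fderiv_ofReal hr, fderiv_ofReal hr, fderiv_ofReal h1.differentiableAt,
    fderiv_ofReal h1.differentiableAt, h1.fderiv]
  simp only [_root_.neg_apply, _root_.smul_apply, smul_eq_mul]
  push_cast
  field_simp
  ring

variable {g : ι → (Fin n → ℂ) → Matrix (Fin n) (Fin n) ℂ} {u : X → ℂ}
  {ρ : ι → (Fin n → ℂ) → ℝ}

/-- The complexified weight `-log ρ`. -/
def cweight (ρ : ι → (Fin n → ℂ) → ℝ) (i : ι) (w : Fin n → ℂ) : ℂ := ((-Real.log (ρ i w) : ℝ) : ℂ)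

theorem contDiffAt_cweight (hρ : IsSmoothDensity A ρ) {i : ι} {z : Fin n → ℂ}
    (hz : z ∈ (A.chart i).target) : ContDiffAt ℝ ∞ (cweight ρ i) z :=
  Complex.ofRealCLM.contDiff.contDiffAt.comp z
    ((hρ.smooth i z hz).log (hρ.pos i z hz).ne').neg

/-- Puts the divergence in the form used by `wdiv_commutator`, with potential `Φ = -log ρ`. -/
theorem divLoc_eq_wdiv (hρ : IsSmoothDensity A ρ) {ζ : ι → (Fin n → ℂ) → (Fin n → ℂ)}
    (hζ : IsVectorField A ζ) {i : ι} {z : Fin n → ℂ} (hz : z ∈ (A.chart i).target) :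
    divLoc ρ ζ i z = wdiv (cweight ρ i) (ζ i) z := by
  have hr : DifferentiableAt ℝ (ρ i) z := (hρ.smooth i z hz).differentiableAt (by simp)
  have hrc : DifferentiableAt ℝ (fun w => (ρ i w : ℂ)) z :=
    Complex.ofRealCLM.differentiableAt.comp z hr
  have hne : (ρ i z : ℂ) ≠ 0 := by exact_mod_cast (hρ.pos i z hz).ne'
  rw [divLoc, wdiv, div_eq_iff hne, Finset.sum_mul]
  refine Finset.sum_congr rfl fun a _ => ?_
  rw [dz_mul a hrc ((contDiffAt_pi.1 (hζ.smooth i z hz) a).differentiableAt (by simp)),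
    dz_neg_log hr (hρ.pos i z hz)]
  unfold cweight
  ring

/-- Mixed second derivatives of the potential dominate the metric: `-i∂∂̄ log ρ ≥ ω`. -/
def CurvBound (A : CoordCover n X ι) (ρ : ι → (Fin n → ℂ) → ℝ)
    (g : ι → (Fin n → ℂ) → Matrix (Fin n) (Fin n) ℂ) : Prop :=
  ∀ i, ∀ z ∈ (A.chart i).target,
    (complexHessian (fun w => -Real.log (ρ i w)) z - g i z).PosSemidef

/-- The complex conjugate of the closedness condition, by Hermitian symmetry of the metric. -/
theorem dzbar_metric_symm (hg : IsKahler A g) {i : ι} {z : Fin n → ℂ}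
    (hz : z ∈ (A.chart i).target) (a b c : Fin n) :
    dzbar b (fun w => g i w a c) z = dzbar c (fun w => g i w a b) z := by
  have h : ∀ d, (fun w => g i w a d) =ᶠ[nhds z] fun w => conj (g i w d a) := by
    intro d
    filter_upwards [(A.chart i).open_target.mem_nhds hz] with w hw
    exact ((hg.posDef i w hw).isHermitian.apply a d).symm
  rw [dzbar_congr (h c), dzbar_congr (h b), dzbar_conj, dzbar_conj, hg.closed i z hz c a b]

variable [IsManifold 𝓘(ℂ, Fin n → ℂ) ω X]

/-- Differentiating `∑ a, g_{a c̄} V^a = ∂̄_c u` gives `∂̄_b ∂̄_c u` minus a term with `∂̄_b g_{a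
c̄}`. Both are symmetric in `b` and `c`, the second because the metric is Kähler. This supplies the
hypothesis of `re_sum_conj_mul_nonneg`. -/
theorem gradV_deriv_symm (hg : IsKahler A g) (hu : A.IsSmooth u) {i : ι} {z : Fin n → ℂ}
    (hz : z ∈ (A.chart i).target) (b c : Fin n) :
    ∑ a, g i z a c * dzbar b (fun w => gradV A g u i w a) z =
      ∑ a, g i z a b * dzbar c (fun w => gradV A g u i w a) z := by
  have hV : ∀ a, DifferentiableAt ℝ (fun w => gradV A g u i w a) z := fun a =>
    (contDiffAt_pi.1 ((isVectorField_gradV hg hu).smooth i z hz) a).differentiableAt (by simp)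
  have hG : ∀ a c, DifferentiableAt ℝ (fun w => g i w a c) z := fun a c =>
    (hg.smooth i z hz a c).differentiableAt (by simp)
  have key : ∀ b c, ∑ a, g i z a c * dzbar b (fun w => gradV A g u i w a) z =
      dzbar b (dzbar c (A.loc i u)) z -
        ∑ a, dzbar b (fun w => g i w a c) z * gradV A g u i z a := by
    intro b c
    have hev : dzbar c (A.loc i u) =ᶠ[nhds z] fun w => ∑ a, g i w a c * gradV A g u i w a := by
      filter_upwards [(A.chart i).open_target.mem_nhds hz] with w hw
      exact (sum_metric_mul_gradV hg hw c).symm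
    rw [dzbar_congr hev, dzbar_sum b _ fun a _ => (hG a c).fun_mul (hV a), ← Finset.sum_sub_distrib]
    refine Finset.sum_congr rfl fun a _ => ?_
    rw [dzbar_mul b (hG a c) (hV a)]
    ring
  rw [key b c, key c b, dzbar_dzbar_comm b (hu i z hz) c]
  congr 1
  exact Finset.sum_congr rfl fun a _ => by rw [dzbar_metric_symm hg hz a b c]

variable [MeasurableSpace X] [BorelSpace X] [T2Space X] [CompactSpace X]

/-- The Bochner formula before integration. The right-hand side equals the two terms of
`wdiv_commutator` for `V = grad u`: the quadratic term in `∂̄V` is nonnegative, and the Hessian of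
`-log ρ` dominates the metric, whose value on `V` is `|∂̄u|²`. -/
theorem dbarSq_le (hρ : IsSmoothDensity A ρ) (hg : IsKahler A g) (hc : CurvBound A ρ g)
    (hu : A.IsSmooth u) (x : X) : dbarSq A g u x ≤
      (conj (dirD A (gradV A g u) (fun x => conj (lapL A ρ g u x)) x) +
        divX A ρ (fun i => barD (gradV A g u i)) x).re := by
  have hx := A.mem_indexAt x
  set i := A.indexAt x
  set z := A.chart i x
  have hz : z ∈ (A.chart i).target := (A.chart i).map_source hx
  have hVf := isVectorField_gradV hg hu
  have hVz := hVf.smooth i z hz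
  have hsym : A.chart i x = z := rfl
  have h1 : conj (dirD A (gradV A g u) (fun x => conj (lapL A ρ g u x)) x) =
      -(∑ b, conj (gradV A g u i z b) * dzbar b (wdiv (cweight ρ i) (gradV A g u i)) z) := by
    rw [dirD_eq hVf (isSmooth_lapL hρ hg hu).conj hx, map_sum, ← Finset.sum_neg_distrib]
    refine Finset.sum_congr rfl fun b _ => ?_
    have e : dz b (A.loc i fun x => conj (lapL A ρ g u x)) z = _ :=
      dz_conj b (A.loc i (lapL A ρ g u)) z
    have hev : A.loc i (lapL A ρ g u) =ᶠ[nhds z]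
        fun w => -(wdiv (cweight ρ i) (gradV A g u i) w) := by
      filter_upwards [(A.chart i).open_target.mem_nhds hz] with w hw
      rw [← divLoc_eq_wdiv hρ hVf hw, ← loc_divX hρ hVf hw]
      rfl
    rw [hsym, map_mul, e, Complex.conj_conj, dzbar_congr hev, dzbar_neg, mul_neg]
  have h2 : divX A ρ (fun i => barD (gradV A g u i)) x =
      wdiv (cweight ρ i) (barD (gradV A g u i)) z := by
    rw [divX_eq hρ (isVectorField_barD hVf) hx, divLoc_eq_wdiv hρ (isVectorField_barD hVf) hz]
  have h3 := (sum_metric_mul_gradV (u := u) hg hz)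
  have h4 : dirD A (gradV A g u) (fun x => conj (u x)) x =
      star (star (gradV A g u i z)) ⬝ᵥ (g i z *ᵥ star (gradV A g u i z)) := by
    rw [dirD_eq hVf hu.conj hx, star_star, dotProduct]
    refine Finset.sum_congr rfl fun a _ => ?_
    have e : dz a (A.loc i fun x => conj (u x)) z = _ := dz_conj a (A.loc i u) z
    rw [hsym, e, ← h3 a, map_sum]
    congr 1
    refine Finset.sum_congr rfl fun b _ => ?_
    rw [map_mul]
    congr 1
    exact (hg.posDef i z hz).isHermitian.apply a b
  rw [h1, h2, wdiv_commutator hVz (contDiffAt_cweight hρ hz), Complex.add_re, dbarSq, h4]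
  have h5 := re_sum_conj_mul_nonneg (M := Matrix.of fun a b =>
    dzbar b (fun w => gradV A g u i w a) z) (hg.posDef i z hz) (by
      ext c b
      simp only [Matrix.transpose_apply, Matrix.mul_apply, Matrix.of_apply]
      exact (gradV_deriv_symm hg hu hz b c).symm)
  -- The matrix `g_{a b̄}` is contracted as `g_{a b̄} V^a conj V^b`, so in the form `star x ⬝ᵥ (M *ᵥ
  -- x)` the vector is the conjugate of the gradient.
  have h6 := (Complex.le_def.1 ((hc i z hz).dotProduct_mulVec_nonneg
    (star (gradV A g u i z)))).1
  rw [Matrix.sub_mulVec, dotProduct_sub, Complex.sub_re, Complex.zero_re] at h6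
  have h7 : star (star (gradV A g u i z)) ⬝ᵥ
      (complexHessian (fun w => -Real.log (ρ i w)) z *ᵥ star (gradV A g u i z)) =
      ∑ a, ∑ b, dz a (dzbar b (cweight ρ i)) z * gradV A g u i z a * conj (gradV A g u i z b) := by
    rw [star_star, dotProduct]
    refine Finset.sum_congr rfl fun a _ => ?_
    rw [Matrix.mulVec, dotProduct, Finset.mul_sum]
    refine Finset.sum_congr rfl fun b _ => ?_
    simp only [complexHessian, Matrix.of_apply, Pi.star_apply]
    change _ * (dz a (dzbar b (cweight ρ i)) z * _) = _
    rw [RCLike.star_def]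
    ring
  rw [h7] at h6
  simp only [Matrix.of_apply] at h5
  linarith

theorem continuous_dbarSq (hg : IsKahler A g) (hu : A.IsSmooth u) :
    Continuous (dbarSq A g u) :=
  Complex.continuous_re.comp (isSmooth_dirD (isVectorField_gradV hg hu) hu.conj).continuous

/-- The Bochner inequality. -/
theorem integral_dbarSq_le (hρ : IsSmoothDensity A ρ) (hg : IsKahler A g) (hc : CurvBound A ρ g)
    (hu : A.IsSmooth u) : ∫ x, dbarSq A g u x ∂(volumeFormMeasure A ρ) ≤
      ∫ x, ‖lapL A ρ g u x‖ ^ 2 ∂(volumeFormMeasure A ρ) := by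
  have hVf := isVectorField_gradV hg hu
  have hL := isSmooth_lapL hρ hg hu
  have hI1 : Integrable (fun x => conj (dirD A (gradV A g u)
      (fun x => conj (lapL A ρ g u x)) x)) (volumeFormMeasure A ρ) :=
    integrable_of_continuous hρ.toIsDensity
      (Complex.continuous_conj.comp (isSmooth_dirD hVf hL.conj).continuous)
  have hI2 : Integrable (divX A ρ fun i => barD (gradV A g u i)) (volumeFormMeasure A ρ) :=
    integrable_of_continuous hρ.toIsDensity (isSmooth_divX hρ (isVectorField_barD hVf)).continuous
  have hI3 : Integrable (dbarSq A g u) (volumeFormMeasure A ρ) :=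
    (integrable_of_continuous hρ.toIsDensity
      (isSmooth_dirD hVf hu.conj).continuous).re
  -- The divergence integrates to zero, and integration by parts turns the other term into the
  -- square norm of `Lu`.
  have h1 : ∫ x, conj (dirD A (gradV A g u) (fun x => conj (lapL A ρ g u x)) x) +
      divX A ρ (fun i => barD (gradV A g u i)) x ∂(volumeFormMeasure A ρ) =
      ((∫ x, ‖lapL A ρ g u x‖ ^ 2 ∂(volumeFormMeasure A ρ) : ℝ) : ℂ) := by
    rw [integral_add hI1 hI2, integral_divX hρ (isVectorField_barD hVf), add_zero, integral_conj,
      ← integral_mul_lapL hρ hg hu hL.conj, ← integral_conj, ← integral_complex_ofReal]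
    refine integral_congr_ae (Filter.Eventually.of_forall fun x => ?_)
    simp only [map_mul, Complex.conj_conj, Complex.ofReal_pow]
    rw [Complex.mul_conj']
  have h2 := congrArg Complex.re h1
  rw [Complex.ofReal_re] at h2
  rw [← h2]
  have h3 : ∫ x, (conj (dirD A (gradV A g u) (fun x => conj (lapL A ρ g u x)) x) +
      divX A ρ (fun i => barD (gradV A g u i)) x).re ∂(volumeFormMeasure A ρ) = _ :=
    integral_re (hI1.add hI2)
  refine le_trans ?_ h3.le
  exact integral_mono hI3 (hI1.add hI2).re fun x => dbarSq_le hρ hg hc hu x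

end

/-! ### The resolvent of `-Δ/4` on a Euclidean space, by Fourier multipliers. -/

section

variable {n : ℕ}

open SchwartzMap FourierTransform LineDeriv Laplacian

section Fourier
variable {W : Type*} [NormedAddCommGroup W] [InnerProductSpace ℝ W] [FiniteDimensional ℝ W]
  [MeasurableSpace W] [BorelSpace W]

theorem eLpNorm_fourier (f : 𝓢(W, ℂ)) :
    eLpNorm (𝓕 f : 𝓢(W, ℂ)) 2 volume = eLpNorm f 2 volume := by
  have h := norm_fourier_toL2_eq f
  rw [norm_toLp, norm_toLp] at h
  exact (ENNReal.toReal_eq_toReal_iff' ((𝓕 f : 𝓢(W, ℂ)).memLp 2 volume).eLpNorm_ne_top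
    (f.memLp 2 volume).eLpNorm_ne_top).1 h

/-- Plancherel's identity reduces the bound to a pointwise one for the symbol. -/
theorem eLpNorm_fourierMultiplier_le {g : W → ℂ} (hg : g.HasTemperateGrowth) {B : ℝ}
    (hB : ∀ x, ‖g x‖ ≤ B) (f : 𝓢(W, ℂ)) :
    eLpNorm (fourierMultiplierCLM ℂ g f) 2 volume ≤ ENNReal.ofReal B * eLpNorm f 2 volume := by
  rw [← eLpNorm_fourier (fourierMultiplierCLM ℂ g f), fourierMultiplierCLM_apply,
    FourierTransform.fourier_fourierInv_eq, ← eLpNorm_fourier f]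
  refine eLpNorm_le_mul_eLpNorm_of_ae_le_mul (Filter.Eventually.of_forall fun x => ?_) 2
  rw [smulLeftCLM_apply_apply hg, norm_smul]
  exact mul_le_mul_of_nonneg_right (hB x) (norm_nonneg _)

/-- The symbol of the resolvent of `-Δ / 4`. -/
def resolventSymbol (W : Type*) [NormedAddCommGroup W] (δ : ℝ) (ξ : W) : ℝ :=
  (Real.pi ^ 2 * ‖ξ‖ ^ 2 + δ)⁻¹

/-- Up to the factor `δ⁻¹` the symbol is a negative power of `1 + |·|²` composed with a dilation. -/
theorem hasTemperateGrowth_resolventSymbol {δ : ℝ} (hδ : 0 < δ) :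
    (resolventSymbol W δ).HasTemperateGrowth := by
  have h1 : (fun ξ : W => (1 + ‖(Real.pi / Real.sqrt δ) • ξ‖ ^ 2) ^ (-1 : ℝ)).HasTemperateGrowth :=
    (Function.hasTemperateGrowth_one_add_norm_sq_rpow W (-1)).comp
      (((Real.pi / Real.sqrt δ) • ContinuousLinearMap.id ℝ W).hasTemperateGrowth)
  have h2 : resolventSymbol W δ =
      (fun _ => δ⁻¹) * fun ξ : W => (1 + ‖(Real.pi / Real.sqrt δ) • ξ‖ ^ 2) ^ (-1 : ℝ) := by
    ext ξ
    simp only [resolventSymbol, Pi.mul_apply, Real.rpow_neg_one, ← mul_inv, norm_smul,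
      Real.norm_eq_abs, mul_pow, sq_abs, div_pow, Real.sq_sqrt hδ.le]
    congr 1
    field_simp
    ring
  rw [h2]
  exact Function.HasTemperateGrowth.mul (by fun_prop) h1

theorem hasTemperateGrowth_ofReal_comp {g : W → ℝ} (hg : g.HasTemperateGrowth) :
    (fun ξ => (g ξ : ℂ)).HasTemperateGrowth :=
  Complex.ofRealCLM.hasTemperateGrowth.comp hg

theorem lineDeriv_eq_multiplier (v : W) (f : 𝓢(W, ℂ)) : (∂_{v} f : 𝓢(W, ℂ)) =
    fourierMultiplierCLM ℂ (fun ξ => (2 * Real.pi * Complex.I : ℂ) * (inner ℝ ξ v : ℝ)) f := by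
  have hin : (inner ℝ · v : W → ℝ).HasTemperateGrowth := by fun_prop
  have hin' := hasTemperateGrowth_ofReal_comp hin
  have h := fourierMultiplierCLM_smul (F := ℂ) hin' (2 * Real.pi * Complex.I)
  rw [lineDeriv_eq_fourierMultiplierCLM, ← fourierMultiplierCLM_ofReal ℂ hin]
  exact (DFunLike.congr_fun h f).symm

theorem laplacian_eq_multiplier (f : 𝓢(W, ℂ)) : Δ f =
    fourierMultiplierCLM ℂ (fun ξ => (-(2 * Real.pi) ^ 2 : ℂ) * ((‖ξ‖ ^ 2 : ℝ) : ℂ)) f := by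
  have hn : (fun ξ : W => ‖ξ‖ ^ 2).HasTemperateGrowth := by fun_prop
  have h := fourierMultiplierCLM_smul (F := ℂ) (hasTemperateGrowth_ofReal_comp hn)
    (-(2 * Real.pi) ^ 2)
  rw [laplacian_eq_fourierMultiplierCLM, ← fourierMultiplierCLM_ofReal ℂ hn]
  refine Eq.trans ?_ (DFunLike.congr_fun h f).symm
  ext x
  simp

/-- The solution has Fourier transform `(π²|ξ|² + δ)⁻¹` times that of `f`; the factor 1/4 is the one
between `∂∂̄` and the Laplacian. The first order bound is `2π|ξ|√δ ≤ π²|ξ|² + δ`. What matters later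
is the dependence on `δ`: terms of order zero and one become small as `δ` grows, while the second
order bound does not depend on `δ`. -/
theorem exists_resolvent {δ : ℝ} (hδ : 0 < δ) (f : 𝓢(W, ℂ)) : ∃ u : 𝓢(W, ℂ),
    ((δ : ℂ) • u - (1 / 4 : ℂ) • Δ u = f) ∧
    eLpNorm u 2 volume ≤ ENNReal.ofReal δ⁻¹ * eLpNorm f 2 volume ∧
    (∀ v : W, eLpNorm (∂_{v} u : 𝓢(W, ℂ)) 2 volume ≤
      ENNReal.ofReal (‖v‖ / Real.sqrt δ) * eLpNorm f 2 volume) ∧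
    ∀ v w : W, eLpNorm (∂_{v} (∂_{w} u) : 𝓢(W, ℂ)) 2 volume ≤
      ENNReal.ofReal (4 * ‖v‖ * ‖w‖) * eLpNorm f 2 volume := by
  have hm := hasTemperateGrowth_ofReal_comp (hasTemperateGrowth_resolventSymbol (W := W) hδ)
  have hin : ∀ v : W, (fun ξ : W => (2 * Real.pi * Complex.I : ℂ) *
      (inner ℝ ξ v : ℝ)).HasTemperateGrowth := fun v =>
    Function.HasTemperateGrowth.mul (by fun_prop)
      (hasTemperateGrowth_ofReal_comp (by fun_prop))
  have hn : (fun ξ : W => (-(2 * Real.pi) ^ 2 : ℂ) *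
      ((‖ξ‖ ^ 2 : ℝ) : ℂ)).HasTemperateGrowth :=
    Function.HasTemperateGrowth.mul (by fun_prop)
      (hasTemperateGrowth_ofReal_comp (by fun_prop))
  have hpos : ∀ ξ : W, 0 < Real.pi ^ 2 * ‖ξ‖ ^ 2 + δ := fun ξ => by positivity
  set m : W → ℂ := fun ξ => (resolventSymbol W δ ξ : ℂ) with hmdef
  refine ⟨fourierMultiplierCLM ℂ m f, ?_, ?_, fun v => ?_, fun v w => ?_⟩
  · rw [laplacian_eq_multiplier, fourierMultiplierCLM_fourierMultiplierCLM_apply hn hm]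
    have h1 := DFunLike.congr_fun (fourierMultiplierCLM_smul (F := ℂ) hm (δ : ℂ)) f
    have h2 := DFunLike.congr_fun (fourierMultiplierCLM_smul (F := ℂ) (hn.mul hm)
      (-(1 / 4 : ℂ))) f
    rw [_root_.smul_apply] at h1 h2
    have hg1 : ((δ : ℂ) • m).HasTemperateGrowth := Function.HasTemperateGrowth.mul (.const _) hm
    have hg2 : (-(1 / 4 : ℂ) • ((fun ξ : W => (-(2 * Real.pi) ^ 2 : ℂ) *
        ((‖ξ‖ ^ 2 : ℝ) : ℂ)) * m)).HasTemperateGrowth :=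
      Function.HasTemperateGrowth.mul (.const _) (hn.mul hm)
    rw [sub_eq_add_neg, ← neg_smul, ← h1, ← h2, fourierMultiplierCLM_apply,
      fourierMultiplierCLM_apply, ← FourierTransform.fourierInv_add, ← _root_.add_apply,
      ← smulLeftCLM_add hg1 hg2]
    have h3 : ((δ : ℂ) • m + -(1 / 4 : ℂ) • ((fun ξ : W => (-(2 * Real.pi) ^ 2 : ℂ) *
        ((‖ξ‖ ^ 2 : ℝ) : ℂ)) * m)) = fun _ => (1 : ℂ) := by
      ext ξ
      have h4 : ((Real.pi ^ 2 * ‖ξ‖ ^ 2 + δ : ℝ) : ℂ) ≠ 0 := by exact_mod_cast (hpos ξ).ne'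
      simp only [hmdef, resolventSymbol, Pi.add_apply, Pi.smul_apply, Pi.mul_apply, smul_eq_mul,
        Complex.ofReal_inv]
      push_cast at h4 ⊢
      field_simp
      ring
    rw [h3, smulLeftCLM_const]
    simp
  · refine eLpNorm_fourierMultiplier_le hm (fun ξ => ?_) f
    simp only [hmdef, resolventSymbol]
    rw [Complex.norm_real, Real.norm_of_nonneg (inv_pos.2 (hpos ξ)).le]
    exact inv_anti₀ hδ (by nlinarith [sq_nonneg (Real.pi * ‖ξ‖)])
  · rw [lineDeriv_eq_multiplier, fourierMultiplierCLM_fourierMultiplierCLM_apply (hin v) hm]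
    refine eLpNorm_fourierMultiplier_le ((hin v).mul hm) (fun ξ => ?_) f
    have h1 : |inner ℝ ξ v| ≤ ‖ξ‖ * ‖v‖ := abs_real_inner_le_norm ξ v
    simp only [hmdef, resolventSymbol, Pi.mul_apply, norm_mul, Complex.norm_I, mul_one,
      Complex.norm_real, Real.norm_eq_abs, Complex.norm_ofNat, abs_inv, abs_of_pos (hpos ξ),
      abs_of_pos Real.pi_pos]
    rw [← div_eq_mul_inv, div_le_div_iff₀ (hpos ξ) (Real.sqrt_pos.2 hδ)]
    have hs := Real.sq_sqrt hδ.le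
    have h2 : 2 * (Real.pi * ‖ξ‖) * Real.sqrt δ ≤ Real.pi ^ 2 * ‖ξ‖ ^ 2 + δ := by
      nlinarith [sq_nonneg (Real.pi * ‖ξ‖ - Real.sqrt δ)]
    calc 2 * Real.pi * |inner ℝ ξ v| * Real.sqrt δ
        ≤ 2 * Real.pi * (‖ξ‖ * ‖v‖) * Real.sqrt δ := by gcongr
      _ = ‖v‖ * (2 * (Real.pi * ‖ξ‖) * Real.sqrt δ) := by ring
      _ ≤ _ := by gcongr
  · rw [lineDeriv_eq_multiplier, lineDeriv_eq_multiplier,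
      fourierMultiplierCLM_fourierMultiplierCLM_apply (hin w) hm,
      fourierMultiplierCLM_fourierMultiplierCLM_apply (hin v) ((hin w).mul hm)]
    refine eLpNorm_fourierMultiplier_le ((hin v).mul ((hin w).mul hm)) (fun ξ => ?_) f
    have h1 : |inner ℝ ξ v| ≤ ‖ξ‖ * ‖v‖ := abs_real_inner_le_norm ξ v
    have h2 : |inner ℝ ξ w| ≤ ‖ξ‖ * ‖w‖ := abs_real_inner_le_norm ξ w
    simp only [hmdef, resolventSymbol, Pi.mul_apply, norm_mul, Complex.norm_I, mul_one,
      Complex.norm_real, Real.norm_eq_abs, Complex.norm_ofNat, abs_inv, abs_of_pos (hpos ξ),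
      abs_of_pos Real.pi_pos]
    rw [← mul_assoc, ← div_eq_mul_inv, div_le_iff₀ (hpos ξ)]
    calc 2 * Real.pi * |inner ℝ ξ v| * (2 * Real.pi * |inner ℝ ξ w|)
        ≤ 2 * Real.pi * (‖ξ‖ * ‖v‖) * (2 * Real.pi * (‖ξ‖ * ‖w‖)) := by gcongr
      _ = 4 * ‖v‖ * ‖w‖ * (Real.pi ^ 2 * ‖ξ‖ ^ 2) := by ring
      _ ≤ _ := by gcongr; linarith

end Fourier

end

/-! ### Second order operators on `ℂⁿ` with constant coefficients. -/

section

variable {n : ℕ}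

open SchwartzMap FourierTransform LineDeriv Laplacian ComplexConjugate Matrix

/-- Replacing `v` by `i v` changes the sign of the coefficients of `∂_a ∂_b` and of `∂̄_a ∂̄_b` but
not those of the mixed derivatives. Thus, when `v` runs through the columns of `C`, the operator
with matrix `C Cᴴ` is a quarter of a Laplacian. -/
theorem sum_dirDeriv_sq {u : (Fin n → ℂ) → ℂ} (hu : ContDiff ℝ ∞ u) (v z : Fin n → ℂ) :
    fderiv ℝ (fun y => fderiv ℝ u y v) z v +
      fderiv ℝ (fun y => fderiv ℝ u y (Complex.I • v)) z (Complex.I • v) =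
    4 * ∑ a, ∑ b, v a * conj (v b) * dz a (dzbar b u) z := by
  have h2 : ∀ w : Fin n → ℂ, fderiv ℝ (fun y => fderiv ℝ u y w) z w = ∑ a, ∑ b,
      (w a * w b * dz a (dz b u) z + w a * conj (w b) * dz a (dzbar b u) z +
        conj (w a) * w b * dzbar a (dz b u) z + conj (w a) * conj (w b) * dzbar a (dzbar b u) z) := by
    intro w
    have h3 : (fun y => fderiv ℝ u y w) = fun y =>
        ∑ b, (w b * dz b u y + conj (w b) * dzbar b u y) := by
      ext y; exact fderiv_eq_sum_dz u y w
    rw [h3, fderiv_eq_sum_dz]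
    refine Finset.sum_congr rfl fun a _ => ?_
    have hd : ∀ b, DifferentiableAt ℝ (dz b u) z := fun b =>
      (contDiffAt_dz b hu.contDiffAt).differentiableAt (by simp)
    have hd' : ∀ b, DifferentiableAt ℝ (dzbar b u) z := fun b =>
      (contDiffAt_dzbar b hu.contDiffAt).differentiableAt (by simp)
    have hs : ∀ b ∈ Finset.univ, DifferentiableAt ℝ
        (fun y => w b * dz b u y + conj (w b) * dzbar b u y) z := fun b _ =>
      ((hd b).const_mul _).add ((hd' b).const_mul _)
    rw [dz_sum a _ hs, dzbar_sum a _ hs,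
      Finset.mul_sum, Finset.mul_sum, ← Finset.sum_add_distrib]
    refine Finset.sum_congr rfl fun b _ => ?_
    rw [dz_add a ((hd b).const_mul _) ((hd' b).const_mul _),
      dzbar_add a ((hd b).const_mul _) ((hd' b).const_mul _), dz_const_mul a _ (hd b),
      dz_const_mul a _ (hd' b), dzbar_const_mul a _ (hd b), dzbar_const_mul a _ (hd' b)]
    ring
  have h4 : ∑ a, ∑ b, conj (v a) * v b * dzbar a (dz b u) z =
      ∑ a, ∑ b, v a * conj (v b) * dz a (dzbar b u) z := by
    rw [Finset.sum_comm]
    refine Finset.sum_congr rfl fun a _ => Finset.sum_congr rfl fun b _ => ?_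
    rw [dz_dzbar_comm a hu.contDiffAt b]
    ring
  rw [h2, h2, ← Finset.sum_add_distrib]
  have h5 : ∀ a b : Fin n, ∀ p q r s : ℂ,
      v a * v b * p + v a * conj (v b) * q + conj (v a) * v b * r + conj (v a) * conj (v b) * s +
      ((Complex.I • v) a * (Complex.I • v) b * p + (Complex.I • v) a * conj ((Complex.I • v) b) * q +
        conj ((Complex.I • v) a) * (Complex.I • v) b * r +
        conj ((Complex.I • v) a) * conj ((Complex.I • v) b) * s) =
      2 * (v a * conj (v b) * q) + 2 * (conj (v a) * v b * r) := by
    intro a b p q r s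
    simp only [Pi.smul_apply, smul_eq_mul, map_mul, Complex.conj_I]
    linear_combination (v a * v b * p - v a * conj (v b) * q - conj (v a) * v b * r +
      conj (v a) * conj (v b) * s) * Complex.I_mul_I
  simp_rw [← Finset.sum_add_distrib, h5, Finset.sum_add_distrib, ← Finset.mul_sum, h4]
  ring

theorem exists_mul_conjTranspose {P : Matrix (Fin n) (Fin n) ℂ} (hP : P.PosDef) :
    ∃ C : Matrix (Fin n) (Fin n) ℂ, IsUnit C ∧ P = C * Cᴴ := by
  open scoped MatrixOrder Matrix.Norms.L2Operator in
  obtain ⟨y, hy, h⟩ := CStarAlgebra.isStrictlyPositive_iff_eq_star_mul_self.mp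
    hP.isStrictlyPositive
  exact ⟨star y, hy.star, by rw [h, star_eq_conjTranspose, conjTranspose_conjTranspose]⟩

/-- Real-linear coordinates adapted to the columns of an invertible matrix. -/
theorem exists_adapted_equiv {C : Matrix (Fin n) (Fin n) ℂ} (hC : IsUnit C) :
    ∃ Λ : EuclideanSpace ℝ (Σ _ : Fin n, Fin 2) ≃L[ℝ] (Fin n → ℂ), ∀ c,
      Λ (EuclideanSpace.basisFun _ ℝ ⟨c, 0⟩) = (fun a => C a c) ∧
      Λ (EuclideanSpace.basisFun _ ℝ ⟨c, 1⟩) = Complex.I • fun a => C a c := by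
  have := hC.invertible
  let b := (Pi.basis fun _ : Fin n => Complex.basisOneI).map
    ((Matrix.toLinearEquiv' C this).restrictScalars ℝ)
  let Λ := ((EuclideanSpace.basisFun (Σ _ : Fin n, Fin 2) ℝ).toBasis.equiv b
    (Equiv.refl _)).toContinuousLinearEquiv
  have h : ∀ i, Λ (EuclideanSpace.basisFun _ ℝ i) = b i := fun i => by
    have := (EuclideanSpace.basisFun (Σ _ : Fin n, Fin 2) ℝ).toBasis.equiv_apply i b
      (Equiv.refl _)
    simpa [Λ] using this
  have hC' : ∀ (c a : Fin n) (y : ℂ), Matrix.toLinearEquiv' C this (Pi.single c y) a =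
      C a c * y := fun c a y => by
    change (C *ᵥ Pi.single c y) a = _
    simp [Matrix.mulVec_single]
  refine ⟨Λ, fun c => ?_⟩
  rw [h, h]
  constructor
  · ext a
    simp [b, Pi.basis_apply, hC']
  · ext a
    simp [b, Pi.basis_apply, hC', mul_comm]

/-- The image of Lebesgue measure under a linear isomorphism is a multiple of Lebesgue measure. The
value of `κ` plays no role, because it multiplies both sides of every estimate that is transported.
-/
theorem exists_eLpNorm_comp_equiv {W : Type*} [NormedAddCommGroup W] [InnerProductSpace ℝ W]
    [FiniteDimensional ℝ W] [MeasurableSpace W] [BorelSpace W] (Λ : W ≃L[ℝ] (Fin n → ℂ)) :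
    ∃ κ : ℝ≥0∞, ∀ s : W → ℂ, eLpNorm (fun z => s (Λ.symm z)) 2 volume = κ * eLpNorm s 2 volume := by
  have : (Measure.map Λ.symm volume).IsAddHaarMeasure := Λ.symm.isAddHaarMeasure_map volume
  have h := Measure.isAddLeftInvariant_eq_smul (Measure.map Λ.symm volume) (volume : Measure W)
  refine ⟨(Measure.addHaarScalarFactor (Measure.map Λ.symm volume) (volume : Measure W) : ℝ≥0∞) ^
    (1 / (2 : ℝ≥0∞)).toReal, fun s => ?_⟩
  have h1 := Λ.symm.toHomeomorph.measurableEmbedding.eLpNorm_map_measure (g := s) (p := 2)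
    (μ := volume)
  have h2 := eLpNorm_smul_measure_of_ne_top (p := 2) (by simp) s (μ := (volume : Measure W))
    (Measure.addHaarScalarFactor (Measure.map Λ.symm volume) (volume : Measure W) : ℝ≥0∞)
  rw [smul_eq_mul] at h2
  rw [← h2]
  refine h1.symm.trans ?_
  change eLpNorm s 2 (Measure.map Λ.symm volume) = _
  conv_lhs => rw [h]
  rfl


section
variable {W : Type*} [NormedAddCommGroup W] [InnerProductSpace ℝ W] [FiniteDimensional ℝ W]
  [MeasurableSpace W] [BorelSpace W] (Λ : W ≃L[ℝ] (Fin n → ℂ))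

theorem fderiv_schwartz_comp (w : 𝓢(W, ℂ)) (v z : Fin n → ℂ) :
    fderiv ℝ (fun z => w (Λ.symm z)) z v = (∂_{Λ.symm v} w : 𝓢(W, ℂ)) (Λ.symm z) := by
  have h := Λ.symm.comp_right_fderiv (f := (w : W → ℂ)) (x := z)
  rw [SchwartzMap.lineDerivOp_apply_eq_fderiv]
  exact DFunLike.congr_fun h v

theorem dz_schwartz_comp (w : 𝓢(W, ℂ)) (a : Fin n) : dz a (fun z => w (Λ.symm z)) =
    fun z => ((1 / 2 : ℂ) • ((∂_{Λ.symm (Pi.single a 1)} w : 𝓢(W, ℂ)) +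
      (-Complex.I) • (∂_{Λ.symm (Pi.single a Complex.I)} w : 𝓢(W, ℂ)))) (Λ.symm z) := by
  ext z
  simp only [dz, fderiv_schwartz_comp, _root_.smul_apply, _root_.add_apply, smul_eq_mul]
  ring

theorem dzbar_schwartz_comp (w : 𝓢(W, ℂ)) (a : Fin n) : dzbar a (fun z => w (Λ.symm z)) =
    fun z => ((1 / 2 : ℂ) • ((∂_{Λ.symm (Pi.single a 1)} w : 𝓢(W, ℂ)) +
      Complex.I • (∂_{Λ.symm (Pi.single a Complex.I)} w : 𝓢(W, ℂ)))) (Λ.symm z) := by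
  ext z
  simp only [dzbar, fderiv_schwartz_comp, _root_.smul_apply, _root_.add_apply,
    smul_eq_mul]

theorem eLpNorm_half_add_le {p q : 𝓢(W, ℂ)} {M : ℝ≥0∞} {c : ℂ} (hc : ‖c‖ = 1)
    (hp : eLpNorm p 2 volume ≤ M) (hq : eLpNorm q 2 volume ≤ M) :
    eLpNorm ((1 / 2 : ℂ) • (p + c • q) : 𝓢(W, ℂ)) 2 volume ≤ M := by
  have h1 : eLpNorm (p + c • q : 𝓢(W, ℂ)) 2 volume ≤ M + M := by
    refine (eLpNorm_add_le (p.continuous.aestronglyMeasurable)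
      ((c • q).continuous.aestronglyMeasurable) (by simp)).trans (add_le_add hp ?_)
    refine (eLpNorm_const_smul c (q : W → ℂ) 2 volume).le.trans ?_
    rwa [← ofReal_norm, hc, ENNReal.ofReal_one, one_mul]
  refine (eLpNorm_const_smul (1 / 2 : ℂ) ((p + c • q : 𝓢(W, ℂ)) : W → ℂ) 2 volume).le.trans ?_
  refine (mul_le_mul_right h1 _).trans ?_
  have : ‖(1 / 2 : ℂ)‖ₑ = (2 : ℝ≥0∞)⁻¹ := by
    rw [← ofReal_norm]
    simp [ENNReal.ofReal_inv_of_pos]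
  rw [this, ← two_mul, ← mul_assoc, ENNReal.inv_mul_cancel (by simp) (by simp), one_mul]

end

/-- Factor `P = C Cᴴ`. In the real coordinates whose unit vectors are the columns of `C` and their
multiples by `i`, the operator becomes `δ - Δ/4`, and the estimates of `exists_resolvent` are
carried over. -/
theorem exists_frozen_resolvent {P : Matrix (Fin n) (Fin n) ℂ} (hP : P.PosDef) :
    ∃ C : ℝ, 0 ≤ C ∧ ∀ δ : ℝ, 0 < δ → ∀ f : (Fin n → ℂ) → ℂ, ContDiff ℝ ∞ f →
      HasCompactSupport f → ∃ u : (Fin n → ℂ) → ℂ, ContDiff ℝ ∞ u ∧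
        (∀ z, δ * u z - ∑ a, ∑ b, P a b * dz a (dzbar b u) z = f z) ∧
        eLpNorm u 2 volume ≤ ENNReal.ofReal δ⁻¹ * eLpNorm f 2 volume ∧
        (∀ a, eLpNorm (dz a u) 2 volume ≤ ENNReal.ofReal (C / √δ) * eLpNorm f 2 volume) ∧
        (∀ a, eLpNorm (dzbar a u) 2 volume ≤ ENNReal.ofReal (C / √δ) * eLpNorm f 2 volume) ∧
        ∀ a b, eLpNorm (dz a (dzbar b u)) 2 volume ≤ ENNReal.ofReal C * eLpNorm f 2 volume := by
  obtain ⟨C, hC, hPC⟩ := exists_mul_conjTranspose hP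
  obtain ⟨Λ, hΛ⟩ := exists_adapted_equiv hC
  obtain ⟨κ, hκ⟩ := exists_eLpNorm_comp_equiv Λ
  set B : ℝ := ‖(Λ.symm : (Fin n → ℂ) →L[ℝ] EuclideanSpace ℝ (Σ _ : Fin n, Fin 2))‖ with hBdef
  have hB0 : 0 ≤ B := norm_nonneg _
  have hB : ∀ (a : Fin n) (y : ℂ), ‖y‖ = 1 → ‖Λ.symm (Pi.single a y)‖ ≤ B := fun a y hy => by
    have h := (Λ.symm : (Fin n → ℂ) →L[ℝ]
      EuclideanSpace ℝ (Σ _ : Fin n, Fin 2)).le_opNorm (Pi.single a y)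
    rw [Pi.norm_single, hy, mul_one] at h
    exact h
  -- One constant for both orders: `B` bounds the directions `Λ.symm (Pi.single a y)`, so first
  -- derivatives cost at most `B / √δ` and second derivatives at most `4 B²`.
  refine ⟨B + 4 * B * B, by positivity, fun δ hδ f hf hfc => ?_⟩
  set F : 𝓢(EuclideanSpace ℝ (Σ _ : Fin n, Fin 2), ℂ) :=
    (hfc.comp_homeomorph Λ.toHomeomorph).toSchwartzMap (hf.comp Λ.contDiff) with hF
  have hFf : (fun z => F (Λ.symm z)) = f := by
    ext z
    simp [hF]
  obtain ⟨w, hw, h0, h1, h2⟩ := exists_resolvent hδ F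
  have hN : eLpNorm f 2 volume = κ * eLpNorm F 2 volume := by rw [← hκ, hFf]
  have key : ∀ {s : 𝓢(EuclideanSpace ℝ (Σ _ : Fin n, Fin 2), ℂ)} {r : ℝ≥0∞},
      eLpNorm s 2 volume ≤ r * eLpNorm F 2 volume →
      eLpNorm (fun z => s (Λ.symm z)) 2 volume ≤ r * eLpNorm f 2 volume := fun {s r} h => by
    rw [hκ, hN, mul_left_comm]
    exact mul_le_mul_right h _
  have h1' : ∀ (a : Fin n) (y : ℂ), ‖y‖ = 1 →
      eLpNorm (∂_{Λ.symm (Pi.single a y)} w : 𝓢(_, ℂ)) 2 volume ≤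
        ENNReal.ofReal ((B + 4 * B * B) / √δ) * eLpNorm F 2 volume := fun a y hy => by
    refine (h1 _).trans (mul_le_mul_left (ENNReal.ofReal_le_ofReal ?_) _)
    gcongr
    nlinarith [hB a y hy]
  have h2' : ∀ (a b : Fin n) (y y' : ℂ), ‖y‖ = 1 → ‖y'‖ = 1 →
      eLpNorm (∂_{Λ.symm (Pi.single a y)} (∂_{Λ.symm (Pi.single b y')} w) : 𝓢(_, ℂ)) 2 volume ≤
        ENNReal.ofReal (B + 4 * B * B) * eLpNorm F 2 volume := fun a b y y' hy hy' => by
    refine (h2 _ _).trans (mul_le_mul_left (ENNReal.ofReal_le_ofReal ?_) _)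
    have := mul_le_mul (hB a y hy) (hB b y' hy') (norm_nonneg _) hB0
    nlinarith
  have hsm : ContDiff ℝ ∞ fun z => w (Λ.symm z) := (w.smooth ⊤).comp Λ.symm.contDiff
  refine ⟨fun z => w (Λ.symm z), hsm, fun z => ?_, key h0, fun a => ?_, fun a => ?_,
    fun a b => ?_⟩
  · have h3 : ∀ c, ∑ a, ∑ b, C a c * conj (C b c) * dz a (dzbar b fun z => w (Λ.symm z)) z =
        (1 / 4) * ((∂_{EuclideanSpace.basisFun _ ℝ (⟨c, 0⟩ : Σ _ : Fin n, Fin 2)}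
          (∂_{EuclideanSpace.basisFun _ ℝ (⟨c, 0⟩ : Σ _ : Fin n, Fin 2)} w) : 𝓢(_, ℂ)) (Λ.symm z) +
        (∂_{EuclideanSpace.basisFun _ ℝ (⟨c, 1⟩ : Σ _ : Fin n, Fin 2)}
          (∂_{EuclideanSpace.basisFun _ ℝ (⟨c, 1⟩ : Σ _ : Fin n, Fin 2)} w) : 𝓢(_, ℂ))
            (Λ.symm z)) := by
      intro c
      have h4 := sum_dirDeriv_sq hsm (fun a => C a c) z
      rw [← (hΛ c).2, ← (hΛ c).1] at h4
      simp only [fderiv_schwartz_comp, ContinuousLinearEquiv.symm_apply_apply] at h4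
      rw [h4]
      ring
    have h5 : ∑ a, ∑ b, P a b * dz a (dzbar b fun z => w (Λ.symm z)) z =
        (1 / 4) * (Δ w) (Λ.symm z) := by
      rw [SchwartzMap.laplacian_eq_sum (EuclideanSpace.basisFun _ ℝ), _root_.sum_apply,
        Fintype.sum_sigma, Finset.mul_sum]
      simp only [Fin.sum_univ_two, ← h3]
      rw [Finset.sum_comm.trans (Finset.sum_congr rfl fun a _ => Finset.sum_comm)]
      refine Finset.sum_congr rfl fun a _ => Finset.sum_congr rfl fun b _ => ?_
      rw [hPC, Matrix.mul_apply, Finset.sum_mul]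
      rfl
    rw [h5, ← congrFun hFf z, ← hw]
    simp
  · rw [dz_schwartz_comp]
    exact key (eLpNorm_half_add_le (by simp) (h1' a 1 (by simp)) (h1' a _ (by simp)))
  · rw [dzbar_schwartz_comp]
    exact key (eLpNorm_half_add_le (by simp) (h1' a 1 (by simp)) (h1' a _ (by simp)))
  · rw [dzbar_schwartz_comp, dz_schwartz_comp]
    have h6 : ∀ y : ℂ, ‖y‖ = 1 → eLpNorm (∂_{Λ.symm (Pi.single a y)} ((1 / 2 : ℂ) •
        ((∂_{Λ.symm (Pi.single b 1)} w : 𝓢(_, ℂ)) +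
        Complex.I • (∂_{Λ.symm (Pi.single b Complex.I)} w : 𝓢(_, ℂ)))) : 𝓢(_, ℂ)) 2 volume ≤
        ENNReal.ofReal (B + 4 * B * B) * eLpNorm F 2 volume := fun y hy => by
      rw [lineDerivOp_smul, lineDerivOp_add, lineDerivOp_smul]
      exact eLpNorm_half_add_le (by simp) (h2' a b y 1 hy (by simp)) (h2' a b y _ hy (by simp))
    exact key (eLpNorm_half_add_le (by simp) (h6 1 (by simp)) (h6 _ (by simp)))

end

/-! ### L² norms in a chart, and the coordinate form of the operator. -/

section

variable {n : ℕ}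
variable {X : Type*} [TopologicalSpace X] [ChartedSpace (Fin n → ℂ) X] {ι : Type*}
  {A : CoordCover n X ι}

section
variable [MeasurableSpace X] [BorelSpace X] {ρ : ι → (Fin n → ℂ) → ℝ}
  [IsManifold 𝓘(ℂ, Fin n → ℂ) ω X]

theorem eLpNorm_two_sq {α G : Type*} [MeasurableSpace α] {μ : Measure α} [NormedAddCommGroup G]
    (f : α → G) : eLpNorm f 2 μ ^ 2 = ∫⁻ x, ‖f x‖ₑ ^ 2 ∂μ := by
  have h := eLpNorm_nnreal_pow_eq_lintegral (f := f) (μ := μ) (p := 2) (by simp)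
  simpa using h

theorem lintegral_eq_chart (hρ : IsDensity A ρ) {i : ι} {H : X → ℝ≥0∞}
    (hH : AEMeasurable H (volumeFormMeasure A ρ)) (h0 : ∀ x ∉ (A.chart i).source, H x = 0) :
    ∫⁻ x, H x ∂(volumeFormMeasure A ρ) =
      ∫⁻ z in (A.chart i).target, ENNReal.ofReal (2 ^ n * ρ i z) * H ((A.chart i).symm z) := by
  have ht := (A.chart i).open_target.measurableSet
  have hs : ∫⁻ x, H x ∂(volumeFormMeasure A ρ) =
      ∫⁻ x in (A.chart i).source, H x ∂(volumeFormMeasure A ρ) := by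
    rw [← lintegral_indicator (A.chart i).open_source.measurableSet]
    congr 1
    ext x
    by_cases hx : x ∈ (A.chart i).source
    · rw [indicator_of_mem hx]
    · rw [indicator_of_notMem hx, h0 x hx]
  have hH' : AEMeasurable H (localMeasure A ρ i) := by
    rw [← volumeFormMeasure_restrict hρ]
    exact hH.mono_measure Measure.restrict_le_self
  rw [hs, volumeFormMeasure_restrict hρ, localMeasure, lintegral_map' hH' (aemeasurable_symm i)]
  exact lintegral_withDensity_eq_lintegral_mul₀'
    ((((hρ.continuousOn i).const_mul (2 ^ n)).aemeasurable ht).ennreal_ofReal)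
    (hH'.comp_aemeasurable (aemeasurable_symm i))

/-- Together with `chart_le_eLpNorm_sq` this moves estimates between `X` and `ℂⁿ`. Bounds on the
density are needed only on the set `C` that carries the function. -/
theorem eLpNorm_sq_le_chart (hρ : IsDensity A ρ) {i : ι} {F : X → ℂ} {C : Set X} {c : ℝ}
    {G : (Fin n → ℂ) → ℝ} (hF : AEStronglyMeasurable F (volumeFormMeasure A ρ))
    (hC : C ⊆ (A.chart i).source) (h0 : ∀ x ∉ C, F x = 0)
    (hc : ∀ z ∈ (A.chart i).target, (A.chart i).symm z ∈ C → 2 ^ n * ρ i z ≤ c)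
    (hG : ∀ z ∈ (A.chart i).target, (A.chart i).symm z ∈ C → ‖A.loc i F z‖ ≤ G z) :
    eLpNorm F 2 (volumeFormMeasure A ρ) ^ 2 ≤ ENNReal.ofReal c * eLpNorm G 2 volume ^ 2 := by
  have ht := (A.chart i).open_target.measurableSet
  rw [eLpNorm_two_sq, eLpNorm_two_sq, lintegral_eq_chart hρ (i := i) (hF.enorm.pow_const 2)
    fun x hx => by simp [h0 x fun h => hx (hC h)], ← lintegral_const_mul' _ _ (by simp)]
  refine (setLIntegral_mono' ht fun z hz => ?_).trans (setLIntegral_le_lintegral _ _)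
  by_cases hzC : (A.chart i).symm z ∈ C
  · have h1 := (hG z hz hzC).trans (le_abs_self _)
    gcongr
    · exact hc z hz hzC
    · exact enorm_le_iff_norm_le.2 h1
  · simp [h0 _ hzC]

theorem chart_le_eLpNorm_sq (hρ : IsDensity A ρ) {i : ι} {F : X → ℂ} {C : Set X} {c : ℝ}
    {φ : (Fin n → ℂ) → ℂ} (hF : AEStronglyMeasurable F (volumeFormMeasure A ρ))
    (hC : C ⊆ (A.chart i).source) (h0 : ∀ x ∉ C, F x = 0)
    (hc : ∀ z ∈ (A.chart i).target, (A.chart i).symm z ∈ C → c ≤ 2 ^ n * ρ i z)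
    (hφ : ∀ z ∈ (A.chart i).target, φ z = A.loc i F z)
    (hφ' : ∀ z ∉ (A.chart i).target, φ z = 0) :
    ENNReal.ofReal c * eLpNorm φ 2 volume ^ 2 ≤ eLpNorm F 2 (volumeFormMeasure A ρ) ^ 2 := by
  have ht := (A.chart i).open_target.measurableSet
  rw [eLpNorm_two_sq, eLpNorm_two_sq, lintegral_eq_chart hρ (i := i) (hF.enorm.pow_const 2)
    fun x hx => by simp [h0 x fun h => hx (hC h)], ← lintegral_const_mul' _ _ (by simp),
    ← lintegral_indicator ht]
  refine lintegral_mono fun z => ?_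
  by_cases hz : z ∈ (A.chart i).target
  · rw [indicator_of_mem hz, hφ z hz]
    by_cases hzC : (A.chart i).symm z ∈ C
    · gcongr
      · exact hc z hz hzC
      · rfl
    · simp [CoordCover.loc, h0 _ hzC]
  · simp [hφ' z hz]

variable {g : ι → (Fin n → ℂ) → Matrix (Fin n) (Fin n) ℂ} {u : X → ℂ}

/-- The first order coefficients of the operator `lapL` in the chart `i`. -/
def lapB (ρ : ι → (Fin n → ℂ) → ℝ) (g : ι → (Fin n → ℂ) → Matrix (Fin n) (Fin n) ℂ) (i : ι)
    (b : Fin n) (z : Fin n → ℂ) : ℂ :=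
  -(∑ a, dz a (fun w => (ρ i w : ℂ) * (g i w)⁻¹ b a) z) / ρ i z

theorem contDiffAt_ofReal_density (hρ : IsSmoothDensity A ρ) {i : ι} {z : Fin n → ℂ}
    (hz : z ∈ (A.chart i).target) : ContDiffAt ℝ ∞ (fun w => (ρ i w : ℂ)) z :=
  Complex.ofRealCLM.contDiff.contDiffAt.comp z (hρ.smooth i z hz)

theorem contDiffAt_metric_inv (hg : IsKahler A g) {i : ι} {z : Fin n → ℂ}
    (hz : z ∈ (A.chart i).target) (a b : Fin n) :
    ContDiffAt ℝ ∞ (fun w => (g i w)⁻¹ a b) z :=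
  contDiffAt_inv_entry (hg.smooth i z hz) (PosDef.det_ne_zero (hg.posDef i z hz)) a b

theorem contDiffAt_lapB (hρ : IsSmoothDensity A ρ) (hg : IsKahler A g) {i : ι} {z : Fin n → ℂ}
    (hz : z ∈ (A.chart i).target) (b : Fin n) : ContDiffAt ℝ ∞ (lapB ρ g i b) z := by
  have h0 : (ρ i z : ℂ) ≠ 0 := by exact_mod_cast (hρ.pos i z hz).ne'
  have h1 : ContDiffAt ℝ ∞ (fun w => -∑ a, dz a (fun w => (ρ i w : ℂ) * (g i w)⁻¹ b a) w) z :=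
    ContDiffAt.neg (ContDiffAt.sum fun a _ => contDiffAt_dz a
      ((contDiffAt_ofReal_density hρ hz).mul (contDiffAt_metric_inv hg hz b a)))
  exact h1.mul ((contDiffAt_ofReal_density hρ hz).inv h0)

theorem loc_lapL [T2Space X] (hρ : IsSmoothDensity A ρ) (hg : IsKahler A g) (hu : A.IsSmooth u)
    {i : ι} {z : Fin n → ℂ} (hz : z ∈ (A.chart i).target) : A.loc i (lapL A ρ g u) z =
      -(∑ a, ∑ b, (g i z)⁻¹ b a * dz a (dzbar b (A.loc i u)) z) +
        ∑ b, lapB ρ g i b z * dzbar b (A.loc i u) z := by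
  have h1 : A.loc i (lapL A ρ g u) z = -divLoc ρ (gradV A g u) i z :=
    congrArg Neg.neg (loc_divX hρ (isVectorField_gradV hg hu) hz)
  have hρ0 : (ρ i z : ℂ) ≠ 0 := by exact_mod_cast (hρ.pos i z hz).ne'
  have hd1 : ∀ a b, DifferentiableAt ℝ (fun w => (ρ i w : ℂ) * (g i w)⁻¹ b a) z := fun a b =>
    ((contDiffAt_ofReal_density hρ hz).mul (contDiffAt_metric_inv hg hz b a)).differentiableAt
      (by simp)
  have hd2 : ∀ b, DifferentiableAt ℝ (dzbar b (A.loc i u)) z := fun b =>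
    (contDiffAt_dzbar b (hu i z hz)).differentiableAt (by simp)
  have h2 : ∀ a, dz a (fun w => (ρ i w : ℂ) * gradV A g u i w a) z =
      ∑ b, (dz a (fun w => (ρ i w : ℂ) * (g i w)⁻¹ b a) z * dzbar b (A.loc i u) z +
        (ρ i z : ℂ) * (g i z)⁻¹ b a * dz a (dzbar b (A.loc i u)) z) := by
    intro a
    have h3 : (fun w => (ρ i w : ℂ) * gradV A g u i w a) = fun w => ∑ b,
        (ρ i w : ℂ) * (g i w)⁻¹ b a * dzbar b (A.loc i u) w := by
      ext w
      simp [gradV, Matrix.mulVec, dotProduct, Finset.mul_sum, mul_assoc]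
    have hs : ∀ b ∈ Finset.univ, DifferentiableAt ℝ
        (fun w => (ρ i w : ℂ) * (g i w)⁻¹ b a * dzbar b (A.loc i u) w) z := fun b _ =>
      (hd1 a b).mul (hd2 b)
    rw [h3, dz_sum a _ hs]
    exact Finset.sum_congr rfl fun b _ => dz_mul a (hd1 a b) (hd2 b)
  rw [h1, divLoc]
  simp only [h2, Finset.sum_add_distrib, lapB]
  have h4 : ∑ b, -(∑ a, dz a (fun w => (ρ i w : ℂ) * (g i w)⁻¹ b a) z) / (ρ i z : ℂ) *
      dzbar b (A.loc i u) z = -(∑ a, ∑ b, dz a (fun w => (ρ i w : ℂ) * (g i w)⁻¹ b a) z *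
        dzbar b (A.loc i u) z) / (ρ i z : ℂ) := by
    rw [Finset.sum_comm, ← Finset.sum_neg_distrib, Finset.sum_div]
    refine Finset.sum_congr rfl fun b _ => ?_
    rw [← Finset.sum_mul]
    ring
  have h5 : ∑ a, ∑ b, (ρ i z : ℂ) * (g i z)⁻¹ b a * dz a (dzbar b (A.loc i u)) z =
      (ρ i z : ℂ) * ∑ a, ∑ b, (g i z)⁻¹ b a * dz a (dzbar b (A.loc i u)) z := by
    simp only [Finset.mul_sum, mul_assoc]
  rw [h4, h5]
  field_simp
  ring

/-- Read off from the coordinate form `loc_lapL`, which is visibly linear in the derivatives of the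
function. -/
theorem lapL_sum [T2Space X] (hρ : IsSmoothDensity A ρ) (hg : IsKahler A g) {κ : Type*}
    (s : Finset κ) {f : κ → X → ℂ} (hf : ∀ k ∈ s, A.IsSmooth (f k)) (x : X) :
    lapL A ρ g (fun x => ∑ k ∈ s, f k x) x = ∑ k ∈ s, lapL A ρ g (f k) x := by
  have hz := (A.chart (A.indexAt x)).map_source (A.mem_indexAt x)
  have hx := (A.chart (A.indexAt x)).left_inv (A.mem_indexAt x)
  have key : ∀ {u : X → ℂ}, A.IsSmooth u → lapL A ρ g u x = _ := fun {u} hu =>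
    (congrArg (lapL A ρ g u) hx).symm.trans (loc_lapL hρ hg hu hz)
  have h1 : ∀ b, ∀ z ∈ (A.chart (A.indexAt x)).target,
      dzbar b (A.loc (A.indexAt x) fun x => ∑ k ∈ s, f k x) z =
      ∑ k ∈ s, dzbar b (A.loc (A.indexAt x) (f k)) z := fun b z hz =>
    dzbar_sum b s fun k hk => (hf k hk _ z hz).differentiableAt (by simp)
  have h2 : ∀ a b, dz a (dzbar b (A.loc (A.indexAt x) fun x => ∑ k ∈ s, f k x))
      (A.chart (A.indexAt x) x) =
      ∑ k ∈ s, dz a (dzbar b (A.loc (A.indexAt x) (f k))) (A.chart (A.indexAt x) x) := fun a b => by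
    rw [← dz_sum a s fun k hk =>
      (contDiffAt_dzbar b (hf k hk _ _ hz)).differentiableAt (by simp)]
    exact dz_congr (Filter.eventually_of_mem
      ((A.chart (A.indexAt x)).open_target.mem_nhds hz) (h1 b)) a
  rw [key (CoordCover.IsSmooth.sum hf), Finset.sum_congr rfl fun k hk => key (hf k hk),
    Finset.sum_add_distrib, Finset.sum_neg_distrib]
  simp only [h1 _ _ hz, h2, Finset.mul_sum]
  congr 1
  · rw [Finset.sum_comm (s := s)]
    congr 1
    refine Finset.sum_congr rfl fun a _ => ?_
    rw [Finset.sum_comm]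
  · rw [Finset.sum_comm]

end

end

/-! ### The local parametrix. -/

section

variable {n : ℕ}
variable {X : Type*} [TopologicalSpace X] [ChartedSpace (Fin n → ℂ) X] {ι : Type*}
  {A : CoordCover n X ι}

open Matrix

theorem contDiff_indicator {F : Type*} [NormedAddCommGroup F] [NormedSpace ℝ F]
    {U C : Set (Fin n → ℂ)} {f : (Fin n → ℂ) → F} (hU : IsOpen U)
    (hf : ∀ z ∈ U, ContDiffAt ℝ ∞ f z) (hC : IsCompact C) (hCU : C ⊆ U)
    (h0 : ∀ z ∈ U, z ∉ C → f z = 0) :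
    ContDiff ℝ ∞ (U.indicator f) ∧ HasCompactSupport (U.indicator f) := by
  have hs : ∀ z ∉ C, U.indicator f z = 0 := fun z hz => by
    by_cases hzU : z ∈ U
    · rw [indicator_of_mem hzU, h0 z hzU hz]
    · rw [indicator_of_notMem hzU]
  refine ⟨contDiff_iff_contDiffAt.2 fun z => ?_, HasCompactSupport.intro hC hs⟩
  by_cases hz : z ∈ U
  · refine (hf z hz).congr_of_eventuallyEq ?_
    filter_upwards [hU.mem_nhds hz] with w hw using indicator_of_mem hw f
  · refine (contDiffAt_const (c := (0 : F))).congr_of_eventuallyEq ?_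
    filter_upwards [hC.isClosed.isOpen_compl.mem_nhds fun h => hz (hCU h)] with w hw
    exact hs w hw

theorem eLpNorm_const_mul_sum_norm_le {κ : Type*} [Fintype κ] {s : κ → (Fin n → ℂ) → ℂ}
    {c B : ℝ} {M : ℝ≥0∞} (hc : 0 ≤ c) (hs : ∀ k, Continuous (s k))
    (h : ∀ k, eLpNorm (s k) 2 volume ≤ ENNReal.ofReal B * M) :
    eLpNorm (fun z => c * ∑ k, ‖s k z‖) 2 volume ≤
      ENNReal.ofReal (c * (Fintype.card κ * B)) * M := by
  have h1 : eLpNorm (∑ k, fun z => ‖s k z‖) 2 volume ≤ ∑ k : κ, ENNReal.ofReal B * M :=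
    (eLpNorm_sum_le (fun k _ => (hs k).norm.aestronglyMeasurable) (by simp)).trans
      (Finset.sum_le_sum fun k _ => (eLpNorm_norm (s k)).trans_le (h k))
  have h2 : (fun z => c * ∑ k, ‖s k z‖) = c • ∑ k, fun z => ‖s k z‖ := by
    ext z
    simp
  rw [h2]
  refine (eLpNorm_const_smul c _ 2 volume).le.trans ((mul_le_mul_right h1 _).trans ?_)
  rw [Finset.sum_const, Finset.card_univ, nsmul_eq_mul, Real.enorm_of_nonneg hc,
    ENNReal.ofReal_mul hc, ENNReal.ofReal_mul (by positivity), ENNReal.ofReal_natCast]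
  exact le_of_eq (by ring)

/-- If the density lies between `r` and `4 r` on the support, then going to the chart and back costs
a factor `√4 = 2` in the norm, whatever `r` is. -/
theorem le_of_sq_le_chart {N Q M : ℝ≥0∞} {r B : ℝ} (hB : 0 ≤ B)
    (h1 : N ^ 2 ≤ ENNReal.ofReal (4 * r) * (ENNReal.ofReal B * Q) ^ 2)
    (h2 : ENNReal.ofReal r * Q ^ 2 ≤ M ^ 2) : N ≤ ENNReal.ofReal (2 * B) * M := by
  refine (ENNReal.pow_le_pow_left_iff two_ne_zero).1 (h1.trans ?_)
  rw [ENNReal.ofReal_mul (by norm_num), ENNReal.ofReal_mul (by norm_num), mul_pow, mul_pow, mul_pow]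
  calc ENNReal.ofReal 4 * ENNReal.ofReal r * (ENNReal.ofReal B ^ 2 * Q ^ 2)
      = ENNReal.ofReal 4 * ENNReal.ofReal B ^ 2 * (ENNReal.ofReal r * Q ^ 2) := by ring
    _ ≤ ENNReal.ofReal 4 * ENNReal.ofReal B ^ 2 * M ^ 2 := by gcongr
    _ = _ := by
      rw [← ENNReal.ofReal_pow (by norm_num : (0 : ℝ) ≤ 2)]
      norm_num

section
variable [MeasurableSpace X] [BorelSpace X] {ρ : ι → (Fin n → ℂ) → ℝ}
  [IsManifold 𝓘(ℂ, Fin n → ℂ) ω X] [T2Space X]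
  {g : ι → (Fin n → ℂ) → Matrix (Fin n) (Fin n) ℂ} {u : X → ℂ}

theorem lapL_eq_zero (hρ : IsSmoothDensity A ρ) (hg : IsKahler A g) (hu : A.IsSmooth u)
    {x : X} (h : u =ᶠ[nhds x] fun _ => 0) : lapL A ρ g u x = 0 := by
  have hz := (A.chart (A.indexAt x)).map_source (A.mem_indexAt x)
  have hx := (A.chart (A.indexAt x)).left_inv (A.mem_indexAt x)
  have h0 : A.loc (A.indexAt x) u =ᶠ[nhds (A.chart (A.indexAt x) x)] fun _ => 0 :=
    ((A.chart (A.indexAt x)).continuousAt_symm hz).eventually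
      (p := fun y => u y = 0) (by rw [hx]; exact h)
  have h1 : ∀ b, dzbar b (A.loc (A.indexAt x) u) =ᶠ[nhds (A.chart (A.indexAt x) x)]
      fun _ => 0 := fun b => by
    filter_upwards [h0.eventually_nhds] with y hy
    rw [dzbar_congr hy, dzbar_const]
  have key := (congrArg (lapL A ρ g u) hx).symm.trans (loc_lapL hρ hg hu hz)
  rw [key]
  simp [fun b => (h1 b).self_of_nhds, fun a b => (dz_congr (h1 b) a).trans (dz_const a 0 _)]

/-- The expansion of a second order operator on a product. -/
theorem second_order_mul {p q : (Fin n → ℂ) → ℂ} (hp : ContDiff ℝ ∞ p) (hq : ContDiff ℝ ∞ q)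
    (G : Fin n → Fin n → ℂ) (β : Fin n → ℂ) (z : Fin n → ℂ) :
    -(∑ a, ∑ b, G a b * dz a (dzbar b fun w => p w * q w) z) +
      ∑ b, β b * dzbar b (fun w => p w * q w) z =
    -(p z * ∑ a, ∑ b, G a b * dz a (dzbar b q) z) +
      ((-(∑ a, ∑ b, G a b * dz a (dzbar b p) z) + ∑ b, β b * dzbar b p z) * q z +
      (∑ b, (-(∑ a, G a b * dz a p z) + β b * p z) * dzbar b q z +
      ∑ a, -(∑ b, G a b * dzbar b p z) * dz a q z)) := by
  have d1 : ∀ {h : (Fin n → ℂ) → ℂ}, ContDiff ℝ ∞ h → ∀ y, DifferentiableAt ℝ h y :=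
    fun h y => h.contDiffAt.differentiableAt (by simp)
  have d2 : ∀ {h : (Fin n → ℂ) → ℂ}, ContDiff ℝ ∞ h → ∀ b y, DifferentiableAt ℝ (dzbar b h) y :=
    fun h b y => (contDiffAt_dzbar b h.contDiffAt).differentiableAt (by simp)
  have h1 : ∀ b, (dzbar b fun w => p w * q w) = fun y => dzbar b p y * q y + p y * dzbar b q y :=
    fun b => funext fun y => dzbar_mul b (d1 hp y) (d1 hq y)
  have h2 : ∀ a b, dz a (dzbar b fun w => p w * q w) z = dz a (dzbar b p) z * q z +
      dzbar b p z * dz a q z + (dz a p z * dzbar b q z + p z * dz a (dzbar b q) z) := by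
    intro a b
    have e1 : DifferentiableAt ℝ (fun y => dzbar b p y * q y) z := (d2 hp b z).mul (d1 hq z)
    have e2 : DifferentiableAt ℝ (fun y => p y * dzbar b q y) z := (d1 hp z).mul (d2 hq b z)
    rw [h1, dz_add a e1 e2, dz_mul a (d2 hp b z) (d1 hq z), dz_mul a (d1 hp z) (d2 hq b z)]
  have h3 : ∑ b, (∑ a, G a b * dz a p z) * dzbar b q z =
      ∑ a, ∑ b, G a b * dz a p z * dzbar b q z := by
    rw [Finset.sum_comm]
    simp only [Finset.sum_mul]
  have h4 := fun b => congrFun (h1 b) z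
  simp only [h2, h4, mul_add, add_mul, neg_mul, Finset.sum_add_distrib, Finset.sum_neg_distrib, h3]
  simp only [Finset.mul_sum, Finset.sum_mul]
  simp only [mul_assoc, mul_left_comm, mul_comm]
  ring

/-- Freeze the leading coefficients at `x`, solve the frozen equation with source `η f`, and
multiply the solution by `η`. The error from freezing is small because the coefficients oscillate
little on `N`, and it carries a factor `η` that makes the later summation free of loss. The
commutator with `η` and the first order part have order at most one in the solution, hence size
`1/√δ`. The order of the quantifiers is essential: `N` is fixed before `η`, while `K` depends on `η`
and is defeated by taking `δ` large. -/
theorem exists_local_parametrix [CompactSpace X] (hρ : IsSmoothDensity A ρ) (hg : IsKahler A g) (x : X) :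
    ∃ N ∈ nhds x, ∀ (η : X → ℝ) (C : Set X), IsCutoff A (A.indexAt x) η C → C ⊆ N →
    ∃ K : ℝ, 0 ≤ K ∧ ∀ δ : ℝ, 1 ≤ δ → ∀ f : X → ℂ, A.IsSmooth f → ∃ w e₁ e₂ : X → ℂ,
      A.IsSmooth w ∧ AEStronglyMeasurable e₁ (volumeFormMeasure A ρ) ∧
      AEStronglyMeasurable e₂ (volumeFormMeasure A ρ) ∧
      (∀ y, δ * w y + lapL A ρ g w y - (η y : ℂ) ^ 2 * f y = η y * e₁ y + e₂ y) ∧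
      eLpNorm e₁ 2 (volumeFormMeasure A ρ) ≤ ENNReal.ofReal (1 / 8) *
        eLpNorm (fun y => η y * f y) 2 (volumeFormMeasure A ρ) ∧
      eLpNorm e₂ 2 (volumeFormMeasure A ρ) ≤ ENNReal.ofReal (K / √δ) *
        eLpNorm (fun y => η y * f y) 2 (volumeFormMeasure A ρ) := by
  set i := A.indexAt x
  have hx : x ∈ (A.chart i).source := A.mem_indexAt x
  have hz0 := (A.chart i).map_source hx
  set z₀ := A.chart i x
  have hto := (A.chart i).open_target
  set P : Matrix (Fin n) (Fin n) ℂ := ((g i z₀)⁻¹)ᵀ with hP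
  obtain ⟨C₀, hC₀, hres⟩ := exists_frozen_resolvent (P := P) (hg.posDef i z₀ hz0).inv.transpose
  -- Half the density at the centre, whose value `2 r` lies strictly between `r` and `4 r`.
  set r : ℝ := 2 ^ n * ρ i z₀ / 2 with hr
  have hr0 : 0 < r := by have := hρ.pos i z₀ hz0; positivity
  -- Ensures `2 · ε n² C₀ ≤ 1/8`: there are `n²` second derivatives, each bounded by `C₀`, and the
  -- passage through the chart costs 2.
  set ε : ℝ := 1 / (16 * ((n : ℝ) ^ 2 * C₀ + 1)) with hε
  have hε0 : 0 < ε := by positivity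
  have hinvc : ∀ a b, ContinuousOn (fun z => (g i z)⁻¹ b a) (A.chart i).target := fun a b z hz =>
    (contDiffAt_metric_inv hg hz b a).continuousAt.continuousWithinAt
  have hU : {z | (r ≤ 2 ^ n * ρ i z ∧ 2 ^ n * ρ i z ≤ 4 * r) ∧
      ∀ a b, ‖P a b - (g i z)⁻¹ b a‖ ≤ ε} ∈ nhds z₀ := by
    have hc : ContinuousAt (fun z => 2 ^ n * ρ i z) z₀ :=
      (((hρ.continuousOn i).continuousAt (hto.mem_nhds hz0)).const_mul _)
    have h1 : ∀ᶠ z in nhds z₀, r ≤ 2 ^ n * ρ i z := by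
      filter_upwards [hc.eventually (lt_mem_nhds (show r < 2 ^ n * ρ i z₀ by linarith))] with z hz
        using hz.le
    have h2 : ∀ᶠ z in nhds z₀, 2 ^ n * ρ i z ≤ 4 * r := by
      filter_upwards [hc.eventually (gt_mem_nhds (show 2 ^ n * ρ i z₀ < 4 * r by linarith))] with
        z hz using hz.le
    have h3 : ∀ a b, ∀ᶠ z in nhds z₀, ‖P a b - (g i z)⁻¹ b a‖ ≤ ε := fun a b => by
      have hc' : ContinuousAt (fun z => ‖P a b - (g i z)⁻¹ b a‖) z₀ :=
        (continuousAt_const.sub ((hinvc a b).continuousAt (hto.mem_nhds hz0))).norm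
      filter_upwards [hc'.eventually (gt_mem_nhds (show ‖P a b - (g i z₀)⁻¹ b a‖ < ε by
        simpa [hP] using hε0))] with z hz using hz.le
    exact (h1.and h2).and (Filter.eventually_all.2 fun a => Filter.eventually_all.2 (h3 a))
  refine ⟨_, ((A.chart i).continuousAt hx).preimage_mem_nhds hU, fun η C hη hCN => ?_⟩
  have hCt : A.chart i '' C ⊆ (A.chart i).target := by
    rintro _ ⟨y, hy, rfl⟩
    exact (A.chart i).map_source (hη.subset hy)
  have hCc : IsCompact (A.chart i '' C) :=
    hη.compact.image_of_continuousOn ((A.chart i).continuousOn.mono hη.subset)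
  have hCmem : ∀ z ∈ (A.chart i).target, (A.chart i).symm z ∈ C → z ∈ A.chart i '' C :=
    fun z hz hzC => ⟨_, hzC, (A.chart i).right_inv hz⟩
  have hCz : ∀ z ∈ (A.chart i).target, (A.chart i).symm z ∈ C →
      (r ≤ 2 ^ n * ρ i z ∧ 2 ^ n * ρ i z ≤ 4 * r) ∧ ∀ a b, ‖P a b - (g i z)⁻¹ b a‖ ≤ ε :=
    fun z hz hzC => by simpa [hz] using hCN hzC
  have hzero : ∀ z ∈ (A.chart i).target, z ∉ A.chart i '' C → (A.chart i).symm z ∉ C :=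
    fun z hz hzC h => hzC (hCmem z hz h)
  set p : (Fin n → ℂ) → ℂ := (A.chart i).target.indicator (A.loc i fun y => (η y : ℂ)) with hp
  obtain ⟨hps, hpc⟩ : ContDiff ℝ ∞ p ∧ HasCompactSupport p :=
    contDiff_indicator hto (hη.smooth.ofReal i) hCc hCt fun z hz hzC => by
      simp [CoordCover.loc, hη.zero _ (hzero z hz hzC)]
  have hp0 : ∀ z ∉ A.chart i '' C, p =ᶠ[nhds z] fun _ => 0 := fun z hz => by
    filter_upwards [hCc.isClosed.isOpen_compl.mem_nhds hz] with w hw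
    by_cases hwt : w ∈ (A.chart i).target
    · simp [hp, hwt, CoordCover.loc, hη.zero _ (hzero w hwt hw)]
    · simp [hp, hwt]
  have hp1 : ∀ b, ∀ z ∉ A.chart i '' C, dz b p z = 0 := fun b z hz => by
    rw [dz_congr (hp0 z hz), dz_const]
  have hp2 : ∀ b, ∀ z ∉ A.chart i '' C, dzbar b p z = 0 := fun b z hz => by
    rw [dzbar_congr (hp0 z hz), dzbar_const]
  have hpD : ∀ b, ContDiff ℝ ∞ (dzbar b p) := fun b =>
    contDiff_iff_contDiffAt.2 fun z => contDiffAt_dzbar b hps.contDiffAt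
  set G : (Fin n → ℂ) → Fin n → Fin n → ℂ := fun z a b => (g i z)⁻¹ b a with hG
  -- The coefficients of `u`, of its ∂̄-derivatives and of its ∂-derivatives in the operator applied
  -- to `p * u`, apart from the leading term. They involve `η` and the geometry only, neither `f`
  -- nor `δ`.
  set c₀ : (Fin n → ℂ) → ℂ := fun z => -(∑ a, ∑ b, G z a b * dz a (dzbar b p) z) +
    ∑ b, lapB ρ g i b z * dzbar b p z with hc₀
  set c₁ : Fin n → (Fin n → ℂ) → ℂ := fun b z =>
    -(∑ a, G z a b * dz a p z) + lapB ρ g i b z * p z with hc₁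
  set c₂ : Fin n → (Fin n → ℂ) → ℂ := fun a z => -(∑ b, G z a b * dzbar b p z) with hc₂
  have hdzc : ∀ {q : (Fin n → ℂ) → ℂ} (a : Fin n), ContDiff ℝ ∞ q → Continuous (dz a q) :=
    fun a hq => continuous_iff_continuousAt.2 fun z =>
      (contDiffAt_dz a hq.contDiffAt).continuousAt
  have hdzbc : ∀ {q : (Fin n → ℂ) → ℂ} (a : Fin n), ContDiff ℝ ∞ q → Continuous (dzbar a q) :=
    fun a hq => continuous_iff_continuousAt.2 fun z =>
      (contDiffAt_dzbar a hq.contDiffAt).continuousAt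
  have hBc : ∀ b, ContinuousOn (lapB ρ g i b) (A.chart i).target := fun b z hz =>
    (contDiffAt_lapB hρ hg hz b).continuousAt.continuousWithinAt
  have hcc₀ : ContinuousOn c₀ (A.chart i).target :=
    (continuousOn_finsetSum _ fun a _ => continuousOn_finsetSum _ fun b _ =>
      (hinvc a b).mul (hdzc a (hpD b)).continuousOn).neg.add
    (continuousOn_finsetSum _ fun b _ => (hBc b).mul (hdzbc b hps).continuousOn)
  have hcc₁ : ∀ b, ContinuousOn (c₁ b) (A.chart i).target := fun b =>
    (continuousOn_finsetSum _ fun a _ => (hinvc a b).mul (hdzc a hps).continuousOn).neg.add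
      ((hBc b).mul hps.continuous.continuousOn)
  have hcc₂ : ∀ a, ContinuousOn (c₂ a) (A.chart i).target := fun a =>
    (continuousOn_finsetSum _ fun b _ => (hinvc a b).mul (hdzbc b hps).continuousOn).neg
  obtain ⟨K₁, hK₁⟩ := hCc.exists_bound_of_continuousOn
    ((hcc₀.norm.add ((continuousOn_finsetSum Finset.univ fun b _ => (hcc₁ b).norm).add
      (continuousOn_finsetSum Finset.univ fun a _ => (hcc₂ a).norm))).mono hCt)
  refine ⟨2 * (|K₁| * (Fintype.card (Option (Fin n ⊕ Fin n)) * (C₀ + 1))), by positivity,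
    fun δ hδ f hf => ?_⟩
  have hδ0 : 0 < δ := by linarith
  set φ : (Fin n → ℂ) → ℂ := (A.chart i).target.indicator (A.loc i fun y => (η y : ℂ) * f y)
    with hφ
  obtain ⟨hφs, hφc⟩ : ContDiff ℝ ∞ φ ∧ HasCompactSupport φ :=
    contDiff_indicator hto ((hη.smooth.ofReal.mul hf) i) hCc hCt fun z hz hzC => by
      simp [CoordCover.loc, hη.zero _ (hzero z hz hzC)]
  obtain ⟨u, hus, hue, hu0, hu1, hu2, hu3⟩ := hres δ hδ0 φ hφs hφc
  have huD : ∀ b, ContDiff ℝ ∞ (dzbar b u) := fun b =>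
    contDiff_iff_contDiffAt.2 fun z => contDiffAt_dzbar b hus.contDiffAt
  set w : X → ℂ := A.ext i fun z => p z * u z with hw
  have hpz : ∀ z ∉ A.chart i '' C, p z * u z = 0 := fun z hz => by
    rw [(hp0 z hz).self_of_nhds, zero_mul]
  have hws : A.IsSmooth w := isSmooth_ext hCc hCt hpz fun z _ => (hps.mul hus).contDiffAt
  have hwloc : ∀ z ∈ (A.chart i).target, A.loc i w =ᶠ[nhds z] fun z => p z * u z := fun z hz => by
    filter_upwards [hto.mem_nhds hz] with y hy using loc_ext _ hy
  have hCi : (A.chart i).symm '' (A.chart i '' C) = C := by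
    rw [image_image]
    exact (image_congr fun y hy => (A.chart i).left_inv (hη.subset hy)).trans (image_id C)
  have hwC : ∀ y ∉ C, w y = 0 := fun y hy => ext_eq_zero hpz (by rwa [hCi])
  have hLC : ∀ y ∉ C, lapL A ρ g w y = 0 := fun y hy => lapL_eq_zero hρ hg hws (by
    filter_upwards [hη.compact.isClosed.isOpen_compl.mem_nhds hy] with y' hy' using hwC y' hy')
  -- The error made by freezing the coefficients.
  set T : (Fin n → ℂ) → ℂ := fun z => ∑ a, ∑ b, (P a b - G z a b) * dz a (dzbar b u) z with hT
  have hTc : ContinuousOn T (A.chart i).target :=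
    continuousOn_finsetSum _ fun a _ => continuousOn_finsetSum _ fun b _ =>
      (continuousOn_const.sub (hinvc a b)).mul (hdzc a (huD b)).continuousOn
  -- The indicator confines `e₁` to `C`, where the oscillation bound is available. Continuity is
  -- lost, but measurability is enough.
  set e₁ : X → ℂ := C.indicator (A.ext i T) with he₁
  have he₁m : AEStronglyMeasurable e₁ (volumeFormMeasure A ρ) := by
    rw [he₁, aestronglyMeasurable_indicator_iff hη.compact.measurableSet]
    refine ContinuousOn.aestronglyMeasurable ?_ hη.compact.measurableSet
    refine ContinuousOn.congr (f := fun y => T (A.chart i y)) ?_ fun y hy => ?_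
    · exact hTc.comp ((A.chart i).continuousOn.mono hη.subset) fun y hy =>
        (A.chart i).map_source (hη.subset hy)
    · rw [CoordCover.ext, indicator_of_mem (hη.subset hy)]
  -- Defined as the remainder, so that the required identity holds by construction; `he₂z` then
  -- shows that no second derivative of `u` is left in it.
  set e₂ : X → ℂ := fun y =>
    δ * w y + lapL A ρ g w y - (η y : ℂ) ^ 2 * f y - η y * e₁ y with he₂
  have hηc := hη.smooth.ofReal.continuous
  have he₂m : AEStronglyMeasurable e₂ (volumeFormMeasure A ρ) :=
    ((((hws.continuous.const_mul _).add (isSmooth_lapL hρ hg hws).continuous).sub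
      ((hηc.pow 2).mul hf.continuous)).aestronglyMeasurable).sub
      (hηc.aestronglyMeasurable.mul he₁m)
  have he₁C : ∀ y ∉ C, e₁ y = 0 := fun y hy => indicator_of_notMem hy _
  have he₂C : ∀ y ∉ C, e₂ y = 0 := fun y hy => by
    simp [he₂, hwC y hy, hLC y hy, he₁C y hy, hη.zero y hy]
  have he₁z : ∀ z ∈ (A.chart i).target, (A.chart i).symm z ∈ C → A.loc i e₁ z = T z :=
    fun z hz hzC => by
      rw [← loc_ext (A := A) T hz]
      exact indicator_of_mem hzC _
  have he₂z : ∀ z ∈ (A.chart i).target, (A.chart i).symm z ∈ C → A.loc i e₂ z =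
      c₀ z * u z + (∑ b, c₁ b z * dzbar b u z + ∑ a, c₂ a z * dz a u z) := by
    intro z hz hzC
    have h1 := loc_lapL hρ hg hws hz
    have h2 : ∀ b, dzbar b (A.loc i w) =ᶠ[nhds z] dzbar b fun z => p z * u z := fun b => by
      filter_upwards [(hwloc z hz).eventually_nhds] with y hy using dzbar_congr hy b
    simp only [fun b => (h2 b).self_of_nhds, fun a b => dz_congr (h2 b) a] at h1
    rw [second_order_mul hps hus (fun a b => (g i z)⁻¹ b a) (fun b => lapB ρ g i b z) z] at h1
    have h3 : A.loc i e₂ z = δ * A.loc i w z + A.loc i (lapL A ρ g w) z -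
        (A.loc i (fun y => (η y : ℂ)) z) ^ 2 * A.loc i f z -
        (A.loc i (fun y => (η y : ℂ)) z) * A.loc i e₁ z := rfl
    have h4 : p z = A.loc i (fun y => (η y : ℂ)) z := indicator_of_mem hz _
    have h5 : φ z = A.loc i (fun y => (η y : ℂ)) z * A.loc i f z := indicator_of_mem hz _
    have h6 : T z = ∑ a, ∑ b, P a b * dz a (dzbar b u) z -
        ∑ a, ∑ b, (g i z)⁻¹ b a * dz a (dzbar b u) z := by
      simp only [hT, sub_mul, Finset.sum_sub_distrib, hG]
    have h7 := hue z
    rw [h5] at h7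
    rw [h3, h1, he₁z z hz hzC, (hwloc z hz).self_of_nhds, h6, ← h4]
    rw [← h4] at h7
    linear_combination p z * h7
  have hQ := chart_le_eLpNorm_sq hρ.toIsDensity (i := i) (F := fun y => (η y : ℂ) * f y) (C := C)
    (c := r) (φ := φ) (hηc.mul hf.continuous).aestronglyMeasurable hη.subset
    (fun y hy => by simp [hη.zero y hy]) (fun z hz hzC => (hCz z hz hzC).1.1)
    (fun z hz => indicator_of_mem hz _) (fun z hz => indicator_of_notMem hz _)
  refine ⟨w, e₁, e₂, hws, he₁m, he₂m, fun y => by simp only [he₂]; ring, ?_, ?_⟩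
  · have hN := eLpNorm_const_mul_sum_norm_le (κ := Fin n × Fin n) (c := ε) (B := C₀)
      (M := eLpNorm φ 2 volume) (s := fun k => dz k.1 (dzbar k.2 u)) hε0.le
      (fun k => hdzc k.1 (huD k.2)) (fun k => hu3 k.1 k.2)
    have h1 := eLpNorm_sq_le_chart hρ.toIsDensity (i := i) he₁m hη.subset he₁C
      (fun z hz hzC => (hCz z hz hzC).1.2) (G := fun z => ε * ∑ k : Fin n × Fin n,
        ‖dz k.1 (dzbar k.2 u) z‖) fun z hz hzC => by
      rw [he₁z z hz hzC, hT, Fintype.sum_prod_type, Finset.mul_sum]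
      refine (norm_sum_le _ _).trans (Finset.sum_le_sum fun a _ => ?_)
      rw [Finset.mul_sum]
      refine (norm_sum_le _ _).trans (Finset.sum_le_sum fun b _ => ?_)
      rw [norm_mul]
      exact mul_le_mul_of_nonneg_right ((hCz z hz hzC).2 a b) (norm_nonneg _)
    refine (le_of_sq_le_chart (by positivity) (h1.trans (mul_le_mul_right (pow_le_pow_left' hN 2) _)) hQ).trans (mul_le_mul_left (ENNReal.ofReal_le_ofReal ?_) _)
    rw [hε, Fintype.card_prod, Fintype.card_fin]
    push_cast
    have : 0 < 16 * ((n : ℝ) ^ 2 * C₀ + 1) := by positivity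
    rw [← mul_assoc, mul_one_div, div_mul_eq_mul_div, div_le_div_iff₀ this (by norm_num)]
    nlinarith
  · have hsq : 0 < √δ := Real.sqrt_pos.2 hδ0
    -- The index type lists `u`, its `n` ∂̄-derivatives and its `n` ∂-derivatives.
    have hN := eLpNorm_const_mul_sum_norm_le (κ := Option (Fin n ⊕ Fin n)) (c := |K₁|)
      (B := (C₀ + 1) / √δ) (M := eLpNorm φ 2 volume)
      (s := fun k => k.elim u (Sum.elim (fun b => dzbar b u) fun a => dz a u)) (abs_nonneg _)
      (by
        rintro (_ | b | a)
        · exact hus.continuous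
        · exact hdzbc b hus
        · exact hdzc a hus)
      (by
        rintro (_ | b | a)
        · refine hu0.trans ?_
          gcongr
          -- The only use of `1 ≤ δ` in the estimates: it gives `1/δ ≤ 1/√δ`, so the order zero term
          -- obeys the same bound as the first order ones.
          rw [inv_eq_one_div, div_le_div_iff₀ hδ0 hsq]
          have h8 : √δ * √δ = δ := Real.mul_self_sqrt hδ0.le
          have h9 : 1 ≤ √δ := Real.one_le_sqrt.2 hδ
          nlinarith
        · refine (hu2 b).trans ?_
          gcongr
          linarith
        · refine (hu1 a).trans ?_
          gcongr
          linarith)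
    have h1 := eLpNorm_sq_le_chart hρ.toIsDensity (i := i) he₂m hη.subset he₂C
      (fun z hz hzC => (hCz z hz hzC).1.2) (G := fun z => |K₁| * ∑ k : Option (Fin n ⊕ Fin n),
        ‖(k.elim u (Sum.elim (fun b => dzbar b u) fun a => dz a u) : (Fin n → ℂ) → ℂ) z‖)
      fun z hz hzC => by
        have hk : ‖c₀ z‖ + (∑ b, ‖c₁ b z‖ + ∑ a, ‖c₂ a z‖) ≤ |K₁| :=
          (le_abs_self _).trans ((hK₁ z (hCmem z hz hzC)).trans (le_abs_self K₁))
        have s1 : ∀ b, ‖c₁ b z‖ ≤ ∑ b, ‖c₁ b z‖ := fun b =>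
          Finset.single_le_sum (f := fun b => ‖c₁ b z‖) (fun _ _ => norm_nonneg _) (Finset.mem_univ b)
        have s2 : ∀ b, ‖c₂ b z‖ ≤ ∑ b, ‖c₂ b z‖ := fun b =>
          Finset.single_le_sum (f := fun b => ‖c₂ b z‖) (fun _ _ => norm_nonneg _) (Finset.mem_univ b)
        have p1 : 0 ≤ ∑ b, ‖c₁ b z‖ := by positivity
        have p2 : 0 ≤ ∑ b, ‖c₂ b z‖ := by positivity
        have p0 := norm_nonneg (c₀ z)
        rw [he₂z z hz hzC, Fintype.sum_option, Fintype.sum_sum_type, mul_add, mul_add,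
          Finset.mul_sum, Finset.mul_sum]
        refine (norm_add_le _ _).trans (add_le_add ?_ ((norm_add_le _ _).trans (add_le_add
          ((norm_sum_le _ _).trans (Finset.sum_le_sum fun b _ => ?_))
          ((norm_sum_le _ _).trans (Finset.sum_le_sum fun b _ => ?_)))))
        · rw [norm_mul]
          exact mul_le_mul_of_nonneg_right (by linarith) (norm_nonneg _)
        · rw [norm_mul]
          exact mul_le_mul_of_nonneg_right (by linarith [s1 b]) (norm_nonneg _)
        · rw [norm_mul]
          exact mul_le_mul_of_nonneg_right (by linarith [s2 b]) (norm_nonneg _)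
    refine (le_of_sq_le_chart (by positivity) (h1.trans (mul_le_mul_right (pow_le_pow_left' hN 2) _)) hQ).trans (le_of_eq ?_)
    congr 2
    ring

end

end

/-! ### Dense range of `δ + L`, and the part orthogonal to the range of `L`. -/

section

variable {n : ℕ}
variable {X : Type*} [TopologicalSpace X] [ChartedSpace (Fin n → ℂ) X] {ι : Type*}
  {A : CoordCover n X ι}

open ComplexConjugate

section
variable [MeasurableSpace X] [BorelSpace X] {ρ : ι → (Fin n → ℂ) → ℝ}
  [IsManifold 𝓘(ℂ, Fin n → ℂ) ω X] [T2Space X] [CompactSpace X]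
  {g : ι → (Fin n → ℂ) → Matrix (Fin n) (Fin n) ℂ} {u v f : X → ℂ}

/-- Cauchy-Schwarz with weights of square sum one. The absence of a factor counting the charts is
what preserves the bound 1/8 of the freezing error, since the number of charts depends on how small
the neighbourhoods had to be. -/
theorem enorm_sum_mul_sq_le {κ : Type*} (s : Finset κ) (a : κ → ℝ) (e : κ → ℂ)
    (ha : ∑ k ∈ s, a k ^ 2 = 1) : ‖∑ k ∈ s, (a k : ℂ) * e k‖ₑ ^ 2 ≤ ∑ k ∈ s, ‖e k‖ₑ ^ 2 := by
  have h1 : ‖∑ k ∈ s, (a k : ℂ) * e k‖ ^ 2 ≤ ∑ k ∈ s, ‖e k‖ ^ 2 := by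
    have h2 : ‖∑ k ∈ s, (a k : ℂ) * e k‖ ≤ ∑ k ∈ s, |a k| * ‖e k‖ :=
      (norm_sum_le _ _).trans (le_of_eq (Finset.sum_congr rfl fun k _ => by simp))
    have h3 := Finset.sum_mul_sq_le_sq_mul_sq s (fun k => |a k|) (fun k => ‖e k‖)
    simp only [sq_abs, ha, one_mul] at h3
    exact (pow_le_pow_left₀ (norm_nonneg _) h2 2).trans h3
  have h4 := ENNReal.ofReal_le_ofReal h1
  rw [ENNReal.ofReal_sum_of_nonneg fun k _ => by positivity] at h4
  simpa only [ENNReal.ofReal_pow (norm_nonneg _), ofReal_norm] using h4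

/-- The sum of the local parametrices. The freezing errors contribute 1/8 by the weighted
Cauchy-Schwarz inequality; the lower order errors are added by the triangle inequality and
contribute another 1/8 once `δ` is large. -/
theorem exists_resolvent_half (hρ : IsSmoothDensity A ρ) (hg : IsKahler A g) :
    ∃ δ : ℝ, 0 < δ ∧ ∀ f : X → ℂ, A.IsSmooth f → ∃ u : X → ℂ, A.IsSmooth u ∧
      eLpNorm (fun x => δ * u x + lapL A ρ g u x - f x) 2 (volumeFormMeasure A ρ) ≤
        ENNReal.ofReal (1 / 4) * eLpNorm f 2 (volumeFormMeasure A ρ) := by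
  choose N hN hpar using exists_local_parametrix (A := A) hρ hg
  obtain ⟨K, η, C, hη, hCN, hsum⟩ := exists_sq_partition A hN
  choose κ hκ0 hκ using fun k => hpar k (η k) (C k) (hη k) (hCN k)
  set s : ℝ := ∑ k ∈ K, κ k with hs
  have hs0 : 0 ≤ s := Finset.sum_nonneg fun k _ => hκ0 k
  -- Here `√δ = 8 s + 1`, so the lower order errors sum to `s / (8 s + 1) ≤ 1/8`; moreover `δ ≥ 1`.
  refine ⟨(8 * s + 1) ^ 2, by positivity, fun f hf => ?_⟩
  choose w e₁ e₂ hw he₁ he₂ heq hn₁ hn₂ using fun k => hκ k ((8 * s + 1) ^ 2) (by nlinarith) f hf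
  rw [Real.sqrt_sq (by positivity)] at hn₂
  set μ := volumeFormMeasure A ρ
  refine ⟨fun x => ∑ k ∈ K, w k x, CoordCover.IsSmooth.sum fun k _ => hw k, ?_⟩
  have hsplit : (fun x => (((8 * s + 1) ^ 2 : ℝ) : ℂ) * (∑ k ∈ K, w k x) +
      lapL A ρ g (fun x => ∑ k ∈ K, w k x) x - f x) =
      (fun x => ∑ k ∈ K, (η k x : ℂ) * e₁ k x) + ∑ k ∈ K, e₂ k := by
    ext x
    have h1 : f x = ∑ k ∈ K, (η k x : ℂ) ^ 2 * f x := by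
      rw [← Finset.sum_mul]
      have : (∑ k ∈ K, (η k x : ℂ) ^ 2) = 1 := by exact_mod_cast hsum x
      rw [this, one_mul]
    rw [lapL_sum hρ hg K (fun k _ => hw k)]
    conv_lhs => rw [h1]
    rw [Finset.mul_sum, ← Finset.sum_add_distrib, ← Finset.sum_sub_distrib,
      Pi.add_apply, Finset.sum_apply, ← Finset.sum_add_distrib]
    exact Finset.sum_congr rfl fun k _ => heq k x
  have hηc : ∀ k, Continuous fun x => (η k x : ℂ) := fun k => (hη k).smooth.ofReal.continuous
  have hηf : ∀ x, ∑ k ∈ K, ‖(η k x : ℂ) * f x‖ₑ ^ 2 = ‖f x‖ₑ ^ 2 := fun x => by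
    have h1 : ∑ k ∈ K, ‖(η k x : ℂ) * f x‖ ^ 2 = ‖f x‖ ^ 2 := by
      simp only [norm_mul, mul_pow, Complex.norm_real, Real.norm_eq_abs, sq_abs]
      rw [← Finset.sum_mul, hsum, one_mul]
    have h2 := congrArg ENNReal.ofReal h1
    rw [ENNReal.ofReal_sum_of_nonneg fun k _ => by positivity] at h2
    simpa only [ENNReal.ofReal_pow (norm_nonneg _), ofReal_norm] using h2
  have hA : eLpNorm (fun x => ∑ k ∈ K, (η k x : ℂ) * e₁ k x) 2 μ ≤
      ENNReal.ofReal (1 / 8) * eLpNorm f 2 μ := by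
    refine (ENNReal.pow_le_pow_left_iff two_ne_zero).1 ?_
    calc eLpNorm (fun x => ∑ k ∈ K, (η k x : ℂ) * e₁ k x) 2 μ ^ 2
        = ∫⁻ x, ‖∑ k ∈ K, (η k x : ℂ) * e₁ k x‖ₑ ^ 2 ∂μ := eLpNorm_two_sq _
      _ ≤ ∫⁻ x, ∑ k ∈ K, ‖e₁ k x‖ₑ ^ 2 ∂μ :=
        lintegral_mono fun x => enorm_sum_mul_sq_le K (fun k => η k x) (fun k => e₁ k x) (hsum x)
      _ = ∑ k ∈ K, eLpNorm (e₁ k) 2 μ ^ 2 := by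
        rw [lintegral_finsetSum' _ fun k _ => (he₁ k).enorm.pow_const 2]
        simp only [eLpNorm_two_sq]
      _ ≤ ∑ k ∈ K, (ENNReal.ofReal (1 / 8) * eLpNorm (fun x => (η k x : ℂ) * f x) 2 μ) ^ 2 :=
        Finset.sum_le_sum fun k _ => pow_le_pow_left' (hn₁ k) 2
      _ = ENNReal.ofReal (1 / 8) ^ 2 * ∫⁻ x, ∑ k ∈ K, ‖(η k x : ℂ) * f x‖ₑ ^ 2 ∂μ := by
        have hm : ∀ k ∈ K, AEMeasurable (fun x => ‖(η k x : ℂ) * f x‖ₑ ^ 2) μ := fun k _ =>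
          ((hηc k).mul hf.continuous).aestronglyMeasurable.enorm.pow_const 2
        rw [lintegral_finsetSum' _ hm, Finset.mul_sum]
        simp only [mul_pow, eLpNorm_two_sq]
      _ = _ := by simp only [hηf, mul_pow, eLpNorm_two_sq]
  have hB : eLpNorm (∑ k ∈ K, e₂ k) 2 μ ≤ ENNReal.ofReal (1 / 8) * eLpNorm f 2 μ := by
    refine (eLpNorm_sum_le (fun k _ => he₂ k) (by simp)).trans ?_
    have h1 : ∀ k ∈ K, eLpNorm (fun x => (η k x : ℂ) * f x) 2 μ ≤ eLpNorm f 2 μ := fun k hk => by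
      refine eLpNorm_mono fun x => ?_
      have h2 : η k x ^ 2 ≤ 1 := hsum x ▸
        Finset.single_le_sum (f := fun k => η k x ^ 2) (fun _ _ => sq_nonneg _) hk
      rw [norm_mul, Complex.norm_real, Real.norm_eq_abs]
      exact mul_le_of_le_one_left (norm_nonneg _) ((sq_le_one_iff_abs_le_one _).1 h2)
    refine (Finset.sum_le_sum fun k hk => (hn₂ k).trans (mul_le_mul_right (h1 k hk) _)).trans ?_
    rw [← Finset.sum_mul, ← ENNReal.ofReal_sum_of_nonneg fun k _ =>
      div_nonneg (hκ0 k) (by positivity), ← Finset.sum_div, ← hs]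
    refine mul_le_mul_left (ENNReal.ofReal_le_ofReal ?_) _
    rw [div_le_div_iff₀ (by positivity) (by norm_num)]
    linarith
  rw [hsplit]
  have hm : AEStronglyMeasurable (fun x => ∑ k ∈ K, (η k x : ℂ) * e₁ k x) μ :=
    Finset.aestronglyMeasurable_fun_sum _ fun k _ => (hηc k).aestronglyMeasurable.mul (he₁ k)
  have hm' : AEStronglyMeasurable (∑ k ∈ K, e₂ k) μ :=
    Finset.aestronglyMeasurable_sum _ fun k _ => he₂ k
  refine (eLpNorm_add_le hm hm' (by simp)).trans ((add_le_add hA hB).trans (le_of_eq ?_))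
  rw [← add_mul, ← ENNReal.ofReal_add (by norm_num) (by norm_num)]
  norm_num

theorem lapL_add (hρ : IsSmoothDensity A ρ) (hg : IsKahler A g) (hu : A.IsSmooth u)
    (hv : A.IsSmooth v) (x : X) :
    lapL A ρ g (fun x => u x + v x) x = lapL A ρ g u x + lapL A ρ g v x := by
  have h := lapL_sum hρ hg (Finset.univ : Finset (Fin 2)) (f := ![u, v])
    (fun k _ => by fin_cases k <;> assumption) x
  simpa [Fin.sum_univ_two] using h

theorem lapL_const_mul (hρ : IsSmoothDensity A ρ) (hg : IsKahler A g) (c : ℂ) (hu : A.IsSmooth u)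
    (x : X) : lapL A ρ g (fun x => c * u x) x = c * lapL A ρ g u x := by
  have hz := (A.chart (A.indexAt x)).map_source (A.mem_indexAt x)
  have hx := (A.chart (A.indexAt x)).left_inv (A.mem_indexAt x)
  have key : ∀ {u : X → ℂ}, A.IsSmooth u → lapL A ρ g u x = _ := fun {u} hu =>
    (congrArg (lapL A ρ g u) hx).symm.trans (loc_lapL hρ hg hu hz)
  have h1 : ∀ b, ∀ z ∈ (A.chart (A.indexAt x)).target,
      dzbar b (A.loc (A.indexAt x) fun x => c * u x) z = c * dzbar b (A.loc (A.indexAt x) u) z :=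
    fun b z hz => dzbar_const_mul b c ((hu _ z hz).differentiableAt (by simp))
  have h2 : ∀ a b, dz a (dzbar b (A.loc (A.indexAt x) fun x => c * u x))
      (A.chart (A.indexAt x) x) =
      c * dz a (dzbar b (A.loc (A.indexAt x) u)) (A.chart (A.indexAt x) x) := fun a b => by
    rw [← dz_const_mul a c ((contDiffAt_dzbar b (hu _ _ hz)).differentiableAt (by simp))]
    exact dz_congr (Filter.eventually_of_mem
      ((A.chart (A.indexAt x)).open_target.mem_nhds hz) (h1 b)) a
  rw [key ((isSmooth_const c).mul hu), key hu]
  simp only [h1 _ _ hz, h2, mul_add, mul_neg, Finset.mul_sum, mul_left_comm]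

theorem dbarSq_const_mul (hu : A.IsSmooth u) (c : ℝ) (x : X) :
    dbarSq A g (fun x => c * u x) x = c ^ 2 * dbarSq A g u x := by
  have hz := (A.chart (A.indexAt x)).map_source (A.mem_indexAt x)
  have h1 : ∀ b, dzbar b (A.loc (A.indexAt x) fun x => (c : ℂ) * u x) (A.chart (A.indexAt x) x) =
      c * dzbar b (A.loc (A.indexAt x) u) (A.chart (A.indexAt x) x) := fun b =>
    dzbar_const_mul b _ ((hu _ _ hz).differentiableAt (by simp))
  have h2 : ∀ a, dz a (A.loc (A.indexAt x) fun x => conj ((c : ℂ) * u x))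
      (A.chart (A.indexAt x) x) =
      c * dz a (A.loc (A.indexAt x) fun x => conj (u x)) (A.chart (A.indexAt x) x) := fun a => by
    refine (dz_conj a (A.loc (A.indexAt x) fun x => (c : ℂ) * u x) _).trans ?_
    rw [h1, map_mul, Complex.conj_ofReal]
    exact congrArg _ (dz_conj a _ _).symm
  have h3 : dirD A (gradV A g fun x => (c : ℂ) * u x) (fun x => conj ((c : ℂ) * u x)) x =
      ((c ^ 2 : ℝ) : ℂ) * dirD A (gradV A g u) (fun x => conj (u x)) x := by
    simp only [dirD, h2, gradV, Matrix.mulVec, dotProduct, h1]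
    simp only [Finset.mul_sum, Finset.sum_mul]
    push_cast
    refine Finset.sum_congr rfl fun a _ => Finset.sum_congr rfl fun b _ => ?_
    ring
  rw [dbarSq, h3, Complex.re_ofReal_mul]
  rfl

theorem memLp_of_continuous (hρ : IsDensity A ρ) (hu : Continuous u) :
    MemLp u 2 (volumeFormMeasure A ρ) := by
  have := isFiniteMeasure_volumeForm hρ
  obtain ⟨c, hc⟩ := isCompact_univ.exists_bound_of_continuousOn hu.continuousOn
  exact MemLp.of_bound hu.aestronglyMeasurable c
    (Filter.Eventually.of_forall fun x => hc x (mem_univ x))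

/-- A Neumann series: each step solves for the residual left by the previous one and divides its
norm by four. -/
theorem exists_resolvent_approx (hρ : IsSmoothDensity A ρ) (hg : IsKahler A g) :
    ∃ δ : ℝ, 0 < δ ∧ ∀ f : X → ℂ, A.IsSmooth f → ∀ ε : ℝ, 0 < ε → ∃ u : X → ℂ, A.IsSmooth u ∧
      eLpNorm (fun x => δ * u x + lapL A ρ g u x - f x) 2 (volumeFormMeasure A ρ) ≤
        ENNReal.ofReal ε := by
  obtain ⟨δ, hδ, h⟩ := exists_resolvent_half (A := A) hρ hg
  refine ⟨δ, hδ, fun f hf ε hε => ?_⟩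
  have key : ∀ m : ℕ, ∃ u : X → ℂ, A.IsSmooth u ∧
      eLpNorm (fun x => δ * u x + lapL A ρ g u x - f x) 2 (volumeFormMeasure A ρ) ≤
        ENNReal.ofReal ((1 / 4) ^ m) * eLpNorm f 2 (volumeFormMeasure A ρ) := by
    intro m
    induction m with
    | zero =>
      refine ⟨fun _ => 0, isSmooth_const 0, ?_⟩
      have h0 : ∀ x, lapL A ρ g (fun _ => 0) x = 0 := fun x =>
        lapL_eq_zero hρ hg (isSmooth_const 0) (Filter.EventuallyEq.refl _ _)
      simp only [h0, mul_zero, zero_add, zero_sub, pow_zero, ENNReal.ofReal_one, one_mul]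
      exact (eLpNorm_neg f 2 _).le
    | succ m ih =>
      obtain ⟨u, hu, hun⟩ := ih
      have hδu := (isSmooth_const (A := A) (δ : ℂ)).mul hu
      have hr : A.IsSmooth fun x => f x + (-1 : ℂ) * (δ * u x + lapL A ρ g u x) :=
        hf.add ((isSmooth_const _).mul (hδu.add (isSmooth_lapL hρ hg hu)))
      obtain ⟨v, hv, hvn⟩ := h _ hr
      refine ⟨fun x => u x + v x, hu.add hv, ?_⟩
      have e1 : (fun x => (δ : ℂ) * (u x + v x) + lapL A ρ g (fun x => u x + v x) x - f x) =
          fun x => δ * v x + lapL A ρ g v x -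
            (f x + (-1 : ℂ) * (δ * u x + lapL A ρ g u x)) := by
        ext x
        rw [lapL_add hρ hg hu hv]
        ring
      have e2 : (fun x => f x + (-1 : ℂ) * (δ * u x + lapL A ρ g u x)) =
          -fun x => δ * u x + lapL A ρ g u x - f x := by
        ext x
        simp only [Pi.neg_apply]
        ring
      rw [e1]
      refine hvn.trans ?_
      rw [e2, eLpNorm_neg, pow_succ', ENNReal.ofReal_mul (by norm_num), mul_assoc]
      exact mul_le_mul_right hun _
  have hfin := (memLp_of_continuous hρ.toIsDensity hf.continuous).eLpNorm_ne_top
  set c := (eLpNorm f 2 (volumeFormMeasure A ρ)).toReal with hc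
  obtain ⟨m, hm⟩ := exists_pow_lt_of_lt_one (show 0 < ε / (c + 1) by positivity)
    (show (1 / 4 : ℝ) < 1 by norm_num)
  obtain ⟨u, hu, hun⟩ := key m
  refine ⟨u, hu, hun.trans ?_⟩
  rw [← ENNReal.ofReal_toReal hfin, ← hc, ← ENNReal.ofReal_mul (by positivity)]
  refine ENNReal.ofReal_le_ofReal ?_
  have hc0 : 0 ≤ c := ENNReal.toReal_nonneg
  rw [lt_div_iff₀ (by positivity)] at hm
  have : 0 ≤ (1 / 4 : ℝ) ^ m := by positivity
  nlinarith

theorem inner_toLp_eq {α : Type*} [MeasurableSpace α] {μ : Measure α} {p q : α → ℂ}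
    (hp : MemLp p 2 μ) (hq : MemLp q 2 μ) :
    inner ℂ (hp.toLp p) (hq.toLp q) = ∫ x, conj (p x) * q x ∂μ := by
  rw [L2.inner_def]
  refine integral_congr_ae ?_
  filter_upwards [hp.coeFn_toLp, hq.coeFn_toLp] with x h1 h2
  rw [h1, h2, RCLike.inner_apply, mul_comm]

theorem integral_conj_mul_lapL (hρ : IsSmoothDensity A ρ) (hg : IsKahler A g)
    (hu : A.IsSmooth u) : ∫ x, conj (u x) * lapL A ρ g u x ∂(volumeFormMeasure A ρ) =
      ((∫ x, dbarSq A g u x ∂(volumeFormMeasure A ρ) : ℝ) : ℂ) := by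
  rw [integral_mul_lapL hρ hg hu hu.conj]
  exact (integral_congr_ae (Filter.Eventually.of_forall fun x =>
    (ofReal_dbarSq hg hu x).symm)).trans integral_complex_ofReal

/-- Let `h` be the component of `f` orthogonal to the range of `L`. Subtracting a suitable `Lw` from
`f` approximates `h`, and `δ u + L u` approximates the result with `u` smooth. Since `h` is
orthogonal to `L u`, pairing the equation with `L u` forces both `‖L u‖` and the Dirichlet energy of
`u` to be small, so `v = δ u` is close to `h`. -/
theorem exists_almost_holomorphic_limit (hρ : IsSmoothDensity A ρ) (hg : IsKahler A g)
    (hf : A.IsSmooth f) : ∃ h : X → ℂ, StronglyMeasurable h ∧ MemLp h 2 (volumeFormMeasure A ρ) ∧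
      (∀ ε : ℝ, 0 < ε → ∃ v : X → ℂ, A.IsSmooth v ∧
        eLpNorm (fun x => v x - h x) 2 (volumeFormMeasure A ρ) ≤ ENNReal.ofReal ε ∧
        ∫ x, dbarSq A g v x ∂(volumeFormMeasure A ρ) ≤ ε) ∧
      ∀ ε : ℝ, 0 < ε → ∃ w : X → ℂ, A.IsSmooth w ∧
        eLpNorm (fun x => f x - h x - lapL A ρ g w x) 2 (volumeFormMeasure A ρ) ≤
          ENNReal.ofReal ε := by
  obtain ⟨δ, hδ, hres⟩ := exists_resolvent_approx (A := A) hρ hg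
  set μ := volumeFormMeasure A ρ
  have hM : ∀ {u : X → ℂ}, A.IsSmooth u → MemLp u 2 μ := fun hu =>
    memLp_of_continuous hρ.toIsDensity hu.continuous
  have hL : ∀ {u : X → ℂ}, A.IsSmooth u → A.IsSmooth (lapL A ρ g u) := fun hu =>
    isSmooth_lapL hρ hg hu
  let R : Submodule ℂ (Lp ℂ 2 μ) :=
    { carrier := {q | ∃ u, ∃ hu : A.IsSmooth u, q = (hM (hL hu)).toLp (lapL A ρ g u)}
      add_mem' := by
        rintro _ _ ⟨u, hu, rfl⟩ ⟨v, hv, rfl⟩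
        refine ⟨fun x => u x + v x, hu.add hv, ?_⟩
        rw [← MemLp.toLp_add]
        exact MemLp.toLp_congr _ _ (Filter.Eventually.of_forall fun x =>
          (lapL_add hρ hg hu hv x).symm)
      zero_mem' := by
        refine ⟨fun _ => 0, isSmooth_const 0, ?_⟩
        rw [← MemLp.toLp_zero (MemLp.zero' (p := 2) (μ := μ))]
        exact MemLp.toLp_congr _ _ (Filter.Eventually.of_forall fun x =>
          (lapL_eq_zero hρ hg (isSmooth_const 0) (Filter.EventuallyEq.refl _ _)).symm)
      smul_mem' := by
        rintro c _ ⟨u, hu, rfl⟩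
        refine ⟨fun x => c * u x, (isSmooth_const c).mul hu, ?_⟩
        rw [← MemLp.toLp_const_smul]
        exact MemLp.toLp_congr _ _ (Filter.Eventually.of_forall fun x =>
          (lapL_const_mul hρ hg c hu x).symm) }
  set F : Lp ℂ 2 μ := (hM hf).toLp f
  -- The projection onto the closed range; it is a limit of functions `Lw` with `w` smooth, which
  -- also gives the second conclusion.
  set q : Lp ℂ 2 μ := R.topologicalClosure.starProjection F with hq
  have hqR : q ∈ closure (R : Set (Lp ℂ 2 μ)) := R.topologicalClosure.starProjection_apply_mem F
  set h : Lp ℂ 2 μ := F - q with hh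
  have horth : ∀ {u : X → ℂ} (hu : A.IsSmooth u),
      inner ℂ h ((hM (hL hu)).toLp (lapL A ρ g u)) = 0 := fun {u} hu =>
    Submodule.inner_left_of_mem_orthogonal (R.le_topologicalClosure ⟨u, hu, rfl⟩)
      (R.topologicalClosure.sub_starProjection_mem_orthogonal F)
  have hnorm : ∀ {p : X → ℂ} (hp : MemLp p 2 μ) {ε : ℝ}, ‖hp.toLp p - h‖ ≤ ε →
      eLpNorm (fun x => p x - h x) 2 μ ≤ ENNReal.ofReal ε := fun {p} hp {ε} hε => by
    rw [Lp.norm_def, eLpNorm_congr_ae (Lp.coeFn_sub _ _)] at hε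
    have hae : (fun x => p x - h x) =ᵐ[μ] ((hp.toLp p : X → ℂ) - (h : X → ℂ)) := by
      filter_upwards [hp.coeFn_toLp] with x hx
      rw [Pi.sub_apply, hx]
    rw [eLpNorm_congr_ae hae]
    exact (ENNReal.le_ofReal_iff_toReal_le ((Lp.memLp _).sub (Lp.memLp _)).eLpNorm_ne_top
      ((ENNReal.toReal_nonneg).trans hε)).2 hε
  have happ : ∀ ε : ℝ, 0 < ε → ∃ w : X → ℂ, ∃ hw : A.IsSmooth w,
      ‖q - (hM (hL hw)).toLp (lapL A ρ g w)‖ < ε := fun ε hε => by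
    obtain ⟨_, ⟨w, hw, rfl⟩, hd⟩ := Metric.mem_closure_iff.1 hqR ε hε
    exact ⟨w, hw, by rwa [← dist_eq_norm]⟩
  refine ⟨h, Lp.stronglyMeasurable h, Lp.memLp h, fun ε hε => ?_, fun ε hε => ?_⟩
  -- The distance from `δ u` to `h` will be at most `2 b`, and its energy at most `δ b²`. The bounds
  -- `b ≤ 1` and `b ≤ ε / δ` make the latter at most `ε`.
  · set b : ℝ := min (ε / 2) (min 1 (ε / δ)) with hb
    have hb0 : 0 < b := by positivity
    obtain ⟨w, hw, hwq⟩ := happ (b / 2) (by positivity)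
    have hfw : A.IsSmooth fun x => f x + (-1 : ℂ) * lapL A ρ g w x :=
      hf.add ((isSmooth_const _).mul (hL hw))
    obtain ⟨u, hu, hun⟩ := hres _ hfw (b / 2) (by positivity)
    have hδu : A.IsSmooth fun x => (δ : ℂ) * u x := (isSmooth_const _).mul hu
    set U := (hM hu).toLp u
    set LU := (hM (hL hu)).toLp (lapL A ρ g u) with hLU
    have e1 : (hM hfw).toLp _ = F - (hM (hL hw)).toLp (lapL A ρ g w) := by
      rw [← MemLp.toLp_sub]
      exact MemLp.toLp_congr _ _ (Filter.Eventually.of_forall fun x => by simp [sub_eq_add_neg])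
    have e2 : (hM (hδu.add (hL hu))).toLp _ = (δ : ℂ) • U + LU := by
      rw [← MemLp.toLp_const_smul, ← MemLp.toLp_add]
      rfl
    have hr1 : ‖(δ : ℂ) • U + LU - (hM hfw).toLp _‖ ≤ b / 2 := by
      rw [← e2, ← MemLp.toLp_sub, Lp.norm_toLp]
      exact ENNReal.toReal_le_of_le_ofReal (by positivity) hun
    have hr : ‖(δ : ℂ) • U + LU - h‖ ≤ b := by
      have e3 : (δ : ℂ) • U + LU - h = ((δ : ℂ) • U + LU - (hM hfw).toLp _) +
          (q - (hM (hL hw)).toLp (lapL A ρ g w)) := by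
        rw [e1, hh]
        abel
      rw [e3]
      exact (norm_add_le _ _).trans (by linarith)
    set D := ∫ x, dbarSq A g u x ∂μ with hD
    have hD0 : 0 ≤ D := integral_nonneg fun x => dbarSq_nonneg hg hu x
    have hin : inner ℂ U LU = (D : ℂ) := by
      rw [inner_toLp_eq, integral_conj_mul_lapL hρ hg hu]
    -- The inner product of `δ u + L u - h` with `L u`: the pairing with `h` vanishes and that of
    -- `u` with `L u` is the energy `D`.
    have key : δ * D + ‖LU‖ ^ 2 ≤ b * ‖LU‖ := by
      have h1 : inner ℂ ((δ : ℂ) • U + LU - h) LU = ((δ * D + ‖LU‖ ^ 2 : ℝ) : ℂ) := by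
        rw [inner_sub_left, horth hu, inner_add_left, inner_smul_left, hin,
          inner_self_eq_norm_sq_to_K, Complex.conj_ofReal]
        push_cast
        simp
      have h2 := norm_inner_le_norm (𝕜 := ℂ) ((δ : ℂ) • U + LU - h) LU
      rw [h1, Complex.norm_real] at h2
      exact (le_abs_self _).trans (h2.trans (mul_le_mul_of_nonneg_right hr (norm_nonneg _)))
    have ha : ‖LU‖ ≤ b := by
      by_contra! hcon
      nlinarith [mul_nonneg hδ.le hD0]
    have hDb : δ * D ≤ b ^ 2 := by nlinarith [norm_nonneg LU]
    refine ⟨fun x => δ * u x, hδu, ?_, ?_⟩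
    · refine hnorm (hM hδu) ?_
      have e4 : (hM hδu).toLp _ = (δ : ℂ) • U := by
        rw [← MemLp.toLp_const_smul]
        rfl
      have e5 : (δ : ℂ) • U - h = ((δ : ℂ) • U + LU - h) - LU := by abel
      rw [e4, e5]
      have : b ≤ ε / 2 := min_le_left _ _
      exact (norm_sub_le _ _).trans (by linarith)
    · simp only [dbarSq_const_mul hu]
      rw [integral_const_mul, ← hD]
      have h1 : b ≤ 1 := (min_le_right _ _).trans (min_le_left _ _)
      have h2 : b ≤ ε / δ := (min_le_right _ _).trans (min_le_right _ _)
      rw [le_div_iff₀ hδ] at h2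
      nlinarith
  · obtain ⟨w, hw, hwq⟩ := happ ε hε
    refine ⟨w, hw, ?_⟩
    have e1 : (fun x => f x - h x - lapL A ρ g w x) = fun x => (f - lapL A ρ g w) x - h x := by
      ext x
      simp only [Pi.sub_apply]
      ring
    rw [e1]
    refine hnorm ((hM hf).sub (hM (hL hw))) ?_
    have e2 : ((hM hf).sub (hM (hL hw))).toLp _ - h = q - (hM (hL hw)).toLp (lapL A ρ g w) := by
      rw [MemLp.toLp_sub]
      change F - (hM (hL hw)).toLp (lapL A ρ g w) - (F - q) = _
      abel
    rw [e2]
    exact hwq.le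

end

end

/-! ### The Riemannian density `det g`, for which the operator is real. -/

section

variable {n : ℕ}
variable {X : Type*} [TopologicalSpace X] [ChartedSpace (Fin n → ℂ) X] {ι : Type*}
  {A : CoordCover n X ι}

open ComplexConjugate Matrix

/-- The Leibniz expansion shows that the derivative depends only on `M t` and `M'`. It can therefore
be computed on the affine path `M t + s M'`, where factoring out `M t` leaves the known expansion of
`det (1 + s N)`. -/
theorem hasDerivAt_det {M : ℝ → Matrix (Fin n) (Fin n) ℂ} {M' : Matrix (Fin n) (Fin n) ℂ} {t : ℝ}
    (hM : ∀ a b, HasDerivAt (fun s => M s a b) (M' a b) t) (h0 : (M t).det ≠ 0) :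
    HasDerivAt (fun s => (M s).det) ((M t).det * ((M t)⁻¹ * M').trace) t := by
  have key : ∀ {N : ℝ → Matrix (Fin n) (Fin n) ℂ} {r : ℝ},
      (∀ a b, HasDerivAt (fun s => N s a b) (M' a b) r) → HasDerivAt (fun s => (N s).det)
      (∑ σ : Equiv.Perm (Fin n), ((Equiv.Perm.sign σ : ℤ) : ℂ) *
        ∑ k, (∏ j ∈ Finset.univ.erase k, N r (σ j) j) • M' (σ k) k) r := by
    intro N r hN
    simp only [Matrix.det_apply']
    exact HasDerivAt.fun_sum fun σ _ => (HasDerivAt.fun_finsetProd fun j _ => hN (σ j) j).const_mul _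
  have h1 := key hM
  have h2 : HasDerivAt (fun s : ℝ => (M t + (s : ℂ) • M').det) _ 0 :=
    key (N := fun s => M t + (s : ℂ) • M') (r := 0) fun a b => by
      have := ((Complex.ofRealCLM.hasDerivAt (x := (0 : ℝ))).mul_const (M' a b)).const_add (M t a b)
      simpa using this
  have h3 : ∀ s : ℝ, (M t + (s : ℂ) • M').det =
      (M t).det * (1 + (s : ℂ) • ((M t)⁻¹ * M')).det := fun s => by
    rw [← Matrix.det_mul, mul_add, mul_one, Matrix.mul_smul, ← mul_assoc,
      Matrix.mul_nonsing_inv _ (isUnit_iff_ne_zero.2 h0), one_mul]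
  have h4 : HasDerivAt (fun s : ℝ => (M t + (s : ℂ) • M').det)
      ((M t).det * ((M t)⁻¹ * M').trace) 0 := by
    simp_rw [h3]
    have h6 : ∀ s : ℝ, (1 + (s : ℂ) • ((M t)⁻¹ * M')).det = _ := fun s =>
      Matrix.det_one_add_smul (s : ℂ) ((M t)⁻¹ * M')
    simp_rw [h6]
    generalize (Matrix.det (1 + (Polynomial.X : Polynomial ℂ) •
      ((M t)⁻¹ * M').map Polynomial.C)).divX.divX = q
    have hc := Complex.ofRealCLM.hasDerivAt (x := (0 : ℝ))
    have hq : HasDerivAt (fun s : ℝ => q.eval (s : ℂ)) _ 0 :=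
      (q.hasDerivAt ((0 : ℝ) : ℂ)).comp_ofReal
    have := (((hc.const_mul ((M t)⁻¹ * M').trace).const_add 1).add (hq.mul (hc.pow 2))).const_mul
      (M t).det
    refine this.congr_deriv ?_
    simp
  have h5 := h2.unique h4
  simp only [Complex.ofReal_zero, zero_smul, add_zero] at h5
  rwa [h5] at h1

theorem dz_det {G : (Fin n → ℂ) → Matrix (Fin n) (Fin n) ℂ} {z : Fin n → ℂ}
    (hG : ∀ a b, ContDiffAt ℝ ∞ (fun w => G w a b) z) (h0 : (G z).det ≠ 0) (c : Fin n) :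
    dz c (fun w => (G w).det) z =
      (G z).det * ∑ b, ∑ a, (G z)⁻¹ b a * dz c (fun w => G w a b) z := by
  have hf : ∀ v, fderiv ℝ (fun w => (G w).det) z v =
      (G z).det * ∑ b, ∑ a, (G z)⁻¹ b a * fderiv ℝ (fun w => G w a b) z v := fun v => by
    have hline : ∀ {f : (Fin n → ℂ) → ℂ}, ContDiffAt ℝ ∞ f z →
        HasDerivAt (fun s : ℝ => f (z + s • v)) (fderiv ℝ f z v) 0 := fun {f} hf => by
      have h1 : HasDerivAt (fun s : ℝ => z + s • v) v 0 := by
        simpa using ((hasDerivAt_id (0 : ℝ)).smul_const v).const_add z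
      have h2 : HasFDerivAt f (fderiv ℝ f z) (z + (0 : ℝ) • v) := by
        simpa using (hf.differentiableAt (by simp)).hasFDerivAt
      exact h2.comp_hasDerivAt 0 h1
    have h1 := hasDerivAt_det (M := fun s : ℝ => G (z + s • v)) (t := 0)
      (M' := Matrix.of fun a b => fderiv ℝ (fun w => G w a b) z v)
      (fun a b => hline (hG a b)) (by simpa using h0)
    have h2 := h1.unique (hline (contDiffAt_det hG))
    rw [← h2]
    simp [Matrix.trace, Matrix.mul_apply]
  simp only [dz, hf, Finset.mul_sum, ← Finset.sum_sub_distrib]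
  refine Finset.sum_congr rfl fun b _ => Finset.sum_congr rfl fun a _ => ?_
  ring

section
variable [MeasurableSpace X] [BorelSpace X] {ρ : ι → (Fin n → ℂ) → ℝ}
  [IsManifold 𝓘(ℂ, Fin n → ℂ) ω X]
  {g : ι → (Fin n → ℂ) → Matrix (Fin n) (Fin n) ℂ} {u v f : X → ℂ}

/-- The density of the Riemannian volume form of a Kähler metric, up to a constant factor. -/
def detDensity (g : ι → (Fin n → ℂ) → Matrix (Fin n) (Fin n) ℂ) (i : ι) (z : Fin n → ℂ) : ℝ :=
  (g i z).det.re

theorem ofReal_detDensity (hg : IsKahler A g) {i : ι} {z : Fin n → ℂ}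
    (hz : z ∈ (A.chart i).target) : (detDensity g i z : ℂ) = (g i z).det :=
  Complex.ext rfl (Complex.pos_iff.1 (hg.posDef i z hz).det_pos).2

theorem isSmoothDensity_detDensity (hg : IsKahler A g) : IsSmoothDensity A (detDensity g) where
  pos i z hz := (Complex.pos_iff.1 (hg.posDef i z hz).det_pos).1
  smooth i z hz := Complex.reCLM.contDiff.contDiffAt.comp z (contDiffAt_det (hg.smooth i z hz))
  continuousOn i z hz := (Complex.reCLM.contDiff.contDiffAt.comp z
    (contDiffAt_det (hg.smooth i z hz))).continuousAt.continuousWithinAt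
  trans i j z hz := by
    have h1 := hg.trans i j z hz
    have h2 : (g i z).det = ((‖(fderiv ℂ (A.trans i j) z).det‖ ^ 2 : ℝ) : ℂ) *
        (g j (A.trans i j z)).det := by
      have h3 : ((jacM A i j z).map conj).det = conj (jacM A i j z).det :=
        (RingHom.map_det (starRingEnd ℂ) (jacM A i j z)).symm
      rw [h1, Matrix.det_mul, Matrix.det_mul, Matrix.det_transpose, h3, ← jacM_det]
      push_cast
      rw [← Complex.mul_conj']
      ring
    rw [detDensity, h2, Complex.re_ofReal_mul]
    rfl

/-- Contracting with `g` gives `∂_c det g` minus `det g` times the trace of `g⁻¹` against `∂_a g_{c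
b̄}`. Closedness lets the indices `a` and `c` be exchanged, and Jacobi's formula shows that the
difference is zero. -/
theorem sum_dz_det_mul_inv (hg : IsKahler A g) {i : ι} {z : Fin n → ℂ}
    (hz : z ∈ (A.chart i).target) (b : Fin n) :
    ∑ a, dz a (fun w => (g i w).det * (g i w)⁻¹ b a) z = 0 := by
  have h0 := PosDef.det_ne_zero (hg.posDef i z hz)
  have hs := hg.smooth i z hz
  have d1 : ∀ a b, DifferentiableAt ℝ (fun w => g i w a b) z := fun a b =>
    (hs a b).differentiableAt (by simp)
  have d2 : ∀ b a, DifferentiableAt ℝ (fun w => (g i w).det * (g i w)⁻¹ b a) z := fun b a =>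
    ((contDiffAt_det hs).mul (contDiffAt_metric_inv hg hz b a)).differentiableAt (by simp)
  have key : ∀ c, ∑ b, g i z c b * ∑ a, dz a (fun w => (g i w).det * (g i w)⁻¹ b a) z = 0 := by
    intro c
    have h1 : ∀ a, ∑ b, g i z c b * dz a (fun w => (g i w).det * (g i w)⁻¹ b a) z =
        dz a (fun w => (g i w).det * (1 : Matrix (Fin n) (Fin n) ℂ) c a) z -
          ∑ b, dz a (fun w => g i w c b) z * ((g i z).det * (g i z)⁻¹ b a) := by
      intro a
      have h2 : (fun w => (g i w).det * (1 : Matrix (Fin n) (Fin n) ℂ) c a) =ᶠ[nhds z]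
          fun w => ∑ b, g i w c b * ((g i w).det * (g i w)⁻¹ b a) := by
        filter_upwards [(A.chart i).open_target.mem_nhds hz] with w hw
        rw [← Matrix.mul_nonsing_inv (g i w)
          (isUnit_iff_ne_zero.2 (PosDef.det_ne_zero (hg.posDef i w hw))), Matrix.mul_apply,
          Finset.mul_sum]
        exact Finset.sum_congr rfl fun b _ => by ring
      have h3 : ∀ b ∈ Finset.univ, DifferentiableAt ℝ
          (fun w => g i w c b * ((g i w).det * (g i w)⁻¹ b a)) z := fun b _ => (d1 c b).mul (d2 b a)
      rw [dz_congr h2, dz_sum a _ h3, ← Finset.sum_sub_distrib]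
      refine Finset.sum_congr rfl fun b _ => ?_
      rw [dz_mul a (d1 c b) (d2 b a)]
      ring
    simp only [Finset.mul_sum]
    rw [Finset.sum_comm]
    simp only [h1]
    rw [Finset.sum_sub_distrib, Finset.sum_eq_single c]
    · simp only [Matrix.one_apply_eq, mul_one]
      rw [dz_det hs h0, Finset.sum_comm, Finset.mul_sum, ← Finset.sum_sub_distrib]
      refine Finset.sum_eq_zero fun a _ => ?_
      rw [Finset.mul_sum, ← Finset.sum_sub_distrib]
      refine Finset.sum_eq_zero fun b _ => ?_
      rw [hg.closed i z hz a b c]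
      ring
    · intro a _ hac
      simp [Matrix.one_apply_ne hac.symm, dz_const]
    · simp
  have h3 : g i z *ᵥ (fun b => ∑ a, dz a (fun w => (g i w).det * (g i w)⁻¹ b a) z) = 0 :=
    funext key
  have h4 := Matrix.eq_zero_of_mulVec_eq_zero h0 h3
  exact congrFun h4 b

theorem lapB_detDensity (hg : IsKahler A g) {i : ι} {z : Fin n → ℂ}
    (hz : z ∈ (A.chart i).target) (b : Fin n) : lapB (detDensity g) g i b z = 0 := by
  have h1 : ∀ a, dz a (fun w => (detDensity g i w : ℂ) * (g i w)⁻¹ b a) z =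
      dz a (fun w => (g i w).det * (g i w)⁻¹ b a) z := fun a => dz_congr (by
    filter_upwards [(A.chart i).open_target.mem_nhds hz] with w hw
    rw [ofReal_detDensity hg hw]) a
  simp [lapB, h1, sum_dz_det_mul_inv hg hz b]

/-- By `lapB_detDensity` there is no first order part, so the operator is `-g^{a b̄} ∂_a ∂̄_b`,
which commutes with conjugation because `g` is Hermitian. -/
theorem lapL_detDensity_conj [T2Space X] (hg : IsKahler A g) (hu : A.IsSmooth u) (x : X) :
    lapL A (detDensity g) g (fun x => conj (u x)) x = conj (lapL A (detDensity g) g u x) := by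
  have hz := (A.chart (A.indexAt x)).map_source (A.mem_indexAt x)
  have hx := (A.chart (A.indexAt x)).left_inv (A.mem_indexAt x)
  have key : ∀ {u : X → ℂ}, A.IsSmooth u → lapL A (detDensity g) g u x = _ := fun {u} hu =>
    (congrArg (lapL A (detDensity g) g u) hx).symm.trans
      (loc_lapL (isSmoothDensity_detDensity hg) hg hu hz)
  rw [key hu, key hu.conj]
  simp only [lapB_detDensity hg hz, zero_mul, Finset.sum_const_zero, add_zero, map_neg, map_sum,
    map_mul]
  rw [Finset.sum_comm]
  congr 1
  refine Finset.sum_congr rfl fun a _ => Finset.sum_congr rfl fun b _ => ?_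
  have h1 : dzbar a (A.loc (A.indexAt x) fun x => conj (u x)) = fun w =>
      conj (dz a (A.loc (A.indexAt x) u) w) := funext fun w =>
    dzbar_conj a (A.loc (A.indexAt x) u) w
  have h2 := (hg.posDef _ _ hz).inv.isHermitian.apply a b
  rw [h1, dz_conj, ← dz_dzbar_comm a (hu _ _ hz), ← h2]
  rfl

/-- For the Riemannian volume the energies of `∂u` and `∂̄u` agree. This is how control of `∂̄`
yields control of the full gradient. -/
theorem integral_dbarSq_conj [T2Space X] [CompactSpace X] (hg : IsKahler A g)
    (hu : A.IsSmooth u) :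
    ∫ x, dbarSq A g (fun x => conj (u x)) x ∂(volumeFormMeasure A (detDensity g)) =
      ∫ x, dbarSq A g u x ∂(volumeFormMeasure A (detDensity g)) := by
  have h1 := integral_conj_mul_lapL (isSmoothDensity_detDensity hg) hg hu
  have h2 := integral_conj_mul_lapL (isSmoothDensity_detDensity hg) hg hu.conj
  have h3 := congrArg conj h1
  rw [← integral_conj, Complex.conj_ofReal] at h3
  refine Complex.ofReal_injective (h2.symm.trans (Eq.trans ?_ h3))
  refine integral_congr_ae (Filter.Eventually.of_forall fun x => ?_)
  simp only [lapL_detDensity_conj hg hu x, map_mul, Complex.conj_conj]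

end

end

/-! ### Functions that are limits with vanishing gradient. -/

section

variable {n : ℕ}
variable {X : Type*} [TopologicalSpace X] [ChartedSpace (Fin n → ℂ) X] {ι : Type*}
  {A : CoordCover n X ι}

open ComplexConjugate Matrix

section
variable {E : Type*} [NormedAddCommGroup E] [NormedSpace ℝ E] [MeasurableSpace E] [BorelSpace E]
  [FiniteDimensional ℝ E] {μ : Measure E} [μ.IsAddHaarMeasure]

theorem setLIntegral_add_le {z₀ a : E} {R : ℝ} (ha : ‖a‖ ≤ R) (F : E → ℝ≥0∞) :
    ∫⁻ x in Metric.ball z₀ R, F (x + a) ∂μ ≤ ∫⁻ x in Metric.ball z₀ (2 * R), F x ∂μ := by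
  rw [← lintegral_indicator Metric.isOpen_ball.measurableSet,
    ← lintegral_indicator Metric.isOpen_ball.measurableSet,
    ← lintegral_add_right_eq_self ((Metric.ball z₀ (2 * R)).indicator F) a]
  refine lintegral_mono fun x => ?_
  by_cases hx : x ∈ Metric.ball z₀ R
  · have hx' : x + a ∈ Metric.ball z₀ (2 * R) := by
      rw [mem_ball_iff_norm] at hx ⊢
      calc ‖x + a - z₀‖ = ‖(x - z₀) + a‖ := by congr 1; abel
        _ ≤ ‖x - z₀‖ + ‖a‖ := norm_add_le _ _
        _ < 2 * R := by linarith
    rw [indicator_of_mem hx, indicator_of_mem hx']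
  · rw [indicator_of_notMem hx]
    exact zero_le

/-- The difference is the integral of the derivative along the segment from `x` to `x + y`, which
stays in the ball of radius `2 R`; the two integrations are then exchanged. -/
theorem setLIntegral_sub_translate_le {v : E → ℂ} (hv : ContDiff ℝ 1 v) {z₀ y : E} {R : ℝ}
    (hy : ‖y‖ ≤ R) : ∫⁻ x in Metric.ball z₀ R, ‖v (x + y) - v x‖ₑ ∂μ ≤
      ‖y‖ₑ * ∫⁻ x in Metric.ball z₀ (2 * R), ‖fderiv ℝ v x‖ₑ ∂μ := by
  have hc : Continuous (fderiv ℝ v) := hv.continuous_fderiv one_ne_zero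
  have hpt : ∀ x, ‖v (x + y) - v x‖ₑ ≤
      ∫⁻ s in Ioc (0 : ℝ) 1, ‖y‖ₑ * ‖fderiv ℝ v (x + s • y)‖ₑ := fun x => by
    have hd : ∀ s : ℝ, HasDerivAt (fun s : ℝ => v (x + s • y)) (fderiv ℝ v (x + s • y) y) s :=
      fun s => by
        have h1 : HasDerivAt (fun s : ℝ => x + s • y) y s := by
          simpa using ((hasDerivAt_id s).smul_const y).const_add x
        exact ((hv.differentiable one_ne_zero _).hasFDerivAt).comp_hasDerivAt s h1
    have h2 := intervalIntegral.integral_eq_sub_of_hasDerivAt (a := 0) (b := 1)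
      (fun s _ => hd s) (Continuous.intervalIntegrable (by fun_prop) _ _)
    simp only [one_smul, zero_smul, add_zero] at h2
    rw [← h2, intervalIntegral.integral_of_le zero_le_one]
    refine (enorm_integral_le_lintegral_enorm _).trans (lintegral_mono fun s => ?_)
    rw [mul_comm]
    exact (fderiv ℝ v (x + s • y)).le_opENorm y
  have hcont : Continuous fun p : E × ℝ => ‖y‖ₑ * ‖fderiv ℝ v (p.1 + p.2 • y)‖ₑ := by
    have h1 : Continuous fun p : E × ℝ => ‖fderiv ℝ v (p.1 + p.2 • y)‖ₑ := by fun_prop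
    exact ENNReal.continuous_const_mul (by simp) |>.comp h1
  calc ∫⁻ x in Metric.ball z₀ R, ‖v (x + y) - v x‖ₑ ∂μ
      ≤ ∫⁻ x in Metric.ball z₀ R, ∫⁻ s in Ioc (0 : ℝ) 1,
          ‖y‖ₑ * ‖fderiv ℝ v (x + s • y)‖ₑ ∂volume ∂μ := lintegral_mono hpt
    _ = ∫⁻ s in Ioc (0 : ℝ) 1, (∫⁻ x in Metric.ball z₀ R,
          ‖y‖ₑ * ‖fderiv ℝ v (x + s • y)‖ₑ ∂μ) :=
      lintegral_lintegral_swap hcont.measurable.aemeasurable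
    _ ≤ ∫⁻ _ in Ioc (0 : ℝ) 1, (‖y‖ₑ * ∫⁻ x in Metric.ball z₀ (2 * R), ‖fderiv ℝ v x‖ₑ ∂μ) := by
      refine setLIntegral_mono' measurableSet_Ioc fun s hs => ?_
      rw [lintegral_const_mul' _ _ (by simp)]
      refine mul_le_mul_right (setLIntegral_add_le ?_ fun x => ‖fderiv ℝ v x‖ₑ) _
      rw [norm_smul, Real.norm_of_nonneg hs.1.le]
      exact (mul_le_of_le_one_left (norm_nonneg _) hs.2).trans hy
    _ = _ := by simp

/-- Approximation shows that `h` agrees almost everywhere with each of its small translates. By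
Fubini some point `x` satisfies `h (x + y) = h x` for almost every small `y`, which makes `h`
constant near `x`. -/
theorem ae_eq_const_of_approx {h : E → ℂ} (hm : Measurable h) {z₀ : E} {R : ℝ} (hR : 0 < R)
    (happ : ∀ ε : ℝ≥0∞, ε ≠ 0 → ∃ v : E → ℂ, ContDiff ℝ 1 v ∧
      ∫⁻ x in Metric.ball z₀ (2 * R), ‖v x - h x‖ₑ ∂μ ≤ ε ∧
      ∫⁻ x in Metric.ball z₀ (2 * R), ‖fderiv ℝ v x‖ₑ ∂μ ≤ ε) :
    ∃ c, ∀ᵐ z ∂(μ.restrict (Metric.ball z₀ (R / 2))), h z = c := by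
  have key : ∀ y ∈ Metric.ball (0 : E) R, ∀ᵐ x ∂(μ.restrict (Metric.ball z₀ R)),
      h (x + y) = h x := by
    intro y hy
    have hyR : ‖y‖ ≤ R := (mem_ball_zero_iff.1 hy).le
    have h0 : ∫⁻ x in Metric.ball z₀ R, ‖h (x + y) - h x‖ₑ ∂μ = 0 := by
      refine le_antisymm (ENNReal.le_of_forall_pos_le_add fun ε hε _ => ?_) zero_le
      -- The approximation error enters twice, at `x` and at `x + y`, and the gradient once with the
      -- factor `‖y‖`.
      have hε' : ((ε : ℝ≥0∞) / (2 + ‖y‖ₑ)) ≠ 0 :=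
        ENNReal.div_ne_zero.2 ⟨by exact_mod_cast hε.ne', by simp⟩
      obtain ⟨v, hv, hv1, hv2⟩ := happ _ hε'
      have hmv := hv.continuous.measurable
      have hmy : Measurable fun x : E => x + y := measurable_id.add_const y
      calc ∫⁻ x in Metric.ball z₀ R, ‖h (x + y) - h x‖ₑ ∂μ
          ≤ ∫⁻ x in Metric.ball z₀ R, ((‖v (x + y) - h (x + y)‖ₑ + ‖v x - h x‖ₑ) +
              ‖v (x + y) - v x‖ₑ) ∂μ := by
            refine lintegral_mono fun x => ?_
            have e : h (x + y) - h x =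
              (-(v (x + y) - h (x + y)) + (v x - h x)) + (v (x + y) - v x) := by ring
            rw [e]
            refine (enorm_add_le _ _).trans (add_le_add_left ((enorm_add_le _ _).trans ?_) _)
            rw [enorm_neg]
        _ = (∫⁻ x in Metric.ball z₀ R, ‖v (x + y) - h (x + y)‖ₑ ∂μ +
              ∫⁻ x in Metric.ball z₀ R, ‖v x - h x‖ₑ ∂μ) +
              ∫⁻ x in Metric.ball z₀ R, ‖v (x + y) - v x‖ₑ ∂μ := by
            rw [lintegral_add_left, lintegral_add_left]
            · exact ((hmv.comp hmy).sub (hm.comp hmy)).enorm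
            · exact (((hmv.comp hmy).sub (hm.comp hmy)).enorm).add ((hmv.sub hm).enorm)
        _ ≤ ((ε : ℝ≥0∞) / (2 + ‖y‖ₑ) + (ε : ℝ≥0∞) / (2 + ‖y‖ₑ)) +
              ‖y‖ₑ * ((ε : ℝ≥0∞) / (2 + ‖y‖ₑ)) := by
            refine add_le_add (add_le_add ?_ ?_) ?_
            · exact (setLIntegral_add_le hyR fun x => ‖v x - h x‖ₑ).trans hv1
            · exact (lintegral_mono_set (Metric.ball_subset_ball (by linarith))).trans hv1
            · exact (setLIntegral_sub_translate_le hv hyR).trans (mul_le_mul_right hv2 _)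
        _ = 0 + ε := by
            rw [← two_mul, ← add_mul, zero_add]
            exact ENNReal.mul_div_cancel (by simp) (by simp)
    have hmy : Measurable fun x : E => x + y := measurable_id.add_const y
    have hmh : Measurable fun x => ‖h (x + y) - h x‖ₑ := ((hm.comp hmy).sub hm).enorm
    rw [lintegral_eq_zero_iff hmh] at h0
    filter_upwards [h0] with x hx
    exact sub_eq_zero.1 (by simpa using hx)
  have hms : MeasurableSet {p : E × E | h (p.1 + p.2) = h p.1} :=
    measurableSet_eq_fun (hm.comp (measurable_fst.add measurable_snd)) (hm.comp measurable_fst)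
  -- The order of the quantifiers over `x` and `y` is exchanged.
  have h1 : ∀ᵐ x ∂(μ.restrict (Metric.ball z₀ R)), ∀ᵐ y ∂(μ.restrict (Metric.ball 0 R)),
      h (x + y) = h x := by
    rw [Measure.ae_ae_comm hms]
    filter_upwards [ae_restrict_mem Metric.isOpen_ball.measurableSet] with y hy using key y hy
  have h2 : ∀ᵐ x ∂(μ.restrict (Metric.ball z₀ (R / 2))),
      ∀ᵐ y ∂(μ.restrict (Metric.ball 0 R)), h (x + y) = h x :=
    ae_restrict_of_ae_restrict_of_subset (Metric.ball_subset_ball (by linarith)) h1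
  have hne : (μ.restrict (Metric.ball z₀ (R / 2))) ≠ 0 := by
    rw [Ne, Measure.restrict_eq_zero]
    exact (Metric.measure_ball_pos μ z₀ (by linarith)).ne'
  have : (ae (μ.restrict (Metric.ball z₀ (R / 2)))).NeBot := ae_neBot.2 hne
  obtain ⟨x, hx, hxB⟩ := (h2.and (ae_restrict_mem Metric.isOpen_ball.measurableSet)).exists
  refine ⟨h x, ?_⟩
  rw [ae_restrict_iff' Metric.isOpen_ball.measurableSet] at hx ⊢
  have h3 := (measurePreserving_sub_right μ x).quasiMeasurePreserving.ae hx
  filter_upwards [h3] with z hz hzB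
  have h4 : z - x ∈ Metric.ball (0 : E) R := by
    rw [mem_ball_iff_norm] at hzB hxB ⊢
    calc ‖z - x - 0‖ = ‖(z - z₀) - (x - z₀)‖ := by congr 1; abel
      _ ≤ ‖z - z₀‖ + ‖x - z₀‖ := norm_sub_le _ _
      _ < R := by linarith
  simpa using hz h4

end

section
variable {g : ι → (Fin n → ℂ) → Matrix (Fin n) (Fin n) ℂ} {u : X → ℂ}

/-- Cauchy-Schwarz for the inner product defined by `P`: with `e = Q e_b` the product of `e` with
`w` is `w b`, and the square norm of `e` is `Q b b`. It bounds coordinate derivatives by the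
invariant norm `dbarSq`. -/
theorem norm_sq_le_of_posDef {P Q : Matrix (Fin n) (Fin n) ℂ} (hP : P.PosDef) (hQ : Q.PosDef)
    (hPQ : P * Q = 1) (w : Fin n → ℂ) (b : Fin n) :
    ‖w b‖ ^ 2 ≤ (Q b b).re * (star w ⬝ᵥ (P *ᵥ w)).re := by
  have hγ := Complex.pos_iff.1 (hQ.diag_pos (i := b))
  set γ : ℝ := (Q b b).re with hγd
  have hQγ : Q b b = (γ : ℂ) := Complex.ext rfl hγ.2.symm
  set e : Fin n → ℂ := Q *ᵥ Pi.single b 1 with he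
  have hPe : P *ᵥ e = Pi.single b 1 := by rw [he, Matrix.mulVec_mulVec, hPQ, Matrix.one_mulVec]
  have hee : star e ⬝ᵥ (P *ᵥ e) = (γ : ℂ) := by
    rw [hPe]
    simp [he, hQγ]
  have hwe : star w ⬝ᵥ (P *ᵥ e) = conj (w b) := by
    rw [hPe]
    simp
  have hew : star e ⬝ᵥ (P *ᵥ w) = w b := by
    have h1 := Matrix.star_dotProduct (P *ᵥ w) e
    have h2 : star (P *ᵥ w) ⬝ᵥ e = star w ⬝ᵥ (P *ᵥ e) := by
      rw [Matrix.star_mulVec, hP.isHermitian.eq]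
      exact (Matrix.dotProduct_mulVec _ _ _).symm
    have h3 : star e ⬝ᵥ (P *ᵥ w) = star (star (P *ᵥ w) ⬝ᵥ e) := by
      rw [h1, star_star]
    rw [h3, h2, hwe]
    simp
  have h := hP.posSemidef.dotProduct_mulVec_nonneg (w - (w b / γ) • e)
  have h' : star (w - (w b / γ) • e) ⬝ᵥ (P *ᵥ (w - (w b / γ) • e)) =
      star w ⬝ᵥ (P *ᵥ w) - ((‖w b‖ ^ 2 / γ : ℝ) : ℂ) := by
    have hγ0 : (γ : ℂ) ≠ 0 := by exact_mod_cast hγ.1.ne'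
    rw [star_sub, star_smul, Matrix.mulVec_sub, Matrix.mulVec_smul, sub_dotProduct,
      dotProduct_sub, dotProduct_sub, smul_dotProduct, smul_dotProduct, dotProduct_smul,
      dotProduct_smul, hee, hwe, hew]
    simp only [smul_eq_mul, star_div₀, RCLike.star_def, Complex.conj_ofReal]
    push_cast
    rw [← Complex.mul_conj']
    field_simp
    ring
  rw [h'] at h
  have h1 := (Complex.le_def.1 h).1
  rw [Complex.sub_re, Complex.ofReal_re, Complex.zero_re, sub_nonneg, div_le_iff₀ hγ.1] at h1
  linarith

variable [IsManifold 𝓘(ℂ, Fin n → ℂ) ω X]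

theorem norm_dzbar_sq_le (hg : IsKahler A g) (hu : A.IsSmooth u) {i : ι} {z : Fin n → ℂ}
    (hz : z ∈ (A.chart i).target) (b : Fin n) : ‖dzbar b (A.loc i u) z‖ ^ 2 ≤
      (g i z b b).re * dbarSq A g u ((A.chart i).symm z) := by
  have h1 := loc_dirD_gradV_conj hg hu hu hz
  have h2 := norm_sq_le_of_posDef (hg.posDef i z hz).inv.transpose (hg.posDef i z hz).transpose
    (by rw [← Matrix.transpose_mul, Matrix.mul_nonsing_inv _ (isUnit_iff_ne_zero.2
      (PosDef.det_ne_zero (hg.posDef i z hz))), Matrix.transpose_one])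
    (fun b => dzbar b (A.loc i u) z) b
  rw [← h1] at h2
  exact h2

theorem norm_dz_sq_le (hg : IsKahler A g) (hu : A.IsSmooth u) {i : ι} {z : Fin n → ℂ}
    (hz : z ∈ (A.chart i).target) (b : Fin n) : ‖dz b (A.loc i u) z‖ ^ 2 ≤
      (g i z b b).re * dbarSq A g (fun x => conj (u x)) ((A.chart i).symm z) := by
  have h := norm_dzbar_sq_le hg hu.conj hz b
  have h1 : dzbar b (A.loc i fun x => conj (u x)) z = conj (dz b (A.loc i u) z) :=
    dzbar_conj b (A.loc i u) z
  rwa [h1, RCLike.norm_conj] at h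

end

end

/-! ### Comparison of densities and of norms. -/

section

variable {n : ℕ}
variable {X : Type*} [TopologicalSpace X] [ChartedSpace (Fin n → ℂ) X] {ι : Type*}
  {A : CoordCover n X ι}

open ComplexConjugate Matrix

section
variable [MeasurableSpace X] [BorelSpace X] {ρ ρ' : ι → (Fin n → ℂ) → ℝ}
  [IsManifold 𝓘(ℂ, Fin n → ℂ) ω X]
  {g : ι → (Fin n → ℂ) → Matrix (Fin n) (Fin n) ℂ} {u v f h : X → ℂ}

/-- The quotient of two densities is independent of the chart, hence a continuous function on the
compact space `X`. -/
theorem exists_density_le [CompactSpace X] (hρ : IsDensity A ρ) (hρ' : IsDensity A ρ') :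
    ∃ c : ℝ, 0 < c ∧ ∀ i, ∀ z ∈ (A.chart i).target, ρ' i z ≤ c * ρ i z := by
  set q : X → ℝ := fun x => ρ' (A.indexAt x) (A.chart (A.indexAt x) x) /
    ρ (A.indexAt x) (A.chart (A.indexAt x) x) with hq
  have hqi : ∀ i, ∀ x ∈ (A.chart i).source, q x = ρ' i (A.chart i x) / ρ i (A.chart i x) := by
    intro i x hx
    have hz := CoordCover.chart_mem_overlap (A.mem_indexAt x) hx
    have h1 := hρ.trans _ _ _ hz
    have h2 := hρ'.trans _ _ _ hz
    have h3 := hρ.pos _ _ (CoordCover.mem_overlap.1 hz).1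
    rw [CoordCover.trans_chart (A.mem_indexAt x)] at h1 h2
    simp only [hq]
    rw [h1] at h3
    rw [h1, h2, mul_div_mul_left]
    intro h0
    rw [h0, zero_mul] at h3
    exact lt_irrefl _ h3
  have hqc : Continuous q := continuous_iff_continuousAt.2 fun x => by
    have hx := A.mem_indexAt x
    have ht := (A.chart (A.indexAt x)).open_target.mem_nhds ((A.chart (A.indexAt x)).map_source hx)
    have h1 : ContinuousAt (fun y => ρ' (A.indexAt x) (A.chart (A.indexAt x) y) /
        ρ (A.indexAt x) (A.chart (A.indexAt x) y)) x := by
      refine ContinuousAt.div ?_ ?_ (hρ.pos _ _ ((A.chart (A.indexAt x)).map_source hx)).ne'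
      · exact ((hρ'.continuousOn _).continuousAt ht).comp ((A.chart (A.indexAt x)).continuousAt hx)
      · exact ((hρ.continuousOn _).continuousAt ht).comp ((A.chart (A.indexAt x)).continuousAt hx)
    refine h1.congr ?_
    filter_upwards [(A.chart (A.indexAt x)).open_source.mem_nhds hx] with y hy
    exact (hqi _ y hy).symm
  obtain ⟨c, hc⟩ := isCompact_univ.exists_bound_of_continuousOn hqc.continuousOn
  refine ⟨|c| + 1, by positivity, fun i z hz => ?_⟩
  have h1 := hqi i _ ((A.chart i).map_target hz)
  rw [(A.chart i).right_inv hz] at h1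
  have h2 := (le_abs_self _).trans (hc ((A.chart i).symm z) (mem_univ _))
  rw [h1, div_le_iff₀ (hρ.pos i z hz)] at h2
  refine h2.trans (mul_le_mul_of_nonneg_right ?_ (hρ.pos i z hz).le)
  linarith [le_abs_self c]

theorem exists_setLIntegral_loc_le (hρ : IsDensity A ρ) {i : ι} {B : Set (Fin n → ℂ)}
    (hB : IsCompact B) (hBt : B ⊆ (A.chart i).target) : ∃ c : ℝ, 0 ≤ c ∧ ∀ H : X → ℝ≥0∞,
      AEMeasurable H (volumeFormMeasure A ρ) → ∫⁻ z in B, H ((A.chart i).symm z) ≤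
        ENNReal.ofReal c * ∫⁻ x, H x ∂(volumeFormMeasure A ρ) := by
  have hpos : ∀ z ∈ (A.chart i).target, 0 < 2 ^ n * ρ i z := fun z hz => by
    have := hρ.pos i z hz
    positivity
  obtain ⟨c, hc⟩ := hB.exists_bound_of_continuousOn (f := fun z => (2 ^ n * ρ i z)⁻¹)
    ((((hρ.continuousOn i).const_mul _).inv₀ fun z hz => (hpos z hz).ne').mono hBt)
  refine ⟨|c|, abs_nonneg _, fun H hH => ?_⟩
  have hs := (A.chart i).open_source.measurableSet
  calc ∫⁻ z in B, H ((A.chart i).symm z)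
      ≤ ∫⁻ z in B, ENNReal.ofReal |c| * (ENNReal.ofReal (2 ^ n * ρ i z) *
          (A.chart i).source.indicator H ((A.chart i).symm z)) := by
        refine setLIntegral_mono' hB.measurableSet fun z hz => ?_
        rw [indicator_of_mem ((A.chart i).map_target (hBt hz)), ← mul_assoc,
          ← ENNReal.ofReal_mul (abs_nonneg _)]
        have h1 := (le_abs_self _).trans ((hc z hz).trans (le_abs_self c))
        have h2 : 1 ≤ |c| * (2 ^ n * ρ i z) := by
          rwa [← div_le_iff₀ (hpos z (hBt hz)), one_div]
        calc H ((A.chart i).symm z) = ENNReal.ofReal 1 * H ((A.chart i).symm z) := by simp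
          _ ≤ _ := mul_le_mul_left (ENNReal.ofReal_le_ofReal h2) _
    _ = ENNReal.ofReal |c| * ∫⁻ z in B, (ENNReal.ofReal (2 ^ n * ρ i z) *
          (A.chart i).source.indicator H ((A.chart i).symm z)) :=
        lintegral_const_mul' _ _ (by simp)
    _ ≤ ENNReal.ofReal |c| * ∫⁻ x, (A.chart i).source.indicator H x ∂(volumeFormMeasure A ρ) := by
        rw [lintegral_eq_chart hρ (i := i) (hH.indicator hs) fun x hx => indicator_of_notMem hx _]
        exact mul_le_mul_right (lintegral_mono_set hBt) _
    _ ≤ _ := mul_le_mul_right (lintegral_mono fun x => indicator_le_self _ _ x) _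

/-- Uses `|φ| ≤ τ + |φ|² / τ` with `τ` small compared with the total mass. -/
theorem exists_lintegral_le_of_sq {α : Type*} [MeasurableSpace α] (μ : Measure α)
    [IsFiniteMeasure μ] {η : ℝ} (hη : 0 < η) : ∃ κ : ℝ, 0 < κ ∧ ∀ φ : α → ℂ,
      ∫⁻ x, ‖φ x‖ₑ ^ 2 ∂μ ≤ ENNReal.ofReal κ → ∫⁻ x, ‖φ x‖ₑ ∂μ ≤ ENNReal.ofReal η := by
  set τ : ℝ := η / (2 * (μ.real univ + 1)) with hτ
  have hm : 0 ≤ μ.real univ := measureReal_nonneg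
  have hτ0 : 0 < τ := by positivity
  refine ⟨τ * (η / 2), by positivity, fun φ hφ => ?_⟩
  have h1 : ∀ x, ‖φ x‖ₑ ≤ ENNReal.ofReal τ + ENNReal.ofReal τ⁻¹ * ‖φ x‖ₑ ^ 2 := fun x => by
    rw [← ofReal_norm, ← ENNReal.ofReal_pow (norm_nonneg _),
      ← ENNReal.ofReal_mul (by positivity), ← ENNReal.ofReal_add hτ0.le (by positivity)]
    refine ENNReal.ofReal_le_ofReal ?_
    have h2 : τ⁻¹ * ‖φ x‖ ^ 2 = ‖φ x‖ ^ 2 / τ := by ring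
    rw [h2, ← sub_le_iff_le_add', le_div_iff₀ hτ0]
    nlinarith [sq_nonneg (‖φ x‖ - τ), norm_nonneg (φ x)]
  calc ∫⁻ x, ‖φ x‖ₑ ∂μ ≤ ∫⁻ x, (ENNReal.ofReal τ + ENNReal.ofReal τ⁻¹ * ‖φ x‖ₑ ^ 2) ∂μ :=
        lintegral_mono h1
    _ = ENNReal.ofReal τ * μ univ + ENNReal.ofReal τ⁻¹ * ∫⁻ x, ‖φ x‖ₑ ^ 2 ∂μ := by
        rw [lintegral_add_left measurable_const, lintegral_const,
          lintegral_const_mul' _ _ (by simp)]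
    _ ≤ ENNReal.ofReal τ * ENNReal.ofReal (μ.real univ) +
          ENNReal.ofReal τ⁻¹ * ENNReal.ofReal (τ * (η / 2)) := by
        rw [ofReal_measureReal]
        gcongr
    _ ≤ ENNReal.ofReal η := by
        rw [← ENNReal.ofReal_mul hτ0.le, ← ENNReal.ofReal_mul (by positivity),
          ← ENNReal.ofReal_add (by positivity) (by positivity)]
        refine ENNReal.ofReal_le_ofReal ?_
        have h3 : τ * (μ.real univ + 1) = η / 2 := by
          rw [hτ]
          field_simp
        rw [inv_mul_cancel_left₀ hτ0.ne']
        nlinarith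

theorem norm_fderiv_le_sum_dz (φ : (Fin n → ℂ) → ℂ) (z : Fin n → ℂ) :
    ‖fderiv ℝ φ z‖ ≤ ∑ a, (‖dz a φ z‖ + ‖dzbar a φ z‖) := by
  refine ContinuousLinearMap.opNorm_le_bound _ (by positivity) fun w => ?_
  rw [fderiv_eq_sum_dz, Finset.sum_mul]
  refine (norm_sum_le _ _).trans (Finset.sum_le_sum fun a _ => (norm_add_le _ _).trans ?_)
  rw [norm_mul, norm_mul, RCLike.norm_conj]
  have := norm_le_pi_norm w a
  nlinarith [norm_nonneg (dz a φ z), norm_nonneg (dzbar a φ z)]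

variable [T2Space X] [CompactSpace X]

theorem integrable_dbarSq (hρ : IsDensity A ρ) (hg : IsKahler A g) (hu : A.IsSmooth u) :
    Integrable (dbarSq A g u) (volumeFormMeasure A ρ) :=
  (integrable_of_continuous hρ (Complex.continuous_ofReal.comp (continuous_dbarSq hg hu))).re

/-- Passes to the density `det g`, where the two energies are equal, and back; each passage costs a
constant by compactness. -/
theorem exists_integral_dbarSq_conj_le (hρ : IsDensity A ρ) (hg : IsKahler A g) :
    ∃ C : ℝ, 0 ≤ C ∧ ∀ u : X → ℂ, A.IsSmooth u →
      ∫ x, dbarSq A g (fun x => conj (u x)) x ∂(volumeFormMeasure A ρ) ≤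
        C * ∫ x, dbarSq A g u x ∂(volumeFormMeasure A ρ) := by
  have hD := (isSmoothDensity_detDensity hg).toIsDensity
  obtain ⟨c, hc, h1⟩ := exists_density_le hρ hD
  obtain ⟨c', hc', h2⟩ := exists_density_le hD hρ
  have hle : ∀ {ρ₁ ρ₂ : ι → (Fin n → ℂ) → ℝ}, IsDensity A ρ₁ → IsDensity A ρ₂ → ∀ {c : ℝ},
      0 < c → (∀ i, ∀ z ∈ (A.chart i).target, ρ₂ i z ≤ c * ρ₁ i z) → ∀ {u : X → ℂ},
      A.IsSmooth u → ∫ x, dbarSq A g u x ∂(volumeFormMeasure A ρ₂) ≤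
        c * ∫ x, dbarSq A g u x ∂(volumeFormMeasure A ρ₁) := by
    intro ρ₁ ρ₂ h₁ h₂ c hc h u hu
    have hm := volumeFormMeasure_mono hc.le h h₁
    refine (integral_mono_measure hm (Filter.Eventually.of_forall fun x => dbarSq_nonneg hg hu x)
      ((integrable_dbarSq h₁ hg hu).smul_measure (by simp))).trans (le_of_eq ?_)
    rw [integral_smul_measure, ENNReal.toReal_ofReal hc.le, smul_eq_mul]
  refine ⟨c' * c, by positivity, fun u hu => ?_⟩
  calc _ ≤ c' * ∫ x, dbarSq A g (fun x => conj (u x)) x ∂(volumeFormMeasure A (detDensity g)) :=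
        hle hD hρ hc' h2 hu.conj
    _ = c' * ∫ x, dbarSq A g u x ∂(volumeFormMeasure A (detDensity g)) := by
        rw [integral_dbarSq_conj hg hu]
    _ ≤ c' * (c * ∫ x, dbarSq A g u x ∂(volumeFormMeasure A ρ)) :=
        mul_le_mul_of_nonneg_left (hle hρ hD hc h1 hu) hc'.le
    _ = _ := by ring

end

end

/-! ### Limits of almost holomorphic functions are constant. -/

section

variable {n : ℕ}
variable {X : Type*} [TopologicalSpace X] [ChartedSpace (Fin n → ℂ) X] {ι : Type*}
  {A : CoordCover n X ι}

open ComplexConjugate Matrix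

section
variable [MeasurableSpace X] [BorelSpace X] {ρ : ι → (Fin n → ℂ) → ℝ}
  [IsManifold 𝓘(ℂ, Fin n → ℂ) ω X] [T2Space X] [CompactSpace X]
  {g : ι → (Fin n → ℂ) → Matrix (Fin n) (Fin n) ℂ} {u v f h : X → ℂ}

theorem exists_contDiff_eqOn_ball {U : Set (Fin n → ℂ)} (hU : IsOpen U) {φ : (Fin n → ℂ) → ℂ}
    (hφ : ∀ z ∈ U, ContDiffAt ℝ ∞ φ z) {z₀ : Fin n → ℂ} {R : ℝ} (hR : 0 < R)
    (hRU : Metric.closedBall z₀ (3 * R) ⊆ U) :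
    ∃ p : (Fin n → ℂ) → ℂ, ContDiff ℝ ∞ p ∧ ∀ z ∈ Metric.ball z₀ (2 * R), p z = φ z := by
  let χ : ContDiffBump z₀ := ⟨2 * R, 3 * R, by linarith, by linarith⟩
  refine ⟨U.indicator fun z => χ z • φ z, (contDiff_indicator hU
    (fun z hz => χ.contDiff.contDiffAt.smul (hφ z hz)) (isCompact_closedBall z₀ (3 * R)) hRU
    fun z _ hz => ?_).1, fun z hz => ?_⟩
  · show χ z • φ z = 0
    rw [χ.zero_of_le_dist (by
      rw [Metric.mem_closedBall, not_le] at hz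
      exact hz.le), zero_smul]
  · rw [indicator_of_mem (hRU (Metric.ball_subset_closedBall
      (Metric.ball_subset_ball (by linarith) hz))), χ.one_of_mem_closedBall
      (Metric.ball_subset_closedBall hz), one_smul]

/-- In a chart, smallness of `|∂̄v|²` and, after conjugation, of `|∂v|²` makes the L¹ norm of the
whole gradient small on a ball, so that `ae_eq_const_of_approx` applies. -/
theorem exists_nhds_ae_eq_const (hρ : IsDensity A ρ) (hg : IsKahler A g)
    (hm : StronglyMeasurable h) (happ : ∀ ε : ℝ, 0 < ε → ∃ v : X → ℂ, A.IsSmooth v ∧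
        eLpNorm (fun x => v x - h x) 2 (volumeFormMeasure A ρ) ≤ ENNReal.ofReal ε ∧
        ∫ x, dbarSq A g v x ∂(volumeFormMeasure A ρ) ≤ ε) (x : X) :
    ∃ U : Set X, IsOpen U ∧ x ∈ U ∧ ∃ c, ∀ᵐ y ∂(volumeFormMeasure A ρ), y ∈ U → h y = c := by
  set i := A.indexAt x
  have hx : x ∈ (A.chart i).source := A.mem_indexAt x
  have hz0 := (A.chart i).map_source hx
  have hto := (A.chart i).open_target
  set z₀ := A.chart i x
  obtain ⟨r, hr, hrU⟩ := Metric.nhds_basis_closedBall.mem_iff.1 (hto.mem_nhds hz0)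
  set R := r / 3 with hR
  have hR0 : 0 < R := by positivity
  have hRU : Metric.closedBall z₀ (3 * R) ⊆ (A.chart i).target := by
    rwa [hR, mul_div_cancel₀ r (by norm_num)]
  have hBt : Metric.ball z₀ (2 * R) ⊆ Metric.closedBall z₀ (3 * R) :=
    Metric.ball_subset_closedBall.trans (Metric.closedBall_subset_closedBall (by linarith))
  obtain ⟨c₁, hc₁, hloc⟩ := exists_setLIntegral_loc_le hρ (isCompact_closedBall z₀ (3 * R)) hRU
  obtain ⟨C₂, hC₂, hconj⟩ := exists_integral_dbarSq_conj_le (A := A) hρ hg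
  have hgc : ContinuousOn (fun z => ∑ a, ‖g i z a a‖) (A.chart i).target :=
    continuousOn_finsetSum _ fun a _ z hz =>
      (hg.smooth i z hz a a).continuousAt.norm.continuousWithinAt
  obtain ⟨M₀, hM₀⟩ := (isCompact_closedBall z₀ (3 * R)).exists_bound_of_continuousOn
    (hgc.mono hRU)
  have hM : ∀ z ∈ Metric.ball z₀ (2 * R), ∀ a, (g i z a a).re ≤ |M₀| := fun z hz a =>
    (Complex.re_le_norm _).trans ((Finset.single_le_sum (f := fun a => ‖g i z a a‖)
      (fun _ _ => norm_nonneg _) (Finset.mem_univ a)).trans ((le_abs_self _).trans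
        ((hM₀ z (hBt hz)).trans (le_abs_self _))))
  set M := |M₀| with hMd
  have hM0 : 0 ≤ M := abs_nonneg _
  have hae := aestronglyMeasurable_loc (i := i) hρ
    (hm.aestronglyMeasurable (μ := volumeFormMeasure A ρ))
  -- A measurable representative on `ℂⁿ`: the coordinate expression of `h` is almost everywhere
  -- measurable on the chart target only.
  set hh : (Fin n → ℂ) → ℂ := hae.mk _ with hhd
  have hh_eq : ∀ᵐ z ∂(volume.restrict (A.chart i).target), A.loc i h z = hh z := hae.ae_eq_mk
  have hfinB : IsFiniteMeasure (volume.restrict (Metric.ball z₀ (2 * R))) :=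
    isFiniteMeasure_restrict.2 (measure_ball_lt_top).ne
  have hdb : ∀ {u : X → ℂ}, A.IsSmooth u → ∫⁻ y, ENNReal.ofReal (dbarSq A g u y)
      ∂(volumeFormMeasure A ρ) = ENNReal.ofReal (∫ y, dbarSq A g u y ∂(volumeFormMeasure A ρ)) :=
    fun hu => (ofReal_integral_eq_lintegral_ofReal (integrable_dbarSq hρ hg hu)
      (Filter.Eventually.of_forall fun y => dbarSq_nonneg hg hu y)).symm
  have hgrad : ∀ {u : X → ℂ} {φ : (Fin n → ℂ) → ℂ}, A.IsSmooth u → ∀ a,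
      (∀ z ∈ (A.chart i).target,
        ‖φ z‖ ^ 2 ≤ (g i z a a).re * dbarSq A g u ((A.chart i).symm z)) →
      ∫⁻ z in Metric.ball z₀ (2 * R), ‖φ z‖ₑ ^ 2 ≤
        ENNReal.ofReal (M * c₁ * ∫ y, dbarSq A g u y ∂(volumeFormMeasure A ρ)) := by
    intro u φ hu a hφ
    calc ∫⁻ z in Metric.ball z₀ (2 * R), ‖φ z‖ₑ ^ 2
        ≤ ∫⁻ z in Metric.ball z₀ (2 * R), ENNReal.ofReal M *
            ENNReal.ofReal (dbarSq A g u ((A.chart i).symm z)) := by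
          refine setLIntegral_mono' Metric.isOpen_ball.measurableSet fun z hz => ?_
          rw [← ofReal_norm, ← ENNReal.ofReal_pow (norm_nonneg _), ← ENNReal.ofReal_mul hM0]
          exact ENNReal.ofReal_le_ofReal ((hφ z (hRU (hBt hz))).trans
            (mul_le_mul_of_nonneg_right (hM z hz a) (dbarSq_nonneg hg hu _)))
      _ = ENNReal.ofReal M * ∫⁻ z in Metric.ball z₀ (2 * R),
            ENNReal.ofReal (dbarSq A g u ((A.chart i).symm z)) :=
          lintegral_const_mul' _ _ (by simp)
      _ ≤ ENNReal.ofReal M * (ENNReal.ofReal c₁ * ENNReal.ofReal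
            (∫ y, dbarSq A g u y ∂(volumeFormMeasure A ρ))) := by
          rw [← hdb hu]
          exact mul_le_mul_right ((lintegral_mono_set hBt).trans (hloc _
            (continuous_dbarSq hg hu).measurable.ennreal_ofReal.aemeasurable)) _
      _ = _ := by
          rw [ENNReal.ofReal_mul (by positivity), ENNReal.ofReal_mul hM0, mul_assoc]
  obtain ⟨c, hc⟩ : ∃ c, ∀ᵐ z ∂(volume.restrict (Metric.ball z₀ (R / 2))), hh z = c := by
    refine ae_eq_const_of_approx hae.stronglyMeasurable_mk.measurable hR0 fun ε hε => ?_
    obtain ⟨η', -, hηpos, hηε⟩ := ENNReal.lt_iff_exists_real_btwn.1 (pos_iff_ne_zero.2 hε)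
    -- The gradient bound adds `2 n` terms of size `η`; the extra one keeps the denominator positive
    -- when `n = 0`.
    set η : ℝ := η' / (2 * n + 1) with hη
    have hη0' : 0 < η' := ENNReal.ofReal_pos.1 hηpos
    have hη0 : 0 < η := by positivity
    obtain ⟨κ, hκ, hL1⟩ := exists_lintegral_le_of_sq
      (volume.restrict (Metric.ball z₀ (2 * R))) hη0
    -- A common majorant of `c₁`, `M c₁` and `M c₁ C₂`, the factors in the bounds for `v - h`, `∂̄v`
    -- and `∂v`.
    set Q : ℝ := (c₁ + 1) * (M + 1) * (C₂ + 1) with hQ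
    have hQ0 : 0 < Q := by positivity
    set ε₀ : ℝ := min 1 (κ / Q) with hε₀
    have hε0 : 0 < ε₀ := by positivity
    have hε1 : ε₀ ≤ 1 := min_le_left _ _
    have hεκ : Q * ε₀ ≤ κ := by
      have := min_le_right 1 (κ / Q)
      rwa [le_div_iff₀ hQ0, mul_comm] at this
    have b1 : c₁ * ε₀ ≤ κ := by
      refine le_trans ?_ hεκ
      gcongr
      rw [hQ]
      nlinarith [mul_nonneg hc₁ hM0, mul_nonneg (mul_nonneg hc₁ hM0) hC₂, mul_nonneg hc₁ hC₂,
        mul_nonneg hM0 hC₂]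
    have b2 : M * c₁ * ε₀ ≤ κ := by
      refine le_trans ?_ hεκ
      gcongr
      rw [hQ]
      nlinarith [mul_nonneg hc₁ hM0, mul_nonneg (mul_nonneg hc₁ hM0) hC₂, mul_nonneg hc₁ hC₂,
        mul_nonneg hM0 hC₂]
    have b3 : M * c₁ * C₂ * ε₀ ≤ κ := by
      refine le_trans ?_ hεκ
      gcongr
      rw [hQ]
      nlinarith [mul_nonneg hc₁ hM0, mul_nonneg (mul_nonneg hc₁ hM0) hC₂, mul_nonneg hc₁ hC₂,
        mul_nonneg hM0 hC₂]
    obtain ⟨v, hv, hv1, hv2⟩ := happ ε₀ hε0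
    -- The translation argument needs a function differentiable on all of `ℂⁿ`, so `v` is cut off
    -- outside the ball of radius `2 R`.
    obtain ⟨p, hp, hpv⟩ := exists_contDiff_eqOn_ball hto (hv i) hR0 hRU
    refine ⟨p, hp.of_le (by simp), ?_, ?_⟩
    · have h1 : ∫⁻ z in Metric.ball z₀ (2 * R), ‖p z - hh z‖ₑ =
          ∫⁻ z in Metric.ball z₀ (2 * R), ‖A.loc i (fun y => v y - h y) z‖ₑ := by
        refine lintegral_congr_ae ?_
        filter_upwards [ae_restrict_of_ae_restrict_of_subset (hBt.trans hRU) hh_eq,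
          ae_restrict_mem Metric.isOpen_ball.measurableSet] with z hz hzB
        rw [← hz, hpv z hzB]
        rfl
      rw [h1]
      refine (hL1 _ ?_).trans (le_trans (ENNReal.ofReal_le_ofReal ?_) hηε.le)
      · refine (lintegral_mono_set hBt).trans ((hloc (fun y => ‖v y - h y‖ₑ ^ 2)
          (((hv.continuous.aestronglyMeasurable).sub
            hm.aestronglyMeasurable).enorm.pow_const 2)).trans ?_)
        rw [← eLpNorm_two_sq (fun y => v y - h y)]
        refine (mul_le_mul_right (pow_le_pow_left' hv1 2) _).trans ?_
        rw [← ENNReal.ofReal_pow hε0.le, ← ENNReal.ofReal_mul hc₁]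
        refine ENNReal.ofReal_le_ofReal (le_trans ?_ b1)
        exact mul_le_mul_of_nonneg_left (by nlinarith) hc₁
      · rw [hη]
        exact div_le_self hη0'.le (by linarith [(Nat.cast_nonneg n : (0 : ℝ) ≤ n)])
    · have h2 : ∀ a, ∫⁻ z in Metric.ball z₀ (2 * R), ‖dzbar a (A.loc i v) z‖ₑ ≤
          ENNReal.ofReal η := fun a => hL1 _ ((hgrad hv a fun z hz =>
        norm_dzbar_sq_le hg hv hz a).trans (ENNReal.ofReal_le_ofReal
          ((mul_le_mul_of_nonneg_left hv2 (by positivity)).trans b2)))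
      have h3 : ∀ a, ∫⁻ z in Metric.ball z₀ (2 * R), ‖dz a (A.loc i v) z‖ₑ ≤
          ENNReal.ofReal η := fun a => hL1 _ ((hgrad hv.conj a fun z hz =>
        norm_dz_sq_le hg hv hz a).trans (ENNReal.ofReal_le_ofReal (by
          refine le_trans ?_ b3
          rw [mul_assoc (M * c₁)]
          exact mul_le_mul_of_nonneg_left ((hconj v hv).trans
            (mul_le_mul_of_nonneg_left hv2 hC₂)) (by positivity))))
      have hmeas : ∀ {φ : (Fin n → ℂ) → ℂ}, (∀ z ∈ (A.chart i).target, ContDiffAt ℝ ∞ φ z) →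
          AEMeasurable (fun z => ‖φ z‖ₑ) (volume.restrict (Metric.ball z₀ (2 * R))) :=
        fun {φ} hφ => (ContinuousOn.aestronglyMeasurable (fun z hz =>
          (hφ z (hRU (hBt hz))).continuousAt.continuousWithinAt)
          Metric.isOpen_ball.measurableSet).enorm
      calc ∫⁻ z in Metric.ball z₀ (2 * R), ‖fderiv ℝ p z‖ₑ
          ≤ ∫⁻ z in Metric.ball z₀ (2 * R), ∑ a, (‖dz a (A.loc i v) z‖ₑ +
              ‖dzbar a (A.loc i v) z‖ₑ) := by
            refine setLIntegral_mono' Metric.isOpen_ball.measurableSet fun z hz => ?_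
            have e1 : p =ᶠ[nhds z] A.loc i v := by
              filter_upwards [Metric.isOpen_ball.mem_nhds hz] with w hw using hpv w hw
            rw [e1.fderiv_eq, ← ofReal_norm]
            refine (ENNReal.ofReal_le_ofReal (norm_fderiv_le_sum_dz _ _)).trans (le_of_eq ?_)
            rw [ENNReal.ofReal_sum_of_nonneg fun a _ => by positivity]
            refine Finset.sum_congr rfl fun a _ => ?_
            rw [ENNReal.ofReal_add (norm_nonneg _) (norm_nonneg _), ofReal_norm, ofReal_norm]
        _ = ∑ a, ((∫⁻ z in Metric.ball z₀ (2 * R), ‖dz a (A.loc i v) z‖ₑ) +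
              ∫⁻ z in Metric.ball z₀ (2 * R), ‖dzbar a (A.loc i v) z‖ₑ) := by
            have m1 := fun a => hmeas fun z hz => contDiffAt_dz a (hv i z hz)
            have m2 := fun a => hmeas fun z hz => contDiffAt_dzbar a (hv i z hz)
            have m3 : ∀ a ∈ Finset.univ, AEMeasurable (fun z => ‖dz a (A.loc i v) z‖ₑ +
                ‖dzbar a (A.loc i v) z‖ₑ) (volume.restrict (Metric.ball z₀ (2 * R))) :=
              fun a _ => (m1 a).add (m2 a)
            rw [lintegral_finsetSum' _ m3]
            exact Finset.sum_congr rfl fun a _ => lintegral_add_left' (m1 a) _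
        _ ≤ ∑ _a : Fin n, (ENNReal.ofReal η + ENNReal.ofReal η) :=
            Finset.sum_le_sum fun a _ => add_le_add (h3 a) (h2 a)
        _ ≤ ENNReal.ofReal η' := by
            rw [← ENNReal.ofReal_add hη0.le hη0.le, ← ENNReal.ofReal_sum_of_nonneg
              fun _ _ => by positivity]
            refine ENNReal.ofReal_le_ofReal ?_
            rw [Finset.sum_const, Finset.card_univ, Fintype.card_fin, nsmul_eq_mul, hη]
            rw [← add_div, ← mul_div_assoc, div_le_iff₀ (by positivity)]
            nlinarith
        _ ≤ ε := hηε.le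
  have hsub : Metric.ball z₀ (R / 2) ⊆ (A.chart i).target :=
    (Metric.ball_subset_closedBall.trans
      (Metric.closedBall_subset_closedBall (by linarith))).trans hRU
  refine ⟨(A.chart i).source ∩ A.chart i ⁻¹' Metric.ball z₀ (R / 2),
    (A.chart i).isOpen_inter_preimage Metric.isOpen_ball,
    ⟨hx, Metric.mem_ball_self (by linarith)⟩, c, ?_⟩
  set U := (A.chart i).source ∩ A.chart i ⁻¹' Metric.ball z₀ (R / 2) with hU
  have hUo : IsOpen U := (A.chart i).isOpen_inter_preimage Metric.isOpen_ball
  have hS : MeasurableSet (U ∩ {y | h y = c}ᶜ) :=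
    hUo.measurableSet.inter (hm.measurable (measurableSet_singleton c)).compl
  have h0 : volumeFormMeasure A ρ (U ∩ {y | h y = c}ᶜ) = 0 := by
    rw [volumeFormMeasure_apply hρ i hS fun y hy => hy.1.1, localMeasure_apply i hS]
    refine setLIntegral_measure_zero _ _ ?_
    have h1 := ae_restrict_of_ae_restrict_of_subset hsub hh_eq
    have h2 : ∀ᵐ z, z ∈ Metric.ball z₀ (R / 2) → A.loc i h z = c := by
      rw [← ae_restrict_iff' Metric.isOpen_ball.measurableSet]
      filter_upwards [h1, hc] with z e1 e2
      rw [e1, e2]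
    refine measure_mono_null (fun z hz => ?_) (mem_ae_iff.1 h2)
    have hzt := hz.1
    have hz2 : (A.chart i).symm z ∈ U ∩ {y | h y = c}ᶜ := hz.2
    have hz3 : A.chart i ((A.chart i).symm z) ∈ Metric.ball z₀ (R / 2) := hz2.1.2
    rw [(A.chart i).right_inv hzt] at hz3
    exact fun hcon => hz2.2 (hcon hz3)
  refine mem_ae_iff.2 (measure_mono_null (fun y hy => ?_) h0)
  exact not_forall.1 hy |>.elim fun a b => ⟨a, b⟩

/-- Overlapping neighbourhoods meet in a set of positive measure, so their constants agree; the
local constant is a locally constant function on a connected space. -/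
theorem ae_eq_const_of_almost_holomorphic [ConnectedSpace X] (hρ : IsDensity A ρ)
    (hg : IsKahler A g)
    (hm : StronglyMeasurable h) (happ : ∀ ε : ℝ, 0 < ε → ∃ v : X → ℂ, A.IsSmooth v ∧
        eLpNorm (fun x => v x - h x) 2 (volumeFormMeasure A ρ) ≤ ENNReal.ofReal ε ∧
        ∫ x, dbarSq A g v x ∂(volumeFormMeasure A ρ) ≤ ε) :
    ∃ c, ∀ᵐ y ∂(volumeFormMeasure A ρ), h y = c := by
  have := isOpenPosMeasure_volumeForm hρ
  choose U hU hxU c hc using exists_nhds_ae_eq_const hρ hg hm happ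
  have hcc : ∀ x, ∀ y ∈ U x, c y = c x := fun x y hy => by
    have h1 : volumeFormMeasure A ρ (U x ∩ U y) ≠ 0 :=
      ((hU x).inter (hU y)).measure_ne_zero _ ⟨y, hy, hxU y⟩
    obtain ⟨w, hw, h2, h3⟩ := (((frequently_ae_mem_iff.2 h1)).and_eventually
      ((hc x).and (hc y))).exists
    rw [← h2 hw.1, ← h3 hw.2]
  have hlc : IsLocallyConstant c := (IsLocallyConstant.iff_eventually_eq c).2 fun x => by
    filter_upwards [(hU x).mem_nhds (hxU x)] with y hy using hcc x y hy
  obtain ⟨x₀⟩ : Nonempty X := inferInstance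
  obtain ⟨K, hK⟩ := isCompact_univ.elim_finite_subcover U hU fun x _ => mem_iUnion.2 ⟨x, hxU x⟩
  refine ⟨c x₀, ?_⟩
  have hall : ∀ᵐ y ∂(volumeFormMeasure A ρ), ∀ k ∈ K, y ∈ U k → h y = c k :=
    (Filter.eventually_all_finset K).2 fun k _ => hc k
  filter_upwards [hall] with y hy
  obtain ⟨k, hk, hyk⟩ := mem_iUnion₂.1 (hK (mem_univ y))
  rw [hy k hk hyk]
  exact hlc.apply_eq_of_preconnectedSpace k x₀

end

end

/-! ### The Poincaré inequality. -/

section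

variable {n : ℕ}
variable {X : Type*} [TopologicalSpace X] [ChartedSpace (Fin n → ℂ) X] {ι : Type*}
  {A : CoordCover n X ι}
open ComplexConjugate Matrix

section
variable [MeasurableSpace X] [BorelSpace X] {ρ : ι → (Fin n → ℂ) → ℝ}
  [IsManifold 𝓘(ℂ, Fin n → ℂ) ω X] [T2Space X] [CompactSpace X]
  {g : ι → (Fin n → ℂ) → Matrix (Fin n) (Fin n) ℂ} {u v f h w : X → ℂ}

/-- The Dirichlet energy of `f - w` is nonnegative; the cross terms are evaluated by symmetry of
`L`. -/
theorem two_mul_re_integral_conj_mul_lapL_le (hρ : IsSmoothDensity A ρ) (hg : IsKahler A g)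
    (hf : A.IsSmooth f) (hw : A.IsSmooth w) :
    2 * (∫ x, conj (f x) * lapL A ρ g w x ∂(volumeFormMeasure A ρ)).re ≤
      ∫ x, dbarSq A g f x ∂(volumeFormMeasure A ρ) +
        ∫ x, dbarSq A g w x ∂(volumeFormMeasure A ρ) := by
  have hw' : A.IsSmooth fun x => (-1 : ℂ) * w x := (isSmooth_const _).mul hw
  have hfw : A.IsSmooth fun x => f x + (-1 : ℂ) * w x := hf.add hw'
  have hLf := (isSmooth_lapL hρ hg hf).continuous
  have hLw := (isSmooth_lapL hρ hg hw).continuous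
  have cf := hf.continuous
  have cw := hw.continuous
  have h1 := integral_conj_mul_lapL hρ hg hfw
  have h2 : ∀ x, conj (f x + (-1 : ℂ) * w x) * lapL A ρ g (fun x => f x + (-1 : ℂ) * w x) x =
      (conj (f x) * lapL A ρ g f x + conj (w x) * lapL A ρ g w x) -
        (conj (f x) * lapL A ρ g w x + conj (w x) * lapL A ρ g f x) := fun x => by
    rw [lapL_add hρ hg hf hw', lapL_const_mul hρ hg _ hw]
    simp only [map_add, map_mul, map_neg, map_one]
    ring
  simp only [h2] at h1
  have i1 : Integrable (fun x => conj (f x) * lapL A ρ g f x) (volumeFormMeasure A ρ) :=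
    integrable_of_continuous hρ.toIsDensity (by fun_prop)
  have i2 : Integrable (fun x => conj (w x) * lapL A ρ g w x) (volumeFormMeasure A ρ) :=
    integrable_of_continuous hρ.toIsDensity (by fun_prop)
  have i3 : Integrable (fun x => conj (f x) * lapL A ρ g w x) (volumeFormMeasure A ρ) :=
    integrable_of_continuous hρ.toIsDensity (by fun_prop)
  have i4 : Integrable (fun x => conj (w x) * lapL A ρ g f x) (volumeFormMeasure A ρ) :=
    integrable_of_continuous hρ.toIsDensity (by fun_prop)
  have i12 : Integrable (fun x => conj (f x) * lapL A ρ g f x + conj (w x) * lapL A ρ g w x)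
    (volumeFormMeasure A ρ) := i1.add i2
  have i34 : Integrable (fun x => conj (f x) * lapL A ρ g w x + conj (w x) * lapL A ρ g f x)
    (volumeFormMeasure A ρ) := i3.add i4
  rw [integral_sub i12 i34, integral_add i1 i2, integral_add i3 i4,
    integral_conj_mul_lapL hρ hg hf, integral_conj_mul_lapL hρ hg hw,
    lapL_symm hρ hg hf hw] at h1
  have h3 : ∫ x, f x * conj (lapL A ρ g w x) ∂(volumeFormMeasure A ρ) =
      conj (∫ x, conj (f x) * lapL A ρ g w x ∂(volumeFormMeasure A ρ)) := by
    rw [← integral_conj]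
    refine integral_congr_ae (Filter.Eventually.of_forall fun x => ?_)
    simp
  rw [h3] at h1
  have h4 := congrArg Complex.re h1
  simp only [Complex.sub_re, Complex.add_re, Complex.ofReal_re, Complex.conj_re] at h4
  have h5 : 0 ≤ ∫ x, dbarSq A g (fun x => f x + (-1 : ℂ) * w x) x ∂(volumeFormMeasure A ρ) :=
    integral_nonneg fun x => dbarSq_nonneg hg hfw x
  linarith

/-- The Poincaré inequality of a weighted Kähler manifold whose weight is at least as positive
as the metric. -/
theorem integral_norm_sq_le_integral_dbarSq [ConnectedSpace X] (hρ : IsSmoothDensity A ρ)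
    (hg : IsKahler A g) (hc : CurvBound A ρ g) (hf : A.IsSmooth f)
    (h0 : ∫ x, f x ∂(volumeFormMeasure A ρ) = 0) :
    ∫ x, ‖f x‖ ^ 2 ∂(volumeFormMeasure A ρ) ≤ ∫ x, dbarSq A g f x ∂(volumeFormMeasure A ρ) := by
  have := isFiniteMeasure_volumeForm hρ.toIsDensity
  obtain ⟨h, hm, -, hv, hw⟩ := exists_almost_holomorphic_limit hρ hg hf
  -- The part of `f` orthogonal to the range of `L` is a constant, so `f - c` is a limit of
  -- functions `Lw`.
  obtain ⟨c, hc'⟩ := ae_eq_const_of_almost_holomorphic hρ.toIsDensity hg hm hv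
  refine le_of_forall_pos_le_add fun ε hε => ?_
  obtain ⟨w, hws, hwε⟩ := hw (Real.sqrt ε) (Real.sqrt_pos.2 hε)
  have hLw := (isSmooth_lapL hρ hg hws).continuous
  have cf := hf.continuous
  have h1 : ∫ x, ‖f x - c - lapL A ρ g w x‖ ^ 2 ∂(volumeFormMeasure A ρ) ≤ ε := by
    have e1 : eLpNorm (fun x => f x - c - lapL A ρ g w x) 2 (volumeFormMeasure A ρ) ≤
        ENNReal.ofReal (Real.sqrt ε) := by
      refine le_trans (le_of_eq (eLpNorm_congr_ae ?_)) hwε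
      filter_upwards [hc'] with x hx
      rw [hx]
    have e2 := pow_le_pow_left' e1 2
    rw [eLpNorm_two_sq, ← ENNReal.ofReal_pow (Real.sqrt_nonneg _), Real.sq_sqrt hε.le] at e2
    rw [integral_eq_lintegral_of_nonneg_ae (Filter.Eventually.of_forall fun x => by positivity)
      (by fun_prop)]
    refine ENNReal.toReal_le_of_le_ofReal hε.le (le_trans (le_of_eq ?_) e2)
    refine lintegral_congr fun x => ?_
    rw [ENNReal.ofReal_pow (norm_nonneg _), ofReal_norm]
  have hint : ∀ {φ : X → ℂ}, Continuous φ →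
      Integrable (fun x => ‖φ x‖ ^ 2) (volumeFormMeasure A ρ) := fun hφ =>
    (memLp_two_iff_integrable_sq_norm hφ.aestronglyMeasurable).1
      (memLp_of_continuous hρ.toIsDensity hφ)
  have i1 : Integrable (fun x => conj (f x) * lapL A ρ g w x) (volumeFormMeasure A ρ) :=
    integrable_of_continuous hρ.toIsDensity (by fun_prop)
  have i2 : Integrable (fun x => conj (f x) * c) (volumeFormMeasure A ρ) :=
    integrable_of_continuous hρ.toIsDensity (by fun_prop)
  have i3 : Integrable (fun x => conj c * lapL A ρ g w x) (volumeFormMeasure A ρ) :=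
    integrable_of_continuous hρ.toIsDensity (by fun_prop)
  have z2 : ∫ x, conj (f x) * c ∂(volumeFormMeasure A ρ) = 0 := by
    rw [integral_mul_const, integral_conj, h0]
    simp
  have z3 : ∫ x, conj c * lapL A ρ g w x ∂(volumeFormMeasure A ρ) = 0 := by
    have := integral_mul_lapL hρ hg hws (p := fun _ => conj c) (isSmooth_const _)
    rw [this]
    refine integral_eq_zero_of_ae (Filter.Eventually.of_forall fun x => ?_)
    exact Finset.sum_eq_zero fun a _ => by
      rw [show A.loc (A.indexAt x) (fun _ => conj c) = fun _ => conj c from rfl, dz_const, mul_zero]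
  have i32 : Integrable (fun x => 2 * (conj c * lapL A ρ g w x) - 2 * (conj (f x) * c))
    (volumeFormMeasure A ρ) := (i3.const_mul 2).sub (i2.const_mul 2)
  have i321 : Integrable (fun x => 2 * (conj c * lapL A ρ g w x) - 2 * (conj (f x) * c) -
      2 * (conj (f x) * lapL A ρ g w x)) (volumeFormMeasure A ρ) := i32.sub (i1.const_mul 2)
  have ire : Integrable (fun x => (2 * (conj c * lapL A ρ g w x) - 2 * (conj (f x) * c) -
      2 * (conj (f x) * lapL A ρ g w x)).re) (volumeFormMeasure A ρ) := i321.re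
  have isq : Integrable (fun x => ‖f x‖ ^ 2 + ‖lapL A ρ g w x‖ ^ 2) (volumeFormMeasure A ρ) :=
    (hint cf).add (hint hLw)
  -- The square is expanded and only `|c|²` is dropped. The cross terms with `c` integrate to zero,
  -- as `f` and `Lw` both have mean zero.
  have h2 : ∫ x, (‖f x‖ ^ 2 + ‖lapL A ρ g w x‖ ^ 2 + (2 * (conj c * lapL A ρ g w x) -
      2 * (conj (f x) * c) - 2 * (conj (f x) * lapL A ρ g w x)).re) ∂(volumeFormMeasure A ρ) ≤
      ∫ x, ‖f x - c - lapL A ρ g w x‖ ^ 2 ∂(volumeFormMeasure A ρ) := by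
    refine integral_mono (isq.add ire) (hint (by fun_prop)) fun x => ?_
    simp only [← Complex.normSq_eq_norm_sq, Complex.normSq_apply, Complex.sub_re, Complex.sub_im,
      Complex.mul_re, Complex.conj_re, Complex.conj_im, Complex.re_ofNat, Complex.im_ofNat]
    nlinarith [mul_self_nonneg c.re, mul_self_nonneg c.im]
  have h3 : ∫ x, (2 * (conj c * lapL A ρ g w x) - 2 * (conj (f x) * c) -
      2 * (conj (f x) * lapL A ρ g w x)).re ∂(volumeFormMeasure A ρ) =
      -(2 * (∫ x, conj (f x) * lapL A ρ g w x ∂(volumeFormMeasure A ρ)).re) := by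
    have := integral_re (𝕜 := ℂ) i321
    simp only [RCLike.re_eq_complex_re] at this
    rw [integral_const_mul] at z3
    rw [this, integral_sub i32 (i1.const_mul 2),
      integral_sub (i3.const_mul 2) (i2.const_mul 2), integral_const_mul, integral_const_mul,
      integral_const_mul, integral_const_mul, z2, z3]
    simp
  rw [integral_add isq ire, integral_add (hint cf) (hint hLw), h3] at h2
  -- The cross term is at most the sum of the energies of `f` and `w`, and by Bochner the energy of
  -- `w` is absorbed by `‖Lw‖²`.
  have h4 := two_mul_re_integral_conj_mul_lapL_le hρ hg hf hws
  have h5 := integral_dbarSq_le hρ hg hc hws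
  linarith

end

end

/-! ### Curvature of metrics on real line bundles. -/

section

variable {n : ℕ}
variable {X : Type*} [TopologicalSpace X] [ChartedSpace (Fin n → ℂ) X] {ι : Type*}
  {A : CoordCover n X ι}

open ComplexConjugate Matrix

section

/-- Harmonicity on the line through `v` says that the real Hessian satisfies `B(v,v) + B(iv,iv) =
0`. Polarization extends this to pairs of vectors, and the mixed Wirtinger derivatives are
combinations of such expressions. -/
theorem dz_dzbar_eq_zero_of_harmonicAt {F : (Fin n → ℂ) → ℂ} {z : Fin n → ℂ}
    (hF : ContDiffAt ℝ ∞ F z)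
    (hh : ∀ v : Fin n → ℂ, InnerProductSpace.HarmonicAt (fun l : ℂ => F (z + l • v)) 0)
    (a b : Fin n) : dz a (dzbar b F) z = 0 := by
  set B := fderiv ℝ (fderiv ℝ F) z with hB
  have hsymm : ∀ v w, B v w = B w v := fun v w => fderiv_fderiv_comm hF v w
  have hline : ∀ v : Fin n → ℂ, B v v + B (Complex.I • v) (Complex.I • v) = 0 := fun v => by
    let Lv : ℂ →L[ℝ] (Fin n → ℂ) := (ContinuousLinearMap.id ℝ ℂ).smulRight v
    have hz : z + Lv 0 = z := by simp
    have h1 := (hh v).2.self_of_nhds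
    rw [InnerProductSpace.laplacian_eq_iteratedFDeriv_complexPlane] at h1
    simp only [iteratedFDeriv_two_apply, Pi.zero_apply] at h1
    have hev : ∀ᶠ l : ℂ in nhds 0, DifferentiableAt ℝ F (z + Lv l) := by
      have h2 : ∀ᶠ w in nhds (z + Lv 0), DifferentiableAt ℝ F w := by
        rw [hz]
        filter_upwards [(hF.of_le (m := 1) (by simp)).eventually (by simp)] with w hw
        exact hw.differentiableAt (by simp)
      have h3 : ContinuousAt (fun l : ℂ => z + Lv l) 0 := by fun_prop
      exact h3.eventually h2
    have hline' : ∀ l : ℂ, HasFDerivAt (fun l : ℂ => z + Lv l) Lv l := fun l =>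
      Lv.hasFDerivAt.const_add z
    have h4 : fderiv ℝ (fun l : ℂ => F (z + l • v)) =ᶠ[nhds 0]
        fun l => (fderiv ℝ F (z + Lv l)).comp Lv := by
      filter_upwards [hev] with l hl
      exact (hl.hasFDerivAt.comp l (hline' l)).fderiv
    have h5 : HasFDerivAt (fun l => fderiv ℝ F (z + Lv l)) (B.comp Lv) 0 := by
      have h6 : DifferentiableAt ℝ (fderiv ℝ F) z :=
        (hF.fderiv_right (m := ∞) (by simp)).differentiableAt (by simp)
      have h7 : HasFDerivAt (fderiv ℝ F) B (z + Lv 0) := by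
        rw [hz]
        exact h6.hasFDerivAt
      exact h7.comp 0 (hline' 0)
    have h6 : ∀ μ ν : ℂ, fderiv ℝ (fderiv ℝ fun l : ℂ => F (z + l • v)) 0 μ ν =
        B (μ • v) (ν • v) := fun μ ν => by
      rw [h4.fderiv_eq, (h5.clm_comp (hasFDerivAt_const Lv (0 : ℂ))).fderiv]
      simp [Lv]
    simpa [h6] using h1
  have hpol : ∀ v w, B v w + B (Complex.I • v) (Complex.I • w) = 0 := fun v w => by
    have h1 := hline (v + w)
    simp only [smul_add, map_add, _root_.add_apply] at h1
    rw [hsymm w v, hsymm (Complex.I • w) (Complex.I • v)] at h1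
    linear_combination (1 / 2) * h1 - (1 / 2) * hline v - (1 / 2) * hline w
  have hI : ∀ c : Fin n, Complex.I • (Pi.single c 1 : Fin n → ℂ) = Pi.single c Complex.I :=
    fun c => by
      rw [← Pi.single_smul']
      simp
  have hII : ∀ c : Fin n, Complex.I • (Pi.single c Complex.I : Fin n → ℂ) = -Pi.single c 1 :=
    fun c => by
      rw [← hI, smul_smul, Complex.I_mul_I, neg_one_smul]
  have e1 := hpol (Pi.single a 1) (Pi.single b 1)
  have e2 := hpol (Pi.single a 1) (Pi.single b Complex.I)
  rw [hI, hI] at e1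
  rw [hI, hII, map_neg] at e2
  rw [dz, fderiv_dzbar _ hF, fderiv_dzbar _ hF]
  linear_combination (1 / 4) * e1 + (1 / 4) * Complex.I * e2 -
    (1 / 4) * B (Pi.single a Complex.I) (Pi.single b Complex.I) * Complex.I_sq

theorem dz_dzbar_comp_holomorphic {T : (Fin n → ℂ) → (Fin n → ℂ)} {f : (Fin n → ℂ) → ℂ}
    {z : Fin n → ℂ} (hT : ContDiffAt ℂ ω T z) (hf : ContDiffAt ℝ ∞ f (T z)) (a b : Fin n) :
    dz a (dzbar b fun w => f (T w)) z = ∑ c, ∑ d, fderiv ℂ T z (Pi.single a 1) d *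
      dz d (dzbar c f) (T z) * conj (fderiv ℂ T z (Pi.single b 1) c) := by
  have hTd : ∀ᶠ w in nhds z, HasFDerivAt T (fderiv ℂ T w) w := by
    filter_upwards [hT.eventually (by simp)] with w hw
    exact (hw.differentiableAt (by simp)).hasFDerivAt
  have hev : ∀ᶠ w in nhds z, DifferentiableAt ℝ f (T w) := by
    have h2 : ∀ᶠ w in nhds (T z), DifferentiableAt ℝ f w := by
      filter_upwards [(hf.of_le (m := 1) (by simp)).eventually (by simp)] with w hw
      exact hw.differentiableAt (by simp)
    exact hT.continuousAt.eventually h2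
  have h1 : (dzbar b fun w => f (T w)) =ᶠ[nhds z]
      fun w => ∑ c, conj (fderiv ℂ T w (Pi.single b 1) c) * dzbar c f (T w) := by
    filter_upwards [hTd, hev] with w hw hw2
    exact dzbar_comp_holomorphic hw hw2 b
  have hJ : ∀ c, DifferentiableAt ℂ (fun w => fderiv ℂ T w (Pi.single b 1) c) z := fun c => by
    have h2 : DifferentiableAt ℂ (fderiv ℂ T) z :=
      (hT.fderiv_right (m := 1) (by simp)).differentiableAt (by simp)
    exact differentiableAt_pi.1 (h2.clm_apply (differentiableAt_const _)) c
  have hJ' : ∀ c, DifferentiableAt ℝ (fun w => conj (fderiv ℂ T w (Pi.single b 1) c)) z :=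
    fun c => Complex.conjCLE.differentiableAt.comp z ((hJ c).restrictScalars ℝ)
  have hfd : ∀ c, DifferentiableAt ℝ (dzbar c f) (T z) := fun c =>
    (contDiffAt_dzbar c hf).differentiableAt (by simp)
  have hTR : DifferentiableAt ℝ T z := (hT.differentiableAt (by simp)).restrictScalars ℝ
  have hfT : ∀ c, DifferentiableAt ℝ (fun w => dzbar c f (T w)) z := fun c => (hfd c).comp z hTR
  have hprod : ∀ c ∈ Finset.univ, DifferentiableAt ℝ
      (fun w => conj (fderiv ℂ T w (Pi.single b 1) c) * dzbar c f (T w)) z :=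
    fun c _ => (hJ' c).mul (hfT c)
  rw [dz_congr h1, dz_sum a _ hprod]
  refine Finset.sum_congr rfl fun c _ => ?_
  rw [dz_mul a (hJ' c) (hfT c), dz_conj, dzbar_holomorphic (hJ c), map_zero, zero_mul, zero_add,
    dz_comp_holomorphic hTd.self_of_nhds (hfd c), Finset.mul_sum]
  exact Finset.sum_congr rfl fun d _ => by ring

end

section
variable [IsManifold 𝓘(ℂ, Fin n → ℂ) ω X] {L S : RealLineBundle A}

def SmoothMetric.localWeight (φ : SmoothMetric L) (i : ι) (z : Fin n → ℂ) : ℝ :=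
  φ.weight i ((A.chart i).symm z)

theorem SmoothMetric.contDiffAt_localWeight (φ : SmoothMetric L) {i : ι} {z : Fin n → ℂ}
    (hz : z ∈ (A.chart i).target) : ContDiffAt ℝ ∞ (φ.localWeight i) z :=
  (φ.smooth i).contDiffAt ((A.chart i).open_target.mem_nhds hz)

theorem SmoothMetric.contDiffAt_ofReal_localWeight (φ : SmoothMetric L) {i : ι} {z : Fin n → ℂ}
    (hz : z ∈ (A.chart i).target) : ContDiffAt ℝ ∞ (fun w => (φ.localWeight i w : ℂ)) z :=
  Complex.ofRealCLM.contDiff.contDiffAt.comp z (φ.contDiffAt_localWeight hz)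

theorem SmoothMetric.curv_apply (φ : SmoothMetric L) (i : ι) (z : Fin n → ℂ) (a b : Fin n) :
    φ.curv i z a b = dz a (dzbar b fun w => (φ.localWeight i w : ℂ)) z := rfl

/-- On each complex line `log |g|` is harmonic for a holomorphic function without zeros, and real
linear combinations remain harmonic. -/
theorem harmonicAt_logTrans (L : RealLineBundle A) {i j : ι} {z : Fin n → ℂ}
    (hz : z ∈ A.overlap i j) (v : Fin n → ℂ) : InnerProductSpace.HarmonicAt
      (fun l : ℂ => ((L.logTrans i j ((A.chart i).symm (z + l • v)) : ℝ) : ℂ)) 0 := by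
  have hz0 : z + (0 : ℂ) • v = z := by simp
  have hcont : Continuous fun l : ℂ => z + l • v := by fun_prop
  set U : Set ℂ := (fun l : ℂ => z + l • v) ⁻¹' A.overlap i j with hU
  have hUo : IsOpen U := (CoordCover.isOpen_overlap i j).preimage hcont
  have h0U : (0 : ℂ) ∈ U := by
    rw [hU, mem_preimage, hz0]
    exact hz
  have hB : ∀ B : LineBundle A, InnerProductSpace.HarmonicAt
      (fun l : ℂ => Real.log ‖B.g i j ((A.chart i).symm (z + l • v))‖) 0 := fun B => by
    refine AnalyticAt.harmonicAt_log_norm (DifferentiableOn.analyticAt (s := U) ?_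
      (hUo.mem_nhds h0U)) ?_
    · exact (B.holomorphic i j).comp (by fun_prop) fun l hl => hl
    · rw [hz0]
      have h1 := CoordCover.mem_overlap.1 hz
      exact B.ne_zero i j _ ⟨(A.chart i).map_target h1.1, h1.2⟩
  have hsum : ∀ s : Finset (LineBundle A), InnerProductSpace.HarmonicAt (fun l : ℂ =>
      ∑ B ∈ s, L B * Real.log (‖B.g i j ((A.chart i).symm (z + l • v))‖ ^ 2)) 0 := fun s => by
    classical
    induction s using Finset.induction_on with
    | empty => simpa using InnerProductSpace.harmonicAt_const (x := (0 : ℂ)) (0 : ℝ)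
    | insert B s hBs ih =>
      have h2 := ((hB B).const_smul (c := L B * 2)).add ih
      convert h2 using 1
      ext l
      simp only [Finset.sum_insert hBs, Pi.add_apply, Pi.smul_apply, smul_eq_mul, Real.log_pow]
      push_cast
      ring
  exact (hsum L.support).comp_CLM Complex.ofRealCLM

/-- Two weights differ by `logTrans`, which is pluriharmonic, so the complex Hessian transforms like
that of a function. With commuting derivatives this makes the curvature of a positive metric a
Kähler metric. -/
theorem SmoothMetric.curv_trans (φ : SmoothMetric L) {i j : ι} {z : Fin n → ℂ}
    (hz : z ∈ A.overlap i j) : φ.curv i z =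
      (jacM A i j z)ᵀ * φ.curv j (A.trans i j z) * (jacM A i j z).map conj := by
  have hzi := (CoordCover.mem_overlap.1 hz).1
  have hsub : ∀ w ∈ A.overlap i j, L.logTrans i j ((A.chart i).symm w) =
      φ.localWeight i w - φ.localWeight j (A.trans i j w) := fun w hw => by
    have h1 := CoordCover.mem_overlap.1 hw
    rw [← φ.transition i j _ ⟨(A.chart i).map_target h1.1, h1.2⟩, SmoothMetric.localWeight,
      SmoothMetric.localWeight, CoordCover.symm_trans hw]
  have hcj := φ.contDiffAt_ofReal_localWeight (CoordCover.trans_mem hz)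
  have hcT : ContDiffAt ℝ ∞ (fun w => (φ.localWeight j (A.trans i j w) : ℂ)) z :=
    hcj.comp z (CoordCover.contDiffAt_trans_real hz)
  have hci := φ.contDiffAt_ofReal_localWeight hzi
  have hF : ContDiffAt ℝ ∞ (fun w => (φ.localWeight i w : ℂ) -
      (φ.localWeight j (A.trans i j w) : ℂ)) z := hci.sub hcT
  have hzero : ∀ a b, dz a (dzbar b fun w => (φ.localWeight i w : ℂ) -
      (φ.localWeight j (A.trans i j w) : ℂ)) z = 0 := fun a b => by
    refine dz_dzbar_eq_zero_of_harmonicAt hF (fun v => ?_) a b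
    refine (InnerProductSpace.harmonicAt_congr_nhds ?_).1 (harmonicAt_logTrans L hz v)
    have hcont : ContinuousAt (fun l : ℂ => z + l • v) 0 := by fun_prop
    have h0 : A.overlap i j ∈ nhds (z + (0 : ℂ) • v) := by
      simpa using (CoordCover.isOpen_overlap i j).mem_nhds hz
    filter_upwards [hcont h0] with l hl
    rw [hsub _ hl]
    push_cast
    rfl
  ext a b
  have h1 := hzero a b
  have hev : (dzbar b fun w => (φ.localWeight i w : ℂ) - (φ.localWeight j (A.trans i j w) : ℂ))
      =ᶠ[nhds z] fun w => dzbar b (fun w => (φ.localWeight i w : ℂ)) w -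
        dzbar b (fun w => (φ.localWeight j (A.trans i j w) : ℂ)) w := by
    filter_upwards [(CoordCover.isOpen_overlap i j).mem_nhds hz] with w hw
    exact dzbar_sub b ((φ.contDiffAt_ofReal_localWeight
      (CoordCover.mem_overlap.1 hw).1).differentiableAt (by simp))
      (((φ.contDiffAt_ofReal_localWeight (CoordCover.trans_mem hw)).comp w
        (CoordCover.contDiffAt_trans_real hw)).differentiableAt (by simp))
  rw [dz_congr hev, dz_sub a ((contDiffAt_dzbar b hci).differentiableAt (by simp))
    ((contDiffAt_dzbar b hcT).differentiableAt (by simp)), sub_eq_zero] at h1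
  rw [SmoothMetric.curv_apply, h1, dz_dzbar_comp_holomorphic
    (f := fun w => (φ.localWeight j w : ℂ)) (CoordCover.contDiffAt_trans hz) hcj]
  simp only [Matrix.mul_apply, Finset.sum_mul, Matrix.transpose_apply, Matrix.map_apply,
    SmoothMetric.curv_apply]
  rfl

theorem PosMetric.isKahler (φ : PosMetric L) : IsKahler A φ.toSmoothMetric.curv where
  smooth i z hz a b := contDiffAt_dz a (contDiffAt_dzbar b
    (φ.toSmoothMetric.contDiffAt_ofReal_localWeight hz))
  posDef := φ.pos
  trans i j z hz := φ.toSmoothMetric.curv_trans hz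
  closed i z hz a b c := dz_dz_comm c (contDiffAt_dzbar b
    (φ.toSmoothMetric.contDiffAt_ofReal_localWeight hz)) a

theorem IsKahler.combination {g g' : ι → (Fin n → ℂ) → Matrix (Fin n) (Fin n) ℂ}
    (hg : IsKahler A g) (hg' : IsKahler A g') {r s : ℝ} (hr : 0 ≤ r) (hs : 0 ≤ s)
    (hrs : 0 < r + s) :
    IsKahler A fun i z => (r : ℂ) • g i z + (s : ℂ) • g' i z where
  smooth i z hz a b := (contDiffAt_const.mul (hg.smooth i z hz a b)).add
    (contDiffAt_const.mul (hg'.smooth i z hz a b))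
  posDef i z hz := by
    rcases hr.eq_or_lt with h | h
    · have hs' : 0 < s := by linarith
      simpa [← h] using (hg'.posDef i z hz).smul (Complex.zero_lt_real.2 hs')
    · exact ((hg.posDef i z hz).smul (Complex.zero_lt_real.2 h)).add_posSemidef
        ((hg'.posDef i z hz).posSemidef.smul (Complex.zero_le_real.2 hs))
  trans i j z hz := by
    rw [hg.trans i j z hz, hg'.trans i j z hz]
    simp [Matrix.mul_add, Matrix.add_mul]
  closed i z hz a b c := by
    have d1 := fun a b => (hg.smooth i z hz a b).differentiableAt (by simp)
    have d2 := fun a b => (hg'.smooth i z hz a b).differentiableAt (by simp)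
    have key : ∀ a b c, dz c (fun w => ((r : ℂ) • g i w + (s : ℂ) • g' i w) a b) z =
        r * dz c (fun w => g i w a b) z + s * dz c (fun w => g' i w a b) z := fun a b c => by
      rw [← dz_const_mul c _ (d1 a b), ← dz_const_mul c _ (d2 a b)]
      exact dz_add c ((d1 a b).const_mul _) ((d2 a b).const_mul _)
    rw [key, key, hg.closed i z hz a b c, hg'.closed i z hz a b c]

theorem RealLineBundle.logTrans_add (L M : RealLineBundle A) (i j : ι) (x : X) :
    (L + M).logTrans i j x = L.logTrans i j x + M.logTrans i j x :=
  Finsupp.sum_add_index' (fun _ => by simp) fun _ _ _ => by ring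

theorem RealLineBundle.logTrans_neg (L : RealLineBundle A) (i j : ι) (x : X) :
    (-L).logTrans i j x = -L.logTrans i j x := by
  have h1 := RealLineBundle.logTrans_add L (-L) i j x
  have h2 : RealLineBundle.logTrans (0 : RealLineBundle A) i j x = 0 := Finsupp.sum_zero_index
  rw [add_neg_cancel, h2] at h1
  linarith

theorem logTrans_canonical (i j : ι) (x : X) :
    (canonical A).logTrans i j x = Real.log (‖A.jac i j x‖ ^ 2) := by
  rw [RealLineBundle.logTrans, canonical, Finsupp.sum_single_index (by simp), one_mul]
  rfl

def expDensity (ψ : SmoothMetric S) (φ : PosMetric (-(canonical A + S))) (i : ι)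
    (z : Fin n → ℂ) : ℝ :=
  Real.exp (-φ.weight i ((A.chart i).symm z) - ψ.weight i ((A.chart i).symm z))

/-- The contributions of `S` to `φ` and `ψ` cancel, and `-K_X` leaves exactly the square modulus of
the holomorphic Jacobian. -/
theorem isSmoothDensity_expDensity (ψ : SmoothMetric S) (φ : PosMetric (-(canonical A + S))) :
    IsSmoothDensity A (expDensity ψ φ) := by
  have hsm : ∀ i, ∀ z ∈ (A.chart i).target, ContDiffAt ℝ ∞ (expDensity ψ φ i) z := fun i z hz =>
    ((φ.toSmoothMetric.contDiffAt_localWeight hz).neg.sub (ψ.contDiffAt_localWeight hz)).exp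
  refine ⟨⟨fun i z hz => (hsm i z hz).continuousAt.continuousWithinAt,
    fun i z _ => Real.exp_pos _, fun i j z hz => ?_⟩, hsm⟩
  have h1 := CoordCover.mem_overlap.1 hz
  have hx : (A.chart i).symm z ∈ (A.chart i).source ∩ (A.chart j).source :=
    ⟨(A.chart i).map_target h1.1, h1.2⟩
  have e1 := φ.transition i j _ hx
  have e2 := ψ.transition i j _ hx
  rw [RealLineBundle.logTrans_neg, RealLineBundle.logTrans_add, logTrans_canonical] at e1
  have e3 : A.jac i j ((A.chart i).symm z) = (fderiv ℂ (A.trans i j) z).det := by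
    rw [CoordCover.jac, (A.chart i).right_inv h1.1]
  have hne : A.jac i j ((A.chart i).symm z) ≠ 0 := (canonicalBundle A).ne_zero i j _ hx
  rw [expDensity, expDensity, CoordCover.symm_trans hz, ← e3,
    ← Real.exp_log (show 0 < ‖A.jac i j ((A.chart i).symm z)‖ ^ 2 by positivity), ← Real.exp_add]
  congr 1
  linarith

/-- The difference of the two forms is exactly the curvature of `ψ`. This is where semipositivity
enters the proof. -/
theorem curvBound_expDensity {ψ : SmoothMetric S} (hψ : ψ.IsSemipositive)
    (φ : PosMetric (-(canonical A + S))) :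
    CurvBound A (expDensity ψ φ) φ.toSmoothMetric.curv := fun i z hz => by
  have h1 : complexHessian (fun w => -Real.log (expDensity ψ φ i w)) z -
      φ.toSmoothMetric.curv i z = ψ.curv i z := by
    have h2 : (fun w => ((-Real.log (expDensity ψ φ i w) : ℝ) : ℂ)) = fun w =>
        (φ.toSmoothMetric.localWeight i w : ℂ) + (ψ.localWeight i w : ℂ) := by
      ext w
      rw [expDensity, Real.log_exp, SmoothMetric.localWeight, SmoothMetric.localWeight]
      push_cast
      ring
    ext a b
    have c1 := φ.toSmoothMetric.contDiffAt_ofReal_localWeight hz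
    have c2 := ψ.contDiffAt_ofReal_localWeight hz
    have hev : (dzbar b fun w => (φ.toSmoothMetric.localWeight i w : ℂ) + (ψ.localWeight i w : ℂ))
        =ᶠ[nhds z] fun w => dzbar b (fun w => (φ.toSmoothMetric.localWeight i w : ℂ)) w +
          dzbar b (fun w => (ψ.localWeight i w : ℂ)) w := by
      filter_upwards [(A.chart i).open_target.mem_nhds hz] with w hw
      exact dzbar_add b ((φ.toSmoothMetric.contDiffAt_ofReal_localWeight hw).differentiableAt
        (by simp)) ((ψ.contDiffAt_ofReal_localWeight hw).differentiableAt (by simp))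
    rw [Matrix.sub_apply, complexHessian, Matrix.of_apply, h2, dz_congr hev,
      dz_add a ((contDiffAt_dzbar b c1).differentiableAt (by simp))
      ((contDiffAt_dzbar b c2).differentiableAt (by simp)), SmoothMetric.curv_apply,
      SmoothMetric.curv_apply]
    ring
  rw [h1]
  exact hψ i z hz

end

end

/-! ### Mixed discriminants and Bernstein polynomials. -/

section

variable {n : ℕ}
variable {X : Type*} [TopologicalSpace X] [ChartedSpace (Fin n → ℂ) X] {ι : Type*}
  {A : CoordCover n X ι}

open ComplexConjugate Matrix

section

def columnMatrix (C : Fin n → Matrix (Fin n) (Fin n) ℂ) (l : Fin n → Fin n) :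
    Matrix (Fin n) (Fin n) ℂ :=
  Matrix.of fun a k => C k a (l k)

/-- A Cauchy-Binet formula: the matrix products are expanded, the column indices `l` are collected,
and the sums over `σ` and `π` become a determinant and its conjugate. -/
theorem wedgeCoeff_mul_conjTranspose (C : Fin n → Matrix (Fin n) (Fin n) ℂ) :
    wedgeCoeff (fun k => C k * (C k)ᴴ) =
      ((∑ l : Fin n → Fin n, ‖(columnMatrix C l).det‖ ^ 2 : ℝ) : ℂ) := by
  have h1 : ∀ σ π : Equiv.Perm (Fin n), ∏ k, (C k * (C k)ᴴ) (σ k) (π k) =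
      ∑ l : Fin n → Fin n, (∏ k, C k (σ k) (l k)) * conj (∏ k, C k (π k) (l k)) := fun σ π => by
    simp only [Matrix.mul_apply, Matrix.conjTranspose_apply]
    rw [Finset.prod_univ_sum]
    simp only [Fintype.piFinset_univ, Finset.prod_mul_distrib, map_prod]
    rfl
  simp only [wedgeCoeff, h1, Finset.mul_sum]
  push_cast
  rw [Finset.sum_congr rfl fun σ _ => Finset.sum_comm, Finset.sum_comm]
  refine Finset.sum_congr rfl fun l _ => ?_
  rw [← Complex.mul_conj', Matrix.det_apply', map_sum, Finset.sum_mul_sum]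
  refine Finset.sum_congr rfl fun σ _ => Finset.sum_congr rfl fun π _ => ?_
  simp only [columnMatrix, Matrix.of_apply, map_mul, map_prod, map_intCast]
  ring

/-- Otherwise the multilinear map `(v_k) ↦ det (C_k v_k)` vanishes on all tuples of basis vectors,
hence identically, although it equals one at `v_k = C_k⁻¹ e_k`. -/
theorem exists_det_columnMatrix_ne_zero {C : Fin n → Matrix (Fin n) (Fin n) ℂ}
    (hC : ∀ k, IsUnit (C k)) : ∃ l : Fin n → Fin n, (columnMatrix C l).det ≠ 0 := by
  by_contra! hcon
  let Φ : MultilinearMap ℂ (fun _ : Fin n => Fin n → ℂ) ℂ :=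
    (Matrix.detRowAlternating (n := Fin n) (R := ℂ)).toMultilinearMap.compLinearMap
      fun k => (C k).mulVecLin
  have h0 : Φ = 0 := by
    refine Module.Basis.ext_multilinear (fun _ => Pi.basisFun ℂ (Fin n)) fun l => ?_
    rw [_root_.zero_apply, ← hcon l, ← Matrix.det_transpose]
    show Matrix.det _ = _
    congr 1
    ext k a
    simp [columnMatrix, Matrix.mulVecLin]
  have h1 : Φ (fun k => (C k)⁻¹ *ᵥ Pi.single k 1) = 1 := by
    show Matrix.det (fun k => C k *ᵥ ((C k)⁻¹ *ᵥ Pi.single k 1)) = 1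
    have h2 : (fun k => C k *ᵥ ((C k)⁻¹ *ᵥ Pi.single k 1)) = (1 : Matrix (Fin n) (Fin n) ℂ) := by
      ext k a
      rw [Matrix.mulVec_mulVec, Matrix.mul_nonsing_inv _ ((Matrix.isUnit_iff_isUnit_det _).1 (hC k)),
        Matrix.one_mulVec, Matrix.one_apply, Pi.single_apply]
      simp [eq_comm]
    rw [h2, Matrix.det_one]
  rw [h0] at h1
  simp at h1

theorem wedgeCoeff_pos {M : Fin n → Matrix (Fin n) (Fin n) ℂ} (hM : ∀ k, (M k).PosDef) :
    0 < wedgeCoeff M := by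
  choose C hC hMC using fun k => exists_mul_conjTranspose (hM k)
  rw [show M = fun k => C k * (C k)ᴴ from funext hMC, wedgeCoeff_mul_conjTranspose]
  obtain ⟨l, hl⟩ := exists_det_columnMatrix_ne_zero hC
  rw [Complex.zero_lt_real]
  exact Finset.sum_pos' (fun _ _ => by positivity) ⟨l, Finset.mem_univ l, by positivity⟩

/-- After factoring each `M k`, every `columnMatrix` is multiplied on the left by `Jᵀ`, so each
summand of the Cauchy-Binet formula gains `‖det J‖²`. This is the transformation rule of a density.
-/
theorem wedgeCoeff_congruence {M : Fin n → Matrix (Fin n) (Fin n) ℂ} (hM : ∀ k, (M k).PosDef)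
    (J : Matrix (Fin n) (Fin n) ℂ) : wedgeCoeff (fun k => Jᵀ * M k * J.map conj) =
      ((‖J.det‖ ^ 2 : ℝ) : ℂ) * wedgeCoeff M := by
  choose C _ hMC using fun k => exists_mul_conjTranspose (hM k)
  have h1 : (fun k => Jᵀ * M k * J.map conj) = fun k => (Jᵀ * C k) * (Jᵀ * C k)ᴴ := by
    ext1 k
    have h2 : (Jᵀ)ᴴ = J.map conj := rfl
    rw [Matrix.conjTranspose_mul, hMC k, h2]
    simp only [Matrix.mul_assoc]
  rw [h1, show M = fun k => C k * (C k)ᴴ from funext hMC, wedgeCoeff_mul_conjTranspose,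
    wedgeCoeff_mul_conjTranspose, ← Complex.ofReal_mul, Finset.mul_sum]
  congr 1
  refine Finset.sum_congr rfl fun l _ => ?_
  have h3 : columnMatrix (fun k => Jᵀ * C k) l = Jᵀ * columnMatrix C l := by
    ext a k
    simp [columnMatrix, Matrix.mul_apply]
  rw [h3, Matrix.det_mul, Matrix.det_transpose, norm_mul, mul_pow]

theorem wedgeCoeff_perm (M : Fin n → Matrix (Fin n) (Fin n) ℂ) (τ : Equiv.Perm (Fin n)) :
    wedgeCoeff (fun k => M (τ k)) = wedgeCoeff M := by
  refine (Fintype.sum_equiv (Equiv.mulRight τ) _ _ fun σ => ?_).symm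
  refine Fintype.sum_equiv (Equiv.mulRight τ) _ _ fun π => ?_
  have h1 : ((Equiv.Perm.sign τ : ℤ) : ℂ) * ((Equiv.Perm.sign τ : ℤ) : ℂ) = 1 := by
    rcases Int.units_eq_one_or (Equiv.Perm.sign τ) with h | h <;> simp [h]
  have h2 : ∏ k, M k (σ k) (π k) = ∏ k, M (τ k) (σ (τ k)) (π (τ k)) :=
    (Equiv.prod_comp τ fun k => M k (σ k) (π k)).symm
  simp only [Equiv.coe_mulRight, Equiv.Perm.sign_mul, Equiv.Perm.coe_mul, Function.comp_apply,
    Units.val_mul, Int.cast_mul, h2]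
  linear_combination (-((Equiv.Perm.sign σ : ℤ) : ℂ) * ((Equiv.Perm.sign π : ℤ) : ℂ) *
    ∏ k, M (τ k) (σ (τ k)) (π (τ k))) * h1

theorem wedgeCoeff_const (M : Matrix (Fin n) (Fin n) ℂ) :
    wedgeCoeff (fun _ => M) = (n.factorial : ℂ) * M.det := by
  rw [wedgeCoeff, Finset.sum_comm]
  have h1 : ∀ π : Equiv.Perm (Fin n), ∑ σ : Equiv.Perm (Fin n), ((Equiv.Perm.sign σ : ℤ) : ℂ) *
      ((Equiv.Perm.sign π : ℤ) : ℂ) * ∏ k, M (σ k) (π k) = M.det := fun π => by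
    rw [Matrix.det_apply']
    refine Fintype.sum_equiv (Equiv.mulRight π⁻¹) _ _ fun σ => ?_
    have h2 : ∏ k, M (σ k) (π k) = ∏ k, M (σ (π⁻¹ k)) k := by
      rw [← Equiv.prod_comp π fun k => M (σ (π⁻¹ k)) k]
      simp
    simp only [Equiv.coe_mulRight, Equiv.Perm.sign_mul, Equiv.Perm.sign_inv, Equiv.Perm.coe_mul,
      Function.comp_apply, Units.val_mul, Int.cast_mul, h2]
  rw [Finset.sum_congr rfl fun π _ => h1 π, Finset.sum_const, Finset.card_univ,
    Fintype.card_perm, Fintype.card_fin, nsmul_eq_mul]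

/-- The mixed discriminant of `j` copies of `M` and `n - j` copies of `N`, times `n!`. -/
def mixedWedge (M N : Matrix (Fin n) (Fin n) ℂ) (j : ℕ) : ℂ :=
  wedgeCoeff fun k : Fin n => if (k : ℕ) < j then M else N

/-- The mixed discriminant is symmetric in its slots, so only the number of slots containing `M`
matters. -/
theorem wedgeCoeff_ite_mem (M N : Matrix (Fin n) (Fin n) ℂ) (T : Finset (Fin n)) :
    wedgeCoeff (fun k => if k ∈ T then M else N) = mixedWedge M N T.card := by
  have hcard : Fintype.card {k : Fin n // (k : ℕ) < T.card} = Fintype.card {k // k ∈ T} := by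
    rw [Fintype.card_fin_lt_of_le (by simpa using T.card_le_univ), Fintype.card_coe]
  let e : {k : Fin n // (k : ℕ) < T.card} ≃ {k // k ∈ T} := Fintype.equivOfCardEq hcard
  rw [← wedgeCoeff_perm _ e.extendSubtype, mixedWedge]
  congr 1
  ext1 k
  by_cases hk : (k : ℕ) < T.card
  · rw [if_pos hk, if_pos (e.extendSubtype_mem k hk)]
  · rw [if_neg hk, if_neg (e.extendSubtype_not_mem k hk)]

/-- The product over the slots is expanded over subsets, and subsets of equal cardinality contribute
equally, whence the binomial coefficients. With `r = 1 - s` they become Bernstein polynomials. -/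
theorem factorial_mul_det_add (M N : Matrix (Fin n) (Fin n) ℂ) (r s : ℂ) :
    (n.factorial : ℂ) * (r • N + s • M).det =
      ∑ j ∈ Finset.range (n + 1), (n.choose j : ℂ) * s ^ j * r ^ (n - j) * mixedWedge M N j := by
  have h1 : ∀ σ π : Equiv.Perm (Fin n), ∏ k, (r • N + s • M) (σ k) (π k) =
      ∑ T : Finset (Fin n), s ^ T.card * r ^ (n - T.card) *
        ∏ k, (if k ∈ T then M else N) (σ k) (π k) := fun σ π => by
    have h2 : ∀ k, (r • N + s • M) (σ k) (π k) = s * M (σ k) (π k) + r * N (σ k) (π k) :=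
      fun k => by simp [add_comm]
    simp only [h2]
    rw [Fintype.prod_add]
    refine Finset.sum_congr rfl fun T _ => ?_
    have e1 : ∏ k ∈ T, (if k ∈ T then M else N) (σ k) (π k) = ∏ k ∈ T, M (σ k) (π k) :=
      Finset.prod_congr rfl fun k hk => by rw [if_pos hk]
    have e2 : ∏ k ∈ Tᶜ, (if k ∈ T then M else N) (σ k) (π k) = ∏ k ∈ Tᶜ, N (σ k) (π k) :=
      Finset.prod_congr rfl fun k hk => by rw [if_neg (Finset.mem_compl.1 hk)]
    rw [Finset.prod_mul_distrib, Finset.prod_mul_distrib, Finset.prod_const, Finset.prod_const,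
      Finset.card_compl, Fintype.card_fin, ← Finset.prod_mul_prod_compl T
        fun k => (if k ∈ T then M else N) (σ k) (π k), e1, e2]
    ring
  have h3 : wedgeCoeff (fun _ => r • N + s • M) =
      ∑ T : Finset (Fin n), s ^ T.card * r ^ (n - T.card) * mixedWedge M N T.card := by
    simp only [← wedgeCoeff_ite_mem]
    simp only [wedgeCoeff, h1, Finset.mul_sum]
    rw [Finset.sum_congr rfl fun σ _ => Finset.sum_comm, Finset.sum_comm]
    exact Finset.sum_congr rfl fun T _ => Finset.sum_congr rfl fun σ _ =>
      Finset.sum_congr rfl fun π _ => by ring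
  rw [← wedgeCoeff_const, h3, ← Finset.powerset_univ,
    Finset.sum_powerset_apply_card fun j => s ^ j * r ^ (n - j) * mixedWedge M N j]
  simp only [Finset.card_univ, Fintype.card_fin, nsmul_eq_mul, mul_assoc]

/-- Consecutive Bernstein polynomials of degree `n` differ by a multiple of the derivative of one of
degree `n + 1` that vanishes at both ends, so all integrals agree. There are `n + 1` of them and
their sum is one. -/
theorem integral_bernstein (n : ℕ) {j : ℕ} (hj : j ≤ n) :
    ∫ s in (0 : ℝ)..1, (bernsteinPolynomial ℝ n j).eval s = 1 / (n + 1) := by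
  have hint : ∀ p : Polynomial ℝ, IntervalIntegrable (fun s => p.eval s) volume 0 1 := fun p =>
    p.continuous.intervalIntegrable _ _
  have h1 : ∀ i < n, ∫ s in (0 : ℝ)..1, (bernsteinPolynomial ℝ n (i + 1)).eval s =
      ∫ s in (0 : ℝ)..1, (bernsteinPolynomial ℝ n i).eval s := fun i hi => by
    have h2 : ∫ s in (0 : ℝ)..1,
        (Polynomial.derivative (bernsteinPolynomial ℝ (n + 1) (i + 1))).eval s = 0 := by
      rw [intervalIntegral.integral_eq_sub_of_hasDerivAt
        (f := fun s => (bernsteinPolynomial ℝ (n + 1) (i + 1)).eval s)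
        (fun s _ => Polynomial.hasDerivAt _ s) (hint _)]
      simp only [bernsteinPolynomial.eval_at_0, bernsteinPolynomial.eval_at_1]
      rw [if_neg (by omega), if_neg (by omega), sub_zero]
    rw [bernsteinPolynomial.derivative_succ] at h2
    simp only [Polynomial.eval_mul, Polynomial.eval_sub, Polynomial.eval_natCast,
      Nat.add_sub_cancel, intervalIntegral.integral_const_mul] at h2
    rw [intervalIntegral.integral_sub (hint _) (hint _)] at h2
    rcases mul_eq_zero.1 h2 with h3 | h3
    · exact absurd h3 (by positivity)
    · linarith
  have h2 : ∀ i ≤ n, ∫ s in (0 : ℝ)..1, (bernsteinPolynomial ℝ n i).eval s =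
      ∫ s in (0 : ℝ)..1, (bernsteinPolynomial ℝ n 0).eval s := fun i => by
    induction i with
    | zero => exact fun _ => rfl
    | succ i ih => exact fun hi => (h1 i hi).trans (ih (by omega))
  have h3 : ∑ i ∈ Finset.range (n + 1), ∫ s in (0 : ℝ)..1, (bernsteinPolynomial ℝ n i).eval s =
      1 := by
    rw [← intervalIntegral.integral_finsetSum fun i _ => hint _]
    simp only [← Polynomial.eval_finsetSum, bernsteinPolynomial.sum]
    simp
  rw [Finset.sum_congr rfl fun i hi => h2 i (by simpa [Nat.lt_succ_iff] using hi),
    Finset.sum_const, Finset.card_range, nsmul_eq_mul] at h3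
  rw [h2 j hj, eq_div_iff (by positivity)]
  push_cast at h3
  linarith

end

end

/-! ### Integrals over `X` depending on a parameter. -/

section

variable {n : ℕ}
variable {X : Type*} [TopologicalSpace X] [ChartedSpace (Fin n → ℂ) X] {ι : Type*}
  {A : CoordCover n X ι}

open ComplexConjugate Matrix

section
variable {α : Type*} [TopologicalSpace α] [MeasurableSpace α] [OpensMeasurableSpace α]
  [TopologicalSpace.PseudoMetrizableSpace α] {μ : Measure α} [IsFiniteMeasureOnCompacts μ]
  {C : Set α} {F F' : ℝ × α → ℝ}

theorem continuousOn_setIntegral_slice {T : Set ℝ} (hT : IsCompact T)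
    (hC : IsCompact C) (hCm : MeasurableSet C) (hF : ContinuousOn F (T ×ˢ C)) :
    ContinuousOn (fun t => ∫ z in C, F (t, z) ∂μ) T := by
  obtain ⟨B, hB⟩ := (hT.prod hC).exists_bound_of_continuousOn hF
  have hfin : IsFiniteMeasure (μ.restrict C) := isFiniteMeasure_restrict.2 hC.measure_lt_top.ne
  refine continuousOn_of_dominated (F := fun t z => F (t, z)) (bound := fun _ => B)
    (fun t ht => ?_) (fun t ht => ?_) (integrable_const B) ?_
  · exact ContinuousOn.aestronglyMeasurable_of_isCompact
      (hF.comp (by fun_prop) fun z hz => ⟨ht, hz⟩) hC hCm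
  · filter_upwards [ae_restrict_mem hCm] with z hz using hB (t, z) ⟨ht, hz⟩
  · filter_upwards [ae_restrict_mem hCm] with z hz
    exact hF.comp (by fun_prop) fun t ht => ⟨ht, hz⟩

theorem hasDerivAt_setIntegral_slice {I : Set ℝ} (hI : IsOpen I) {t₀ : ℝ} (ht₀ : t₀ ∈ I)
    (hC : IsCompact C) (hCm : MeasurableSet C) (hF : ContinuousOn F (I ×ˢ C))
    (hF' : ContinuousOn F' (I ×ˢ C))
    (hd : ∀ t ∈ I, ∀ z ∈ C, HasDerivAt (fun t => F (t, z)) (F' (t, z)) t) :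
    HasDerivAt (fun t => ∫ z in C, F (t, z) ∂μ) (∫ z in C, F' (t₀, z) ∂μ) t₀ := by
  obtain ⟨δ, hδ, hδI⟩ := Metric.nhds_basis_closedBall.mem_iff.1 (hI.mem_nhds ht₀)
  have hs : ∀ {G : ℝ × α → ℝ}, ContinuousOn G (I ×ˢ C) → ∀ t ∈ I,
      ContinuousOn (fun z => G (t, z)) C := fun hG t ht =>
    hG.comp (by fun_prop) fun z hz => ⟨ht, hz⟩
  obtain ⟨B, hB⟩ := ((isCompact_closedBall t₀ δ).prod hC).exists_bound_of_continuousOn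
    (hF'.mono (prod_mono hδI subset_rfl))
  have hfin : IsFiniteMeasure (μ.restrict C) := isFiniteMeasure_restrict.2 hC.measure_lt_top.ne
  refine (hasDerivAt_integral_of_dominated_loc_of_deriv_le (F := fun t z => F (t, z))
    (F' := fun t z => F' (t, z)) (bound := fun _ => B)
    (Metric.closedBall_mem_nhds t₀ hδ) ?_ ?_ ?_ ?_ (integrable_const B) ?_).2
  · filter_upwards [hI.mem_nhds ht₀] with t ht
    exact (hs hF t ht).aestronglyMeasurable_of_isCompact hC hCm
  · exact (hs hF t₀ ht₀).integrableOn_compact' hC hCm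
  · exact (hs hF' t₀ ht₀).aestronglyMeasurable_of_isCompact hC hCm
  · filter_upwards [ae_restrict_mem hCm] with z hz t ht using hB (t, z) ⟨ht, hz⟩
  · filter_upwards [ae_restrict_mem hCm] with z hz t ht using hd t (hδI ht) z hz

end


section
variable [MeasurableSpace X] [BorelSpace X]
  [IsManifold 𝓘(ℂ, Fin n → ℂ) ω X] [T2Space X] [CompactSpace X]

theorem continuous_of_continuousOn_loc {F : Type*} [TopologicalSpace F] {f : X → F}
    (hf : ∀ i, ContinuousOn (A.loc i f) (A.chart i).target) : Continuous f := by
  refine continuous_iff_continuousAt.2 fun x => ?_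
  have hx := A.mem_indexAt x
  have h1 : ContinuousAt (A.loc (A.indexAt x) f) (A.chart (A.indexAt x) x) :=
    (hf _).continuousAt ((A.chart _).open_target.mem_nhds ((A.chart _).map_source hx))
  refine (h1.comp ((A.chart _).continuousAt hx)).congr ?_
  filter_upwards [(A.chart _).open_source.mem_nhds hx] with y hy
  simp [CoordCover.loc, (A.chart (A.indexAt x)).left_inv hy]

theorem integrable_real_of_continuous {ρ : ι → (Fin n → ℂ) → ℝ} (hρ : IsDensity A ρ) {f : X → ℝ}
    (hf : Continuous f) : Integrable f (volumeFormMeasure A ρ) := by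
  have := isFiniteMeasure_volumeForm hρ
  exact hf.integrable_of_hasCompactSupport (HasCompactSupport.of_compactSpace f)

/-- Integration over the manifold as a sum of integrals over compact sets in the charts. -/
theorem exists_integral_eq_sum (A : CoordCover n X ι) :
    ∃ (K : Finset X) (D : X → Set (Fin n → ℂ)) (χ : X → (Fin n → ℂ) → ℝ),
      (∀ k, IsCompact (D k)) ∧ (∀ k, MeasurableSet (D k)) ∧
      (∀ k, D k ⊆ (A.chart (A.indexAt k)).target) ∧ (∀ k, ContinuousOn (χ k) (D k)) ∧
      ∀ ρ, IsDensity A ρ → ∀ f : X → ℝ, Continuous f →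
        ∫ x, f x ∂(volumeFormMeasure A ρ) = ∑ k ∈ K, ∫ z in D k,
          χ k z * (ρ (A.indexAt k) z * A.loc (A.indexAt k) f z) := by
  obtain ⟨K, η, C, hη, -, hsum⟩ := exists_sq_partition A (N := fun _ => univ)
    fun _ => Filter.univ_mem
  have hDt : ∀ k, A.chart (A.indexAt k) '' C k ⊆ (A.chart (A.indexAt k)).target := by
    rintro k _ ⟨x, hx, rfl⟩
    exact (A.chart _).map_source ((hη k).subset hx)
  have hD : ∀ k, IsCompact (A.chart (A.indexAt k) '' C k) := fun k =>
    (hη k).compact.image_of_continuousOn ((A.chart _).continuousOn.mono (hη k).subset)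
  -- The weights `2^n η²` involve neither the density nor the integrand, so one formula serves a
  -- whole path and reduces its differentiation to compact sets in `ℂⁿ`.
  refine ⟨K, fun k => A.chart (A.indexAt k) '' C k,
    fun k z => 2 ^ n * A.loc (A.indexAt k) (η k) z ^ 2, hD, fun k => (hD k).measurableSet, hDt,
    fun k z hz => ?_, fun ρ hρ f hf => ?_⟩
  · exact (continuousAt_const.mul (((hη k).smooth _ z (hDt k hz)).continuousAt.pow
      2)).continuousWithinAt
  have hc : ∀ k, Continuous fun x => η k x ^ 2 * f x := fun k =>
    ((hη k).smooth.continuous.pow 2).mul hf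
  have h1 : ∀ x, f x = ∑ k ∈ K, η k x ^ 2 * f x := fun x => by
    rw [← Finset.sum_mul, hsum, one_mul]
  rw [integral_congr_ae (Filter.Eventually.of_forall h1),
    integral_finsetSum _ fun k _ => integrable_real_of_continuous hρ (hc k)]
  refine Finset.sum_congr rfl fun k _ => ?_
  rw [integral_eq_chart hρ (hc k).aestronglyMeasurable (i := A.indexAt k) fun x hx => by
    rw [(hη k).zero x fun hxC => hx ((hη k).subset hxC)]
    ring]
  refine (setIntegral_eq_of_subset_of_forall_sdiff_eq_zero
    (A.chart (A.indexAt k)).open_target.measurableSet (hDt k) fun z hz => ?_).trans ?_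
  · have h2 : (A.chart (A.indexAt k)).symm z ∉ C k := fun hcon =>
      hz.2 ⟨_, hcon, (A.chart _).right_inv hz.1⟩
    simp [CoordCover.loc, (hη k).zero _ h2]
  · refine setIntegral_congr_fun (hD k).measurableSet fun z _ => ?_
    simp only [CoordCover.loc, smul_eq_mul]
    ring

structure IsDensityPath (A : CoordCover n X ι) (T : Set ℝ)
    (ρ : ℝ → ι → (Fin n → ℂ) → ℝ) : Prop where
  isDensity : ∀ t ∈ T, IsDensity A (ρ t)
  continuousOn : ∀ i, ContinuousOn (fun p : ℝ × (Fin n → ℂ) => ρ p.1 i p.2)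
    (T ×ˢ (A.chart i).target)

def IsContinuousPath (A : CoordCover n X ι) (T : Set ℝ) (u : ℝ → X → ℝ) : Prop :=
  ∀ i, ContinuousOn (fun p : ℝ × (Fin n → ℂ) => A.loc i (u p.1) p.2) (T ×ˢ (A.chart i).target)

variable {T : Set ℝ} {ρ ρ' : ℝ → ι → (Fin n → ℂ) → ℝ} {u u' : ℝ → X → ℝ}

theorem IsContinuousPath.continuous (hu : IsContinuousPath A T u) {t : ℝ} (ht : t ∈ T) :
    Continuous (u t) :=
  continuous_of_continuousOn_loc fun i => (hu i).comp (f := fun z => (t, z)) (by fun_prop)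
    fun _ hz => ⟨ht, hz⟩

theorem continuousOn_integral_path (hT : IsCompact T) (hρ : IsDensityPath A T ρ)
    (hu : IsContinuousPath A T u) :
    ContinuousOn (fun t => ∫ x, u t x ∂(volumeFormMeasure A (ρ t))) T := by
  obtain ⟨K, D, χ, hD, hDm, hDt, hχ, hint⟩ := exists_integral_eq_sum A
  have h1 : ContinuousOn (fun t => ∑ k ∈ K, ∫ z in D k,
      χ k z * (ρ t (A.indexAt k) z * A.loc (A.indexAt k) (u t) z)) T := by
    refine continuousOn_finsetSum _ fun k _ => ?_
    refine continuousOn_setIntegral_slice hT (hD k) (hDm k) (F := fun p : ℝ × (Fin n → ℂ) =>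
      χ k p.2 * (ρ p.1 (A.indexAt k) p.2 * A.loc (A.indexAt k) (u p.1) p.2)) ?_
    exact ((hχ k).comp continuousOn_snd fun p hp => hp.2).mul
      (((hρ.continuousOn _).mono (prod_mono subset_rfl (hDt k))).mul
        ((hu _).mono (prod_mono subset_rfl (hDt k))))
  exact h1.congr fun t ht => hint _ (hρ.isDensity t ht) _ (hu.continuous ht)

/-- Differentiation of the integral of a path of functions against a path of volume forms. -/
theorem exists_hasDerivAt_integral_path (hT : IsOpen T) (hρ : IsDensityPath A T ρ)
    (hu : IsContinuousPath A T u) (hu' : IsContinuousPath A T u')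
    (hρ' : ∀ i, ContinuousOn (fun p : ℝ × (Fin n → ℂ) => ρ' p.1 i p.2) (T ×ˢ (A.chart i).target))
    (hud : ∀ t ∈ T, ∀ x, HasDerivAt (fun s => u s x) (u' t x) t)
    (hρd : ∀ t ∈ T, ∀ i, ∀ z ∈ (A.chart i).target,
      HasDerivAt (fun s => ρ s i z) (ρ' t i z) t) {t : ℝ} (ht : t ∈ T) :
    ∃ c, HasDerivAt (fun s => ∫ x, u s x ∂(volumeFormMeasure A (ρ s))) c t ∧
      ∀ v : X → ℝ, Continuous v → (∀ i, ∀ z ∈ (A.chart i).target, ρ t i z * A.loc i v z =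
        ρ' t i z * A.loc i (u t) z + ρ t i z * A.loc i (u' t) z) →
      ∫ x, v x ∂(volumeFormMeasure A (ρ t)) = c := by
  obtain ⟨K, D, χ, hD, hDm, hDt, hχ, hint⟩ := exists_integral_eq_sum A
  -- The time derivative of a density need not be positive, so the value is first written as a sum
  -- over charts. The second clause lets a caller recognize it as one integral against the density
  -- at time `t`.
  refine ⟨∑ k ∈ K, ∫ z in D k, χ k z * (ρ' t (A.indexAt k) z * A.loc (A.indexAt k) (u t) z +
    ρ t (A.indexAt k) z * A.loc (A.indexAt k) (u' t) z), ?_, fun v hv hvv => ?_⟩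
  · have h1 : HasDerivAt (fun s => ∑ k ∈ K, ∫ z in D k,
        χ k z * (ρ s (A.indexAt k) z * A.loc (A.indexAt k) (u s) z))
        (∑ k ∈ K, ∫ z in D k, χ k z * (ρ' t (A.indexAt k) z * A.loc (A.indexAt k) (u t) z +
          ρ t (A.indexAt k) z * A.loc (A.indexAt k) (u' t) z)) t := by
      refine HasDerivAt.fun_sum fun k _ => ?_
      have hm : T ×ˢ D k ⊆ T ×ˢ (A.chart (A.indexAt k)).target := prod_mono subset_rfl (hDt k)
      have hχ' : ContinuousOn (fun p : ℝ × (Fin n → ℂ) => χ k p.2) (T ×ˢ D k) :=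
        (hχ k).comp continuousOn_snd fun p hp => hp.2
      exact hasDerivAt_setIntegral_slice (μ := volume) hT ht (hD k) (hDm k)
        (F := fun p : ℝ × (Fin n → ℂ) =>
          χ k p.2 * (ρ p.1 (A.indexAt k) p.2 * A.loc (A.indexAt k) (u p.1) p.2))
        (F' := fun p : ℝ × (Fin n → ℂ) =>
          χ k p.2 * (ρ' p.1 (A.indexAt k) p.2 * A.loc (A.indexAt k) (u p.1) p.2 +
            ρ p.1 (A.indexAt k) p.2 * A.loc (A.indexAt k) (u' p.1) p.2))
        (hχ'.mul (((hρ.continuousOn _).mono hm).mul ((hu _).mono hm)))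
        (hχ'.mul ((((hρ' _).mono hm).mul ((hu _).mono hm)).add
          (((hρ.continuousOn _).mono hm).mul ((hu' _).mono hm))))
        fun s hs z hz => ((hρd s hs (A.indexAt k) z (hDt k hz)).fun_mul
          (hud s hs ((A.chart (A.indexAt k)).symm z))).const_mul (χ k z)
    refine h1.congr_of_eventuallyEq ?_
    filter_upwards [hT.mem_nhds ht] with s hs
    exact hint _ (hρ.isDensity s hs) _ (hu.continuous hs)
  · rw [hint _ (hρ.isDensity t ht) v hv]
    exact Finset.sum_congr rfl fun k _ =>
      setIntegral_congr_fun (hDm k) fun z hz => by rw [hvv _ z (hDt k hz)]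

theorem integral_eq_sum_of_density_eq {κ : Type*} (s : Finset κ) {r : ι → (Fin n → ℂ) → ℝ}
    {w : κ → ι → (Fin n → ℂ) → ℝ} {c : κ → ℝ} (hr : IsDensity A r)
    (hw : ∀ j ∈ s, IsDensity A (w j))
    (h : ∀ i, ∀ z ∈ (A.chart i).target, r i z = ∑ j ∈ s, c j * w j i z)
    {f : X → ℝ} (hf : Continuous f) : ∫ x, f x ∂(volumeFormMeasure A r) =
      ∑ j ∈ s, c j * ∫ x, f x ∂(volumeFormMeasure A (w j)) := by
  obtain ⟨K, D, χ, hD, hDm, hDt, hχ, hint⟩ := exists_integral_eq_sum A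
  have hi : ∀ j ∈ s, ∀ k, IntegrableOn
      (fun z => χ k z * (w j (A.indexAt k) z * A.loc (A.indexAt k) f z)) (D k) := fun j hj k => by
    refine ContinuousOn.integrableOn_compact' (hD k) (hDm k) ((hχ k).mul
      ((((hw j hj).continuousOn _).mono (hDt k)).mul ?_))
    exact (hf.comp_continuousOn (A.chart (A.indexAt k)).continuousOn_symm).mono (hDt k)
  have e1 : ∑ j ∈ s, c j * ∫ x, f x ∂(volumeFormMeasure A (w j)) =
      ∑ j ∈ s, c j * ∑ k ∈ K, ∫ z in D k,
        χ k z * (w j (A.indexAt k) z * A.loc (A.indexAt k) f z) :=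
    Finset.sum_congr rfl fun j hj => by rw [hint _ (hw j hj) f hf]
  rw [hint r hr f hf, e1]
  simp only [Finset.mul_sum]
  rw [Finset.sum_comm]
  refine Finset.sum_congr rfl fun k _ => ?_
  simp only [← integral_const_mul]
  rw [← integral_finsetSum _ fun j hj => (hi j hj k).const_mul _]
  refine setIntegral_congr_fun (hDm k) fun z hz => ?_
  simp only [h _ z (hDt k hz), Finset.sum_mul, Finset.mul_sum]
  exact Finset.sum_congr rfl fun j _ => by ring

end

end

/-! ### Smooth paths of metrics: velocity, acceleration and curvature. -/

section

variable {n : ℕ}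
variable {X : Type*} [TopologicalSpace X] [ChartedSpace (Fin n → ℂ) X] {ι : Type*}
  {A : CoordCover n X ι}

open ComplexConjugate Matrix

section
variable {G : Type*} [NormedAddCommGroup G] [NormedSpace ℝ G] {T : Set ℝ} {U : Set (Fin n → ℂ)}
  {F : ℝ × (Fin n → ℂ) → G} {t : ℝ} {z : Fin n → ℂ}

/-- The derivative within `T ×ˢ U` is used so that the end points of a closed interval are covered;
they are needed for the continuity of the functional on `[0,1]`. -/
theorem fderiv_slice (hU : IsOpen U) (hF : ContDiffOn ℝ ∞ F (T ×ˢ U)) (ht : t ∈ T) (hz : z ∈ U)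
    (v : Fin n → ℂ) :
    fderiv ℝ (fun w => F (t, w)) z v = fderivWithin ℝ F (T ×ˢ U) (t, z) (0, v) := by
  have h1 := (hF.differentiableOn (by simp) (t, z) ⟨ht, hz⟩).hasFDerivWithinAt
  have h2 : HasFDerivWithinAt (fun w : Fin n → ℂ => (t, w))
      (ContinuousLinearMap.inr ℝ ℝ (Fin n → ℂ)) U z := (hasFDerivAt_prodMk_right t z).hasFDerivWithinAt
  have h3 := (h1.comp z h2 fun w hw => ⟨ht, hw⟩).hasFDerivAt (hU.mem_nhds hz)
  rw [show (fun w => F (t, w)) = F ∘ fun w => (t, w) from rfl, h3.fderiv]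
  simp

theorem contDiffOn_fderiv_slice (hT : UniqueDiffOn ℝ T) (hU : IsOpen U)
    (hF : ContDiffOn ℝ ∞ F (T ×ˢ U)) (v : Fin n → ℂ) :
    ContDiffOn ℝ ∞ (fun p : ℝ × (Fin n → ℂ) => fderiv ℝ (fun w => F (p.1, w)) p.2 v)
      (T ×ˢ U) :=
  ((hF.fderivWithin (m := ∞) (hT.prod hU.uniqueDiffOn) (by simp)).clm_apply
    (contDiffOn_const (c := ((0 : ℝ), v)))).congr
    fun p hp => fderiv_slice hU hF hp.1 hp.2 v

theorem hasDerivAt_slice (hT : IsOpen T) (hU : IsOpen U) (hF : ContDiffOn ℝ ∞ F (T ×ˢ U))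
    (ht : t ∈ T) (hz : z ∈ U) :
    HasDerivAt (fun s => F (s, z)) (fderiv ℝ F (t, z) (1, 0)) t := by
  have h1 := ((hF.contDiffAt ((hT.prod hU).mem_nhds
    (show (t, z) ∈ T ×ˢ U from ⟨ht, hz⟩))).differentiableAt (by simp)).hasFDerivAt
  have h2 : HasDerivAt (fun s : ℝ => (s, z)) ((1 : ℝ), (0 : Fin n → ℂ)) t :=
    (hasDerivAt_id t).prodMk (hasDerivAt_const t z)
  exact h1.comp_hasDerivAt t h2

theorem contDiffOn_deriv_slice (hT : IsOpen T) (hU : IsOpen U)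
    (hF : ContDiffOn ℝ ∞ F (T ×ˢ U)) :
    ContDiffOn ℝ ∞ (fun p : ℝ × (Fin n → ℂ) => deriv (fun s => F (s, p.2)) p.1) (T ×ˢ U) :=
  ((hF.fderiv_of_isOpen (m := ∞) (hT.prod hU) (by simp)).clm_apply
    (contDiffOn_const (c := ((1 : ℝ), (0 : Fin n → ℂ))))).congr
    fun _ hp => (hasDerivAt_slice hT hU hF hp.1 hp.2).deriv

/-- Symmetry of the second derivative in the time and space directions. -/
theorem hasDerivAt_fderiv_slice (hT : IsOpen T) (hU : IsOpen U) (hF : ContDiffOn ℝ ∞ F (T ×ˢ U))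
    (ht : t ∈ T) (hz : z ∈ U) (v : Fin n → ℂ) :
    HasDerivAt (fun s => fderiv ℝ (fun w => F (s, w)) z v)
      (fderiv ℝ (fun w => deriv (fun s => F (s, w)) t) z v) t := by
  have hO := hT.prod hU
  have hp : (t, z) ∈ T ×ˢ U := ⟨ht, hz⟩
  have hat := hF.contDiffAt (hO.mem_nhds hp)
  have h2d : HasFDerivAt (fderiv ℝ F) (fderiv ℝ (fderiv ℝ F) (t, z)) (t, z) :=
    ((hat.fderiv_right (m := ∞) (by simp)).differentiableAt (by simp)).hasFDerivAt
  have h2 : HasDerivAt (fun s : ℝ => (s, z)) ((1 : ℝ), (0 : Fin n → ℂ)) t :=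
    (hasDerivAt_id t).prodMk (hasDerivAt_const t z)
  have hev : ∀ q : ℝ × (Fin n → ℂ), HasFDerivAt (fun p => fderiv ℝ F p q)
      ((fderiv ℝ (fderiv ℝ F) (t, z)).flip q) (t, z) := fun q =>
    (ContinuousLinearMap.apply ℝ G q).hasFDerivAt.comp (t, z) h2d
  have h3 : HasDerivAt (fun s => fderiv ℝ F (s, z) (0, v))
      (fderiv ℝ (fderiv ℝ F) (t, z) (1, 0) (0, v)) t :=
    HasFDerivAt.comp_hasDerivAt (f := fun s : ℝ => (s, z)) (l := fun p => fderiv ℝ F p (0, v))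
      (l' := (fderiv ℝ (fderiv ℝ F) (t, z)).flip (0, v)) t (hev (0, v)) h2
  have h4 : fderiv ℝ (fun w => deriv (fun s => F (s, w)) t) z v =
      fderiv ℝ (fderiv ℝ F) (t, z) (0, v) (1, 0) := by
    have e1 : (fun w => deriv (fun s => F (s, w)) t) =ᶠ[nhds z]
        fun w => fderiv ℝ F (t, w) (1, 0) := by
      filter_upwards [hU.mem_nhds hz] with w hw using (hasDerivAt_slice hT hU hF ht hw).deriv
    have h5 : HasFDerivAt (fun w => fderiv ℝ F (t, w) (1, 0))
        (((fderiv ℝ (fderiv ℝ F) (t, z)).flip (1, 0)).comp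
          (ContinuousLinearMap.inr ℝ ℝ (Fin n → ℂ))) z :=
      (hev (1, 0)).comp z (hasFDerivAt_prodMk_right t z)
    rw [e1.fderiv_eq, h5.fderiv]
    rfl
  have h6 := (hat.isSymmSndFDerivAt (by simp; exact WithTop.coe_le_coe.2 le_top)).eq (1, 0) (0, v)
  rw [h4, ← h6]
  refine h3.congr_of_eventuallyEq ?_
  filter_upwards [hT.mem_nhds ht] with s hs
  rw [fderiv_slice hU hF hs hz, fderivWithin_of_isOpen hO ⟨hs, hz⟩]

end

section
variable {T : Set ℝ} {U : Set (Fin n → ℂ)}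
  {F : ℝ × (Fin n → ℂ) → ℂ} {t : ℝ} {z : Fin n → ℂ} (a b : Fin n)

theorem contDiffOn_dz_slice (hT : UniqueDiffOn ℝ T) (hU : IsOpen U)
    (hF : ContDiffOn ℝ ∞ F (T ×ˢ U)) :
    ContDiffOn ℝ ∞ (fun p : ℝ × (Fin n → ℂ) => dz a (fun w => F (p.1, w)) p.2) (T ×ˢ U) :=
  contDiffOn_const.mul ((contDiffOn_fderiv_slice hT hU hF _).sub
    (contDiffOn_const.mul (contDiffOn_fderiv_slice hT hU hF _)))

theorem contDiffOn_dzbar_slice (hT : UniqueDiffOn ℝ T) (hU : IsOpen U)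
    (hF : ContDiffOn ℝ ∞ F (T ×ˢ U)) :
    ContDiffOn ℝ ∞ (fun p : ℝ × (Fin n → ℂ) => dzbar a (fun w => F (p.1, w)) p.2) (T ×ˢ U) :=
  contDiffOn_const.mul ((contDiffOn_fderiv_slice hT hU hF _).add
    (contDiffOn_const.mul (contDiffOn_fderiv_slice hT hU hF _)))

theorem hasDerivAt_dz_slice (hT : IsOpen T) (hU : IsOpen U) (hF : ContDiffOn ℝ ∞ F (T ×ˢ U))
    (ht : t ∈ T) (hz : z ∈ U) : HasDerivAt (fun s => dz a (fun w => F (s, w)) z)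
      (dz a (fun w => deriv (fun s => F (s, w)) t) z) t :=
  ((hasDerivAt_fderiv_slice hT hU hF ht hz _).sub
    ((hasDerivAt_fderiv_slice hT hU hF ht hz _).const_mul _)).const_mul _

theorem hasDerivAt_dzbar_slice (hT : IsOpen T) (hU : IsOpen U) (hF : ContDiffOn ℝ ∞ F (T ×ˢ U))
    (ht : t ∈ T) (hz : z ∈ U) : HasDerivAt (fun s => dzbar a (fun w => F (s, w)) z)
      (dzbar a (fun w => deriv (fun s => F (s, w)) t) z) t :=
  ((hasDerivAt_fderiv_slice hT hU hF ht hz _).add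
    ((hasDerivAt_fderiv_slice hT hU hF ht hz _).const_mul _)).const_mul _

theorem hasDerivAt_dz_dzbar_slice (hT : IsOpen T) (hU : IsOpen U)
    (hF : ContDiffOn ℝ ∞ F (T ×ˢ U)) (ht : t ∈ T) (hz : z ∈ U) :
    HasDerivAt (fun s => dz a (dzbar b fun w => F (s, w)) z)
      (dz a (dzbar b fun w => deriv (fun s => F (s, w)) t) z) t := by
  have h1 := hasDerivAt_dz_slice a hT hU (contDiffOn_dzbar_slice b hT.uniqueDiffOn hU hF) ht hz
  have h2 : (fun w => deriv (fun s => dzbar b (fun y => F (s, y)) w) t) =ᶠ[nhds z]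
      dzbar b fun w => deriv (fun s => F (s, w)) t := by
    filter_upwards [hU.mem_nhds hz] with w hw
    exact (hasDerivAt_dzbar_slice b hT hU hF ht hw).deriv
  rw [← dz_congr h2 a]
  exact h1

end

section
variable [MeasurableSpace X] [BorelSpace X]
  [IsManifold 𝓘(ℂ, Fin n → ℂ) ω X] [T2Space X] [CompactSpace X]
  {L : RealLineBundle A} {φ : ℝ → PosMetric L} {φ₀ : PosMetric L}

def IsSmoothPath (φ : ℝ → PosMetric L) : Prop :=
  ∀ i, ContDiffOn ℝ ∞ (fun p : ℝ × (Fin n → ℂ) => (φ p.1).toSmoothMetric.localWeight i p.2)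
    (Icc (0 : ℝ) 1 ×ˢ (A.chart i).target)

/-- The time derivative of a path of metrics. -/
def velocity (φ : ℝ → PosMetric L) (t : ℝ) (x : X) : ℝ :=
  deriv (fun s => (φ s).weight (A.indexAt x) x) t

def acceleration (φ : ℝ → PosMetric L) (t : ℝ) (x : X) : ℝ :=
  deriv (fun s => velocity φ s x) t

/-- The transition functions do not depend on time, so the velocity is a global function although
the weights are not. -/
theorem deriv_weight_eq (φ : ℝ → PosMetric L) (t : ℝ) {i j : ι} {x : X}
    (hi : x ∈ (A.chart i).source) (hj : x ∈ (A.chart j).source) :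
    deriv (fun s => (φ s).weight i x) t = deriv (fun s => (φ s).weight j x) t := by
  have h1 : (fun s => (φ s).weight i x) = fun s => (φ s).weight j x + L.logTrans i j x := by
    ext s
    linarith [(φ s).transition i j x ⟨hi, hj⟩]
  rw [h1, deriv_add_const]

theorem loc_velocity (φ : ℝ → PosMetric L) (t : ℝ) {i : ι} {z : Fin n → ℂ}
    (hz : z ∈ (A.chart i).target) : A.loc i (velocity φ t) z =
      deriv (fun s => (φ s).toSmoothMetric.localWeight i z) t :=
  deriv_weight_eq φ t (A.mem_indexAt _) ((A.chart i).map_target hz)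

theorem loc_acceleration (φ : ℝ → PosMetric L) (t : ℝ) {i : ι} {z : Fin n → ℂ}
    (hz : z ∈ (A.chart i).target) : A.loc i (acceleration φ t) z =
      deriv (deriv fun s => (φ s).toSmoothMetric.localWeight i z) t := by
  rw [show (deriv fun s => (φ s).toSmoothMetric.localWeight i z) =
    fun s => A.loc i (velocity φ s) z from funext fun s => (loc_velocity φ s hz).symm]
  rfl

theorem loc_metricDiff (φ φ₀ : PosMetric L) {i : ι} {z : Fin n → ℂ}
    (hz : z ∈ (A.chart i).target) : A.loc i (metricDiff φ φ₀) z =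
      φ.toSmoothMetric.localWeight i z - φ₀.toSmoothMetric.localWeight i z := by
  have h1 := (A.chart i).map_target hz
  have h2 := φ.transition _ i _ ⟨A.mem_indexAt _, h1⟩
  have h3 := φ₀.transition _ i _ ⟨A.mem_indexAt _, h1⟩
  simp only [CoordCover.loc, metricDiff, SmoothMetric.localWeight]
  linarith

theorem isSmooth_metricDiff (φ φ₀ : PosMetric L) : A.IsSmooth (metricDiff φ φ₀) := fun i z hz =>
  ((φ.toSmoothMetric.contDiffAt_localWeight hz).sub
    (φ₀.toSmoothMetric.contDiffAt_localWeight hz)).congr_of_eventuallyEq (by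
      filter_upwards [(A.chart i).open_target.mem_nhds hz] with w hw using loc_metricDiff φ φ₀ hw)

theorem IsSmoothPath.contDiffOn_ofReal (hφ : IsSmoothPath φ) (i : ι) :
    ContDiffOn ℝ ∞ (fun p : ℝ × (Fin n → ℂ) =>
      (((φ p.1).toSmoothMetric.localWeight i p.2 : ℝ) : ℂ))
      (Icc (0 : ℝ) 1 ×ˢ (A.chart i).target) :=
  Complex.ofRealCLM.contDiff.comp_contDiffOn (hφ i)

theorem Ioo_prod_subset (U : Set (Fin n → ℂ)) : Ioo (0 : ℝ) 1 ×ˢ U ⊆ Icc (0 : ℝ) 1 ×ˢ U :=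
  prod_mono Ioo_subset_Icc_self subset_rfl

theorem IsSmoothPath.contDiffOn_velocity (hφ : IsSmoothPath φ) (i : ι) :
    ContDiffOn ℝ ∞ (fun p : ℝ × (Fin n → ℂ) => A.loc i (velocity φ p.1) p.2)
      (Ioo (0 : ℝ) 1 ×ˢ (A.chart i).target) :=
  (contDiffOn_deriv_slice isOpen_Ioo (A.chart i).open_target
    ((hφ i).mono (Ioo_prod_subset _))).congr fun p hp => loc_velocity φ p.1 hp.2

theorem IsSmoothPath.contDiffOn_acceleration (hφ : IsSmoothPath φ) (i : ι) :
    ContDiffOn ℝ ∞ (fun p : ℝ × (Fin n → ℂ) => A.loc i (acceleration φ p.1) p.2)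
      (Ioo (0 : ℝ) 1 ×ˢ (A.chart i).target) :=
  contDiffOn_deriv_slice isOpen_Ioo (A.chart i).open_target (hφ.contDiffOn_velocity i)

theorem IsSmoothPath.isSmooth_velocity (hφ : IsSmoothPath φ) {t : ℝ} (ht : t ∈ Ioo (0 : ℝ) 1) :
    A.IsSmooth (velocity φ t) := fun i z hz =>
  ((hφ.contDiffOn_velocity i).contDiffAt ((isOpen_Ioo.prod (A.chart i).open_target).mem_nhds
    (show (t, z) ∈ _ from ⟨ht, hz⟩))).comp z (contDiff_prodMk_right t).contDiffAt

theorem IsSmoothPath.hasDerivAt_localWeight (hφ : IsSmoothPath φ) {t : ℝ}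
    (ht : t ∈ Ioo (0 : ℝ) 1) {i : ι} {z : Fin n → ℂ} (hz : z ∈ (A.chart i).target) :
    HasDerivAt (fun s => (φ s).toSmoothMetric.localWeight i z) (A.loc i (velocity φ t) z) t := by
  have h1 := hasDerivAt_slice isOpen_Ioo (A.chart i).open_target
    ((hφ i).mono (Ioo_prod_subset _)) ht hz
  rw [loc_velocity φ t hz]
  exact h1.differentiableAt.hasDerivAt

theorem IsSmoothPath.hasDerivAt_velocity (hφ : IsSmoothPath φ) {t : ℝ}
    (ht : t ∈ Ioo (0 : ℝ) 1) (x : X) :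
    HasDerivAt (fun s => velocity φ s x) (acceleration φ t x) t := by
  have hx := A.mem_indexAt x
  have h1 := hasDerivAt_slice isOpen_Ioo (A.chart (A.indexAt x)).open_target
    (hφ.contDiffOn_velocity (A.indexAt x)) ht ((A.chart _).map_source hx)
  have h2 := h1.differentiableAt.hasDerivAt
  simp only [CoordCover.loc, (A.chart (A.indexAt x)).left_inv hx] at h2
  exact h2

theorem IsSmoothPath.hasDerivAt_metricDiff (hφ : IsSmoothPath φ) {t : ℝ}
    (ht : t ∈ Ioo (0 : ℝ) 1) (x : X) :
    HasDerivAt (fun s => metricDiff (φ s) φ₀ x) (velocity φ t x) t := by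
  have hx := A.mem_indexAt x
  have h1 := hφ.hasDerivAt_localWeight ht ((A.chart _).map_source hx)
  simp only [CoordCover.loc, SmoothMetric.localWeight, (A.chart (A.indexAt x)).left_inv hx] at h1
  exact h1.sub_const _

theorem IsSmoothPath.contDiffOn_curv (hφ : IsSmoothPath φ) (i : ι) (a b : Fin n) :
    ContDiffOn ℝ ∞ (fun p : ℝ × (Fin n → ℂ) => (φ p.1).toSmoothMetric.curv i p.2 a b)
      (Icc (0 : ℝ) 1 ×ˢ (A.chart i).target) :=
  contDiffOn_dz_slice a (uniqueDiffOn_Icc one_pos) (A.chart i).open_target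
    (contDiffOn_dzbar_slice b (uniqueDiffOn_Icc one_pos) (A.chart i).open_target
      (hφ.contDiffOn_ofReal i))

theorem IsSmoothPath.hasDerivAt_curv (hφ : IsSmoothPath φ) {t : ℝ} (ht : t ∈ Ioo (0 : ℝ) 1)
    {i : ι} {z : Fin n → ℂ} (hz : z ∈ (A.chart i).target) (a b : Fin n) :
    HasDerivAt (fun s => (φ s).toSmoothMetric.curv i z a b)
      (dz a (dzbar b (A.loc i fun x => (velocity φ t x : ℂ))) z) t := by
  have h1 := hasDerivAt_dz_dzbar_slice a b isOpen_Ioo (A.chart i).open_target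
    ((hφ.contDiffOn_ofReal i).mono (Ioo_prod_subset _)) ht hz
  have h2 : (dzbar b fun w => deriv (fun s =>
      (((φ s).toSmoothMetric.localWeight i w : ℝ) : ℂ)) t) =ᶠ[nhds z]
      dzbar b (A.loc i fun x => (velocity φ t x : ℂ)) := by
    filter_upwards [(A.chart i).open_target.mem_nhds hz] with w hw
    refine dzbar_congr ?_ b
    filter_upwards [(A.chart i).open_target.mem_nhds hw] with y hy
    exact (hφ.hasDerivAt_localWeight ht hy).ofReal_comp.deriv
  rw [← dz_congr h2 a]
  exact h1

theorem curv_sub_eq (φ φ₀ : PosMetric L) {i : ι} {z : Fin n → ℂ} (hz : z ∈ (A.chart i).target)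
    (a b : Fin n) : φ.toSmoothMetric.curv i z a b - φ₀.toSmoothMetric.curv i z a b =
      dz a (dzbar b (A.loc i fun x => (metricDiff φ φ₀ x : ℂ))) z := by
  have c1 := φ.toSmoothMetric.contDiffAt_ofReal_localWeight hz
  have c2 := φ₀.toSmoothMetric.contDiffAt_ofReal_localWeight hz
  have h1 : dzbar b (A.loc i fun x => (metricDiff φ φ₀ x : ℂ)) =ᶠ[nhds z] fun w =>
      dzbar b (fun w => (φ.toSmoothMetric.localWeight i w : ℂ)) w -
        dzbar b (fun w => (φ₀.toSmoothMetric.localWeight i w : ℂ)) w := by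
    filter_upwards [(A.chart i).open_target.mem_nhds hz] with w hw
    rw [← dzbar_sub b ((φ.toSmoothMetric.contDiffAt_ofReal_localWeight hw).differentiableAt
      (by simp)) ((φ₀.toSmoothMetric.contDiffAt_ofReal_localWeight hw).differentiableAt (by simp))]
    refine dzbar_congr ?_ b
    filter_upwards [(A.chart i).open_target.mem_nhds hw] with y hy
    have := loc_metricDiff φ φ₀ hy
    simp only [CoordCover.loc] at this ⊢
    rw [this]
    push_cast
    rfl
  rw [dz_congr h1, dz_sub a ((contDiffAt_dzbar b c1).differentiableAt (by simp))
    ((contDiffAt_dzbar b c2).differentiableAt (by simp))]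
  rfl

end

end

/-! ### First variation of integrals against determinant densities. -/

section

variable {n : ℕ}
variable {X : Type*} [TopologicalSpace X] [ChartedSpace (Fin n → ℂ) X] {ι : Type*}
  {A : CoordCover n X ι}

open ComplexConjugate Matrix

section
variable [MeasurableSpace X] [BorelSpace X]
  [IsManifold 𝓘(ℂ, Fin n → ℂ) ω X] [T2Space X] [CompactSpace X]

theorem contDiffOn_det {E : Type*} [NormedAddCommGroup E] [NormedSpace ℝ E] {S : Set E}
    {M : E → Matrix (Fin n) (Fin n) ℂ} (hM : ∀ a b, ContDiffOn ℝ ∞ (fun w => M w a b) S) :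
    ContDiffOn ℝ ∞ (fun w => (M w).det) S := by
  simp only [Matrix.det_apply']
  exact ContDiffOn.sum fun σ _ => contDiffOn_const.mul (contDiffOn_prod fun a _ => hM _ _)

theorem isDensityPath_detDensity {T : Set ℝ} {g : ℝ → ι → (Fin n → ℂ) → Matrix (Fin n) (Fin n) ℂ}
    (hg : ∀ t ∈ T, IsKahler A (g t)) (hgs : ∀ i a b, ContDiffOn ℝ ∞
      (fun p : ℝ × (Fin n → ℂ) => g p.1 i p.2 a b) (T ×ˢ (A.chart i).target)) :
    IsDensityPath A T fun t => detDensity (g t) where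
  isDensity t ht := (isSmoothDensity_detDensity (hg t ht)).toIsDensity
  continuousOn i := Complex.continuous_re.comp_continuousOn (contDiffOn_det (hgs i)).continuousOn

/-- The first variation of an integral against the volume forms of a path of Kähler metrics that
varies by the complex Hessian of a function. -/
theorem hasDerivAt_integral_detDensity {T : Set ℝ} (hT : IsOpen T)
    {g : ℝ → ι → (Fin n → ℂ) → Matrix (Fin n) (Fin n) ℂ} (hg : ∀ t ∈ T, IsKahler A (g t))
    (hgs : ∀ i a b, ContDiffOn ℝ ∞ (fun p : ℝ × (Fin n → ℂ) => g p.1 i p.2 a b)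
      (T ×ˢ (A.chart i).target)) {u u' : ℝ → X → ℝ} (hu : IsContinuousPath A T u)
    (hu' : IsContinuousPath A T u') (hud : ∀ t ∈ T, ∀ x, HasDerivAt (fun s => u s x) (u' t x) t)
    {t : ℝ} (ht : t ∈ T) {w : X → ℝ} (hw : A.IsSmooth w) {c : ℝ}
    (hd : ∀ i, ∀ z ∈ (A.chart i).target, ∀ a b, HasDerivAt (fun s => g s i z a b)
      (c * dz a (dzbar b (A.loc i fun x => (w x : ℂ))) z) t) :
    HasDerivAt (fun s => ∫ x, u s x ∂(volumeFormMeasure A (detDensity (g s))))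
      (∫ x, (u' t x - c * (u t x * (lapL A (detDensity (g t)) (g t) (fun x => (w x : ℂ)) x).re))
        ∂(volumeFormMeasure A (detDensity (g t)))) t := by
  have hdet : ∀ i, ContDiffOn ℝ ∞ (fun p : ℝ × (Fin n → ℂ) => detDensity (g p.1) i p.2)
      (T ×ˢ (A.chart i).target) := fun i =>
    Complex.reCLM.contDiff.comp_contDiffOn (contDiffOn_det (hgs i))
  have hL := isSmooth_lapL (isSmoothDensity_detDensity (hg t ht)) (hg t ht) hw.ofReal
  obtain ⟨C, hC, hv⟩ := exists_hasDerivAt_integral_path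
    (ρ' := fun t i z => deriv (fun s => detDensity (g s) i z) t) hT
    (isDensityPath_detDensity hg hgs) hu hu'
    (fun i => (contDiffOn_deriv_slice hT (A.chart i).open_target (hdet i)).continuousOn) hud
    (fun s hs i z hz => (hasDerivAt_slice hT (A.chart i).open_target (hdet i) hs
      hz).differentiableAt.hasDerivAt) ht
  have hvc : Continuous fun x =>
      u' t x - c * (u t x * (lapL A (detDensity (g t)) (g t) (fun x => (w x : ℂ)) x).re) :=
    (hu'.continuous ht).sub (continuous_const.mul ((hu.continuous ht).mul
      (Complex.continuous_re.comp hL.continuous)))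
  rw [hv _ hvc fun i z hz => ?_]
  · exact hC
  have hdz := hasDerivAt_det (M := fun s => g s i z)
    (M' := Matrix.of fun a b => (c : ℂ) * dz a (dzbar b (A.loc i fun x => (w x : ℂ))) z)
    (hd i z hz) (PosDef.det_ne_zero ((hg t ht).posDef i z hz))
  have hre : deriv (fun s => detDensity (g s) i z) t = ((g t i z).det * ((g t i z)⁻¹ *
      Matrix.of fun a b => (c : ℂ) * dz a (dzbar b (A.loc i fun x => (w x : ℂ))) z).trace).re :=
    (Complex.reCLM.hasFDerivAt.comp_hasDerivAt t hdz).deriv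
  have hl := loc_lapL (isSmoothDensity_detDensity (hg t ht)) (hg t ht) hw.ofReal hz
  simp only [lapB_detDensity (hg t ht) hz, zero_mul, Finset.sum_const_zero, add_zero] at hl
  -- By Jacobi's formula the density varies by the trace of `g⁻¹ ∂∂̄w`, and for the density `det g`
  -- this trace is `-L w`.
  have htr : ((g t i z)⁻¹ * Matrix.of fun a b =>
      (c : ℂ) * dz a (dzbar b (A.loc i fun x => (w x : ℂ))) z).trace =
      -(c : ℂ) * A.loc i (lapL A (detDensity (g t)) (g t) fun x => (w x : ℂ)) z := by
    rw [hl, Matrix.trace, Finset.sum_comm]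
    simp only [Matrix.diag_apply, Matrix.mul_apply, Matrix.of_apply, neg_mul_neg, Finset.mul_sum]
    exact Finset.sum_congr rfl fun _ _ => Finset.sum_congr rfl fun _ _ => by ring
  rw [hre, htr, ← ofReal_detDensity (hg t ht) hz, Complex.re_ofReal_mul, ← Complex.ofReal_neg,
    Complex.re_ofReal_mul]
  simp only [CoordCover.loc]
  ring

theorem integral_mul_re_lapL_symm {ρ : ι → (Fin n → ℂ) → ℝ}
    {g : ι → (Fin n → ℂ) → Matrix (Fin n) (Fin n) ℂ} (hρ : IsSmoothDensity A ρ)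
    (hg : IsKahler A g) {u v : X → ℝ} (hu : A.IsSmooth u) (hv : A.IsSmooth v) :
    ∫ x, v x * (lapL A ρ g (fun x => (u x : ℂ)) x).re ∂(volumeFormMeasure A ρ) =
      ∫ x, u x * (lapL A ρ g (fun x => (v x : ℂ)) x).re ∂(volumeFormMeasure A ρ) := by
  have h1 := congrArg Complex.re (lapL_symm hρ hg hu.ofReal hv.ofReal)
  have c1 := (isSmooth_lapL hρ hg hu.ofReal).continuous
  have c2 := (isSmooth_lapL hρ hg hv.ofReal).continuous
  have hu1 := hu.continuous
  have hv1 := hv.continuous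
  have e1 := integral_re (𝕜 := ℂ) (integrable_of_continuous hρ.toIsDensity
    (f := fun x => conj (v x : ℂ) * lapL A ρ g (fun x => (u x : ℂ)) x) (by fun_prop))
  have e2 := integral_re (𝕜 := ℂ) (integrable_of_continuous hρ.toIsDensity
    (f := fun x => (u x : ℂ) * conj (lapL A ρ g (fun x => (v x : ℂ)) x)) (by fun_prop))
  simp only [RCLike.re_eq_complex_re, Complex.conj_ofReal, Complex.re_ofReal_mul,
    Complex.conj_re] at e1 e2 h1
  rw [e1, e2, h1]

theorem integral_mul_re_lapL_self {ρ : ι → (Fin n → ℂ) → ℝ}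
    {g : ι → (Fin n → ℂ) → Matrix (Fin n) (Fin n) ℂ} (hρ : IsSmoothDensity A ρ)
    (hg : IsKahler A g) {u : X → ℝ} (hu : A.IsSmooth u) :
    ∫ x, u x * (lapL A ρ g (fun x => (u x : ℂ)) x).re ∂(volumeFormMeasure A ρ) =
      ∫ x, dbarSq A g (fun x => (u x : ℂ)) x ∂(volumeFormMeasure A ρ) := by
  have h1 := congrArg Complex.re (integral_conj_mul_lapL hρ hg hu.ofReal)
  have c1 := (isSmooth_lapL hρ hg hu.ofReal).continuous
  have hu1 := hu.continuous
  have e1 := integral_re (𝕜 := ℂ) (integrable_of_continuous hρ.toIsDensity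
    (f := fun x => conj (u x : ℂ) * lapL A ρ g (fun x => (u x : ℂ)) x) (by fun_prop))
  simp only [RCLike.re_eq_complex_re, Complex.conj_ofReal, Complex.re_ofReal_mul,
    Complex.ofReal_re] at e1 h1
  rw [e1, h1]

variable {L : RealLineBundle A} {φ : ℝ → PosMetric L} {φ₀ : PosMetric L}

def wedgeDensity (φ φ₀ : PosMetric L) (j : ℕ) (i : ι) (z : Fin n → ℂ) : ℝ :=
  (mixedWedge (φ.toSmoothMetric.curv i z) (φ₀.toSmoothMetric.curv i z) j).re

theorem contDiffOn_mixedWedge {E : Type*} [NormedAddCommGroup E] [NormedSpace ℝ E] {S : Set E}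
    {M N : E → Matrix (Fin n) (Fin n) ℂ} (hM : ∀ a b, ContDiffOn ℝ ∞ (fun w => M w a b) S)
    (hN : ∀ a b, ContDiffOn ℝ ∞ (fun w => N w a b) S) (j : ℕ) :
    ContDiffOn ℝ ∞ (fun w => (mixedWedge (M w) (N w) j).re) S := by
  refine Complex.reCLM.contDiff.comp_contDiffOn (ContDiffOn.sum fun σ _ => ContDiffOn.sum fun π _ =>
    contDiffOn_const.mul (contDiffOn_prod fun k _ => ?_))
  beta_reduce
  split_ifs
  exacts [hM _ _, hN _ _]

theorem IsKahler.contDiffOn {g : ι → (Fin n → ℂ) → Matrix (Fin n) (Fin n) ℂ} (hg : IsKahler A g)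
    (i : ι) (a b : Fin n) : ContDiffOn ℝ ∞ (fun w => g i w a b) (A.chart i).target :=
  fun z hz => (hg.smooth i z hz a b).contDiffWithinAt

theorem isDensity_wedgeDensity (φ φ₀ : PosMetric L) (j : ℕ) :
    IsDensity A (wedgeDensity φ φ₀ j) := by
  have hpd : ∀ i, ∀ z ∈ (A.chart i).target, ∀ k : Fin n, (if (k : ℕ) < j then
      φ.toSmoothMetric.curv i z else φ₀.toSmoothMetric.curv i z).PosDef := fun i z hz k => by
    split_ifs
    exacts [φ.pos i z hz, φ₀.pos i z hz]
  refine ⟨fun i => (contDiffOn_mixedWedge (φ.isKahler.contDiffOn i) (φ₀.isKahler.contDiffOn i)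
    j).continuousOn, fun i z hz => (Complex.pos_iff.1 (wedgeCoeff_pos (hpd i z hz))).1,
    fun i j' z hz => ?_⟩
  have h1 := wedgeCoeff_congruence (hpd j' _ (CoordCover.trans_mem hz)) (jacM A i j' z)
  rw [wedgeDensity, wedgeDensity, mixedWedge, mixedWedge, ← Complex.re_ofReal_mul, ← jacM_det, ← h1]
  congr 2
  ext1 k
  split_ifs
  exacts [φ.isKahler.trans i j' z hz, φ₀.isKahler.trans i j' z hz]

theorem IsSmoothPath.contDiffOn_wedgeDensity (hφ : IsSmoothPath φ) (φ₀ : PosMetric L) (j : ℕ)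
    (i : ι) : ContDiffOn ℝ ∞ (fun p : ℝ × (Fin n → ℂ) => wedgeDensity (φ p.1) φ₀ j i p.2)
      (Icc (0 : ℝ) 1 ×ˢ (A.chart i).target) :=
  contDiffOn_mixedWedge (hφ.contDiffOn_curv i)
    (fun a b => (φ₀.isKahler.contDiffOn i a b).comp contDiffOn_snd fun _ hp => hp.2) j

theorem IsSmoothPath.isContinuousPath_metricDiff (hφ : IsSmoothPath φ) :
    IsContinuousPath A (Icc 0 1) fun t => metricDiff (φ t) φ₀ := fun i =>
  ((hφ i).continuousOn.sub
    ((φ₀.toSmoothMetric.smooth i).continuousOn.comp continuousOn_snd fun _ hp => hp.2)).congr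
    fun p hp => loc_metricDiff (φ p.1) φ₀ hp.2

theorem IsSmoothPath.isContinuousPath_velocity (hφ : IsSmoothPath φ) :
    IsContinuousPath A (Ioo 0 1) (velocity φ) := fun i => (hφ.contDiffOn_velocity i).continuousOn

theorem IsContinuousPath.mono {T S : Set ℝ} {u : ℝ → X → ℝ} (hu : IsContinuousPath A T u)
    (h : S ⊆ T) : IsContinuousPath A S u := fun i => (hu i).mono (prod_mono h subset_rfl)

/-- Interpolating linearly between the two forms collects all the measures of the energy functional
into one determinant density. -/
theorem integral_detDensity_combination (φ φ₀ : PosMetric L) {s : ℝ} (hs : s ∈ Icc (0 : ℝ) 1)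
    {f : X → ℝ} (hf : Continuous f) :
    ∫ x, f x ∂(volumeFormMeasure A (detDensity fun i z =>
      ((1 - s : ℝ) : ℂ) • φ₀.toSmoothMetric.curv i z + (s : ℂ) • φ.toSmoothMetric.curv i z)) =
      ∑ j ∈ Finset.range (n + 1), ((bernsteinPolynomial ℝ n j).eval s / n.factorial) *
        ∫ x, f x ∂(mixedMA φ φ₀ j) := by
  have hK := φ₀.isKahler.combination φ.isKahler (sub_nonneg.2 hs.2) hs.1 (by linarith)
  refine integral_eq_sum_of_density_eq _ (isSmoothDensity_detDensity hK).toIsDensity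
    (fun j _ => isDensity_wedgeDensity φ φ₀ j) (fun i z hz => ?_) hf
  have h1 := factorial_mul_det_add (φ.toSmoothMetric.curv i z) (φ₀.toSmoothMetric.curv i z)
    ((1 - s : ℝ) : ℂ) (s : ℂ)
  have h2 := congrArg Complex.re h1
  rw [← Complex.ofReal_natCast, Complex.re_ofReal_mul, Complex.re_sum] at h2
  rw [← mul_right_inj' (show (n.factorial : ℝ) ≠ 0 by positivity), Finset.mul_sum]
  refine h2.trans (Finset.sum_congr rfl fun j _ => ?_)
  have h3 : (n.choose j : ℂ) * (s : ℂ) ^ j * ((1 - s : ℝ) : ℂ) ^ (n - j) =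
      ((bernsteinPolynomial ℝ n j).eval s : ℝ) := by
    simp [bernsteinPolynomial]
  rw [h3, Complex.re_ofReal_mul, wedgeDensity]
  field_simp

end

end

/-! ### The energy along a path and along a geodesic. -/

section

variable {n : ℕ}
variable {X : Type*} [TopologicalSpace X] [ChartedSpace (Fin n → ℂ) X] {ι : Type*}
  {A : CoordCover n X ι}

open ComplexConjugate Matrix

section
variable [MeasurableSpace X] [BorelSpace X]
  [IsManifold 𝓘(ℂ, Fin n → ℂ) ω X] [T2Space X] [CompactSpace X]
  {L : RealLineBundle A} {φ : ℝ → PosMetric L} {φ₀ : PosMetric L}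

/-- Only existence is needed: the individual derivatives are never computed, only their sum. -/
theorem exists_hasDerivAt_integral_mixedMA (hφ : IsSmoothPath φ) (φ₀ : PosMetric L) {t : ℝ}
    (ht : t ∈ Ioo (0 : ℝ) 1) (j : ℕ) :
    ∃ c, HasDerivAt (fun s => ∫ x, metricDiff (φ s) φ₀ x ∂(mixedMA (φ s) φ₀ j)) c t := by
  have hw := fun i => (hφ.contDiffOn_wedgeDensity φ₀ j i).mono (Ioo_prod_subset _)
  obtain ⟨c, hc, -⟩ := exists_hasDerivAt_integral_path
    (ρ := fun s => wedgeDensity (φ s) φ₀ j)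
    (ρ' := fun t i z => deriv (fun s => wedgeDensity (φ s) φ₀ j i z) t) isOpen_Ioo
    ⟨fun s _ => isDensity_wedgeDensity _ _ _, fun i => (hw i).continuousOn⟩
    (hφ.isContinuousPath_metricDiff.mono Ioo_subset_Icc_self) hφ.isContinuousPath_velocity
    (fun i => (contDiffOn_deriv_slice isOpen_Ioo (A.chart i).open_target (hw i)).continuousOn)
    (fun s hs x => hφ.hasDerivAt_metricDiff hs x)
    (fun s hs i z hz => (hasDerivAt_slice isOpen_Ioo (A.chart i).open_target (hw i) hs
      hz).differentiableAt.hasDerivAt) ht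
  exact ⟨c, hc⟩

/-- With `m = φ - φ₀`, `v` the velocity and `g_s` the interpolated metric, the time derivative of `∫
m det g_s` is `∫ (v - s m L v) det g_s`. By symmetry of `L` this equals `∫ (v - s v L m) det g_s`,
and since `∂_s g_s = ∂∂̄m` that is the `s`-derivative of `s ∫ v det g_s`. -/
theorem sum_bernstein_mul_deriv_eq (hφ : IsSmoothPath φ) {t : ℝ}
    (ht : t ∈ Ioo (0 : ℝ) 1) {c : ℕ → ℝ} (hc : ∀ j, HasDerivAt
      (fun s => ∫ x, metricDiff (φ s) φ₀ x ∂(mixedMA (φ s) φ₀ j)) (c j) t)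
    {s : ℝ} (hs : s ∈ Ioo (0 : ℝ) 1) :
    HasDerivAt (fun s => s * ∑ j ∈ Finset.range (n + 1),
        ((bernsteinPolynomial ℝ n j).eval s / n.factorial) *
          ∫ x, velocity φ t x ∂(mixedMA (φ t) φ₀ j))
      (∑ j ∈ Finset.range (n + 1), ((bernsteinPolynomial ℝ n j).eval s / n.factorial) * c j) s := by
  set g : ℝ → ℝ → ι → (Fin n → ℂ) → Matrix (Fin n) (Fin n) ℂ := fun τ s i z =>
    ((1 - s : ℝ) : ℂ) • φ₀.toSmoothMetric.curv i z + (s : ℂ) • (φ τ).toSmoothMetric.curv i z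
    with hg
  have hK : ∀ τ, ∀ s ∈ Ioo (0 : ℝ) 1, IsKahler A (g τ s) := fun τ s hs =>
    φ₀.isKahler.combination (φ τ).isKahler (sub_nonneg.2 hs.2.le) hs.1.le (by linarith)
  have hv := hφ.isSmooth_velocity ht
  have hm := isSmooth_metricDiff (φ t) φ₀
  have hφ₀ : ∀ i a b, ContDiffOn ℝ ∞ (fun p : ℝ × (Fin n → ℂ) =>
      φ₀.toSmoothMetric.curv i p.2 a b) (Ioo (0 : ℝ) 1 ×ˢ (A.chart i).target) := fun i a b =>
    (φ₀.isKahler.contDiffOn i a b).comp contDiffOn_snd fun _ hp => hp.2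
  have d1 := hasDerivAt_integral_detDensity isOpen_Ioo (g := fun τ => g τ s)
    (fun τ _ => hK τ s hs)
    (fun i a b => (contDiffOn_const.mul (hφ₀ i a b)).add
      (contDiffOn_const.mul ((hφ.contDiffOn_curv i a b).mono (Ioo_prod_subset _))))
    ((hφ.isContinuousPath_metricDiff (φ₀ := φ₀)).mono Ioo_subset_Icc_self)
    hφ.isContinuousPath_velocity (fun s hs x => hφ.hasDerivAt_metricDiff hs x) ht hv (c := s)
    (fun i z hz a b => ((hφ.hasDerivAt_curv ht hz a b).const_mul (s : ℂ)).const_add _)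
  have d1' : HasDerivAt (fun τ => ∫ x, metricDiff (φ τ) φ₀ x
      ∂(volumeFormMeasure A (detDensity (g τ s))))
      (∑ j ∈ Finset.range (n + 1), ((bernsteinPolynomial ℝ n j).eval s / n.factorial) * c j) t := by
    have h1 : (fun τ => ∫ x, metricDiff (φ τ) φ₀ x ∂(volumeFormMeasure A (detDensity (g τ s)))) =
        fun τ => ∑ j ∈ Finset.range (n + 1), ((bernsteinPolynomial ℝ n j).eval s / n.factorial) *
          ∫ x, metricDiff (φ τ) φ₀ x ∂(mixedMA (φ τ) φ₀ j) := funext fun τ =>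
      integral_detDensity_combination (φ τ) φ₀ ⟨hs.1.le, hs.2.le⟩
        (isSmooth_metricDiff _ _).continuous
    rw [h1]
    exact HasDerivAt.fun_sum fun j _ => (hc j).const_mul _
  have hcv : IsContinuousPath A (Ioo 0 1) fun _ => velocity φ t := fun i z hz =>
    ((hv i z.2 hz.2).continuousAt.comp continuousAt_snd).continuousWithinAt
  have d2 := hasDerivAt_integral_detDensity isOpen_Ioo (g := g t) (hK t)
    (u := fun σ x => σ * velocity φ t x) (u' := fun _ => velocity φ t)
    (fun i a b => by
      have e1 : ContDiff ℝ ∞ fun p : ℝ × (Fin n → ℂ) => ((1 - p.1 : ℝ) : ℂ) :=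
        Complex.ofRealCLM.contDiff.comp (contDiff_const.sub contDiff_fst)
      have e2 : ContDiff ℝ ∞ fun p : ℝ × (Fin n → ℂ) => (p.1 : ℂ) :=
        Complex.ofRealCLM.contDiff.comp contDiff_fst
      exact (e1.contDiffOn.mul (hφ₀ i a b)).add (e2.contDiffOn.mul
        (((φ t).isKahler.contDiffOn i a b).comp contDiffOn_snd fun _ hp => hp.2)))
    (fun i => continuousOn_fst.mul (hcv i)) hcv
    (fun σ _ x => by simpa using (hasDerivAt_id σ).mul_const (velocity φ t x)) hs hm (c := 1)
    (fun i z hz a b => by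
      have e1 : HasDerivAt (fun σ : ℝ => ((1 - σ : ℝ) : ℂ)) (-1 : ℂ) s := by
        simpa using ((hasDerivAt_id s).const_sub 1).ofReal_comp
      have e2 : HasDerivAt (fun σ : ℝ => (σ : ℂ)) (1 : ℂ) s := by
        simpa using (hasDerivAt_id s).ofReal_comp
      have e3 := (e1.mul_const (φ₀.toSmoothMetric.curv i z a b)).add
        (e2.mul_const ((φ t).toSmoothMetric.curv i z a b))
      rw [← curv_sub_eq (φ t) φ₀ hz]
      refine e3.congr_deriv ?_
      push_cast
      ring)
  have hρ := isSmoothDensity_detDensity (hK t s hs)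
  have cL := Complex.continuous_re.comp (isSmooth_lapL hρ (hK t s hs) hv.ofReal).continuous
  have cL' := Complex.continuous_re.comp (isSmooth_lapL hρ (hK t s hs) hm.ofReal).continuous
  have cv := hv.continuous
  have cm := hm.continuous
  have hXY : ∫ x, (velocity φ t x - s * (metricDiff (φ t) φ₀ x * (lapL A (detDensity (g t s))
      (g t s) (fun x => (velocity φ t x : ℂ)) x).re))
        ∂(volumeFormMeasure A (detDensity (g t s))) =
      ∫ x, (velocity φ t x - 1 * (s * velocity φ t x * (lapL A (detDensity (g t s))
      (g t s) (fun x => (metricDiff (φ t) φ₀ x : ℂ)) x).re))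
        ∂(volumeFormMeasure A (detDensity (g t s))) := by
    have i1 := integrable_real_of_continuous hρ.toIsDensity cv
    have i2 : Integrable (fun x => s * (metricDiff (φ t) φ₀ x * (lapL A (detDensity (g t s))
      (g t s) (fun x => (velocity φ t x : ℂ)) x).re)) (volumeFormMeasure A (detDensity (g t s))) :=
      integrable_real_of_continuous hρ.toIsDensity (continuous_const.mul (cm.mul cL))
    have i3 : Integrable (fun x => s * (velocity φ t x * (lapL A (detDensity (g t s))
      (g t s) (fun x => (metricDiff (φ t) φ₀ x : ℂ)) x).re))
      (volumeFormMeasure A (detDensity (g t s))) :=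
      integrable_real_of_continuous hρ.toIsDensity (continuous_const.mul (cv.mul cL'))
    simp only [one_mul, mul_assoc]
    rw [integral_sub i1 i2, integral_sub i1 i3, integral_const_mul, integral_const_mul,
      integral_mul_re_lapL_symm hρ (hK t s hs) hv hm]
  rw [d1'.unique d1, hXY]
  refine d2.congr_of_eventuallyEq ?_
  filter_upwards [isOpen_Ioo.mem_nhds hs] with σ hσ
  rw [integral_const_mul, integral_detDensity_combination (φ t) φ₀ ⟨hσ.1.le, hσ.2.le⟩ cv]

/-- The identity of `sum_bernstein_mul_deriv_eq` is integrated over `[0,1]`. The boundary term at `s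
= 0` vanishes because of the factor `s`, and at `s = 1` the interpolated metric is the curvature of
`φ t`. -/
theorem sum_deriv_integral_mixedMA (hφ : IsSmoothPath φ) {t : ℝ}
    (ht : t ∈ Ioo (0 : ℝ) 1) {c : ℕ → ℝ} (hc : ∀ j, HasDerivAt
      (fun s => ∫ x, metricDiff (φ s) φ₀ x ∂(mixedMA (φ s) φ₀ j)) (c j) t) :
    ∑ j ∈ Finset.range (n + 1), c j = (n + 1) * n.factorial *
      ∫ x, velocity φ t x ∂(volumeFormMeasure A (detDensity (φ t).toSmoothMetric.curv)) := by
  have hcont : ∀ (d : ℕ → ℝ), Continuous fun s : ℝ => ∑ j ∈ Finset.range (n + 1),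
      ((bernsteinPolynomial ℝ n j).eval s / n.factorial) * d j := fun d =>
    continuous_finsetSum _ fun j _ => ((Polynomial.continuous _).div_const _).mul_const _
  have h1 := intervalIntegral.integral_eq_sub_of_hasDerivAt_of_le zero_le_one
    ((continuous_id.mul (hcont _)).continuousOn)
    (fun s hs => sum_bernstein_mul_deriv_eq hφ ht hc hs) ((hcont c).intervalIntegrable _ _)
  rw [intervalIntegral.integral_finsetSum fun j _ =>
    (((Polynomial.continuous _).div_const _).mul_const _).intervalIntegrable _ _] at h1
  have h2 : ∑ j ∈ Finset.range (n + 1), ∫ s in (0 : ℝ)..1,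
      ((bernsteinPolynomial ℝ n j).eval s / n.factorial) * c j =
      (∑ j ∈ Finset.range (n + 1), c j) / ((n + 1) * n.factorial) := by
    rw [Finset.sum_div]
    refine Finset.sum_congr rfl fun j hj => ?_
    rw [intervalIntegral.integral_mul_const, intervalIntegral.integral_div,
      integral_bernstein n (Nat.lt_succ_iff.1 (Finset.mem_range.1 hj))]
    field_simp
  have h3 := integral_detDensity_combination (φ t) φ₀ (right_mem_Icc.2 (zero_le_one (α := ℝ)))
    (hφ.isSmooth_velocity ht).continuous
  rw [h2] at h1
  simp only [Pi.mul_apply, id_eq, one_mul, zero_mul, sub_zero] at h1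
  rw [← h3, div_eq_iff (by positivity)] at h1
  rw [h1, mul_comm]
  simp

theorem hasDerivAt_energy (hφ : IsSmoothPath φ) {t : ℝ} (ht : t ∈ Ioo (0 : ℝ) 1) :
    HasDerivAt (fun s => energy φ₀ (φ s)) (n.factorial / kahlerVolume φ₀ *
      ∫ x, velocity φ t x ∂(volumeFormMeasure A (detDensity (φ t).toSmoothMetric.curv))) t := by
  choose c hc using exists_hasDerivAt_integral_mixedMA hφ φ₀ ht
  have h1 := (HasDerivAt.fun_sum fun j (_ : j ∈ Finset.range (n + 1)) => hc j).const_mul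
    (1 / ((n + 1 : ℝ) * kahlerVolume φ₀))
  rw [sum_deriv_integral_mixedMA hφ ht hc] at h1
  refine h1.congr_deriv ?_
  have : (n + 1 : ℝ) ≠ 0 := by positivity
  field_simp

theorem continuousOn_energy (hφ : IsSmoothPath φ) :
    ContinuousOn (fun s => energy φ₀ (φ s)) (Icc 0 1) :=
  continuousOn_const.mul (continuousOn_finsetSum _ fun j _ =>
    continuousOn_integral_path isCompact_Icc (ρ := fun s => wedgeDensity (φ s) φ₀ j)
      ⟨fun _ _ => isDensity_wedgeDensity _ _ _,
        fun i => (hφ.contDiffOn_wedgeDensity φ₀ j i).continuousOn⟩ hφ.isContinuousPath_metricDiff)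

theorem IsSmoothGeodesic.isSmoothPath (hφ : IsSmoothGeodesic φ) : IsSmoothPath φ := hφ.smooth

theorem IsSmoothGeodesic.acceleration_eq (hφ : IsSmoothGeodesic φ) {t : ℝ}
    (ht : t ∈ Ioo (0 : ℝ) 1) (x : X) : acceleration φ t x =
      dbarSq A (φ t).toSmoothMetric.curv (fun x => (velocity φ t x : ℂ)) x := by
  set i := A.indexAt x with hi
  have hx : x ∈ (A.chart i).source := A.mem_indexAt x
  have hz := (A.chart i).map_source hx
  have h1 := loc_acceleration φ t hz
  simp only [CoordCover.loc, (A.chart i).left_inv hx] at h1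
  have h2 : (fun w => ((deriv (fun s => (φ s).weight i ((A.chart i).symm w)) t : ℝ) : ℂ))
      =ᶠ[nhds (A.chart i x)] A.loc i fun x => (velocity φ t x : ℂ) := by
    filter_upwards [(A.chart i).open_target.mem_nhds hz] with w hw
    exact congrArg _ (loc_velocity φ t hw).symm
  rw [h1]
  refine (hφ.equation t ht i _ hz).trans ?_
  rw [gradNormSq, dbarSq, dirD]
  congr 1
  refine Finset.sum_congr rfl fun a _ => ?_
  simp only [Complex.conj_ofReal]
  rw [gradV, Matrix.mulVec, dotProduct, Finset.sum_mul]
  refine Finset.sum_congr rfl fun b _ => ?_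
  rw [dz_congr h2, dzbar_congr h2, Matrix.transpose_apply]
  ring

/-- The derivative is the integral of `φ''` minus that of `|∂̄φ'|²`, which is zero by the geodesic
equation. Hence the energy is affine along the geodesic. -/
theorem IsSmoothGeodesic.hasDerivAt_integral_velocity (hφ : IsSmoothGeodesic φ) {t : ℝ}
    (ht : t ∈ Ioo (0 : ℝ) 1) : HasDerivAt (fun t => ∫ x, velocity φ t x
      ∂(volumeFormMeasure A (detDensity (φ t).toSmoothMetric.curv))) 0 t := by
  have hs := hφ.isSmoothPath
  have hv := hs.isSmooth_velocity ht
  have hK := (φ t).isKahler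
  have hρ := isSmoothDensity_detDensity hK
  have hacc : IsContinuousPath A (Ioo 0 1) (acceleration φ) := fun i =>
    (hs.contDiffOn_acceleration i).continuousOn
  have d := hasDerivAt_integral_detDensity isOpen_Ioo
    (g := fun t => (φ t).toSmoothMetric.curv) (fun t _ => (φ t).isKahler)
    (fun i a b => (hs.contDiffOn_curv i a b).mono (Ioo_prod_subset _))
    hs.isContinuousPath_velocity hacc (fun s h x => hs.hasDerivAt_velocity h x) ht hv (c := 1)
    (fun i z hz a b => by simpa using hs.hasDerivAt_curv ht hz a b)
  have cL := Complex.continuous_re.comp (isSmooth_lapL hρ hK hv.ofReal).continuous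
  have cv := hv.continuous
  have i1 := integrable_real_of_continuous hρ.toIsDensity (hacc.continuous ht)
  have i2 : Integrable (fun x => velocity φ t x * (lapL A (detDensity (φ t).toSmoothMetric.curv)
      (φ t).toSmoothMetric.curv (fun x => (velocity φ t x : ℂ)) x).re)
      (volumeFormMeasure A (detDensity (φ t).toSmoothMetric.curv)) :=
    integrable_real_of_continuous hρ.toIsDensity (cv.mul cL)
  simp only [one_mul] at d
  rw [integral_sub i1 i2, integral_mul_re_lapL_self hρ hK hv,
    integral_congr_ae (Filter.Eventually.of_forall fun x => hφ.acceleration_eq ht x), sub_self] at d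
  exact d

end

end

/-! ### Convexity of the twisted Ding functional. -/

section

variable {n : ℕ}
variable {X : Type*} [TopologicalSpace X] [ChartedSpace (Fin n → ℂ) X] {ι : Type*}
  {A : CoordCover n X ι}

open ComplexConjugate Matrix

section
variable [MeasurableSpace X] [BorelSpace X]
  [IsManifold 𝓘(ℂ, Fin n → ℂ) ω X] [T2Space X] [CompactSpace X]
  {S : RealLineBundle A} {ψ : SmoothMetric S} {φ : ℝ → PosMetric (-(canonical A + S))}

theorem expMeasure_eq (ψ : SmoothMetric S) (φ : PosMetric (-(canonical A + S))) :
    expMeasure ψ φ = volumeFormMeasure A (expDensity ψ φ) := rfl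

theorem expMeasure_real_univ (ψ : SmoothMetric S) (φ : PosMetric (-(canonical A + S))) :
    (expMeasure ψ φ).real univ = ∫ _, (1 : ℝ) ∂(volumeFormMeasure A (expDensity ψ φ)) := by
  rw [integral_const, smul_eq_mul, mul_one]
  rfl

theorem expMeasure_real_univ_pos [ConnectedSpace X] (ψ : SmoothMetric S)
    (φ : PosMetric (-(canonical A + S))) : 0 < (expMeasure ψ φ).real univ := by
  have hρ := (isSmoothDensity_expDensity ψ φ).toIsDensity
  have h1 := isOpenPosMeasure_volumeForm hρ
  have h2 := isFiniteMeasure_volumeForm hρ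
  rw [measureReal_def, expMeasure_eq]
  exact ENNReal.toReal_pos (isOpen_univ.measure_ne_zero _ univ_nonempty) (measure_ne_top _ _)

theorem isDensityPath_expDensity (ψ : SmoothMetric S) (hφ : IsSmoothPath φ) :
    IsDensityPath A (Icc 0 1) fun t => expDensity ψ (φ t) where
  isDensity t _ := (isSmoothDensity_expDensity ψ (φ t)).toIsDensity
  continuousOn i := Real.continuous_exp.comp_continuousOn ((hφ i).continuousOn.neg.sub
    ((ψ.smooth i).continuousOn.comp continuousOn_snd fun _ hp => hp.2))

theorem hasDerivAt_integral_expDensity (ψ : SmoothMetric S) (hφ : IsSmoothPath φ)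
    {u u' : ℝ → X → ℝ} (hu : IsContinuousPath A (Ioo 0 1) u)
    (hu' : IsContinuousPath A (Ioo 0 1) u')
    (hud : ∀ t ∈ Ioo (0 : ℝ) 1, ∀ x, HasDerivAt (fun s => u s x) (u' t x) t)
    {t : ℝ} (ht : t ∈ Ioo (0 : ℝ) 1) :
    HasDerivAt (fun s => ∫ x, u s x ∂(volumeFormMeasure A (expDensity ψ (φ s))))
      (∫ x, (u' t x - u t x * velocity φ t x) ∂(volumeFormMeasure A (expDensity ψ (φ t)))) t := by
  have hρ := isDensityPath_expDensity ψ hφ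
  have hρ' : IsDensityPath A (Ioo 0 1) fun t => expDensity ψ (φ t) :=
    ⟨fun t ht => hρ.isDensity t (Ioo_subset_Icc_self ht), fun i =>
      (hρ.continuousOn i).mono (Ioo_prod_subset _)⟩
  have hv := hφ.isContinuousPath_velocity
  obtain ⟨c, hc, hcv⟩ := exists_hasDerivAt_integral_path
    (ρ' := fun t i z => expDensity ψ (φ t) i z * -A.loc i (velocity φ t) z)
    isOpen_Ioo hρ' hu hu' (fun i => (hρ'.continuousOn i).mul (hv i).neg) hud
    (fun s hs i z hz => ((hφ.hasDerivAt_localWeight hs hz).neg.sub_const _).exp) ht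
  have hvc : Continuous fun x => u' t x - u t x * velocity φ t x :=
    (hu'.continuous ht).sub ((hu.continuous ht).mul (hv.continuous ht))
  rw [hcv _ hvc fun i z hz => ?_]
  · exact hc
  simp only [CoordCover.loc]
  ring

theorem dbarSq_sub_const {g : ι → (Fin n → ℂ) → Matrix (Fin n) (Fin n) ℂ} {u : X → ℂ}
    (hu : A.IsSmooth u) (c : ℂ) (x : X) :
    dbarSq A g (fun x => u x - c) x = dbarSq A g u x := by
  have hz := (A.chart (A.indexAt x)).map_source (A.mem_indexAt x)
  have h1 := (hu _ _ hz).differentiableAt (by simp)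
  have h2 := (hu.conj _ _ hz).differentiableAt (by simp)
  have e1 : ∀ b, dzbar b (A.loc (A.indexAt x) fun x => u x - c) (A.chart (A.indexAt x) x) =
      dzbar b (A.loc (A.indexAt x) u) (A.chart (A.indexAt x) x) := fun b =>
    (dzbar_sub b h1 (differentiableAt_const c)).trans (by rw [dzbar_const, sub_zero])
  have e2 : ∀ b, dz b (A.loc (A.indexAt x) fun x => conj (u x - c)) (A.chart (A.indexAt x) x) =
      dz b (A.loc (A.indexAt x) fun x => conj (u x)) (A.chart (A.indexAt x) x) := fun b => by
    simp only [map_sub]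
    exact (dz_sub b h2 (differentiableAt_const (conj c))).trans (by rw [dz_const, sub_zero])
  simp only [dbarSq, dirD, gradV, e1, e2]

/-- The variance of the velocity of a geodesic is at most the integral of its acceleration. -/
theorem IsSmoothGeodesic.variance_velocity_le [ConnectedSpace X] (hψ : ψ.IsSemipositive)
    (hφ : IsSmoothGeodesic φ) {t : ℝ} (ht : t ∈ Ioo (0 : ℝ) 1) :
    (expMeasure ψ (φ t)).real univ *
      ∫ x, (velocity φ t x) ^ 2 ∂(volumeFormMeasure A (expDensity ψ (φ t))) -
        (∫ x, velocity φ t x ∂(volumeFormMeasure A (expDensity ψ (φ t)))) ^ 2 ≤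
      (expMeasure ψ (φ t)).real univ *
        ∫ x, acceleration φ t x ∂(volumeFormMeasure A (expDensity ψ (φ t))) := by
  have hρ := isSmoothDensity_expDensity ψ (φ t)
  have hM := expMeasure_real_univ_pos ψ (φ t)
  have hv := hφ.isSmoothPath.isSmooth_velocity ht
  have cv := hv.continuous
  have hfin := isFiniteMeasure_volumeForm hρ.toIsDensity
  set M := (expMeasure ψ (φ t)).real univ with hMd
  set N := ∫ x, velocity φ t x ∂(volumeFormMeasure A (expDensity ψ (φ t))) with hN
  have i1 := integrable_real_of_continuous hρ.toIsDensity cv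
  have i2 : Integrable (fun x => velocity φ t x ^ 2)
      (volumeFormMeasure A (expDensity ψ (φ t))) :=
    integrable_real_of_continuous hρ.toIsDensity (cv.pow 2)
  have hM1 : ∀ c : ℝ, ∫ _, c ∂(volumeFormMeasure A (expDensity ψ (φ t))) = M * c := fun c => by
    rw [integral_const, smul_eq_mul]
    rfl
  have hf : A.IsSmooth fun x => (velocity φ t x : ℂ) - ((N / M : ℝ) : ℂ) :=
    by simpa only [sub_eq_add_neg] using hv.ofReal.add (isSmooth_const (-((N / M : ℝ) : ℂ)))
  have h0 : ∫ x, ((velocity φ t x : ℂ) - ((N / M : ℝ) : ℂ))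
      ∂(volumeFormMeasure A (expDensity ψ (φ t))) = 0 := by
    have e1 : ∫ x, (velocity φ t x - N / M) ∂(volumeFormMeasure A (expDensity ψ (φ t))) = 0 := by
      rw [integral_sub i1 (integrable_const _), hM1, mul_div_cancel₀ _ hM.ne', ← hN, sub_self]
    have e2 := integral_ofReal (𝕜 := ℂ) (μ := volumeFormMeasure A (expDensity ψ (φ t)))
      (f := fun x => velocity φ t x - N / M)
    simp only [e1] at e2
    simpa using e2
  -- The Poincaré inequality for the velocity minus its mean `N / M`; by the geodesic equation its
  -- energy is the integral of the acceleration.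
  have hP := integral_norm_sq_le_integral_dbarSq hρ (φ t).isKahler
    (curvBound_expDensity hψ (φ t)) hf h0
  have e3 : ∀ x, ‖(velocity φ t x : ℂ) - ((N / M : ℝ) : ℂ)‖ ^ 2 =
      velocity φ t x ^ 2 - 2 * (N / M) * velocity φ t x + (N / M) ^ 2 := fun x => by
    rw [← Complex.ofReal_sub, Complex.norm_real, Real.norm_eq_abs, sq_abs]
    ring
  have i3 : Integrable (fun x => velocity φ t x ^ 2 - 2 * (N / M) * velocity φ t x)
      (volumeFormMeasure A (expDensity ψ (φ t))) := i2.sub (i1.const_mul _)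
  simp only [e3, dbarSq_sub_const hv.ofReal, ← hφ.acceleration_eq ht] at hP
  rw [integral_add i3 (integrable_const _), integral_sub i2 (i1.const_mul _), integral_const_mul,
    hM1, ← hN] at hP
  have h5 := mul_le_mul_of_nonneg_left hP hM.le
  refine le_trans (le_of_eq ?_) h5
  field_simp
  ring

/-- Derivatives exist in the open interval only; continuity at the end points is supplied
separately, and the second derivative is computed inside. -/
theorem IsSmoothGeodesic.convexOn_dingFunctional [ConnectedSpace X] (hψ : ψ.IsSemipositive)
    (φ₀ : PosMetric (-(canonical A + S))) (hφ : IsSmoothGeodesic φ) :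
    ConvexOn ℝ (Icc (0 : ℝ) 1) fun t => dingFunctional ψ φ₀ (φ t) := by
  have hs := hφ.isSmoothPath
  have hv := hs.isContinuousPath_velocity
  have hacc : IsContinuousPath A (Ioo 0 1) (acceleration φ) := fun i =>
    (hs.contDiffOn_acceleration i).continuousOn
  have hM := fun t => expMeasure_real_univ_pos ψ (φ t)
  have hMc : ContinuousOn (fun t => (expMeasure ψ (φ t)).real univ) (Icc 0 1) := by
    simp only [expMeasure_real_univ]
    exact continuousOn_integral_path isCompact_Icc (isDensityPath_expDensity ψ hs)
      (u := fun _ _ => 1) fun i => continuousOn_const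
  have hMd : ∀ t ∈ Ioo (0 : ℝ) 1, HasDerivAt (fun t => (expMeasure ψ (φ t)).real univ)
      (-∫ x, velocity φ t x ∂(volumeFormMeasure A (expDensity ψ (φ t)))) t := fun t ht => by
    simp only [expMeasure_real_univ]
    have h1 := hasDerivAt_integral_expDensity ψ hs (u := fun _ _ => 1) (u' := fun _ _ => 0)
      (fun i => continuousOn_const) (fun i => continuousOn_const)
      (fun s _ x => hasDerivAt_const s 1) ht
    simpa only [zero_sub, one_mul, integral_neg] using h1
  have hNd : ∀ t ∈ Ioo (0 : ℝ) 1, HasDerivAt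
      (fun t => ∫ x, velocity φ t x ∂(volumeFormMeasure A (expDensity ψ (φ t))))
      (∫ x, acceleration φ t x ∂(volumeFormMeasure A (expDensity ψ (φ t))) -
        ∫ x, velocity φ t x ^ 2 ∂(volumeFormMeasure A (expDensity ψ (φ t)))) t := fun t ht => by
    have h1 := hasDerivAt_integral_expDensity ψ hs hv hacc
      (fun s h x => hs.hasDerivAt_velocity h x) ht
    have hρ := (isSmoothDensity_expDensity ψ (φ t)).toIsDensity
    have i1 : Integrable (fun x => velocity φ t x * velocity φ t x)
        (volumeFormMeasure A (expDensity ψ (φ t))) :=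
      integrable_real_of_continuous hρ ((hv.continuous ht).mul (hv.continuous ht))
    rw [integral_sub (integrable_real_of_continuous hρ (hacc.continuous ht)) i1] at h1
    simpa only [sq] using h1
  refine convexOn_of_hasDerivWithinAt2_nonneg (convex_Icc 0 1)
    (f' := fun t => -(n.factorial / kahlerVolume φ₀ * ∫ x, velocity φ t x
      ∂(volumeFormMeasure A (detDensity (φ t).toSmoothMetric.curv))) +
      (∫ x, velocity φ t x ∂(volumeFormMeasure A (expDensity ψ (φ t)))) /
        (expMeasure ψ (φ t)).real univ)
    -- The energy contributes zero; the rest is the quotient rule for `N / M`, where `M' = -N` and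
    -- `N' = ∫ φ'' dμ - ∫ φ'² dμ`.
    (f'' := fun t => -(n.factorial / kahlerVolume φ₀ * 0) +
      ((∫ x, acceleration φ t x ∂(volumeFormMeasure A (expDensity ψ (φ t))) -
        ∫ x, velocity φ t x ^ 2 ∂(volumeFormMeasure A (expDensity ψ (φ t)))) *
          (expMeasure ψ (φ t)).real univ -
        (∫ x, velocity φ t x ∂(volumeFormMeasure A (expDensity ψ (φ t)))) *
          -∫ x, velocity φ t x ∂(volumeFormMeasure A (expDensity ψ (φ t)))) /
        (expMeasure ψ (φ t)).real univ ^ 2) ?_ ?_ ?_ ?_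
  · exact (continuousOn_energy hs).neg.add (hMc.log fun t _ => (hM t).ne').neg
  · rw [interior_Icc]
    intro t ht
    have h1 := (hasDerivAt_energy (φ₀ := φ₀) hs ht).neg.add ((hMd t ht).log (hM t).ne').neg
    rw [neg_div, neg_neg] at h1
    exact h1.hasDerivWithinAt
  · rw [interior_Icc]
    intro t ht
    exact (((hφ.hasDerivAt_integral_velocity ht).const_mul _).neg.add
      ((hNd t ht).div (hMd t ht) (hM t).ne')).hasDerivWithinAt
  · rw [interior_Icc]
    intro t ht
    rw [mul_zero, neg_zero, zero_add]
    refine div_nonneg ?_ (sq_nonneg _)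
    -- The numerator is `M ∫ φ'' dμ` minus `M ∫ φ'² dμ - N²`, which is nonnegative by the variance
    -- bound.
    linarith [hφ.variance_velocity_le hψ ht]

end

end

end TwistedDing

end

open TwistedDing in
theorem mainTheorem3 {n : ℕ} {X : Type*} [TopologicalSpace X] [T2Space X] [CompactSpace X]
    [ConnectedSpace X] [ChartedSpace (Fin n → ℂ) X] [IsManifold 𝓘(ℂ, Fin n → ℂ) ω X]
    [MeasurableSpace X] [BorelSpace X] {ι : Type*} (A : CoordCover n X ι)
    (S : RealLineBundle A) (ψ : SmoothMetric S) (hψ : ψ.IsSemipositive)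
    (φ₀ : PosMetric (-(canonical A + S)))
    (φ : ℝ → PosMetric (-(canonical A + S))) (hφ : IsSmoothGeodesic φ) :
    ConvexOn ℝ (Icc (0 : ℝ) 1) (fun t => dingFunctional ψ φ₀ (φ t)) := by
  exact hφ.convexOn_dingFunctional hψ φ₀
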